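/- Let $n\ge 1$. Write $v=(v',v_{n+1})$ with $v'=(v_0,\dots,v_n)\in\mathbb C^{n+1}$, $v_0+\dots+v_n=0$, $v_{n+1}\in\mathbb C$, let $L$ be the lattice of such $v$ with integer entries, and let $\langle v,w\rangle=\sum_{i=0}^n v_iw_i-n(n+1)v_{n+1}w_{n+1}$. Let $\Omega$ be the space of triples $(u,v,\tau)$ with $u\in\mathbb C$ and $\tau\in\mathbb H$, and $\Omega^\circ\subset\Omega$ the open set where $(n+1)v_{n+1}\notin\mathbb Z+\tau\mathbb Z$. The group $\mathcal J(\tilde A_n)$ acts on $\Omega$ and $\Omega^\circ$ through the permutations $w\in S_{n+1}$ of $v_0,\dots,v_n$, the translations $$t_{\lambda,\mu,j}(u,v,\tau)=\big(u-\langle\lambda,v\rangle-\tfrac12\langle\lambda,\lambda\rangle\tau+j,\;v+\lambda\tau+\mu,\;\tau\big)\qquad(\lambda,\mu\in L,\ j\in\mathbb Z)$$ and, for $\gamma=\begin{pmatrix}a&b\\c&d\end{pmatrix}\in SL_2(\mathbb Z)$, $$\gamma(u,v,\tau)=\Big(u+\frac{c\langle v,v\rangle}{2(c\tau+d)},\;\frac{v}{c\tau+d},\;\frac{a\tau+b}{c\tau+d}\Big).$$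 For $k,l,m\in\mathbb Z$ let $J_{k,l,m}$ be the space of weak meromorphic Jacobi forms of weight $k$, order $l$ and index $m$: holomorphic functions $\varphi:\Omega^\circ\to\mathbb C$, invariant under permutations and translations, with $\varphi(\gamma(u,v,\tau))=(c\tau+d)^{k}\varphi(u,v,\tau)$ and $-\frac1{2\pi i}\frac{\partial\varphi}{\partial u}=m\varphi$, such that (i) for fixed $u,v_{n+1}$ the function $\varphi$ is locally bounded in $v'$ as $\operatorname{Im}\tau\to+\infty$ (each $v'$ has a neighbourhood on which $\varphi$ is bounded uniformly in all $\tau$ with $\operatorname{Im}\tau$ large), and (ii) for fixed $u,v',\tau$ the function $v_{n+1}\mapsto\varphi(u,v',v_{n+1},\tau)$ is meromorphic with poles of order at most $l+2m$ at the points with $(n+1)v_{n+1}\in\mathbb Z+\tau\mathbb Z$. Inside the ring of functions on $\Omega^\circ$ put $$J_{\bullet,\bullet,\bullet}=\sum_{k,l,m}J_{k,l,m},\qquad E_{\bullet,\bullet}=J_{\bullet,\bullet,0}=\sum_{k,l}J_{k,l,0}.$$ Let $\theta_1$ be the Jacobi theta function, and $\wp,\zeta$ the Weierstrass functions of the lattice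 $\mathbb Z+\tau\mathbb Z$. **Theorem.** 1. There are unique functions $\varphi_0,\dots,\varphi_n$ on $\Omega^\circ$ such that, with $w=(n+1)v_{n+1}$, for all $z$ with $z,\,z+w\notin\mathbb Z+\tau\mathbb Z$, $$e^{-2\pi iu}\frac{\prod_{i=0}^n\theta_1(z-v_i+v_{n+1},\tau)}{\theta_1(z,\tau)^n\,\theta_1(z+w,\tau)}=\varphi_0+\varphi_1\big[\zeta(z,\tau)-\zeta(z+w,\tau)+\zeta(w,\tau)\big]+\sum_{j=2}^n\varphi_j\,\wp^{(j-2)}(z,\tau),$$ where $\wp^{(r)}$ is the $r$-th $z$-derivative. Each $\varphi_j$ is a weak meromorphic Jacobi form of weight $-j$, index $1$ and some finite order. 2. $J_{\bullet,\bullet,\bullet}$ is freely generated by $\varphi_0,\dots,\varphi_n$ over $E_{\bullet,\bullet}$: the $\varphi_j$ are algebraically independent over $E_{\bullet,\bullet}$ and $$J_{\bullet,\bullet,\bullet}=E_{\bullet,\bullet}[\varphi_0,\dots,\varphi_n].$$ 3. The sum is direct in weight and index: the subspaces $J_{k,\bullet,m}=\sum_lJ_{k,l,m}$, $(k,m)\in\mathbb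 Z^2$, are linearly independent (in $l$ the spaces are nested, $J_{k,l,m}\subset J_{k,l+1,m}$). 4. For all $k,l$, the space $J_{k,l,0}$ consists exactly of the functions $(u,v,\tau)\mapsto g(v_{n+1},\tau)$ with $g$ holomorphic on $\{(s,\tau):\tau\in\mathbb H,\ (n+1)s\notin\mathbb Z+\tau\mathbb Z\}$, satisfying $g\big(\frac{s}{c\tau+d},\frac{a\tau+b}{c\tau+d}\big)=(c\tau+d)^kg(s,\tau)$ for all $\begin{pmatrix}a&b\\c&d\end{pmatrix}\in SL_2(\mathbb Z)$, bounded for fixed $s$ as $\operatorname{Im}\tau\to+\infty$, and, for fixed $\tau$, elliptic in $s$ with respect to $\mathbb Z+\tau\mathbb Z$ with poles of order at most $l$, only at the points with $(n+1)s\in\mathbb Z+\tau\mathbb Z$. -/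

import Mathlib

open Complex Topology

noncomputable section

namespace AffineJacobi

/-! ### The space on which the group acts -/

/-- The reflection representation of `A_n`: vectors `(v_0, …, v_n)` in `ℂ^(n+1)` with sum zero. -/
def Hyperplane (n : ℕ) : Submodule ℂ (Fin (n + 1) → ℂ) where
  carrier := {x | ∑ i, x i = 0}
  add_mem' := by
    intro a b ha hb
    simp only [Set.mem_ofPred_eq, Pi.add_apply, Finset.sum_add_distrib] at *
    rw [ha, hb, add_zero]
  zero_mem' := by simp
  smul_mem' := by
    intro c x hx
    simp only [Set.mem_ofPred_eq, Pi.smul_apply, smul_eq_mul, ← Finset.mul_sum] at *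
    rw [hx, mul_zero]

/-- The complexified lattice: pairs `v = (v', v_{n+1})`. -/
abbrev Cartan (n : ℕ) : Type := Hyperplane n × ℂ

/-- The lattice of all `(z_0, …, z_n, z_{n+1}) ∈ ℤ^(n+2)` with `z_0 + ⋯ + z_n = 0`. -/
def intLattice (n : ℕ) : Set (Cartan n) :=
  {x | (∀ i, ∃ k : ℤ, x.1.1 i = k) ∧ ∃ k : ℤ, x.2 = k}

/-- The bilinear form with `⟨v, v⟩ = v_0² + ⋯ + v_n² - n (n + 1) v_{n+1}²`. -/
def form {n : ℕ} (v w : Cartan n) : ℂ :=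
  ∑ i, v.1.1 i * w.1.1 i - n * (n + 1) * v.2 * w.2

/-- The ambient complex vector space of triples `(u, v, τ)`. -/
abbrev Space (n : ℕ) : Type := ℂ × Cartan n × ℂ

/-- The points `(u, v, τ)` with `Im τ > 0` at which `v_{n+1}` is not an `(n+1)`-torsion point
of `ℂ / (ℤ + τ ℤ)`. -/
def regular (n : ℕ) : Set (Space n) :=
  {p | 0 < p.2.2.im ∧ ∀ a b : ℤ, ((n : ℂ) + 1) * p.2.1.2 ≠ a + b * p.2.2}

/-! ### The three kinds of generators of the group -/

/-- Permutation of `v_0, …, v_n`. -/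
def weylAct {n : ℕ} (σ : Equiv.Perm (Fin (n + 1))) (p : Space n) : Space n :=
  (p.1, (⟨fun i => p.2.1.1.1 (σ i), (Equiv.sum_comp σ p.2.1.1.1).trans p.2.1.1.2⟩, p.2.1.2), p.2.2)

/-- Translation by `(l, μ, k)`. -/
def transAct {n : ℕ} (l μ : Cartan n) (k : ℤ) (p : Space n) : Space n :=
  (p.1 - form l p.2.1 - 1 / 2 * form l l * p.2.2 + k, p.2.1 + p.2.2 • l + μ, p.2.2)

/-- The factor `c τ + d`. -/
def autFactor (γ : Matrix.SpecialLinearGroup (Fin 2) ℤ) (τ : ℂ) : ℂ :=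
  (γ.1 1 0 : ℂ) * τ + (γ.1 1 1 : ℂ)

/-- The fractional linear action `(a τ + b) / (c τ + d)`. -/
def moebius (γ : Matrix.SpecialLinearGroup (Fin 2) ℤ) (τ : ℂ) : ℂ :=
  ((γ.1 0 0 : ℂ) * τ + (γ.1 0 1 : ℂ)) / autFactor γ τ

/-- The action of `SL₂(ℤ)` on triples `(u, v, τ)`. -/
def modAct {n : ℕ} (γ : Matrix.SpecialLinearGroup (Fin 2) ℤ) (p : Space n) : Space n :=
  (p.1 + (γ.1 1 0 : ℂ) * form p.2.1 p.2.1 / (2 * autFactor γ p.2.2),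
    (autFactor γ p.2.2)⁻¹ • p.2.1, moebius γ p.2.2)

theorem weylAct_mem {n : ℕ} (σ : Equiv.Perm (Fin (n + 1))) {p : Space n} (hp : p ∈ regular n) :
    weylAct σ p ∈ regular n := hp

theorem transAct_mem {n : ℕ} {l μ : Cartan n} (hl : l ∈ intLattice n) (hμ : μ ∈ intLattice n)
    (k : ℤ) {p : Space n} (hp : p ∈ regular n) : transAct l μ k p ∈ regular n := by
  obtain ⟨-, x, hx⟩ := hl
  obtain ⟨-, y, hy⟩ := hμ
  refine ⟨hp.1, fun a b h => hp.2 (a - (n + 1) * y) (b - (n + 1) * x) ?_⟩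
  simp only [transAct, Prod.snd_add, Prod.smul_snd, smul_eq_mul, hx, hy] at h
  push_cast
  linear_combination h

theorem autFactor_ne_zero (γ : Matrix.SpecialLinearGroup (Fin 2) ℤ) {τ : ℂ} (hτ : 0 < τ.im) :
    autFactor γ τ ≠ 0 := by
  have := UpperHalfPlane.denom_ne_zero (γ : GL (Fin 2) ℝ) ⟨τ, hτ⟩
  simpa [UpperHalfPlane.denom, autFactor] using this

theorem moebius_im_pos (γ : Matrix.SpecialLinearGroup (Fin 2) ℤ) {τ : ℂ} (hτ : 0 < τ.im) :
    0 < (moebius γ τ).im := by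
  have h := (γ • (⟨τ, hτ⟩ : UpperHalfPlane)).im_pos
  have e : ((γ • (⟨τ, hτ⟩ : UpperHalfPlane) : UpperHalfPlane) : ℂ) = moebius γ τ := by
    rw [UpperHalfPlane.specialLinearGroup_apply]
    simp [moebius, autFactor]
  rw [← e]
  exact h

theorem modAct_mem {n : ℕ} (γ : Matrix.SpecialLinearGroup (Fin 2) ℤ) {p : Space n}
    (hp : p ∈ regular n) : modAct γ p ∈ regular n := by
  have hne := autFactor_ne_zero γ hp.1
  refine ⟨moebius_im_pos γ hp.1, fun a b h => hp.2 (a * γ.1 1 1 + b * γ.1 0 1)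
    (a * γ.1 1 0 + b * γ.1 0 0) ?_⟩
  simp only [modAct, moebius, Prod.smul_snd, smul_eq_mul] at h
  field_simp at h
  rw [h]
  simp only [autFactor]
  push_cast
  ring

/-! ### Jacobi forms -/

/-- Functions on the regular points. -/
abbrev Fun (n : ℕ) : Type := regular n → ℂ

open Classical in
/-- Extension of a function by `0` to all triples; only the values at regular points matter. -/
def ext {n : ℕ} (F : Fun n) (p : Space n) : ℂ := if h : p ∈ regular n then F ⟨p, h⟩ else 0

/-- Weak meromorphic Jacobi forms of weight `k`, order `l` and index `m`. -/
structure IsJacobiForm (n : ℕ) (k l m : ℤ) (F : Fun n) : Prop where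
  weyl : ∀ (σ : Equiv.Perm (Fin (n + 1))) (p : regular n),
    F ⟨weylAct σ p.1, weylAct_mem σ p.2⟩ = F p
  trans : ∀ (x y : Cartan n) (hx : x ∈ intLattice n) (hy : y ∈ intLattice n) (j : ℤ)
    (p : regular n), F ⟨transAct x y j p.1, transAct_mem hx hy j p.2⟩ = F p
  modular : ∀ (γ : Matrix.SpecialLinearGroup (Fin 2) ℤ) (p : regular n),
    F ⟨modAct γ p.1, modAct_mem γ p.2⟩ = autFactor γ p.1.2.2 ^ k * F p
  /-- `-(2πi)⁻¹ ∂F/∂u = m F`. -/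
  index : ∀ p : regular n,
    -(1 / (2 * Real.pi * I)) * deriv (fun u => ext F (u, p.1.2)) p.1.1 = m * F p
  /-- Local boundedness in `v'` as `Im τ → +∞`. -/
  weak : ∀ (u : ℂ) (v : Hyperplane n) (s : ℂ), ∃ U ∈ 𝓝 v, ∃ C T : ℝ, ∀ v' ∈ U, ∀ τ : ℂ,
    T ≤ τ.im → ‖ext F (u, (v', s), τ)‖ ≤ C
  /-- In `v_{n+1}` there are poles of order at most `l + 2m` at the `(n+1)`-torsion points. -/
  polar : ∀ (u : ℂ) (v : Hyperplane n) (s τ : ℂ), 0 < τ.im →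
    (∃ a b : ℤ, ((n : ℂ) + 1) * s = a + b * τ) →
    MeromorphicAt (fun s' => ext F (u, (v, s'), τ)) s ∧
      ((-(l + 2 * m) : ℤ) : WithTop ℤ) ≤ meromorphicOrderAt (fun s' => ext F (u, (v, s'), τ)) s
  /-- `F` is holomorphic away from the torsion points. -/
  holo : DifferentiableOn ℂ (ext F) (regular n)

theorem ext_apply {n : ℕ} (F : Fun n) (p : regular n) : ext F p.1 = F p := by
  simp [ext, p.2]

theorem ext_add {n : ℕ} (F G : Fun n) : ext (F + G) = ext F + ext G := by
  funext p
  by_cases h : p ∈ regular n <;> simp [ext, h]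

theorem ext_mul {n : ℕ} (F G : Fun n) : ext (F * G) = ext F * ext G := by
  funext p
  by_cases h : p ∈ regular n <;> simp [ext, h]

theorem ext_smul {n : ℕ} (c : ℂ) (F : Fun n) : ext (c • F) = c • ext F := by
  funext p
  by_cases h : p ∈ regular n <;> simp [ext, h]

theorem ext_zero {n : ℕ} : ext (0 : Fun n) = 0 := by
  funext p
  simp [ext]

theorem ext_const {n : ℕ} (p : Space n) (hp : p ∈ regular n) : ext (1 : Fun n) p = 1 := by
  simp [ext, hp]

/-- The slice in `u` through a regular point is differentiable. -/
theorem IsJacobiForm.diff {n : ℕ} {k l m : ℤ} {F : Fun n} (h : IsJacobiForm n k l m F)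
    (p : regular n) : DifferentiableAt ℂ (fun u => ext F (u, p.1.2)) p.1.1 := by
  have h1 : DifferentiableOn ℂ (fun u : ℂ => ext F (u, p.1.2)) Set.univ :=
    h.holo.comp (t := regular n) (s := Set.univ) (f := fun u : ℂ => (u, p.1.2))
      (by fun_prop) (fun u _ => p.2)
  exact (h1 p.1.1 (Set.mem_univ _)).differentiableAt Filter.univ_mem

theorem IsJacobiForm.zero (n : ℕ) (k l m : ℤ) : IsJacobiForm n k l m 0 where
  weyl _ _ := rfl
  trans _ _ _ _ _ _ := rfl
  modular _ _ := by simp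
  index _ := by simp [ext_zero]
  weak _ _ _ := ⟨Set.univ, Filter.univ_mem, 0, 0, by simp [ext_zero]⟩
  polar u v s τ _ _ := by
    have e : (fun s' : ℂ => ext (0 : Fun n) (u, (v, s'), τ)) = fun _ => 0 := by
      funext; simp [ext_zero]
    rw [e]
    refine ⟨MeromorphicAt.const 0 s, ?_⟩
    rw [meromorphicOrderAt_eq_top_iff.2 (by simp)]
    exact le_top
  holo := by rw [ext_zero]; exact differentiableOn_const 0

theorem IsJacobiForm.add {n : ℕ} {k l m : ℤ} {F G : Fun n} (hF : IsJacobiForm n k l m F)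
    (hG : IsJacobiForm n k l m G) : IsJacobiForm n k l m (F + G) where
  weyl σ p := by simp [hF.weyl, hG.weyl]
  trans x y hx hy j p := by simp [hF.trans, hG.trans, hx, hy]
  modular γ p := by simp [hF.modular, hG.modular, mul_add]
  index p := by
    have := hF.index p
    have := hG.index p
    simp only [ext_add, Pi.add_apply]
    rw [deriv_fun_add (hF.diff p) (hG.diff p)]
    linear_combination hF.index p + hG.index p
  weak u v s := by
    obtain ⟨U, hU, C, T, h⟩ := hF.weak u v s
    obtain ⟨U', hU', C', T', h'⟩ := hG.weak u v s
    refine ⟨U ∩ U', Filter.inter_mem hU hU', C + C', max T T', fun v' hv τ hτ => ?_⟩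
    rw [ext_add]
    exact (norm_add_le _ _).trans (add_le_add (h v' hv.1 τ ((le_max_left _ _).trans hτ))
      (h' v' hv.2 τ ((le_max_right _ _).trans hτ)))
  polar u v s τ hτ hs := by
    obtain ⟨h1, h2⟩ := hF.polar u v s τ hτ hs
    obtain ⟨h3, h4⟩ := hG.polar u v s τ hτ hs
    rw [ext_add]
    exact ⟨h1.add h3, (le_min h2 h4).trans (meromorphicOrderAt_add h1 h3)⟩
  holo := by rw [ext_add]; exact hF.holo.add hG.holo

theorem IsJacobiForm.smul {n : ℕ} {k l m : ℤ} {F : Fun n} (c : ℂ) (hF : IsJacobiForm n k l m F) :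
    IsJacobiForm n k l m (c • F) where
  weyl σ p := by simp [hF.weyl]
  trans x y hx hy j p := by simp [hF.trans, hx, hy]
  modular γ p := by simp only [Pi.smul_apply, hF.modular, smul_eq_mul]; ring
  index p := by
    simp only [ext_smul, Pi.smul_apply, smul_eq_mul]
    rw [deriv_const_mul _ (hF.diff p)]
    linear_combination c * hF.index p
  weak u v s := by
    obtain ⟨U, hU, C, T, h⟩ := hF.weak u v s
    refine ⟨U, hU, ‖c‖ * C, T, fun v' hv τ hτ => ?_⟩
    rw [ext_smul, Pi.smul_apply, norm_smul]
    exact mul_le_mul_of_nonneg_left (h v' hv τ hτ) (norm_nonneg c)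
  polar u v s τ hτ hs := by
    obtain ⟨h1, h2⟩ := hF.polar u v s τ hτ hs
    rw [ext_smul]
    have hc : MeromorphicAt (fun _ : ℂ => c) s := MeromorphicAt.const c s
    refine ⟨hc.mul h1, ?_⟩
    change _ ≤ meromorphicOrderAt ((fun _ : ℂ => c) * fun s' => ext F (u, (v, s'), τ)) s
    rw [meromorphicOrderAt_mul hc h1]
    have h0 : 0 ≤ meromorphicOrderAt (fun _ : ℂ => c) s :=
      (analyticAt_const (v := c)).meromorphicOrderAt_nonneg
    calc _ ≤ 0 + meromorphicOrderAt (fun s' => ext F (u, (v, s'), τ)) s := by rwa [zero_add]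
      _ ≤ _ := by gcongr
  holo := by rw [ext_smul]; exact hF.holo.const_smul c

theorem IsJacobiForm.mul {n : ℕ} {k l m k' l' m' : ℤ} {F G : Fun n}
    (hF : IsJacobiForm n k l m F) (hG : IsJacobiForm n k' l' m' G) :
    IsJacobiForm n (k + k') (l + l') (m + m') (F * G) where
  weyl σ p := by simp [hF.weyl, hG.weyl]
  trans x y hx hy j p := by simp [hF.trans, hG.trans, hx, hy]
  modular γ p := by
    simp only [Pi.mul_apply, hF.modular, hG.modular, zpow_add₀ (autFactor_ne_zero γ p.2.1)]
    ring
  index p := by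
    have e1 : ext F (p.1.1, p.1.2) = F p := ext_apply F p
    have e2 : ext G (p.1.1, p.1.2) = G p := ext_apply G p
    simp only [ext_mul, Pi.mul_apply]
    rw [deriv_fun_mul (hF.diff p) (hG.diff p), e1, e2]
    push_cast
    linear_combination G p * hF.index p + F p * hG.index p
  weak u v s := by
    obtain ⟨U, hU, C, T, h⟩ := hF.weak u v s
    obtain ⟨U', hU', C', T', h'⟩ := hG.weak u v s
    refine ⟨U ∩ U', Filter.inter_mem hU hU', C * C', max T T', fun v' hv τ hτ => ?_⟩
    have a := h v' hv.1 τ ((le_max_left _ _).trans hτ)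
    have b := h' v' hv.2 τ ((le_max_right _ _).trans hτ)
    rw [ext_mul, Pi.mul_apply, norm_mul]
    exact mul_le_mul a b (norm_nonneg _) ((norm_nonneg _).trans a)
  polar u v s τ hτ hs := by
    obtain ⟨h1, h2⟩ := hF.polar u v s τ hτ hs
    obtain ⟨h3, h4⟩ := hG.polar u v s τ hτ hs
    rw [ext_mul]
    refine ⟨h1.mul h3, ?_⟩
    change _ ≤ meromorphicOrderAt ((fun s' => ext F (u, (v, s'), τ)) *
      fun s' => ext G (u, (v, s'), τ)) s
    rw [meromorphicOrderAt_mul h1 h3]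
    refine le_trans (le_of_eq ?_) (add_le_add h2 h4)
    rw [← WithTop.coe_add]
    congr 1
    ring
  holo := by rw [ext_mul]; exact hF.holo.mul hG.holo

/-- The lattice `ℤ + τ ℤ`. -/
def periods (τ : ℂ) (hτ : 0 < τ.im) : PeriodPair where
  ω₁ := 1
  ω₂ := τ
  indep := by
    rw [LinearIndependent.pair_iff]
    intro a b h
    have him := congrArg Complex.im h
    have hre := congrArg Complex.re h
    simp at him hre
    have hb : b = 0 := him.resolve_right hτ.ne'
    subst hb
    simpa using hre

theorem regular_punctured {n : ℕ} (u : ℂ) (v : Hyperplane n) (s τ : ℂ) (hτ : 0 < τ.im) :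
    ∀ᶠ s' in 𝓝[≠] s, (u, (v, s'), τ) ∈ regular n := by
  have hn : ((n : ℂ) + 1) ≠ 0 := by exact_mod_cast n.succ_ne_zero
  have hc : Filter.Tendsto (fun s' : ℂ => ((n : ℂ) + 1) * s') (𝓝 s) (𝓝 (((n : ℂ) + 1) * s)) :=
    (continuous_const.mul continuous_id).tendsto s
  have h1 := hc.eventually ((periods τ hτ).compl_lattice_sdiff_singleton_mem_nhds _)
  filter_upwards [nhdsWithin_le_nhds h1, self_mem_nhdsWithin] with s' h2 h3
  refine ⟨hτ, fun a b h => h2 ⟨?_, fun h4 => h3 (mul_left_cancel₀ hn h4)⟩⟩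
  refine PeriodPair.mem_lattice.2 ⟨a, b, ?_⟩
  simp only [periods, mul_one]
  exact h.symm

/-- The constant function `1` has weight, order and index `0`. -/
theorem IsJacobiForm.one (n : ℕ) : IsJacobiForm n 0 0 0 1 where
  weyl _ _ := rfl
  trans _ _ _ _ _ _ := rfl
  modular _ _ := by simp
  index p := by
    have e : (fun u : ℂ => ext (1 : Fun n) (u, p.1.2)) = fun _ => 1 := by
      funext u; exact ext_const _ p.2
    rw [e]; simp
  weak u v s := ⟨Set.univ, Filter.univ_mem, 1, 0, fun v' _ τ _ => by
    by_cases h : (u, (v', s), τ) ∈ regular n <;> simp [ext, h]⟩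
  polar u v s τ hτ _ := by
    have e : (fun _ : ℂ => (1 : ℂ)) =ᶠ[𝓝[≠] s] fun s' => ext (1 : Fun n) (u, (v, s'), τ) :=
      (regular_punctured u v s τ hτ).mono fun s' h => (ext_const _ h).symm
    refine ⟨(MeromorphicAt.const 1 s).congr e, ?_⟩
    rw [← meromorphicOrderAt_congr e]
    exact (analyticAt_const (v := (1 : ℂ))).meromorphicOrderAt_nonneg
  holo := (differentiableOn_const (1 : ℂ)).congr fun p hp => ext_const p hp

/-- The space `J_{k,l,m}` of Jacobi forms of weight `k`, order `l` and index `m`. -/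
def J (n : ℕ) (k l m : ℤ) : Submodule ℂ (Fun n) where
  carrier := {F | IsJacobiForm n k l m F}
  add_mem' hF hG := hF.add hG
  zero_mem' := IsJacobiForm.zero n k l m
  smul_mem' c _ hF := hF.smul c

theorem J_mul_le (n : ℕ) (k l m k' l' m' : ℤ) :
    J n k l m * J n k' l' m' ≤ J n (k + k') (l + l') (m + m') :=
  Submodule.mul_le.2 fun _ hF _ hG => IsJacobiForm.mul hF hG

/-- The algebra `J_{•,•,•}` of all Jacobi forms, the sum of all the spaces `J_{k,l,m}`. -/
def jacobiAlgebra (n : ℕ) : Subalgebra ℂ (Fun n) :=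
  (⨆ (k : ℤ) (l : ℤ) (m : ℤ), J n k l m).toSubalgebra
    (Submodule.mem_iSup_of_mem 0 <| Submodule.mem_iSup_of_mem 0 <|
      Submodule.mem_iSup_of_mem 0 <| IsJacobiForm.one n)
    (by
      intro F G hF hG
      have h := Submodule.mul_mem_mul hF hG
      simp only [Submodule.iSup_mul, Submodule.mul_iSup] at h
      refine SetLike.le_def.1 ?_ h
      simp only [iSup_le_iff]
      intro k l m k' l' m'
      exact (J_mul_le n _ _ _ _ _ _).trans
        ((le_iSup (fun m => J n _ _ m) _).trans (le_iSup₂ (f := fun k l => ⨆ m, J n k l m) _ _)))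

/-- The ring of coefficients `E_{•,•} = J_{•,•,0}`, the sum of all the spaces `J_{k,l,0}`. -/
def coeffRing (n : ℕ) : Subalgebra ℂ (Fun n) :=
  (⨆ (k : ℤ) (l : ℤ), J n k l 0).toSubalgebra
    (Submodule.mem_iSup_of_mem 0 <| Submodule.mem_iSup_of_mem 0 <| IsJacobiForm.one n)
    (by
      intro F G hF hG
      have h := Submodule.mul_mem_mul hF hG
      simp only [Submodule.iSup_mul, Submodule.mul_iSup] at h
      refine SetLike.le_def.1 ?_ h
      simp only [iSup_le_iff]
      intro k' l' k l
      have := J_mul_le n k l 0 k' l' 0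
      rw [add_zero] at this
      exact this.trans (le_iSup₂ (f := fun k l => J n k l 0) _ _))

/-! ### The basic Jacobi forms -/

/-- The Jacobi theta function
`θ₁(z, τ) = 2 ∑_{r ≥ 0} (-1)^r exp(πi (r + 1/2)² τ) sin((2r + 1) π z)`. -/
def theta1 (z τ : ℂ) : ℂ :=
  -cexp (Real.pi * I * τ / 4 + Real.pi * I * (z + 1 / 2)) * jacobiTheta₂ (z + 1 / 2 + τ / 2) τ

/-- The Weierstrass zeta function of a lattice (the summand of `l = 0` is `1 / z`, as `1 / 0 = 0`
here). -/
def weierstrassZeta (L : PeriodPair) (z : ℂ) : ℂ :=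
  ∑' l : L.lattice, (1 / (z - l) + 1 / (l : ℂ) + z / (l : ℂ) ^ 2)

/-- The function `λ(z) = e^{-2πiu} ∏ θ₁(z - v_i + v_{n+1}) / (θ₁(z)^n θ₁(z + (n+1) v_{n+1}))`. -/
def superpotential {n : ℕ} (p : Space n) (z : ℂ) : ℂ :=
  cexp (-2 * Real.pi * I * p.1) *
    (∏ i, theta1 (z - p.2.1.1.1 i + p.2.1.2) p.2.2) /
    (theta1 z p.2.2 ^ n * theta1 (z + ((n : ℂ) + 1) * p.2.1.2) p.2.2)

/-- The elliptic functions of `z` in which `λ` is expanded: `1`, then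
`ζ(z) - ζ(z + w) + ζ(w)`, then `℘(z), ℘'(z), ℘''(z), …`. -/
def basisFun (L : PeriodPair) (w z : ℂ) : ℕ → ℂ
  | 0 => 1
  | 1 => weierstrassZeta L z - weierstrassZeta L (z + w) + weierstrassZeta L w
  | j + 2 => iteratedDeriv j L.weierstrassP z

/-- `φ_0, …, φ_n` are the coefficients in the expansion
`λ(z) = φ_n ℘^{(n-2)}(z) + ⋯ + φ_2 ℘(z) + φ_1 [ζ(z) - ζ(z + w) + ζ(w)] + φ_0`,
where `w = (n+1) v_{n+1}`, valid at all `z` apart from the poles. -/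
def IsExpansion {n : ℕ} (φ : Fin (n + 1) → Fun n) : Prop :=
  ∀ (p : regular n) (z : ℂ), z ∉ (periods p.1.2.2 p.2.1).lattice →
    z + ((n : ℂ) + 1) * p.1.2.1.2 ∉ (periods p.1.2.2 p.2.1).lattice →
    superpotential p.1 z =
      ∑ j : Fin (n + 1), φ j p * basisFun (periods p.1.2.2 p.2.1) (((n : ℂ) + 1) * p.1.2.1.2) z j

/-! ### Functions of `(v_{n+1}, τ)`, modular in `τ` and elliptic in `v_{n+1}` -/

/-- The pairs `(s, τ)` with `Im τ > 0` and `s` not an `(n+1)`-torsion point of `ℂ / (ℤ + τ ℤ)`. -/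
def ellRegular (n : ℕ) : Set (ℂ × ℂ) :=
  {q | 0 < q.2.im ∧ ∀ a b : ℤ, ((n : ℂ) + 1) * q.1 ≠ a + b * q.2}

/-- Functions of `(s, τ)`, modular of weight `k` under `SL₂(ℤ)`, elliptic in `s` with respect to
`ℤ + τ ℤ`, with poles of order at most `l`, at the `(n+1)`-torsion points only. The values at these
points do not matter. -/
structure IsEllipticModular (n : ℕ) (k l : ℤ) (g : ℂ × ℂ → ℂ) : Prop where
  elliptic : ∀ (a b : ℤ), ∀ q ∈ ellRegular n, g (q.1 + a * q.2 + b, q.2) = g q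
  modular : ∀ (γ : Matrix.SpecialLinearGroup (Fin 2) ℤ), ∀ q ∈ ellRegular n,
    g (q.1 / autFactor γ q.2, moebius γ q.2) = autFactor γ q.2 ^ k * g q
  weak : ∀ s : ℂ, ∃ C T : ℝ, ∀ τ : ℂ, T ≤ τ.im → (s, τ) ∈ ellRegular n → ‖g (s, τ)‖ ≤ C
  polar : ∀ s τ : ℂ, 0 < τ.im → (∃ a b : ℤ, ((n : ℂ) + 1) * s = a + b * τ) →
    MeromorphicAt (fun s' => g (s', τ)) s ∧
      ((-l : ℤ) : WithTop ℤ) ≤ meromorphicOrderAt (fun s' => g (s', τ)) s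
  holo : DifferentiableOn ℂ g (ellRegular n)

end AffineJacobi

end

open Complex Topology

noncomputable section

namespace AffineJacobi

/-! ### Holomorphic functions of several variables -/

section SeveralVariables

open Metric Set Filter

variable {E : Type*} [NormedAddCommGroup E] [NormedSpace ℂ E]

/-! Over a fixed point `(s, τ)` with `s = v_{n+1}`, a Jacobi form of index `m` is `exp(-2πimu)`
times a symmetric theta function of level `m` in `v'` for the root lattice of type `A_n`
(`IsJacobiForm.isThetaFun`). Everything rests on the fact that, over each such point, the monomials
of degree `m` in `φ_0, …, φ_n` form a basis of these theta functions; the number of monomials is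
`binom(m + n, n)`.

Spanning comes from interpolation. Along a line in the direction of a root, a theta function of
level `m` is a quasi-periodic entire function of degree `2m`, so it vanishes once it has more than
`2m` incongruent zeros (`IsQuasiperiodic.eq_zero`). Transpositions double the known zeros, and
fixing the coordinates one after another shows that a theta function is determined by its values at
the vectors whose first `n` coordinates are distinct among `m + n` nodes (`IsThetaFun.eq_zero`). Up
to permutation these are `binom(m + n, n)` points, and the Lagrange basis for them consists of
products of `m` functions `∏ θ(y - v_i)` (`IsThetaFun.eq_sum_nodeBasis`). Such a function is the
numerator of the superpotential `λ` at `z = y - s`, so the expansion of `λ` makes it a linear form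
in the `φ_j` (`IsExpansion.exp_mul_thetaAt`). Hence forms of degree `m` in the `φ_j` take arbitrary
values at the interpolation points, and equality of dimensions turns this surjectivity into
injectivity (`IsExpansion.eq_zero_of_symForm`).

A Jacobi form is therefore a form in the `φ_j` with unique coefficients depending on `(s, τ)`.
Uniqueness transfers periodicity and modularity to the coefficients. The explicit Lagrange formula,
with nodes adapted to the point, gives their holomorphy, their boundedness and the order of their
poles (`IsCoeff.isEllipticModular`). So they have index zero, and index zero means independence of
`u` and `v'` because theta functions of level zero are constant (`mem_J_zero_iff`).

The `φ_j` themselves exist because `λ` is elliptic in `z` with a pole of order at most `n` at `0`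
and at most `1` at `-w`: subtraction of principal parts leaves a constant (`exists_expansion`). For
`j ≥ 1` they are contour integrals of `λ` around `0` (`expansion_succ_eq`), whence uniqueness,
holomorphy and growth. Their transformation rules follow from the invariance of `λ` and the
homogeneity of the functions in the expansion (`IsExpansion.apply_eq`).

Finally, translation in `u` scales the `φ_j` and separates degrees and indices, and the factors `c τ
+ 1` for varying `c` separate weights. This gives algebraic independence and the direct sum. -/

theorem norm_fderiv_le_of_ball {f : E → ℂ} {x : E} {r M : ℝ} (hr : 0 < r)
    (hf : DifferentiableOn ℂ f (ball x r)) (hM : ∀ y ∈ ball x r, ‖f y‖ ≤ M) :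
    ‖fderiv ℂ f x‖ ≤ (M + M) / r := by
  refine Complex.norm_fderiv_le_div_of_mapsTo_ball hf (fun y hy => ?_) hr
  rw [mem_closedBall, dist_eq_norm]
  exact (norm_sub_le _ _).trans (add_le_add (hM y hy) (hM x (mem_ball_self hr)))

/-- The bounds on a ball control the derivatives of the terms on the concentric ball of half the
radius, so the series can be differentiated term by term in any number of variables. -/
theorem differentiableAt_tsum_of_norm_le {ι : Type*} {f : ι → E → ℂ} {u : ι → ℝ} {x : E} {r : ℝ}
    (hr : 0 < r) (hu : Summable u) (hf : ∀ i, DifferentiableOn ℂ (f i) (ball x r))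
    (hfu : ∀ i, ∀ y ∈ ball x r, ‖f i y‖ ≤ u i) :
    DifferentiableAt ℂ (fun y => ∑' i, f i y) x := by
  have hr2 : 0 < r / 2 := by positivity
  have hsub : ∀ y ∈ ball x (r / 2), ball y (r / 2) ⊆ ball x r := fun y hy =>
    ball_subset_ball' (by rw [mem_ball] at hy; linarith)
  have hsum : Summable fun i => (u i + u i) / (r / 2) := (hu.add hu).div_const _
  refine (hasFDerivAt_tsum_of_isPreconnected hsum isOpen_ball (convex_ball x (r / 2)).isPreconnected
    (f' := fun i y => fderiv ℂ (f i) y) (fun i y hy => ?_) (fun i y hy => ?_)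
    (mem_ball_self hr2) ?_ (mem_ball_self hr2)).differentiableAt
  · exact ((hf i).differentiableAt (isOpen_ball.mem_nhds
      (hsub y hy (mem_ball_self hr2)))).hasFDerivAt
  · exact norm_fderiv_le_of_ball hr2 ((hf i).mono (hsub y hy)) fun z hz => hfu i z (hsub y hy hz)
  · exact hu.of_norm_bounded fun i => hfu i x (mem_ball_self hr)

/-- The terms without a bound are split off as a finite sum. In the lattice sum for `ζ` these are
the terms of the short lattice vectors. -/
theorem differentiableAt_tsum_of_norm_le_cofinite {ι : Type*} {f : ι → E → ℂ} {u : ι → ℝ} {x : E}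
    {r : ℝ} (hr : 0 < r) (hu : Summable u) (hf : ∀ i, DifferentiableOn ℂ (f i) (ball x r))
    (hfu : ∀ᶠ i in cofinite, ∀ y ∈ ball x r, ‖f i y‖ ≤ u i) :
    DifferentiableAt ℂ (fun y => ∑' i, f i y) x := by
  classical
  set s : Finset ι := (eventually_cofinite.1 hfu).toFinset with hs
  have hs' : ∀ i ∉ s, ∀ y ∈ ball x r, ‖f i y‖ ≤ u i := by
    intro i hi
    simpa [hs] using hi
  set g : ι → E → ℂ := fun i y => if i ∈ s then 0 else f i y with hg
  set u' : ι → ℝ := fun i => if i ∈ s then 0 else u i with hu'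
  have hu's : Summable u' := by
    refine hu.congr_cofinite ?_
    filter_upwards [s.finite_toSet.compl_mem_cofinite] with i hi
    simp only [hu']
    rw [if_neg (by simpa using hi)]
  have hgu : ∀ i, ∀ y ∈ ball x r, ‖g i y‖ ≤ u' i := by
    intro i y hy
    by_cases hi : i ∈ s
    · simp [hg, hu', hi]
    · simpa [hg, hu', hi] using hs' i hi y hy
  have hgd : ∀ i, DifferentiableOn ℂ (g i) (ball x r) := by
    intro i
    by_cases hi : i ∈ s
    · simp [hg, hi]
    · simpa [hg, hi] using hf i
  have h1 := differentiableAt_tsum_of_norm_le hr hu's hgd hgu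
  have h2 : DifferentiableAt ℂ (fun y => ∑ i ∈ s, f i y) x :=
    .fun_sum fun i _ => (hf i).differentiableAt (ball_mem_nhds x hr)
  refine (h2.add h1).congr_of_eventuallyEq ?_
  filter_upwards [ball_mem_nhds x hr] with y hy
  have hgs : Summable fun i => g i y := hu's.of_norm_bounded fun i => hgu i y hy
  have hfin : Summable fun i => if i ∈ s then f i y else 0 :=
    summable_of_ne_finset_zero (s := s) fun i hi => by simp [hi]
  have e : ∀ i, f i y = (if i ∈ s then f i y else 0) + g i y := by
    intro i
    by_cases hi : i ∈ s <;> simp [hg, hi]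
  calc ∑' i, f i y = ∑' i, ((if i ∈ s then f i y else 0) + g i y) := tsum_congr e
    _ = _ := by
      rw [hfin.tsum_add hgs, tsum_eq_sum (s := s) fun i hi => by simp [hi]]
      simp only [Pi.add_apply]
      congr 1
      exact Finset.sum_congr rfl fun i hi => by simp [hi]

/-- Continuity in all variables and holomorphy in the parameter suffice: compactness of the circle
gives a uniform bound, and the derivative estimate turns it into a dominating constant. -/
theorem differentiableAt_circleIntegral [ProperSpace E] {f : E → ℂ → ℂ} {x₀ : E} {c : ℂ} {R : ℝ}
    (hR : 0 ≤ R) (hf : ∀ z ∈ sphere c R, ∀ᶠ q : E × ℂ in 𝓝 (x₀, z),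
      ContinuousAt (fun q : E × ℂ => f q.1 q.2) q ∧ DifferentiableAt ℂ (fun x => f x q.2) q.1) :
    DifferentiableAt ℂ (fun x => ∮ z in C(c, R), f x z) x₀ := by
  have h1 := (isCompact_sphere c R).eventually_forall_of_forall_eventually
    (P := fun x z => ContinuousAt (fun q : E × ℂ => f q.1 q.2) (x, z) ∧
      DifferentiableAt ℂ (fun x => f x z) x) hf
  obtain ⟨r, hr, hball⟩ := nhds_basis_closedBall.eventually_iff.1 h1
  have hcK : ContinuousOn (fun q : E × ℂ => f q.1 q.2) (closedBall x₀ r ×ˢ sphere c R) :=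
    fun q hq => (hball hq.1 q.2 hq.2).1.continuousWithinAt
  have hK : IsCompact (closedBall x₀ r ×ˢ sphere c R) :=
    (isCompact_closedBall x₀ r).prod (isCompact_sphere c R)
  obtain ⟨M, hM⟩ := hK.exists_bound_of_continuousOn hcK
  have hr2 : 0 < r / 2 := by positivity
  have hmem : ∀ θ, circleMap c R θ ∈ sphere c R := circleMap_mem_sphere c hR
  have hsub : ∀ y ∈ ball x₀ (r / 2), ball y (r / 2) ⊆ closedBall x₀ r := fun y hy =>
    (ball_subset_ball' (by rw [mem_ball] at hy; linarith)).trans ball_subset_closedBall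
  have hD : ∀ z ∈ sphere c R, ∀ y ∈ closedBall x₀ r, DifferentiableAt ℂ (fun x => f x z) y :=
    fun z hz y hy => (hball hy z hz).2
  have hcθ : ∀ x ∈ closedBall x₀ r, Continuous fun θ : ℝ => f x (circleMap c R θ) := by
    intro x hx
    rw [continuous_iff_continuousAt]
    intro θ
    have hc := (hball hx _ (hmem θ)).1
    exact ContinuousAt.comp (g := fun q : E × ℂ => f q.1 q.2) (f := fun θ => (x, circleMap c R θ)) hc
      (by fun_prop)
  have hx0 : x₀ ∈ closedBall x₀ r := mem_closedBall_self hr.le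
  -- The derivative at `x₀` depends continuously on the angle because the difference of the
  -- functions for two nearby angles is uniformly small on a ball; the bound `ε r / 8` leads to `ε /
  -- 4` for the derivatives.
  have hcF : Continuous fun θ : ℝ => fderiv ℂ (fun x => f x (circleMap c R θ)) x₀ := by
    rw [continuous_iff_continuousAt]
    intro θ
    rw [Metric.continuousAt_iff']
    intro ε hε
    have h2 := (isCompact_closedBall x₀ r).eventually_forall_of_forall_eventually (x₀ := θ)
      (P := fun θ' x => ‖f x (circleMap c R θ') - f x (circleMap c R θ)‖ < ε * r / 8) (by
        intro x hx
        have hc := (hball hx _ (hmem θ)).1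
        have hc1 : ContinuousAt (fun p : ℝ × E => f p.2 (circleMap c R p.1)) (θ, x) :=
          ContinuousAt.comp (g := fun q : E × ℂ => f q.1 q.2)
            (f := fun p : ℝ × E => (p.2, circleMap c R p.1)) hc (by fun_prop)
        have hc2 : ContinuousAt (fun p : ℝ × E => f p.2 (circleMap c R θ)) (θ, x) :=
          ContinuousAt.comp (g := fun q : E × ℂ => f q.1 q.2)
            (f := fun p : ℝ × E => (p.2, circleMap c R θ)) hc (by fun_prop)
        have hc3 := (hc1.sub hc2).norm
        exact hc3.eventually_lt (by fun_prop) (by simp; positivity))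
    filter_upwards [h2] with θ' h3
    rw [dist_eq_norm, ← fderiv_fun_sub (hD _ (hmem θ') _ hx0) (hD _ (hmem θ) _ hx0)]
    have h4 := norm_fderiv_le_of_ball hr (x := x₀) (M := ε * r / 8)
      (f := fun x => f x (circleMap c R θ') - f x (circleMap c R θ))
      (fun y hy => ((hD _ (hmem θ') _ (ball_subset_closedBall hy)).sub
        (hD _ (hmem θ) _ (ball_subset_closedBall hy))).differentiableWithinAt)
      (fun y hy => (h3 y (ball_subset_closedBall hy)).le)
    refine h4.trans_lt ?_
    rw [div_lt_iff₀ hr]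
    nlinarith [mul_pos hε hr]
  unfold circleIntegral
  refine (intervalIntegral.hasFDerivAt_integral_of_dominated_of_fderiv_le
    (F := fun x θ => deriv (circleMap c R) θ • f x (circleMap c R θ))
    (F' := fun x θ => deriv (circleMap c R) θ • fderiv ℂ (fun x => f x (circleMap c R θ)) x)
    (bound := fun _ => R * ((M + M) / (r / 2)))
    (ball_mem_nhds x₀ hr2) ?_ ?_ ?_ ?_ (by simp) ?_).differentiableAt
  · filter_upwards [closedBall_mem_nhds x₀ hr] with x hx
    refine (Continuous.aestronglyMeasurable ?_)
    simp only [deriv_circleMap]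
    exact ((continuous_circleMap 0 R).mul continuous_const).smul (hcθ x hx)
  · refine Continuous.intervalIntegrable ?_ _ _
    simp only [deriv_circleMap]
    exact ((continuous_circleMap 0 R).mul continuous_const).smul (hcθ x₀ hx0)
  · refine (Continuous.aestronglyMeasurable ?_)
    simp only [deriv_circleMap]
    fun_prop
  · refine Eventually.of_forall fun θ _ x hx => ?_
    rw [norm_smul]
    have e : ‖deriv (circleMap c R) θ‖ = R := by simp [deriv_circleMap, abs_of_nonneg hR]
    rw [e]
    refine mul_le_mul_of_nonneg_left ?_ hR
    exact norm_fderiv_le_of_ball hr2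
      (fun y hy => (hD _ (hmem θ) y (hsub x hx hy)).differentiableWithinAt)
      fun y hy => hM (y, circleMap c R θ) ⟨hsub x hx hy, hmem θ⟩
  · refine Eventually.of_forall fun θ _ x hx => ?_
    have hx' : x ∈ closedBall x₀ r := ball_subset_closedBall (ball_subset_ball (by linarith) hx)
    exact ((hD _ (hmem θ) x hx').hasFDerivAt).fun_const_smul _

/-- Cauchy's formula over a circle of fixed radius writes the partial derivative as an integral
whose integrand is holomorphic in all variables. -/
theorem differentiableOn_deriv_fst [ProperSpace E] {f : ℂ × E → ℂ} {U : Set (ℂ × E)}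
    (hU : IsOpen U) (hf : DifferentiableOn ℂ f U) :
    DifferentiableOn ℂ (fun q => deriv (fun z => f (z, q.2)) q.1) U := by
  intro q hq
  refine DifferentiableAt.differentiableWithinAt ?_
  obtain ⟨r, hr, hball⟩ := Metric.isOpen_iff.1 hU q hq
  have hr2 : 0 < r / 2 := by positivity
  have hin : ∀ q' ∈ ball q (r / 2), ∀ t : ℂ, ‖t‖ ≤ r / 2 → (q'.1 + t, q'.2) ∈ U := by
    intro q' hq' t ht
    refine hball ?_
    rw [mem_ball, dist_eq_norm] at hq' ⊢
    have e : (q'.1 + t, q'.2) - q = (q' - q) + (t, (0 : E)) := by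
      ext <;> simp
      ring
    have h1 : ‖((t, 0) : ℂ × E)‖ = ‖t‖ := by simp [Prod.norm_def]
    rw [e]
    calc _ ≤ ‖q' - q‖ + ‖((t, 0) : ℂ × E)‖ := norm_add_le _ _
      _ < r := by rw [h1]; linarith
  have key : ∀ q' ∈ ball q (r / 2), deriv (fun z => f (z, q'.2)) q'.1 =
      (2 * Real.pi * I)⁻¹ * ∮ t in C(0, r / 2), (1 / t ^ 2) * f (q'.1 + t, q'.2) := by
    intro q' hq'
    have hd : DifferentiableOn ℂ (fun t => f (q'.1 + t, q'.2)) (closedBall 0 (r / 2)) := by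
      intro t ht
      have := (hf _ (hin q' hq' t (by simpa using ht))).differentiableAt
        (hU.mem_nhds (hin q' hq' t (by simpa using ht)))
      exact (DifferentiableAt.comp (g := f) (f := fun t : ℂ => (q'.1 + t, q'.2)) t this
        (by fun_prop)).differentiableWithinAt
    have h1 := DiffContOnCl.deriv_eq_smul_circleIntegral hr2
      (hd.mono closure_ball_subset_closedBall).diffContOnCl
    simp only [sub_zero, smul_eq_mul] at h1
    rw [h1, ← mul_assoc, inv_mul_cancel₀ Complex.two_pi_I_ne_zero, one_mul]
    have h2 := deriv_comp_const_add (f := fun z => f (z, q'.2)) q'.1 0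
    simp only [add_zero] at h2
    exact h2.symm
  refine DifferentiableAt.congr_of_eventuallyEq ?_
    (Filter.eventually_of_mem (ball_mem_nhds q hr2) key)
  refine DifferentiableAt.const_mul ?_ _
  refine differentiableAt_circleIntegral hr2.le fun z hz => ?_
  have hz0 : z ≠ 0 := by
    rintro rfl
    simp at hz
    linarith
  have hzU : (q.1 + z, q.2) ∈ U := hin q (mem_ball_self hr2) z (by simpa using (le_of_eq hz))
  have hc : ContinuousAt (fun p : (ℂ × E) × ℂ => (p.1.1 + p.2, p.1.2)) (q, z) := by fun_prop
  filter_upwards [hc.eventually (hU.mem_nhds hzU), (continuousAt_snd (p := (q, z))).eventually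
    (isOpen_ne.mem_nhds hz0)] with p hp1 hp2
  have hfd := (hf _ hp1).differentiableAt (hU.mem_nhds hp1)
  have hp3 : p.2 ^ 2 ≠ 0 := pow_ne_zero _ hp2
  constructor
  · refine ContinuousAt.mul (ContinuousAt.div (by fun_prop) (by fun_prop) hp3) ?_
    exact ContinuousAt.comp (g := f) (f := fun p : (ℂ × E) × ℂ => (p.1.1 + p.2, p.1.2))
      hfd.continuousAt (by fun_prop)
  · refine DifferentiableAt.const_mul ?_ _
    exact DifferentiableAt.comp (g := f) (f := fun x : ℂ × E => (x.1 + p.2, x.2)) p.1 hfd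
      (by fun_prop)

theorem differentiableOn_iteratedDeriv_fst [ProperSpace E] {f : ℂ × E → ℂ} {U : Set (ℂ × E)}
    (hU : IsOpen U) (hf : DifferentiableOn ℂ f U) (j : ℕ) :
    DifferentiableOn ℂ (fun q => iteratedDeriv j (fun z => f (z, q.2)) q.1) U := by
  induction j with
  | zero => simpa using hf
  | succ j ih =>
    simp only [iteratedDeriv_succ]
    exact differentiableOn_deriv_fst hU ih

end SeveralVariables

/-! ### Removable singularities and orders of poles -/

section Punctured

open Filter

theorem exists_analyticAt_of_bounded {f : ℂ → ℂ} {a : ℂ}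
    (hd : ∀ᶠ z in 𝓝[≠] a, DifferentiableAt ℂ f z) {C : ℝ} (hb : ∀ᶠ z in 𝓝[≠] a, ‖f z‖ ≤ C) :
    ∃ g : ℂ → ℂ, AnalyticAt ℂ g a ∧ ∀ᶠ z in 𝓝[≠] a, f z = g z := by
  have h := hd.and hb
  rw [eventually_nhdsWithin_iff] at h
  obtain ⟨s, hs, ho, ha⟩ := mem_nhds_iff.1 h
  have hsd : s ∈ 𝓝 a := ho.mem_nhds ha
  have h1 := Complex.differentiableOn_update_limUnder_of_bddAbove (f := f) hsd
    (fun z hz => (hs hz.1 hz.2).1.differentiableWithinAt) ⟨C, by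
      rintro _ ⟨z, hz, rfl⟩
      exact (hs hz.1 hz.2).2⟩
  refine ⟨_, h1.analyticAt hsd, ?_⟩
  filter_upwards [self_mem_nhdsWithin] with z hz
  rw [Function.update_of_ne hz]

theorem meromorphicAt_of_bounded {f : ℂ → ℂ} {a : ℂ} (N : ℤ)
    (hd : ∀ᶠ z in 𝓝[≠] a, DifferentiableAt ℂ f z) {C : ℝ}
    (hb : ∀ᶠ z in 𝓝[≠] a, ‖(z - a) ^ N * f z‖ ≤ C) :
    MeromorphicAt f a ∧ ((-N : ℤ) : WithTop ℤ) ≤ meromorphicOrderAt f a := by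
  obtain ⟨g, hg, hfg⟩ := exists_analyticAt_of_bounded (f := fun z => (z - a) ^ N * f z) (a := a)
    (by
      filter_upwards [hd, self_mem_nhdsWithin] with z hz hza
      have : z - a ≠ 0 := sub_ne_zero.2 hza
      have h1 : DifferentiableAt ℂ (fun z : ℂ => (z - a) ^ N) z :=
        DifferentiableAt.zpow (by fun_prop) (Or.inl this)
      exact h1.mul hz) hb
  have hm : MeromorphicAt (fun z : ℂ => (z - a) ^ (-N)) a := by fun_prop
  have e : ((fun z : ℂ => (z - a) ^ (-N)) * g) =ᶠ[𝓝[≠] a] f := by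
    filter_upwards [hfg, self_mem_nhdsWithin] with z hz hza
    have : z - a ≠ 0 := sub_ne_zero.2 hza
    rw [Pi.mul_apply, ← hz, ← mul_assoc, ← zpow_add₀ this]
    simp
  refine ⟨(hm.mul hg.meromorphicAt).congr e, ?_⟩
  rw [← meromorphicOrderAt_congr e, meromorphicOrderAt_mul hm hg.meromorphicAt,
    fun_meromorphicOrderAt_zpow_id_sub_const]
  calc ((-N : ℤ) : WithTop ℤ) = ((-N : ℤ) : WithTop ℤ) + 0 := (add_zero _).symm
    _ ≤ _ := add_le_add le_rfl hg.meromorphicOrderAt_nonneg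

theorem bounded_of_order_le {f : ℂ → ℂ} {a : ℂ} {N : ℤ} (hf : MeromorphicAt f a)
    (ho : ((-N : ℤ) : WithTop ℤ) ≤ meromorphicOrderAt f a) :
    ∃ C : ℝ, ∀ᶠ z in 𝓝[≠] a, ‖(z - a) ^ N * f z‖ ≤ C := by
  have hm : MeromorphicAt (fun z : ℂ => (z - a) ^ N) a := by fun_prop
  have h0 : 0 ≤ meromorphicOrderAt ((fun z : ℂ => (z - a) ^ N) * f) a := by
    rw [meromorphicOrderAt_mul hm hf, fun_meromorphicOrderAt_zpow_id_sub_const]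
    calc (0 : WithTop ℤ) = ((N : ℤ) : WithTop ℤ) + ((-N : ℤ) : WithTop ℤ) := by
          rw [← WithTop.coe_add]; simp
      _ ≤ _ := add_le_add le_rfl ho
  obtain ⟨c, hc⟩ := tendsto_nhds_of_meromorphicOrderAt_nonneg (hm.mul hf) h0
  refine ⟨‖c‖ + 1, ?_⟩
  filter_upwards [hc.norm.eventually (gt_mem_nhds (lt_add_one ‖c‖))] with z hz
  exact hz.le

/-- Division of entire functions by an entire function with simple zeros. -/
theorem exists_eq_mul_of_simple_zeros {g h : ℂ → ℂ} (hg : Differentiable ℂ g)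
    (hh : Differentiable ℂ h) (hs : ∀ z, h z = 0 → deriv h z ≠ 0) (hz : ∀ z, h z = 0 → g z = 0) :
    ∃ q : ℂ → ℂ, Differentiable ℂ q ∧ ∀ z, g z = h z * q z := by
  classical
  -- At a zero of `h` the value is the one of l'Hôpital's rule. Near such a point the quotient
  -- agrees with the quotient of the two `dslope`s, whose denominator does not vanish as the zero is
  -- simple.
  refine ⟨fun z => if h z = 0 then deriv g z / deriv h z else g z / h z, fun a => ?_, fun z => ?_⟩
  · by_cases ha : h a = 0
    · have hga : DifferentiableAt ℂ (dslope g a) a :=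
        ((Complex.differentiableOn_dslope Filter.univ_mem).2 hg.differentiableOn a
          (Set.mem_univ _)).differentiableAt Filter.univ_mem
      have hha : DifferentiableAt ℂ (dslope h a) a :=
        ((Complex.differentiableOn_dslope Filter.univ_mem).2 hh.differentiableOn a
          (Set.mem_univ _)).differentiableAt Filter.univ_mem
      have hne : dslope h a a ≠ 0 := by rw [dslope_same]; exact hs a ha
      refine (hga.div hha hne).congr_of_eventuallyEq ?_
      filter_upwards [hha.continuousAt.eventually_ne hne] with z hz1
      by_cases hza : z = a
      · subst hza
        simp [ha, dslope_same]
      · have h1 : h z = (z - a) * dslope h a z := by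
          rw [dslope_of_ne _ hza, slope_def_field, ha]
          field_simp [sub_ne_zero.2 hza]
          ring
        have h2 : g z = (z - a) * dslope g a z := by
          rw [dslope_of_ne _ hza, slope_def_field, hz a ha]
          field_simp [sub_ne_zero.2 hza]
          ring
        have h3 : h z ≠ 0 := by rw [h1]; exact mul_ne_zero (sub_ne_zero.2 hza) hz1
        rw [if_neg h3, h1, h2, Pi.div_apply, mul_div_mul_left _ _ (sub_ne_zero.2 hza)]
    · refine ((hg a).div (hh a) ha).congr_of_eventuallyEq ?_
      filter_upwards [(hh a).continuousAt.eventually_ne ha] with z hz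
      simp [hz]
  · by_cases hz0 : h z = 0
    · simp [hz0, hz z hz0]
    · simp only [hz0, if_false]
      field_simp

/-- The complement of a countable set is dense. In this way functional equations of quotients extend
across the zeros of the denominators. -/
theorem eq_of_eq_off_countable {f g : ℂ → ℂ} (hf : Continuous f) (hg : Continuous g) {s : Set ℂ}
    (hs : s.Countable) (h : ∀ z ∉ s, f z = g z) : f = g :=
  hf.ext_on (hs.dense_compl ℝ) hg h

end Punctured

/-! ### Quasi-periodic functions -/

/-- `g` has period `1` and is multiplied by `C exp(-2πi d z)` under `z ↦ z + τ`. -/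
structure IsQuasiperiodic (τ C : ℂ) (d : ℤ) (g : ℂ → ℂ) : Prop where
  add_one : ∀ z, g (z + 1) = g z
  add_tau : ∀ z, g (z + τ) = C * cexp (-2 * Real.pi * I * d * z) * g z

theorem mem_periods {τ : ℂ} {hτ : 0 < τ.im} {x : ℂ} :
    x ∈ (periods τ hτ).lattice ↔ ∃ a b : ℤ, x = a + b * τ := by
  rw [PeriodPair.mem_lattice]
  simp only [periods, mul_one]
  exact exists₂_congr fun a b => eq_comm

/-- A property of periods that is stable under addition and negation has to be checked for `1` and
`τ` only. -/
theorem lattice_le_of_mem {τ : ℂ} (hτ : 0 < τ.im) {G : AddSubgroup ℂ} (h1 : (1 : ℂ) ∈ G)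
    (h2 : τ ∈ G) {l : ℂ} (hl : l ∈ (periods τ hτ).lattice) : l ∈ G := by
  obtain ⟨a, b, rfl⟩ := mem_periods.1 hl
  refine add_mem ?_ ?_
  · simpa using zsmul_mem h1 a
  · simpa using zsmul_mem h2 b

theorem exp_two_pi_int (k : ℤ) : cexp (2 * Real.pi * I * k) = 1 := by
  rw [mul_comm]; exact Complex.exp_int_mul_two_pi_mul_I k

/-- The translations with a multiplier of this shape form a subgroup. Only the fact that the
multiplier has no zeros matters later, so its constants stay unspecified. -/
theorem IsQuasiperiodic.add_lattice {τ C : ℂ} {d : ℤ} {g : ℂ → ℂ} (hg : IsQuasiperiodic τ C d g)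
    (hτ : 0 < τ.im) (hC : C ≠ 0) {l : ℂ} (hl : l ∈ (periods τ hτ).lattice) :
    ∃ C' : ℂ, C' ≠ 0 ∧ ∃ d' : ℤ, ∀ z, g (z + l) = C' * cexp (-2 * Real.pi * I * d' * z) * g z := by
  let G : AddSubgroup ℂ :=
    { carrier := {l | ∃ C' : ℂ, C' ≠ 0 ∧ ∃ d' : ℤ,
        ∀ z, g (z + l) = C' * cexp (-2 * Real.pi * I * d' * z) * g z}
      zero_mem' := ⟨1, one_ne_zero, 0, fun z => by simp⟩
      add_mem' := by
        rintro a b ⟨C₁, h1, d₁, e1⟩ ⟨C₂, h2, d₂, e2⟩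
        refine ⟨C₁ * C₂ * cexp (-2 * Real.pi * I * d₂ * a), by simp [h1, h2], d₁ + d₂, fun z => ?_⟩
        rw [← add_assoc, e2, e1]
        rw [show (-2 * Real.pi * I * ((d₁ + d₂ : ℤ) : ℂ) * z) = -2 * Real.pi * I * d₁ * z +
          -2 * Real.pi * I * d₂ * z by push_cast; ring,
          show -2 * Real.pi * I * d₂ * (z + a) = -2 * Real.pi * I * d₂ * z +
          -2 * Real.pi * I * d₂ * a by ring, Complex.exp_add, Complex.exp_add]
        ring
      neg_mem' := by
        rintro a ⟨C₁, h1, d₁, e1⟩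
        refine ⟨C₁⁻¹ * cexp (-2 * Real.pi * I * d₁ * a), by simp [h1], -d₁, fun z => ?_⟩
        have h := e1 (z + -a)
        rw [neg_add_cancel_right] at h
        rw [h]
        have e : -2 * Real.pi * I * ((-d₁ : ℤ) : ℂ) * z =
          -(-2 * Real.pi * I * d₁ * (z + -a)) + -(-2 * Real.pi * I * d₁ * a) := by push_cast; ring
        rw [e, Complex.exp_add, Complex.exp_neg, Complex.exp_neg]
        field_simp }
  exact lattice_le_of_mem (G := G) hτ ⟨1, one_ne_zero, 0, fun z => by simp [hg.add_one]⟩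
    ⟨C, hC, d, hg.add_tau⟩ hl

theorem IsQuasiperiodic.eq_zero_iff {τ C : ℂ} {d : ℤ} {g : ℂ → ℂ} (hg : IsQuasiperiodic τ C d g)
    (hτ : 0 < τ.im) (hC : C ≠ 0) {l : ℂ} (hl : l ∈ (periods τ hτ).lattice) (z : ℂ) :
    g (z + l) = 0 ↔ g z = 0 := by
  obtain ⟨C', h1, d', h2⟩ := hg.add_lattice hτ hC hl
  rw [h2]
  simp [h1]

/-- Liouville's theorem: the range is compact, since it is the image of a torus. -/
theorem apply_eq_apply_of_periodic {τ : ℂ} (hτ : 0 < τ.im) {f : ℂ → ℂ} (hf : Differentiable ℂ f)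
    (h1 : ∀ z, f (z + 1) = f z) (h2 : ∀ z, f (z + τ) = f z) (z w : ℂ) : f z = f w := by
  have h : ∀ z l : ℂ, l ∈ (periods τ hτ).lattice → f (z + l) = f z := by
    intro z l hl
    let G : AddSubgroup ℂ :=
      { carrier := {l | ∀ z, f (z + l) = f z}
        zero_mem' := by simp
        add_mem' := by
          intro a b ha hb z
          rw [← add_assoc, hb, ha]
        neg_mem' := by
          intro a ha z
          have := ha (z + -a)
          rw [neg_add_cancel_right] at this
          exact this.symm }
    exact lattice_le_of_mem (G := G) hτ h1 h2 hl z
  exact hf.apply_eq_apply_of_bounded (IsZLattice.isCompact_range_of_periodic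
    (periods τ hτ).lattice f hf.continuous h).isBounded z w

theorem countable_lattice {τ : ℂ} (hτ : 0 < τ.im) :
    ((periods τ hτ).lattice : Set ℂ).Countable := by
  have : ((periods τ hτ).lattice : Set ℂ) ⊆ Set.range fun x : ℤ × ℤ => (x.1 : ℂ) + x.2 * τ := by
    intro x hx
    obtain ⟨a, b, rfl⟩ := mem_periods.1 hx
    exact ⟨(a, b), rfl⟩
  exact (Set.countable_range _).mono this

/-- The multiplier has no zeros, so a simple zero at `0` remains simple at every lattice point. -/
theorem deriv_ne_zero_of_lattice {τ C : ℂ} {d : ℤ} {g : ℂ → ℂ} (hg : IsQuasiperiodic τ C d g)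
    (hτ : 0 < τ.im) (hC : C ≠ 0) (hd : Differentiable ℂ g) (h0 : g 0 = 0) (h1 : deriv g 0 ≠ 0)
    {l : ℂ} (hl : l ∈ (periods τ hτ).lattice) : deriv g l ≠ 0 := by
  obtain ⟨C', hC', d', h2⟩ := hg.add_lattice hτ hC hl
  have h3 := deriv_comp_add_const (f := g) l 0
  rw [zero_add] at h3
  rw [← h3, funext h2, deriv_fun_mul (by fun_prop) (hd 0)]
  simp [h0, h1, hC']

/-! ### The theta function, normalised -/

/-- `θ₁` up to an exponential factor; it tends to `1 - exp(-2πiz)` as `Im τ → +∞`. -/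
def theta (τ z : ℂ) : ℂ := jacobiTheta₂ (z + 1 / 2 + τ / 2) τ

theorem theta_add_one (τ z : ℂ) : theta τ (z + 1) = theta τ z := by
  rw [theta, theta, ← jacobiTheta₂_add_left (z + 1 / 2 + τ / 2)]
  congr 1
  ring

theorem theta_add_tau (τ z : ℂ) :
    theta τ (z + τ) = -cexp (-2 * Real.pi * I * (z + τ)) * theta τ z := by
  rw [theta, theta, show z + τ + 1 / 2 + τ / 2 = (z + 1 / 2 + τ / 2) + τ by ring,
    jacobiTheta₂_add_left', show -Real.pi * I * (τ + 2 * (z + 1 / 2 + τ / 2)) =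
      -2 * Real.pi * I * (z + τ) - Real.pi * I by ring, Complex.exp_sub, Complex.exp_pi_mul_I]
  ring

theorem theta_sub_tau (τ z : ℂ) :
    theta τ (z - τ) = -cexp (2 * Real.pi * I * z) * theta τ z := by
  have h := theta_add_tau τ (z - τ)
  rw [sub_add_cancel] at h
  rw [h, show -2 * Real.pi * I * z = -(2 * Real.pi * I * z) by ring, Complex.exp_neg]
  field_simp

theorem theta_neg (τ z : ℂ) : theta τ (-z) = -cexp (2 * Real.pi * I * z) * theta τ z := by
  rw [← theta_sub_tau, ← theta_add_one τ (-z), theta, theta, ← jacobiTheta₂_neg_left]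
  have h1 := jacobiTheta₂_add_left (z - 3 / 2 - τ / 2) τ
  have h2 := jacobiTheta₂_add_left (z - 3 / 2 - τ / 2 + 1) τ
  rw [show -(-z + 1 + 1 / 2 + τ / 2) = z - 3 / 2 - τ / 2 by ring, ← h1, ← h2]
  congr 1
  ring

theorem theta_zero (τ : ℂ) : theta τ 0 = 0 := by
  have h := theta_neg τ 0
  rw [neg_zero, mul_zero, Complex.exp_zero, neg_one_mul] at h
  exact CharZero.eq_neg_self_iff.1 h

theorem theta_isQuasiperiodic (τ : ℂ) :
    IsQuasiperiodic τ (-cexp (-2 * Real.pi * I * τ)) 1 (theta τ) where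
  add_one := theta_add_one τ
  add_tau z := by
    rw [theta_add_tau, show -2 * Real.pi * I * (z + τ) = -2 * Real.pi * I * τ +
      -2 * Real.pi * I * ((1 : ℤ) : ℂ) * z by push_cast; ring, Complex.exp_add]
    ring

theorem differentiableAt_theta₂ {q : ℂ × ℂ} (hq : 0 < q.2.im) :
    DifferentiableAt ℂ (fun q : ℂ × ℂ => theta q.2 q.1) q := by
  have h := (hasFDerivAt_jacobiTheta₂ (q.1 + 1 / 2 + q.2 / 2) hq).differentiableAt
  exact DifferentiableAt.comp (g := fun p : ℂ × ℂ => jacobiTheta₂ p.1 p.2)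
    (f := fun q : ℂ × ℂ => (q.1 + 1 / 2 + q.2 / 2, q.2)) q h (by fun_prop)

theorem differentiable_theta {τ : ℂ} (hτ : 0 < τ.im) : Differentiable ℂ (theta τ) := fun z =>
  DifferentiableAt.comp (g := fun q : ℂ × ℂ => theta q.2 q.1) (f := fun z : ℂ => (z, τ)) z
    (differentiableAt_theta₂ hτ) (by fun_prop)

/-- This is the constant Fourier coefficient; it shows that the theta function is not identically
zero. -/
theorem integral_jacobiTheta₂ {τ : ℂ} (hτ : 0 < τ.im) :
    ∫ x in (0 : ℝ)..1, jacobiTheta₂ x τ = 1 := by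
  have hb := summable_pow_mul_jacobiTheta₂_term_bound 0 hτ 0
  have h1 := intervalIntegral.hasSum_integral_of_dominated_convergence (a := 0) (b := 1)
    (μ := MeasureTheory.volume)
    (F := fun (k : ℤ) (x : ℝ) => jacobiTheta₂_term k x τ) (f := fun x : ℝ => jacobiTheta₂ x τ)
    (fun k _ => (|k| ^ 0 : ℝ) * Real.exp (-Real.pi * (τ.im * k ^ 2 - 2 * 0 * |k|)))
    (fun k => by
      refine Continuous.aestronglyMeasurable ?_
      unfold jacobiTheta₂_term
      fun_prop)
    (fun k => Filter.Eventually.of_forall fun x _ => by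
      have := norm_jacobiTheta₂_term_le hτ (S := 0) (z := x) (by simp) le_rfl k
      simpa using this)
    (Filter.Eventually.of_forall fun x _ => hb) (by simp)
    (Filter.Eventually.of_forall fun x _ => hasSum_jacobiTheta₂_term x hτ)
  refine h1.unique ?_
  have h2 : ∀ k : ℤ, k ≠ 0 → ∫ x in (0 : ℝ)..1, jacobiTheta₂_term k x τ = 0 := by
    intro k hk
    have hk' : (2 * Real.pi * I * k : ℂ) ≠ 0 := by
      simp [hk, Real.pi_ne_zero]
    have e : ∀ x : ℝ, jacobiTheta₂_term k x τ =
        cexp (Real.pi * I * k ^ 2 * τ) * cexp ((2 * Real.pi * I * k) * x) := by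
      intro x
      rw [jacobiTheta₂_term, Complex.exp_add, mul_comm]
    simp_rw [e]
    rw [intervalIntegral.integral_const_mul, integral_exp_mul_complex hk']
    have := exp_two_pi_int k
    simp [this]
  have h3 := hasSum_single (f := fun k : ℤ => ∫ x in (0 : ℝ)..1, jacobiTheta₂_term k x τ) 0 h2
  simpa [jacobiTheta₂_term] using h3

theorem exists_theta_ne_zero {τ : ℂ} (hτ : 0 < τ.im) : ∃ z, theta τ z ≠ 0 := by
  by_contra! h
  have : ∀ x : ℝ, jacobiTheta₂ x τ = 0 := by
    intro x
    have := h (x - 1 / 2 - τ / 2)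
    rw [theta] at this
    rw [← this]
    congr 1
    ring
  have h2 := integral_jacobiTheta₂ hτ
  simp [this] at h2

/-! ### The product that shows the zeros of the theta function -/

/-- The product `∏ (1 - q^n x)`. -/
def qProd (q x : ℂ) : ℂ := ∏' n : ℕ, (1 - q ^ n * x)

theorem summable_qProd {q : ℂ} (hq : ‖q‖ < 1) (x : ℂ) : Summable fun n : ℕ => ‖-(q ^ n * x)‖ := by
  simpa using (summable_geometric_of_lt_one (norm_nonneg _) hq).mul_right ‖x‖

theorem qProd_eq {q : ℂ} (hq : ‖q‖ < 1) (x : ℂ) : qProd q x = (1 - x) * qProd q (q * x) := by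
  have h : Multipliable fun n : ℕ => 1 - q ^ (n + 1) * x := by
    have := multipliable_one_add_of_summable (summable_qProd hq (q * x))
    refine this.congr fun n => ?_
    ring
  have h1 := tprod_eq_zero_mul' (f := fun n : ℕ => 1 - q ^ n * x) h
  have h2 : ∀ n : ℕ, 1 - q ^ (n + 1) * x = 1 - q ^ n * (q * x) := fun n => by ring
  simp only [h2, pow_zero, one_mul] at h1
  exact h1

theorem qProd_ne_zero {q : ℂ} (hq : ‖q‖ < 1) {x : ℂ} (hx : ∀ n : ℕ, q ^ n * x ≠ 1) :
    qProd q x ≠ 0 := by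
  have := tprod_one_add_ne_zero_of_summable (f := fun n : ℕ => -(q ^ n * x))
    (fun n => by rw [← sub_eq_add_neg, sub_ne_zero]; exact (hx n).symm) (summable_qProd hq x)
  simpa [qProd, sub_eq_add_neg] using this

theorem differentiable_qProd {q : ℂ} (hq : ‖q‖ < 1) : Differentiable ℂ (qProd q) := by
  intro x
  have hx : x ∈ Metric.ball (0 : ℂ) (‖x‖ + 1) := by simp
  have h := Summable.hasProdLocallyUniformlyOn_nat_one_add (f := fun (n : ℕ) x => -(q ^ n * x))
    (K := Metric.ball (0 : ℂ) (‖x‖ + 1)) Metric.isOpen_ball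
    ((summable_geometric_of_lt_one (norm_nonneg _) hq).mul_right (‖x‖ + 1))
    (Filter.Eventually.of_forall fun n y hy => by
      rw [norm_neg, norm_mul, norm_pow]
      gcongr
      simpa using (Metric.mem_ball.1 hy).le)
    (fun n => by fun_prop)
  have h2 := h.differentiableOn (Filter.Eventually.of_forall fun s => by
    simpa [Finset.prod_fn] using DifferentiableOn.finsetProd (fun _ _ => by fun_prop))
    Metric.isOpen_ball
  have h3 := (h2 x hx).differentiableAt (Metric.isOpen_ball.mem_nhds hx)
  simpa only [qProd, sub_eq_add_neg] using! h3

theorem norm_exp_tau_lt_one {τ : ℂ} (hτ : 0 < τ.im) : ‖cexp (2 * Real.pi * I * τ)‖ < 1 := by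
  rw [Complex.norm_exp, Real.exp_lt_one_iff]
  simp
  positivity

/-- The product `∏_{n ≥ 0} (1 - q^n x) ∏_{n ≥ 1} (1 - q^n / x)` with `x = exp(2πiz)`. -/
def thetaProd (τ z : ℂ) : ℂ :=
  qProd (cexp (2 * Real.pi * I * τ)) (cexp (2 * Real.pi * I * z)) *
    qProd (cexp (2 * Real.pi * I * τ)) (cexp (2 * Real.pi * I * τ) * cexp (-(2 * Real.pi * I * z)))

theorem differentiable_thetaProd {τ : ℂ} (hτ : 0 < τ.im) : Differentiable ℂ (thetaProd τ) := by
  have h := differentiable_qProd (norm_exp_tau_lt_one hτ)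
  unfold thetaProd
  exact (h.comp (by fun_prop)).mul (h.comp (by fun_prop))

theorem thetaProd_isQuasiperiodic {τ : ℂ} (hτ : 0 < τ.im) :
    IsQuasiperiodic τ (-1) 1 (thetaProd τ) where
  add_one z := by
    have e : cexp (2 * Real.pi * I * (z + 1)) = cexp (2 * Real.pi * I * z) := by
      rw [mul_add, mul_one, Complex.exp_add, Complex.exp_two_pi_mul_I, mul_one]
    simp only [thetaProd, Complex.exp_neg, e]
  add_tau z := by
    have hq := norm_exp_tau_lt_one hτ
    simp only [thetaProd]
    set q := cexp (2 * Real.pi * I * τ)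
    rw [show 2 * Real.pi * I * (z + τ) = 2 * Real.pi * I * τ + 2 * Real.pi * I * z by ring,
      neg_add, Complex.exp_add, Complex.exp_add, Complex.exp_neg, Complex.exp_neg,
      show (-2 * Real.pi * I * ((1 : ℤ) : ℂ) * z) = -(2 * Real.pi * I * z) by push_cast; ring,
      Complex.exp_neg]
    have hq0 : q ≠ 0 := Complex.exp_ne_zero _
    have hx0 : cexp (2 * Real.pi * I * z) ≠ 0 := Complex.exp_ne_zero _
    set x := cexp (2 * Real.pi * I * z)
    change qProd q (q * x) * qProd q (q * (q⁻¹ * x⁻¹)) = -1 * x⁻¹ * (qProd q x * qProd q (q * x⁻¹))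
    -- Translation by `τ` removes the factor `1 - x` from the first product and adds `1 - 1/x` to
    -- the second; their ratio is the multiplier.
    rw [← mul_assoc q, mul_inv_cancel₀ hq0, one_mul, qProd_eq hq x, qProd_eq hq x⁻¹]
    field_simp
    ring

theorem thetaProd_eq_zero {τ : ℂ} (hτ : 0 < τ.im) {z : ℂ} (h : thetaProd τ z = 0) :
    z ∈ (periods τ hτ).lattice := by
  have hq := norm_exp_tau_lt_one hτ
  by_contra hz
  have hz' : ∀ a b : ℤ, z ≠ a + b * τ := fun a b hab => hz (mem_periods.2 ⟨a, b, hab⟩)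
  have aux : ∀ w : ℂ, cexp (2 * Real.pi * I * w) = 1 → ∃ k : ℤ, w = k := by
    intro w hw
    obtain ⟨k, hk⟩ := Complex.exp_eq_one_iff.1 hw
    refine ⟨k, ?_⟩
    have : (2 * Real.pi * I : ℂ) ≠ 0 := Complex.two_pi_I_ne_zero
    apply mul_left_cancel₀ this
    rw [hk, mul_comm]
  refine mul_ne_zero (qProd_ne_zero hq fun n hn => ?_) (qProd_ne_zero hq fun n hn => ?_) h
  · rw [← Complex.exp_nat_mul, ← Complex.exp_add] at hn
    obtain ⟨k, hk⟩ := aux (n * τ + z) (by rw [← hn]; congr 1; ring)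
    refine hz' k (-n) ?_
    push_cast
    linear_combination hk
  · rw [← Complex.exp_nat_mul, ← Complex.exp_add, ← Complex.exp_add] at hn
    obtain ⟨k, hk⟩ := aux (n * τ + τ - z) (by rw [← hn]; congr 1; ring)
    refine hz' (-k) (n + 1) ?_
    push_cast
    linear_combination -hk

/-- The factor `1 - x` with `x = exp(2πiz)` carries the simple zero; the remaining product at `x =
1` is the square of a product whose factors `1 - q^(n+1)` do not vanish. -/
theorem deriv_thetaProd_zero {τ : ℂ} (hτ : 0 < τ.im) :
    thetaProd τ 0 = 0 ∧ deriv (thetaProd τ) 0 ≠ 0 := by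
  have hq := norm_exp_tau_lt_one hτ
  have hd := differentiable_qProd hq
  set q := cexp (2 * Real.pi * I * τ) with hqdef
  have e : thetaProd τ = fun z => (1 - cexp (2 * Real.pi * I * z)) *
      (qProd q (q * cexp (2 * Real.pi * I * z)) * qProd q (q * cexp (-(2 * Real.pi * I * z)))) := by
    funext z
    rw [thetaProd, ← hqdef, qProd_eq hq (cexp (2 * Real.pi * I * z)), mul_assoc]
  have hne : qProd q q ≠ 0 := qProd_ne_zero hq fun n hn => by
    have h1 : ‖q ^ n * q‖ < 1 := by
      rw [← pow_succ, norm_pow]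
      exact pow_lt_one₀ (norm_nonneg _) hq (by simp)
    rw [hn] at h1
    simp at h1
  constructor
  · simp [e]
  · have hd1 : DifferentiableAt ℂ (fun z => qProd q (q * cexp (2 * Real.pi * I * z)) *
        qProd q (q * cexp (-(2 * Real.pi * I * z)))) 0 := by fun_prop
    rw [e, deriv_fun_mul (by fun_prop) hd1]
    have h1 : deriv (fun z : ℂ => 1 - cexp (2 * Real.pi * I * z)) 0 = -(2 * Real.pi * I) := by
      have h2 : HasDerivAt (fun z : ℂ => 1 - cexp (2 * Real.pi * I * z))
          (-(cexp (2 * Real.pi * I * 0) * (2 * Real.pi * I * 1))) 0 :=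
        (((hasDerivAt_id (0 : ℂ)).const_mul (2 * Real.pi * I)).cexp).const_sub 1
      rw [h2.deriv]
      simp
    rw [h1]
    simp [hne, Real.pi_ne_zero]

theorem theta_eq_zero_of_mem {τ : ℂ} (hτ : 0 < τ.im) {z : ℂ} (hz : z ∈ (periods τ hτ).lattice) :
    theta τ z = 0 := by
  rw [← zero_add z, (theta_isQuasiperiodic τ).eq_zero_iff hτ (by simp) hz]
  exact theta_zero τ

/-- Jacobi's triple product without the value of its constant. The zeros of `thetaProd` are simple
and lie in the lattice, where `theta` vanishes as well, so the quotient is entire; it is doubly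
periodic, hence constant. The product makes visible that `theta` has no further zeros. -/
theorem exists_theta_eq {τ : ℂ} (hτ : 0 < τ.im) : ∃ c : ℂ, c ≠ 0 ∧
    ∀ z, theta τ z = c * cexp (-(2 * Real.pi * I * z)) * thetaProd τ z := by
  have hP := thetaProd_isQuasiperiodic hτ
  have hd : Differentiable ℂ fun z => cexp (2 * Real.pi * I * z) * theta τ z := by
    have := differentiable_theta hτ
    fun_prop
  obtain ⟨Q, hQ, hQe⟩ := exists_eq_mul_of_simple_zeros hd (differentiable_thetaProd hτ)
    (fun z hz => deriv_ne_zero_of_lattice hP hτ (by simp) (differentiable_thetaProd hτ)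
      (deriv_thetaProd_zero hτ).1 (deriv_thetaProd_zero hτ).2 (thetaProd_eq_zero hτ hz))
    (fun z hz => by simp [theta_eq_zero_of_mem hτ (thetaProd_eq_zero hτ hz)])
  have hne : ∀ z ∉ ((periods τ hτ).lattice : Set ℂ), thetaProd τ z ≠ 0 := fun z hz h =>
    hz (thetaProd_eq_zero hτ h)
  have hQc := hQ.continuous
  have h1 : ∀ z, Q (z + 1) = Q z := by
    refine congrFun (eq_of_eq_off_countable (f := fun z => Q (z + 1)) (by fun_prop)
      hQ.continuous (countable_lattice hτ) fun z hz => ?_)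
    refine mul_left_cancel₀ (hne z hz) ?_
    have := hQe (z + 1)
    rw [hP.add_one, theta_add_one, mul_add, mul_one, Complex.exp_add,
      Complex.exp_two_pi_mul_I, mul_one] at this
    rw [← hQe, this]
  have h2 : ∀ z, Q (z + τ) = Q z := by
    refine congrFun (eq_of_eq_off_countable (f := fun z => Q (z + τ)) (by fun_prop)
      hQ.continuous (countable_lattice hτ) fun z hz => ?_)
    refine mul_left_cancel₀ (hne z hz) ?_
    have := hQe (z + τ)
    rw [hP.add_tau, theta_add_tau, show -2 * Real.pi * I * (z + τ) = -(2 * Real.pi * I * (z + τ)) by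
      ring, Complex.exp_neg, show -2 * Real.pi * I * ((1 : ℤ) : ℂ) * z = -(2 * Real.pi * I * z) by
      push_cast; ring, Complex.exp_neg] at this
    rw [← hQe]
    field_simp at this
    linear_combination this
  have h3 : ∀ z, Q z = Q 0 := fun z => apply_eq_apply_of_periodic hτ hQ h1 h2 z 0
  have h4 : ∀ z, theta τ z = Q 0 * cexp (-(2 * Real.pi * I * z)) * thetaProd τ z := by
    intro z
    have := hQe z
    rw [h3] at this
    rw [Complex.exp_neg]
    field_simp
    linear_combination this
  refine ⟨Q 0, fun h0 => ?_, h4⟩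
  obtain ⟨z, hz⟩ := exists_theta_ne_zero hτ
  exact hz (by rw [h4, h0]; simp)

theorem theta_eq_zero_iff {τ : ℂ} (hτ : 0 < τ.im) {z : ℂ} :
    theta τ z = 0 ↔ z ∈ (periods τ hτ).lattice := by
  refine ⟨fun h => ?_, theta_eq_zero_of_mem hτ⟩
  obtain ⟨c, hc, h1⟩ := exists_theta_eq hτ
  rw [h1] at h
  refine thetaProd_eq_zero hτ ?_
  simpa [hc] using h

theorem deriv_theta_ne_zero {τ : ℂ} (hτ : 0 < τ.im) {z : ℂ} (hz : z ∈ (periods τ hτ).lattice) :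
    deriv (theta τ) z ≠ 0 := by
  refine deriv_ne_zero_of_lattice (theta_isQuasiperiodic τ) hτ (by simp) (differentiable_theta hτ)
    (theta_zero τ) ?_ hz
  obtain ⟨c, hc, h1⟩ := exists_theta_eq hτ
  rw [funext h1, deriv_fun_mul (by fun_prop) (differentiable_thetaProd hτ 0)]
  simp [(deriv_thetaProd_zero hτ).1, (deriv_thetaProd_zero hτ).2, hc]

/-! ### Counting zeros of quasi-periodic entire functions -/

/-- Multiplication by `θ(x - p)^k` raises the degree to `0`. For a suitable `p` the product is
doubly periodic, hence constant, and it vanishes at `p`. -/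
theorem IsQuasiperiodic.eq_zero_of_neg {τ C : ℂ} (hτ : 0 < τ.im) (hC : C ≠ 0) {k : ℕ} (hk : k ≠ 0)
    {g : ℂ → ℂ} (hd : Differentiable ℂ g) (hg : IsQuasiperiodic τ C (-k) g) : g = 0 := by
  have hk' : (k : ℂ) ≠ 0 := Nat.cast_ne_zero.2 hk
  have hne : C * (-1) ^ k ≠ 0 := mul_ne_zero hC (pow_ne_zero _ (by norm_num))
  obtain ⟨w, hw⟩ : ∃ w : ℂ, cexp w = (C * (-1) ^ k)⁻¹ :=
    ⟨_, Complex.exp_log (inv_ne_zero hne)⟩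
  -- The point `p` solves `C (-1)^k exp(2πik(p - τ)) = 1`, which says that the multiplier of the
  -- product under translation by `τ` is `1`.
  set p : ℂ := τ + w / (2 * Real.pi * I * k) with hp
  have hpw : 2 * Real.pi * I * k * (p - τ) = w := by
    rw [hp]
    have := Complex.two_pi_I_ne_zero
    field_simp
    ring
  have hG : Differentiable ℂ fun x => g x * theta τ (x - p) ^ k := by
    have := differentiable_theta hτ
    fun_prop
  have h0 : ∀ x, g x * theta τ (x - p) ^ k = 0 := by
    intro x
    have h := apply_eq_apply_of_periodic hτ hG (fun z => ?_) (fun z => ?_) x p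
    · rw [h, sub_self, theta_zero, zero_pow hk, mul_zero]
    · rw [hg.add_one, show z + 1 - p = z - p + 1 by ring, theta_add_one]
    · rw [hg.add_tau, show z + τ - p = z - p + τ by ring, theta_add_tau, mul_pow, neg_pow,
        ← Complex.exp_nat_mul]
      have e : C * (-1) ^ k * cexp w = 1 := by rw [hw, mul_inv_cancel₀ hne]
      have e2 : cexp (-2 * Real.pi * I * ((-(k : ℤ) : ℤ) : ℂ) * z) *
          cexp (k * (-2 * Real.pi * I * (z - p + τ))) = cexp w := by
        rw [← Complex.exp_add, ← hpw]
        congr 1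
        push_cast
        ring
      linear_combination (g z * theta τ (z - p) ^ k) * (e + C * (-1) ^ k * e2)
  refine eq_of_eq_off_countable (g := 0) hd.continuous continuous_const
    (s := (fun x => x - p) ⁻¹' ((periods τ hτ).lattice : Set ℂ))
    ((countable_lattice hτ).preimage (sub_left_injective)) fun z hz => ?_
  have h1 : theta τ (z - p) ≠ 0 := fun h => hz ((theta_eq_zero_iff hτ).1 h)
  exact (mul_eq_zero.1 (h0 z)).resolve_right (pow_ne_zero _ h1)

/-- A quasi-periodic entire function of degree `d` with more than `d` zeros vanishes. -/
theorem IsQuasiperiodic.eq_zero {τ : ℂ} (hτ : 0 < τ.im) (s : Finset ℂ)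
    (hs : ∀ a ∈ s, ∀ b ∈ s, a ≠ b → a - b ∉ (periods τ hτ).lattice) {C : ℂ} (hC : C ≠ 0) {d : ℤ}
    (hds : d < s.card) {g : ℂ → ℂ} (hd : Differentiable ℂ g) (hg : IsQuasiperiodic τ C d g)
    (h0 : ∀ a ∈ s, g a = 0) : g = 0 := by
  -- Division by `θ(x - a)` uses up the zero `a` and lowers the degree by one. The other prescribed
  -- zeros survive because they are not congruent to `a`. With no zeros left the degree is negative.
  induction s using Finset.induction_on generalizing C d g with
  | empty =>
    simp only [Finset.card_empty, Nat.cast_zero] at hds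
    obtain ⟨k, hk⟩ := Int.eq_ofNat_of_zero_le (a := -d) (by omega)
    have : d = -k := by omega
    subst this
    exact IsQuasiperiodic.eq_zero_of_neg hτ hC (by rintro rfl; simp at hds) hd hg
  | insert a s ha ih =>
    have hθ := differentiable_theta hτ
    have hθa : Differentiable ℂ fun x => theta τ (x - a) := by fun_prop
    have hz : ∀ z, theta τ (z - a) = 0 → z - a ∈ (periods τ hτ).lattice := fun z hz =>
      (theta_eq_zero_iff hτ).1 hz
    have hc : ((fun x => x - a) ⁻¹' ((periods τ hτ).lattice : Set ℂ)).Countable :=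
      (countable_lattice hτ).preimage (sub_left_injective)
    obtain ⟨q, hq, hgq⟩ := exists_eq_mul_of_simple_zeros hd hθa
      (fun z h => by
        rw [deriv_comp_sub_const]
        exact deriv_theta_ne_zero hτ (hz z h))
      (fun z h => by
        have := (hg.eq_zero_iff hτ hC (hz z h) a).2 (h0 a (Finset.mem_insert_self a s))
        rwa [add_sub_cancel] at this)
    have hqc := hq.continuous
    have hq' : IsQuasiperiodic τ (-(C * cexp (2 * Real.pi * I * (τ - a)))) (d - 1) q := by
      constructor
      · refine congrFun (eq_of_eq_off_countable (f := fun z => q (z + 1)) (by fun_prop) hqc hc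
          fun z h => ?_)
        have h1 : theta τ (z - a) ≠ 0 := fun h' => h (hz z h')
        have h2 := hgq (z + 1)
        rw [hg.add_one, hgq z, show z + 1 - a = z - a + 1 by ring, theta_add_one] at h2
        exact (mul_left_cancel₀ h1 h2).symm
      · refine congrFun (eq_of_eq_off_countable (f := fun z => q (z + τ)) (by fun_prop)
          (by fun_prop) hc fun z h => ?_)
        have h1 : theta τ (z - a) ≠ 0 := fun h' => h (hz z h')
        have h2 := hgq (z + τ)
        rw [hg.add_tau, hgq z, show z + τ - a = z - a + τ by ring, theta_add_tau,
          show -2 * Real.pi * I * (z - a + τ) = -(2 * Real.pi * I * (z + (τ - a))) by ring,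
          Complex.exp_neg, mul_add, Complex.exp_add] at h2
        have h3 : -2 * Real.pi * I * ((d - 1 : ℤ) : ℂ) * z =
          -2 * Real.pi * I * d * z + 2 * Real.pi * I * z := by push_cast; ring
        rw [h3, Complex.exp_add,
          show -2 * Real.pi * I * d * z = -(2 * Real.pi * I * d * z) by ring]
        field_simp at h2
        linear_combination h2
    have hq0 : q = 0 := by
      refine ih (fun x hx y hy => hs x (Finset.mem_insert_of_mem hx) y (Finset.mem_insert_of_mem hy))
        (by simp [hC]) ?_ hq hq' fun x hx => ?_
      · rw [Finset.card_insert_of_notMem ha] at hds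
        push_cast at hds
        omega
      · have h1 := h0 x (Finset.mem_insert_of_mem hx)
        rw [hgq] at h1
        refine (mul_eq_zero.1 h1).resolve_left fun h => ?_
        exact hs x (Finset.mem_insert_of_mem hx) a (Finset.mem_insert_self a s)
          (by rintro rfl; exact ha hx) (hz x h)
    funext z
    rw [hgq, hq0]
    simp

/-! ### Theta functions on the hyperplane -/

/-- The vector `e_i - e_j`. -/
def rootVec {n : ℕ} (i j : Fin (n + 1)) : Hyperplane n :=
  ⟨Pi.single i 1 - Pi.single j 1, by
    change ∑ k, (Pi.single i (1 : ℂ) - Pi.single j (1 : ℂ) : Fin (n + 1) → ℂ) k = 0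
    simp [Finset.sum_sub_distrib]⟩

theorem rootVec_apply {n : ℕ} (i j k : Fin (n + 1)) :
    (rootVec i j).1 k = (Pi.single i 1 : Fin (n + 1) → ℂ) k - (Pi.single j 1 : Fin (n + 1) → ℂ) k :=
  rfl

theorem rootVec_left {n : ℕ} {i j : Fin (n + 1)} (h : i ≠ j) : (rootVec i j).1 i = 1 := by
  simp [rootVec_apply, h]

theorem rootVec_right {n : ℕ} {i j : Fin (n + 1)} (h : i ≠ j) : (rootVec i j).1 j = -1 := by
  simp [rootVec_apply, h.symm]

theorem rootVec_of_ne {n : ℕ} {i j k : Fin (n + 1)} (h : k ≠ i) (h' : k ≠ j) :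
    (rootVec i j).1 k = 0 := by
  simp [rootVec_apply, h, h']

theorem Hyperplane.sum_eq_zero {n : ℕ} (v : Hyperplane n) : ∑ i, v.1 i = 0 := v.2

/-- Permutation of the coordinates. -/
def permute {n : ℕ} (σ : Equiv.Perm (Fin (n + 1))) (v : Hyperplane n) : Hyperplane n :=
  ⟨fun i => v.1 (σ i), (Equiv.sum_comp σ v.1).trans v.2⟩

/-- Symmetric theta functions of level `m` for the root lattice of type `A_n`. -/
structure IsThetaFun {n : ℕ} (τ : ℂ) (m : ℤ) (f : Hyperplane n → ℂ) : Prop where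
  diff : Differentiable ℂ f
  symm : ∀ (σ : Equiv.Perm (Fin (n + 1))) (v : Hyperplane n), f (permute σ v) = f v
  add_root : ∀ (i j : Fin (n + 1)), i ≠ j → ∀ v, f (v + rootVec i j) = f v
  add_tau : ∀ (i j : Fin (n + 1)), i ≠ j → ∀ v : Hyperplane n, f (v + τ • rootVec i j) =
    cexp (-2 * Real.pi * I * m * (v.1 i - v.1 j + τ)) * f v

namespace IsThetaFun

variable {n : ℕ} {τ : ℂ} {m m' : ℤ} {f g : Hyperplane n → ℂ}

theorem sub (hf : IsThetaFun τ m f) (hg : IsThetaFun τ m g) :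
    IsThetaFun τ m (fun v => f v - g v) where
  diff := hf.diff.sub hg.diff
  symm σ v := by rw [hf.symm, hg.symm]
  add_root i j h v := by rw [hf.add_root i j h, hg.add_root i j h]
  add_tau i j h v := by rw [hf.add_tau i j h, hg.add_tau i j h]; ring

theorem const_mul (c : ℂ) (hf : IsThetaFun τ m f) : IsThetaFun τ m (fun v => c * f v) where
  diff := hf.diff.const_mul c
  symm σ v := by rw [hf.symm]
  add_root i j h v := by rw [hf.add_root i j h]
  add_tau i j h v := by rw [hf.add_tau i j h]; ring

theorem zero : IsThetaFun τ m (fun _ : Hyperplane n => 0) where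
  diff := differentiable_const _
  symm _ _ := rfl
  add_root _ _ _ _ := rfl
  add_tau _ _ _ _ := by simp

theorem add (hf : IsThetaFun τ m f) (hg : IsThetaFun τ m g) :
    IsThetaFun τ m (fun v => f v + g v) where
  diff := hf.diff.add hg.diff
  symm σ v := by rw [hf.symm, hg.symm]
  add_root i j h v := by rw [hf.add_root i j h, hg.add_root i j h]
  add_tau i j h v := by rw [hf.add_tau i j h, hg.add_tau i j h]; ring

theorem sum {ι : Type*} (s : Finset ι) {F : ι → Hyperplane n → ℂ}
    (hF : ∀ i ∈ s, IsThetaFun τ m (F i)) : IsThetaFun τ m (fun v => ∑ i ∈ s, F i v) := by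
  classical
  induction s using Finset.induction_on with
  | empty => simpa using zero
  | insert a s ha ih =>
    simp only [Finset.sum_insert ha]
    exact (hF a (Finset.mem_insert_self a s)).add
      (ih fun i hi => hF i (Finset.mem_insert_of_mem hi))

theorem one : IsThetaFun τ 0 (fun _ : Hyperplane n => 1) where
  diff := differentiable_const _
  symm _ _ := rfl
  add_root _ _ _ _ := rfl
  add_tau _ _ _ _ := by simp

theorem mul (hf : IsThetaFun τ m f) (hg : IsThetaFun τ m' g) :
    IsThetaFun τ (m + m') (fun v => f v * g v) where
  diff := hf.diff.mul hg.diff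
  symm σ v := by rw [hf.symm, hg.symm]
  add_root i j h v := by rw [hf.add_root i j h, hg.add_root i j h]
  add_tau i j h v := by
    rw [hf.add_tau i j h, hg.add_tau i j h, show -2 * Real.pi * I * ((m + m' : ℤ) : ℂ) *
      (v.1 i - v.1 j + τ) = -2 * Real.pi * I * m * (v.1 i - v.1 j + τ) +
      -2 * Real.pi * I * m' * (v.1 i - v.1 j + τ) by push_cast; ring, Complex.exp_add]
    ring

theorem prod {ι : Type*} (s : Finset ι) {F : ι → Hyperplane n → ℂ}
    (hF : ∀ i ∈ s, IsThetaFun τ 1 (F i)) : IsThetaFun τ s.card (fun v => ∏ i ∈ s, F i v) := by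
  classical
  induction s using Finset.induction_on with
  | empty => simpa using one
  | insert a s ha ih =>
    simp only [Finset.prod_insert ha]
    have := (hF a (Finset.mem_insert_self a s)).mul
      (ih fun i hi => hF i (Finset.mem_insert_of_mem hi))
    rw [Finset.card_insert_of_notMem ha]
    push_cast
    rwa [add_comm (s.card : ℤ)]

/-- Restriction to the lines in the direction of a root. -/
theorem line (hf : IsThetaFun τ m f) {i j : Fin (n + 1)} (h : i ≠ j) (v : Hyperplane n) :
    IsQuasiperiodic τ (cexp (-2 * Real.pi * I * m * (v.1 i - v.1 j + τ))) (2 * m)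
      (fun t => f (v + t • rootVec i j)) where
  add_one t := by rw [add_smul, one_smul, ← add_assoc, hf.add_root i j h]
  add_tau t := by
    rw [add_smul, ← add_assoc, hf.add_tau i j h, ← Complex.exp_add]
    congr 2
    -- The difference of the two coordinates moves by `2t`, which is why the degree is `2m`.
    have h1 : (v + t • rootVec i j).1 i = v.1 i + t := by
      simp [rootVec_left h]
    have h2 : (v + t • rootVec i j).1 j = v.1 j - t := by
      simp [rootVec_right h, sub_eq_add_neg]
    rw [h1, h2]
    push_cast
    ring

end IsThetaFun

/-- The theta function `v ↦ ∏ θ(y - v_i)` of level one. -/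
def thetaAt {n : ℕ} (τ y : ℂ) (v : Hyperplane n) : ℂ := ∏ i, theta τ (y - v.1 i)

theorem differentiable_coord {n : ℕ} (i : Fin (n + 1)) :
    Differentiable ℂ fun v : Hyperplane n => v.1 i :=
  ((ContinuousLinearMap.proj (R := ℂ) (φ := fun _ : Fin (n + 1) => ℂ) i).comp
    (Hyperplane n).subtypeL).differentiable

/-- Translation by `τ (e_i - e_j)` shifts the argument of the `i`-th factor by `-τ` and that of the
`j`-th factor by `τ`. In the product of the two multipliers `y` cancels and the level is one. -/
theorem thetaAt_isThetaFun {n : ℕ} {τ : ℂ} (hτ : 0 < τ.im) (y : ℂ) :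
    IsThetaFun τ 1 (thetaAt (n := n) τ y) where
  diff := by
    unfold thetaAt
    have h : ∀ i, Differentiable ℂ fun v : Hyperplane n => theta τ (y - v.1 i) := fun i =>
      (differentiable_theta hτ).comp ((differentiable_const y).sub (differentiable_coord i))
    fun_prop
  symm σ v := Equiv.prod_comp σ fun i => theta τ (y - v.1 i)
  add_root i j h v := by
    refine Finset.prod_congr rfl fun k _ => ?_
    by_cases hi : k = i
    · subst hi
      rw [← theta_add_one]
      congr 1
      simp [rootVec_left h]
      ring
    · by_cases hj : k = j
      · subst hj
        rw [← theta_add_one τ (y - v.1 k)]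
        congr 1
        simp [rootVec_right h]
        ring
      · simp [rootVec_of_ne hi hj]
  add_tau i j h v := by
    classical
    unfold thetaAt
    rw [← Finset.mul_prod_erase _ _ (Finset.mem_univ i), ← Finset.mul_prod_erase _ _
      (Finset.mem_erase.2 ⟨h.symm, Finset.mem_univ j⟩),
      ← Finset.mul_prod_erase _ (fun k => theta τ (y - v.1 k)) (Finset.mem_univ i),
      ← Finset.mul_prod_erase _ (fun k => theta τ (y - v.1 k))
      (Finset.mem_erase.2 ⟨h.symm, Finset.mem_univ j⟩)]
    have e1 : y - (v + τ • rootVec i j).1 i = y - v.1 i - τ := by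
      simp [rootVec_left h]
      ring
    have e2 : y - (v + τ • rootVec i j).1 j = y - v.1 j + τ := by
      simp [rootVec_right h]
      ring
    have e3 : ∏ k ∈ (Finset.univ.erase i).erase j, theta τ (y - (v + τ • rootVec i j).1 k) =
        ∏ k ∈ (Finset.univ.erase i).erase j, theta τ (y - v.1 k) := by
      refine Finset.prod_congr rfl fun k hk => ?_
      simp only [Finset.mem_erase] at hk
      simp [rootVec_of_ne hk.2.1 hk.1]
    have e4 : cexp (-2 * Real.pi * I * ((1 : ℤ) : ℂ) * (v.1 i - v.1 j + τ)) =
        cexp (2 * Real.pi * I * (y - v.1 i)) * cexp (-2 * Real.pi * I * (y - v.1 j + τ)) := by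
      rw [← Complex.exp_add]
      congr 1
      push_cast
      ring
    rw [e1, e2, e3, theta_sub_tau, theta_add_tau, e4]
    ring

/-! ### Interpolation of theta functions on the hyperplane -/

/-- Interpolation nodes: distinct positive reals with all relevant sums less than `1`. -/
structure IsNodes (y : ℕ → ℝ) : Prop where
  pos : ∀ k, 0 < y k
  inj : Function.Injective y
  small : ∀ (k : ℕ) (s : Finset ℕ), y k + ∑ l ∈ s, y l < 1

theorem notMem_lattice_of_real {τ : ℂ} (hτ : 0 < τ.im) {x : ℝ} (h0 : 0 < x) (h1 : x < 1) :
    (x : ℂ) ∉ (periods τ hτ).lattice := by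
  intro h
  obtain ⟨a, b, hab⟩ := mem_periods.1 h
  have him := congrArg Complex.im hab
  have hre := congrArg Complex.re hab
  simp at him hre
  have hb : b = 0 := him.resolve_right hτ.ne'
  subst hb
  simp at hre
  rw [hre] at h0 h1
  have h2 : 0 < a := by exact_mod_cast h0
  have h3 : a < 1 := by exact_mod_cast h1
  omega

theorem IsNodes.sub_notMem {y : ℕ → ℝ} (hy : IsNodes y) {τ : ℂ} (hτ : 0 < τ.im) {k l : ℕ}
    (h : k ≠ l) : (y k : ℂ) - y l ∉ (periods τ hτ).lattice := by
  have hk := hy.small k ∅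
  have hl := hy.small l ∅
  have hk' := hy.pos k
  have hl' := hy.pos l
  simp only [Finset.sum_empty, add_zero] at hk hl
  rcases lt_or_gt_of_ne (hy.inj.ne h) with h1 | h1
  · have := notMem_lattice_of_real hτ (x := y l - y k) (by linarith) (by linarith)
    intro h2
    apply this
    rw [← neg_mem_iff]
    push_cast
    simpa using h2
  · have := notMem_lattice_of_real hτ (x := y k - y l) (by linarith) (by linarith)
    push_cast at this
    exact this

/-- This takes care of the last coordinate of an interpolation point, which is minus the sum of the
other ones. -/
theorem IsNodes.add_sum_notMem {y : ℕ → ℝ} (hy : IsNodes y) {τ : ℂ} (hτ : 0 < τ.im) (k : ℕ)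
    (s : Finset ℕ) : (y k : ℂ) + ∑ l ∈ s, (y l : ℂ) ∉ (periods τ hτ).lattice := by
  have := notMem_lattice_of_real hτ (x := y k + ∑ l ∈ s, y l)
    (add_pos_of_pos_of_nonneg (hy.pos k) (Finset.sum_nonneg fun l _ => (hy.pos l).le))
    (hy.small k s)
  push_cast at this
  exact this

theorem add_smul_rootVec_left {n : ℕ} {i j : Fin (n + 1)} (h : i ≠ j) (v : Hyperplane n) (t : ℂ) :
    (v + t • rootVec i j).1 i = v.1 i + t := by
  simp [rootVec_left h]

theorem add_smul_rootVec_right {n : ℕ} {i j : Fin (n + 1)} (h : i ≠ j) (v : Hyperplane n) (t : ℂ) :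
    (v + t • rootVec i j).1 j = v.1 j - t := by
  simp [rootVec_right h, sub_eq_add_neg]

theorem add_smul_rootVec_of_ne {n : ℕ} {i j k : Fin (n + 1)} (h : k ≠ i) (h' : k ≠ j)
    (v : Hyperplane n) (t : ℂ) : (v + t • rootVec i j).1 k = v.1 k := by
  simp [rootVec_of_ne h h']

theorem IsThetaFun.differentiable_line {n : ℕ} {τ : ℂ} {m : ℤ} {f : Hyperplane n → ℂ}
    (hf : IsThetaFun τ m f) (v w : Hyperplane n) : Differentiable ℂ fun t : ℂ => f (v + t • w) :=
  hf.diff.comp (by fun_prop)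

/-- The inductive step of the vanishing theorem, for a vector in general position. -/
theorem IsThetaFun.eq_zero_of_generic {n : ℕ} {τ : ℂ} (hτ : 0 < τ.im) {m : ℤ}
    {f : Hyperplane n → ℂ} (hf : IsThetaFun τ m f) {y : ℕ → ℝ} (hy : IsNodes y) (K : Finset ℕ)
    (hK : m < K.card) {i j : Fin (n + 1)} (hij : i ≠ j) (v : Hyperplane n)
    (hgen : ∀ k ∈ K, ∀ l ∈ K, (y k : ℂ) + y l - (v.1 i + v.1 j) ∉ (periods τ hτ).lattice)
    (h0 : ∀ k ∈ K, f (v + ((y k : ℂ) - v.1 i) • rootVec i j) = 0) : f v = 0 := by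
  classical
  -- The transposition of `i` and `j` maps the line to itself. Each zero at which coordinate `i` is
  -- a node gives a second zero at which coordinate `j` is that node, so there are `2 |K|` zeros
  -- against the degree `2m`. The hypothesis `hgen` says that zeros of different kinds are
  -- incongruent.
  have hsw : ∀ k ∈ K, f (v + (v.1 j - (y k : ℂ)) • rootVec i j) = 0 := by
    intro k hk
    rw [← h0 k hk, ← hf.symm (Equiv.swap i j)]
    congr 1
    ext l
    change (v + (v.1 j - (y k : ℂ)) • rootVec i j).1 (Equiv.swap i j l) =
      (v + ((y k : ℂ) - v.1 i) • rootVec i j).1 l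
    by_cases h1 : l = i
    · subst h1
      rw [Equiv.swap_apply_left, add_smul_rootVec_right hij, add_smul_rootVec_left hij]
      ring
    · by_cases h2 : l = j
      · subst h2
        rw [Equiv.swap_apply_right, add_smul_rootVec_right hij, add_smul_rootVec_left hij]
        ring
      · rw [Equiv.swap_apply_of_ne_of_ne h1 h2, add_smul_rootVec_of_ne h1 h2,
          add_smul_rootVec_of_ne h1 h2]
  set A : Finset ℂ := K.image fun k => (y k : ℂ) - v.1 i with hA
  set B : Finset ℂ := K.image fun k => v.1 j - (y k : ℂ) with hB
  have hyi : Function.Injective fun k => (y k : ℂ) := Complex.ofReal_injective.comp hy.inj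
  have hAc : A.card = K.card := Finset.card_image_of_injective _ fun a b h => by
    simpa using hyi.eq_iff.1 (sub_left_injective h)
  have hBc : B.card = K.card := Finset.card_image_of_injective _ fun a b h => by
    simpa using hyi.eq_iff.1 (sub_right_injective h)
  have hcross : ∀ a ∈ A, ∀ b ∈ B, a - b ∉ (periods τ hτ).lattice := by
    intro a ha b hb
    obtain ⟨k, hk, rfl⟩ := Finset.mem_image.1 ha
    obtain ⟨l, hl, rfl⟩ := Finset.mem_image.1 hb
    have := hgen k hk l hl
    rwa [show (y k : ℂ) - v.1 i - (v.1 j - y l) = (y k : ℂ) + y l - (v.1 i + v.1 j) by ring]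
  have hdisj : Disjoint A B := Finset.disjoint_left.2 fun a ha hb => by
    have := hcross a ha a hb
    rw [sub_self] at this
    exact this (zero_mem _)
  have hg := hf.line hij v
  have hz := hg.eq_zero hτ (A ∪ B) (by
    intro a ha b hb hab
    rcases Finset.mem_union.1 ha with ha | ha <;> rcases Finset.mem_union.1 hb with hb | hb
    · obtain ⟨k, hk, rfl⟩ := Finset.mem_image.1 ha
      obtain ⟨l, hl, rfl⟩ := Finset.mem_image.1 hb
      have hkl : k ≠ l := by rintro rfl; exact hab rfl
      have := hy.sub_notMem hτ hkl
      rwa [sub_sub_sub_cancel_right]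
    · exact hcross a ha b hb
    · rw [← neg_mem_iff, neg_sub]
      exact hcross b hb a ha
    · obtain ⟨k, hk, rfl⟩ := Finset.mem_image.1 ha
      obtain ⟨l, hl, rfl⟩ := Finset.mem_image.1 hb
      have hkl : l ≠ k := by rintro rfl; exact hab rfl
      have := hy.sub_notMem hτ hkl
      rwa [sub_sub_sub_cancel_left])
    (Complex.exp_ne_zero _) (by
      rw [Finset.card_union_of_disjoint hdisj, hAc, hBc]
      push_cast
      omega) (hf.differentiable_line v _) (by
      intro a ha
      rcases Finset.mem_union.1 ha with ha | ha
      · obtain ⟨k, hk, rfl⟩ := Finset.mem_image.1 ha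
        exact h0 k hk
      · obtain ⟨k, hk, rfl⟩ := Finset.mem_image.1 ha
        exact hsw k hk)
  have := congrFun hz 0
  simpa using this

theorem sum_castSucc_eq {n : ℕ} (v : Hyperplane n) :
    ∑ i : Fin n, v.1 i.castSucc = -v.1 (Fin.last n) := by
  have h := Hyperplane.sum_eq_zero v
  rw [Fin.sum_univ_castSucc] at h
  linear_combination h

/-- The descent from `r + 1` prescribed coordinates to `r`. On the line in the direction of `e_r -
e_n` the coordinate `r` can take any node not yet used, and the function vanishes at each of these
points by `ih`. -/
theorem IsThetaFun.eq_zero_aux {n : ℕ} {τ : ℂ} (hτ : 0 < τ.im) {m : ℤ}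
    {f : Hyperplane n → ℂ} (hf : IsThetaFun τ m f) {y : ℕ → ℝ} (hy : IsNodes y) {N : ℕ}
    (hN : m + n ≤ N) {r : ℕ} (hr : r < n)
    (ih : ∀ e : Fin n → ℕ, Set.InjOn e {i | (i : ℕ) < r + 1} → (∀ i : Fin n, (i : ℕ) < r + 1 → e i < N) →
      ∀ v : Hyperplane n, (∀ i : Fin n, (i : ℕ) < r + 1 → v.1 i.castSucc = y (e i)) → f v = 0)
    (e : Fin n → ℕ) (he : Set.InjOn e {i | (i : ℕ) < r}) (heN : ∀ i : Fin n, (i : ℕ) < r → e i < N)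
    (v : Hyperplane n) (hv : ∀ i : Fin n, (i : ℕ) < r → v.1 i.castSucc = y (e i)) : f v = 0 := by
  classical
  set i₀ : Fin n := ⟨r, hr⟩ with hi₀
  set R : Finset ℕ := (Finset.univ.filter fun i : Fin n => (i : ℕ) < r).image e with hR
  have hRc : R.card ≤ r := by
    refine Finset.card_image_le.trans ?_
    rw [Fin.card_filter_val_lt]
    exact min_le_right _ _
  set K : Finset ℕ := Finset.range N \ R with hKdef
  -- At most `r` nodes are in use, and `N - r ≥ m + n - r > m`.
  have hK : m < K.card := by
    have : (Finset.range N).card - R.card ≤ K.card := Finset.le_card_sdiff R (Finset.range N)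
    rw [Finset.card_range] at this
    omega
  have hne : i₀.castSucc ≠ Fin.last n := (Fin.castSucc_lt_last _).ne
  have main : ∀ w : Hyperplane n, (∀ i : Fin n, (i : ℕ) < r → w.1 i.castSucc = y (e i)) →
      (∀ k ∈ K, ∀ l ∈ K, (y k : ℂ) + y l - (w.1 i₀.castSucc + w.1 (Fin.last n)) ∉
        (periods τ hτ).lattice) → f w = 0 := by
    intro w hw hgen
    refine hf.eq_zero_of_generic hτ hy K hK hne w hgen fun k hk => ?_
    obtain ⟨hkN, hkR⟩ := Finset.mem_sdiff.1 hk
    have hupd : ∀ i : Fin n, (i : ℕ) < r → Function.update e i₀ k i = e i := fun i hi =>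
      Function.update_of_ne (by rintro rfl; simp [hi₀] at hi) _ _
    have hlt : ∀ i : Fin n, (i : ℕ) < r + 1 → (i : ℕ) < r ∨ i = i₀ := by
      intro i hi
      rcases Nat.lt_succ_iff_lt_or_eq.1 hi with h | h
      · exact Or.inl h
      · exact Or.inr (Fin.ext h)
    have hnot : ∀ i : Fin n, (i : ℕ) < r → e i ≠ k := by
      rintro i hi rfl
      exact hkR (Finset.mem_image.2 ⟨i, by simpa using hi, rfl⟩)
    refine ih (Function.update e i₀ k) ?_ ?_ _ ?_
    · intro a ha b hb hab
      rcases hlt a ha with ha | rfl <;> rcases hlt b hb with hb | rfl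
      · rw [hupd a ha, hupd b hb] at hab
        exact he ha hb hab
      · rw [hupd a ha, Function.update_self] at hab
        exact absurd hab (hnot a ha)
      · rw [hupd b hb, Function.update_self] at hab
        exact absurd hab.symm (hnot b hb)
      · rfl
    · intro i hi
      rcases hlt i hi with hi | rfl
      · rw [hupd i hi]; exact heN i hi
      · rw [Function.update_self]; exact Finset.mem_range.1 hkN
    · intro i hi
      rcases hlt i hi with hi | rfl
      · rw [hupd i hi, ← hw i hi]
        refine add_smul_rootVec_of_ne ?_ (Fin.castSucc_lt_last _).ne _ _
        intro h
        have := congrArg Fin.val h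
        simp [hi₀] at this
        omega
      · rw [Function.update_self, add_smul_rootVec_left hne]
        ring
  -- If a further coordinate is free, motion along `e_{r+1} - e_n` changes the last coordinate; all
  -- but countably many parameters give a vector in general position, and continuity covers the
  -- rest. Otherwise `v_r + v_n` is minus a sum of nodes, and general position follows from the
  -- conditions on the nodes.
  by_cases hlast : r + 1 < n
  · set i₁ : Fin n := ⟨r + 1, hlast⟩ with hi₁
    have hne1 : i₁.castSucc ≠ Fin.last n := (Fin.castSucc_lt_last _).ne
    have hne2 : i₀.castSucc ≠ i₁.castSucc := by
      intro h
      have := congrArg Fin.val h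
      simp [hi₀, hi₁] at this
    have hfun := eq_of_eq_off_countable (hf.differentiable_line v (rootVec i₁.castSucc (Fin.last n))).continuous
      (g := fun _ => 0) continuous_const
      (s := ⋃ k : ℕ, ⋃ l : ℕ, (fun t : ℂ => t + ((y k : ℂ) + y l - (v.1 i₀.castSucc + v.1 (Fin.last n)))) ⁻¹'
        ((periods τ hτ).lattice : Set ℂ))
      (Set.countable_iUnion fun k => Set.countable_iUnion fun l =>
        (countable_lattice hτ).preimage (add_left_injective _)) (fun t ht => by
        refine main _ (fun i hi => ?_) fun k hk l hl hmem => ht ?_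
        · rw [← hv i hi]
          refine add_smul_rootVec_of_ne ?_ (Fin.castSucc_lt_last _).ne _ _
          intro h
          have := congrArg Fin.val h
          simp [hi₁] at this
          omega
        · refine Set.mem_iUnion.2 ⟨k, Set.mem_iUnion.2 ⟨l, ?_⟩⟩
          rw [add_smul_rootVec_of_ne hne2 hne, add_smul_rootVec_right hne1] at hmem
          have e : t + ((y k : ℂ) + y l - (v.1 i₀.castSucc + v.1 (Fin.last n))) =
              y k + y l - (v.1 i₀.castSucc + (v.1 (Fin.last n) - t)) := by ring
          change t + ((y k : ℂ) + y l - (v.1 i₀.castSucc + v.1 (Fin.last n))) ∈ (periods τ hτ).lattice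
          rw [e]
          exact hmem)
    have := congrFun hfun 0
    simpa using this
  · have hrn : r + 1 = n := by omega
    refine main v hv fun k hk l hl hmem => ?_
    have hkR := (Finset.mem_sdiff.1 hk).2
    have hlR := (Finset.mem_sdiff.1 hl).2
    refine hy.add_sum_notMem hτ k (insert l R) ?_
    rw [Finset.sum_insert hlR]
    convert hmem using 1
    have h1 := sum_castSucc_eq v
    rw [← Finset.add_sum_erase _ _ (Finset.mem_univ i₀)] at h1
    have h2 : ∑ x ∈ R, (y x : ℂ) = ∑ i ∈ Finset.univ.erase i₀, v.1 i.castSucc := by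
      have hfil : (Finset.univ.filter fun i : Fin n => (i : ℕ) < r) = Finset.univ.erase i₀ := by
        ext i
        simp only [Finset.mem_filter, Finset.mem_univ, true_and, Finset.mem_erase, and_true]
        constructor
        · rintro h rfl
          simp [hi₀] at h
        · intro h
          have h3 : (i : ℕ) ≠ r := fun h4 => h (Fin.ext h4)
          omega
      rw [hR, Finset.sum_image (fun a ha b hb => he (by simpa using ha) (by simpa using hb)), hfil]
      refine Finset.sum_congr rfl fun i hi => ?_
      rw [← hfil] at hi
      exact (hv i (by simpa using hi)).symm
    rw [h2]
    linear_combination h1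

/-- A symmetric theta function of level `m` that vanishes at all vectors whose first `n` coordinates
are distinct nodes among the first `N ≥ m + n` nodes is zero. -/
theorem IsThetaFun.eq_zero {n : ℕ} {τ : ℂ} (hτ : 0 < τ.im) {m : ℤ}
    {f : Hyperplane n → ℂ} (hf : IsThetaFun τ m f) {y : ℕ → ℝ} (hy : IsNodes y) {N : ℕ}
    (hN : m + n ≤ N) (h : ∀ e : Fin n → ℕ, Function.Injective e → (∀ i, e i < N) →
      ∀ v : Hyperplane n, (∀ i : Fin n, v.1 i.castSucc = y (e i)) → f v = 0) (v : Hyperplane n) :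
    f v = 0 := by
  have key : ∀ j r : ℕ, r + j = n → ∀ e : Fin n → ℕ, Set.InjOn e {i | (i : ℕ) < r} →
      (∀ i : Fin n, (i : ℕ) < r → e i < N) →
      ∀ v : Hyperplane n, (∀ i : Fin n, (i : ℕ) < r → v.1 i.castSucc = y (e i)) → f v = 0 := by
    intro j
    induction j with
    | zero =>
      rintro r rfl e he heN v hv
      exact h e (fun a b hab => he a.2 b.2 hab) (fun i => heN i i.2) v fun i => hv i i.2
    | succ j ih =>
      exact fun r hr e he heN v hv =>
        hf.eq_zero_aux hτ hy hN (by omega) (ih (r + 1) (by omega)) e he heN v hv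
  exact key n 0 (Nat.zero_add n) (fun _ => 0) (fun a ha => absurd ha (Nat.not_lt_zero _))
    (fun i hi => absurd hi (Nat.not_lt_zero _)) v fun i hi => absurd hi (Nat.not_lt_zero _)

/-- For negative level `n - 1` nodes are enough. There are no `n` distinct ones among them, so the
vanishing condition is void. -/
theorem IsThetaFun.eq_zero_of_neg {n : ℕ} (hn : 1 ≤ n) {τ : ℂ} (hτ : 0 < τ.im) {m : ℤ} (hm : m < 0)
    {f : Hyperplane n → ℂ} (hf : IsThetaFun τ m f) {y : ℕ → ℝ} (hy : IsNodes y)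
    (v : Hyperplane n) : f v = 0 := by
  refine hf.eq_zero hτ hy (N := n - 1) (by omega) (fun e he heN => ?_) v
  have := Fintype.card_le_of_injective (fun i : Fin n => (⟨e i, heN i⟩ : Fin (n - 1)))
    (fun a b hab => he (by simpa using hab))
  simp at this
  omega

/-! ### The Lagrange basis -/

/-- The vector whose first `n` coordinates are given. -/
def nodeVec {n : ℕ} (x : Fin n → ℂ) : Hyperplane n :=
  ⟨Fin.snoc (α := fun _ => ℂ) x (-∑ i, x i), by
    change ∑ i, (Fin.snoc (α := fun _ => ℂ) x (-∑ i, x i) : Fin (n + 1) → ℂ) i = 0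
    rw [Fin.sum_univ_castSucc]
    simp⟩

theorem nodeVec_castSucc {n : ℕ} (x : Fin n → ℂ) (i : Fin n) : (nodeVec x).1 i.castSucc = x i := by
  simp [nodeVec]

theorem nodeVec_last {n : ℕ} (x : Fin n → ℂ) : (nodeVec x).1 (Fin.last n) = -∑ i, x i := by
  simp [nodeVec]

theorem eq_nodeVec {n : ℕ} (v : Hyperplane n) : v = nodeVec fun i => v.1 i.castSucc := by
  ext i
  refine Fin.lastCases ?_ (fun i => ?_) i
  · rw [nodeVec_last, sum_castSucc_eq, neg_neg]
  · rw [nodeVec_castSucc]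

theorem exists_permute_nodeVec {n : ℕ} (x : Fin n → ℂ) (π : Equiv.Perm (Fin n)) :
    ∃ σ : Equiv.Perm (Fin (n + 1)), nodeVec (fun i => x (π i)) = permute σ (nodeVec x) := by
  refine ⟨finSuccEquivLast.symm.permCongr (Equiv.optionCongr π), ?_⟩
  ext i
  refine Fin.lastCases ?_ (fun i => ?_) i
  · rw [nodeVec_last, Equiv.sum_comp π x, ← nodeVec_last]
    simp [permute]
  · rw [nodeVec_castSucc]
    simp [permute, nodeVec_castSucc]

/-- The index set of the Lagrange basis. -/
abbrev NodeSet (n N : ℕ) : Type := {S : Finset ℕ // S ∈ Finset.powersetCard n (Finset.range N)}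

theorem NodeSet.card {n N : ℕ} (S : NodeSet n N) : S.1.card = n := (Finset.mem_powersetCard.1 S.2).2

theorem NodeSet.subset {n N : ℕ} (S : NodeSet n N) : S.1 ⊆ Finset.range N :=
  (Finset.mem_powersetCard.1 S.2).1

/-- The interpolation points. -/
def nodePoint {n N : ℕ} (y : ℕ → ℝ) (S : NodeSet n N) : Hyperplane n :=
  nodeVec fun i => (y (S.1.orderEmbOfFin S.card i) : ℂ)

/-- The Lagrange basis, up to scalars. -/
def nodeBasis {n N : ℕ} (τ : ℂ) (y : ℕ → ℝ) (S : NodeSet n N) (v : Hyperplane n) : ℂ :=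
  ∏ k ∈ Finset.range N \ S.1, thetaAt τ (y k) v

theorem nodeBasis_isThetaFun {n m : ℕ} {τ : ℂ} (hτ : 0 < τ.im) (y : ℕ → ℝ) (S : NodeSet n (m + n)) :
    IsThetaFun τ m (nodeBasis τ y S) := by
  have h := IsThetaFun.prod (Finset.range (m + n) \ S.1)
    (F := fun k => thetaAt (n := n) τ (y k)) fun k _ => thetaAt_isThetaFun hτ (y k)
  rw [Finset.card_sdiff_of_subset S.subset, S.card, Finset.card_range, Nat.add_sub_cancel] at h
  exact h

/-- Sets of equal size that differ are not contained in each other, so some node of `T` lies outside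
`S`; its factor vanishes because it is a coordinate of the point. -/
theorem nodeBasis_nodePoint_of_ne {n N : ℕ} (τ : ℂ) (y : ℕ → ℝ) {S T : NodeSet n N} (h : T ≠ S) :
    nodeBasis τ y S (nodePoint y T) = 0 := by
  obtain ⟨k, hkT, hkS⟩ : ∃ k ∈ T.1, k ∉ S.1 := by
    by_contra! hsub
    exact h (Subtype.ext (Finset.eq_of_subset_of_card_le hsub (by rw [S.card, T.card])))
  refine Finset.prod_eq_zero (Finset.mem_sdiff.2 ⟨T.subset hkT, hkS⟩) ?_
  have : k ∈ Set.range (T.1.orderEmbOfFin T.card) := by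
    rw [Finset.range_orderEmbOfFin]; exact hkT
  obtain ⟨i, rfl⟩ := this
  refine Finset.prod_eq_zero (Finset.mem_univ i.castSucc) ?_
  rw [nodePoint, nodeVec_castSucc, sub_self, theta_zero]

theorem sum_orderEmbOfFin {n N : ℕ} (S : NodeSet n N) (x : ℕ → ℂ) :
    ∑ i, x (S.1.orderEmbOfFin S.card i) = ∑ k ∈ S.1, x k := by
  refine (Finset.sum_map Finset.univ (S.1.orderEmbOfFin S.card).toEmbedding x).symm.trans ?_
  congr 1
  ext k
  simp

/-- The coordinates of the point are the nodes in `S` and minus their sum. A node outside `S` is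
congruent to none of them. -/
theorem nodeBasis_nodePoint_self {n N : ℕ} {τ : ℂ} (hτ : 0 < τ.im) {y : ℕ → ℝ} (hy : IsNodes y)
    (S : NodeSet n N) : nodeBasis τ y S (nodePoint y S) ≠ 0 := by
  refine Finset.prod_ne_zero_iff.2 fun k hk => Finset.prod_ne_zero_iff.2 fun i _ => ?_
  rw [ne_eq, theta_eq_zero_iff hτ]
  refine Fin.lastCases ?_ (fun i => ?_) i
  · rw [nodePoint, nodeVec_last, sum_orderEmbOfFin S fun k => (y k : ℂ), sub_neg_eq_add]
    exact hy.add_sum_notMem hτ k S.1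
  · rw [nodePoint, nodeVec_castSucc]
    refine hy.sub_notMem hτ ?_
    rintro rfl
    exact (Finset.mem_sdiff.1 hk).2 (Finset.orderEmbOfFin_mem S.1 S.card i)

/-- Lagrange interpolation: both sides agree at the interpolation points, and every vector with `n`
distinct nodes as first coordinates is a permutation of the interpolation point of its set of nodes.
-/
theorem IsThetaFun.eq_sum_nodeBasis {n m : ℕ} {τ : ℂ} (hτ : 0 < τ.im) {f : Hyperplane n → ℂ}
    (hf : IsThetaFun τ m f) {y : ℕ → ℝ} (hy : IsNodes y) (v : Hyperplane n) :
    f v = ∑ S : NodeSet n (m + n), f (nodePoint y S) / nodeBasis τ y S (nodePoint y S) *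
      nodeBasis τ y S v := by
  classical
  have h1 := hf.sub (IsThetaFun.sum Finset.univ fun (S : NodeSet n (m + n)) _ =>
    (nodeBasis_isThetaFun hτ y S).const_mul
      (f (nodePoint y S) / nodeBasis τ y S (nodePoint y S)))
  refine sub_eq_zero.1 (h1.eq_zero hτ hy (N := m + n) (by push_cast; rfl) (fun e he heN w hw => ?_) v)
  have hS : Finset.univ.image e ∈ Finset.powersetCard n (Finset.range (m + n)) := by
    refine Finset.mem_powersetCard.2 ⟨fun k hk => ?_, ?_⟩
    · obtain ⟨i, -, rfl⟩ := Finset.mem_image.1 hk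
      exact Finset.mem_range.2 (heN i)
    · rw [Finset.card_image_of_injective _ he, Finset.card_univ, Fintype.card_fin]
  set S : NodeSet n (m + n) := ⟨_, hS⟩ with hSdef
  have hmem : ∀ i, ∃ j, S.1.orderEmbOfFin S.card j = e i := by
    intro i
    have : e i ∈ Set.range (S.1.orderEmbOfFin S.card) := by
      rw [Finset.range_orderEmbOfFin]
      exact Finset.mem_image_of_mem e (Finset.mem_univ i)
    exact this
  choose π hπ using hmem
  have hπi : Function.Injective π := fun a b hab => he (by rw [← hπ a, ← hπ b, hab])
  obtain ⟨σ, hσ⟩ := exists_permute_nodeVec (fun i => (y (S.1.orderEmbOfFin S.card i) : ℂ))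
    (Equiv.ofBijective π (Finite.injective_iff_bijective.1 hπi))
  have hwS : w = permute σ (nodePoint y S) := by
    rw [eq_nodeVec w, nodePoint, ← hσ]
    congr 1
    funext i
    rw [hw, Equiv.ofBijective_apply, hπ]
  rw [hwS, h1.symm, Finset.sum_eq_single S]
  · rw [div_mul_cancel₀ _ (nodeBasis_nodePoint_self hτ hy S), sub_self]
  · intro T _ hT
    rw [nodeBasis_nodePoint_of_ne τ y hT.symm, mul_zero]
  · simp

/-- A convenient family of nodes. -/
theorem isNodes_geometric {t : ℝ} (h0 : 0 < t) (h1 : t < 1) :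
    IsNodes fun k => t * (1 / 2) ^ (k + 2) where
  pos k := by positivity
  inj a b h := by
    have h2 : ((1 / 2 : ℝ)) ^ (a + 2) = (1 / 2) ^ (b + 2) := mul_left_cancel₀ h0.ne' h
    have := pow_right_injective₀ (a := (1 / 2 : ℝ)) (by norm_num) (by norm_num) h2
    omega
  small k s := by
    have hs : ∑ l ∈ s, ((1 / 2 : ℝ)) ^ l ≤ 2 := by
      have := (summable_geometric_two).sum_le_tsum s (fun i _ => by positivity)
      rwa [tsum_geometric_two] at this
    have hk : ((1 / 2 : ℝ)) ^ k ≤ 1 := pow_le_one₀ (by norm_num) (by norm_num)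
    have e : ∑ l ∈ s, t * ((1 / 2 : ℝ)) ^ (l + 2) = t / 4 * ∑ l ∈ s, ((1 / 2 : ℝ)) ^ l := by
      rw [Finset.mul_sum]
      exact Finset.sum_congr rfl fun l _ => by ring
    rw [e, pow_add]
    nlinarith

/-- Each node of the geometric family excludes only countably many values of the scaling parameter
in `(0, 1)`. -/
theorem exists_nodes (s : Set ℂ) (hs : s.Countable) : ∃ y : ℕ → ℝ, IsNodes y ∧ ∀ k, (y k : ℂ) ∉ s := by
  have hc : (⋃ k : ℕ, (fun t : ℝ => ((t * (1 / 2) ^ (k + 2) : ℝ) : ℂ)) ⁻¹' s).Countable := by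
    refine Set.countable_iUnion fun k => hs.preimage fun a b h => ?_
    exact mul_right_cancel₀ (by positivity) (Complex.ofReal_injective h)
  obtain ⟨t, ht, ht'⟩ := (hc.dense_compl ℝ).exists_mem_open isOpen_Ioo (Set.nonempty_Ioo.2 one_pos)
  refine ⟨_, isNodes_geometric ht'.1 ht'.2, fun k hk => ht ?_⟩
  exact Set.mem_iUnion.2 ⟨k, hk⟩

/-! ### The Weierstrass zeta function of a lattice -/

/-- The summand of the zeta function. -/
def zetaTerm (z l : ℂ) : ℂ := 1 / (z - l) + 1 / l + z / l ^ 2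

theorem zetaTerm_zero (z : ℂ) : zetaTerm z 0 = 1 / z := by simp [zetaTerm]

theorem zetaTerm_eq {z l : ℂ} (hl : l ≠ 0) (h : z - l ≠ 0) :
    zetaTerm z l = z ^ 2 / (l ^ 2 * (z - l)) := by
  rw [zetaTerm]
  field_simp
  ring

/-- After cancellation the summand is `z² / (l² (z - l))`, and `|l|` is bounded by a multiple of `|z
- l|`: for `|l| ≥ 2r` by the triangle inequality, otherwise by the lower bound `δ`. -/
theorem norm_zetaTerm_le {z l : ℂ} {r δ : ℝ} (hz : ‖z‖ ≤ r) (hl : l ≠ 0) (hδ : 0 < δ)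
    (h : δ ≤ ‖z - l‖) : ‖zetaTerm z l‖ ≤ r ^ 2 * (2 + 2 * r / δ) * ‖l‖ ^ (-3 : ℝ) := by
  have hr : 0 ≤ r := (norm_nonneg z).trans hz
  have hl' : 0 < ‖l‖ := norm_pos_iff.2 hl
  have hzl : 0 < ‖z - l‖ := hδ.trans_le h
  have hK : ‖l‖ ≤ (2 + 2 * r / δ) * ‖z - l‖ := by
    rcases le_total (2 * r) ‖l‖ with h1 | h1
    · have h2 : ‖l‖ ≤ ‖z‖ + ‖z - l‖ := by
        have := norm_sub_le z (z - l)
        rwa [sub_sub_cancel] at this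
      have h3 : 0 ≤ 2 * r / δ * ‖z - l‖ := by positivity
      linarith
    · have h2 : 2 * r / δ * δ ≤ 2 * r / δ * ‖z - l‖ := by gcongr
      rw [div_mul_cancel₀ _ hδ.ne'] at h2
      linarith
  rw [zetaTerm_eq hl (norm_pos_iff.1 hzl), norm_div, norm_pow, norm_mul, norm_pow,
    show (-3 : ℝ) = ((-3 : ℤ) : ℝ) by norm_num, Real.rpow_intCast,
    div_le_iff₀ (by positivity)]
  have e : r ^ 2 * (2 + 2 * r / δ) * ‖l‖ ^ (-3 : ℤ) * (‖l‖ ^ 2 * ‖z - l‖) =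
      r ^ 2 * (((2 + 2 * r / δ) * ‖z - l‖) / ‖l‖) := by
    rw [zpow_neg, show (3 : ℤ) = ((3 : ℕ) : ℤ) by norm_num, zpow_natCast]
    field_simp
  rw [e]
  have h1 : 1 ≤ ((2 + 2 * r / δ) * ‖z - l‖) / ‖l‖ := by rwa [one_le_div hl']
  calc ‖z‖ ^ 2 ≤ r ^ 2 := by gcongr
    _ = r ^ 2 * 1 := (mul_one _).symm
    _ ≤ _ := by gcongr

theorem norm_zetaTerm_le_of_two_mul_le {z l : ℂ} {r : ℝ} (hr : 0 < r) (hz : ‖z‖ ≤ r)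
    (hl : 2 * r ≤ ‖l‖) : ‖zetaTerm z l‖ ≤ 4 * r ^ 2 * ‖l‖ ^ (-3 : ℝ) := by
  have hl0 : l ≠ 0 := norm_pos_iff.1 (by linarith)
  refine (norm_zetaTerm_le hz hl0 hr ?_).trans (le_of_eq ?_)
  · rw [norm_sub_rev]
    have := norm_sub_norm_le l z
    linarith
  · field_simp
    ring

theorem differentiableAt_zetaTerm {z l : ℂ} (h : z ≠ l) :
    DifferentiableAt ℂ (fun z => zetaTerm z l) z := by
  have : z - l ≠ 0 := sub_ne_zero.2 h
  unfold zetaTerm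
  fun_prop (disch := assumption)

theorem deriv_zetaTerm {z l : ℂ} (h : z ≠ l) :
    deriv (fun z => zetaTerm z l) z = -(1 / (z - l) ^ 2 - 1 / l ^ 2) := by
  have h0 : z - l ≠ 0 := sub_ne_zero.2 h
  have h1 : HasDerivAt (fun z : ℂ => 1 / (z - l)) (-1 / (z - l) ^ 2) z := by
    simpa using ((hasDerivAt_id z).sub_const l).fun_inv h0
  have h2 : HasDerivAt (fun z : ℂ => z / l ^ 2) (1 / l ^ 2) z := (hasDerivAt_id z).div_const _
  have h3 := ((h1.add_const (1 / l)).add h2).deriv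
  refine Eq.trans ?_ (h3.trans ?_)
  · rfl
  · ring

variable (L : PeriodPair)

open Classical in
/-- The zeta function without its pole at `0`. -/
def zetaRest (z : ℂ) : ℂ := ∑' l : L.lattice, if (l : ℂ) = 0 then 0 else zetaTerm z l

theorem hasSumLocallyUniformly_zetaRest [DecidableEq ℂ] :
    HasSumLocallyUniformly
      (fun (l : L.lattice) (z : ℂ) => if (l : ℂ) = 0 then 0 else zetaTerm z l) (zetaRest L) := by
  have e : zetaRest L = fun z => ∑' l : L.lattice, if (l : ℂ) = 0 then 0 else zetaTerm z l := by
    funext z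
    rw [zetaRest]
    congr! 3
  rw [e]
  refine L.hasSumLocallyUniformly_aux _ (u := fun r l => 4 * r ^ 2 * ‖l‖ ^ (-3 : ℝ))
    (fun _ _ => (ZLattice.summable_norm_rpow _ _ (by simp; norm_num)).mul_left _) fun r hr =>
    Filter.eventually_atTop.mpr ⟨2 * r, ?_⟩
  rintro _ h s hs l rfl
  split_ifs
  · rw [norm_zero]; positivity
  · exact norm_zetaTerm_le_of_two_mul_le hr hs.le h

theorem summable_zetaRest [DecidableEq ℂ] (z : ℂ) :
    Summable (fun l : L.lattice => if (l : ℂ) = 0 then 0 else zetaTerm z l) :=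
  (hasSumLocallyUniformly_zetaRest L).hasSum.summable

theorem ne_of_mem_compl {z : ℂ} (hz : z ∈ ((L.lattice : Set ℂ) \ {0})ᶜ) {l : L.lattice}
    (hl : (l : ℂ) ≠ 0) : z ≠ l := by
  rintro rfl
  exact hz ⟨l.2, hl⟩

theorem differentiableOn_zetaRest :
    DifferentiableOn ℂ (zetaRest L) ((L.lattice : Set ℂ) \ {0})ᶜ := by
  classical
  refine (hasSumLocallyUniformly_zetaRest L).hasSumLocallyUniformlyOn.differentiableOn
    (.of_forall fun s => .fun_sum fun i hi => ?_) L.isOpen_compl_lattice_sdiff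
  split_ifs with h
  · exact differentiableOn_const _
  · exact fun z hz => (differentiableAt_zetaTerm (ne_of_mem_compl L hz h)).differentiableWithinAt

theorem deriv_zetaRest {z : ℂ} (hz : z ∈ ((L.lattice : Set ℂ) \ {0})ᶜ) :
    deriv (zetaRest L) z = -L.weierstrassPExcept 0 z := by
  classical
  have h1 := (hasSumLocallyUniformly_zetaRest L).tendstoLocallyUniformlyOn
    (s := ((L.lattice : Set ℂ) \ {0})ᶜ)
  have h2 := h1.deriv (.of_forall fun s => .fun_sum fun i hi => ?_) L.isOpen_compl_lattice_sdiff
  · have h3 := h2.tendsto_at hz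
    have h4 := (L.hasSum_weierstrassPExcept 0 z).neg
    refine tendsto_nhds_unique h3 (Filter.Tendsto.congr (fun s => ?_) h4)
    simp only [Function.comp_apply]
    rw [deriv_fun_sum]
    · refine Finset.sum_congr rfl fun l _ => ?_
      split_ifs with hl
      · simp
      · exact (deriv_zetaTerm (ne_of_mem_compl L hz hl)).symm
    · intro l _
      split_ifs with hl
      · exact differentiableAt_const _
      · exact differentiableAt_zetaTerm (ne_of_mem_compl L hz hl)
  · split_ifs with h
    · exact differentiableOn_const _
    · exact fun z hz => (differentiableAt_zetaTerm (ne_of_mem_compl L hz h)).differentiableWithinAt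

theorem weierstrassZeta_eq (z : ℂ) : weierstrassZeta L z = 1 / z + zetaRest L z := by
  classical
  have h1 := summable_zetaRest L z
  have h2 : HasSum (fun l : L.lattice => if l = 0 then 1 / z else 0) (1 / z) := hasSum_ite_eq 0 _
  have h3 := (h2.add h1.hasSum).tsum_eq
  rw [weierstrassZeta]
  refine Eq.trans (tsum_congr fun l => ?_) (h3.trans ?_)
  · by_cases hl : l = 0
    · subst hl; simp
    · have : (l : ℂ) ≠ 0 := by simpa using hl
      simp [hl, zetaTerm]
  · rw [zetaRest]

theorem mem_compl_of_notMem {z : ℂ} (hz : z ∉ L.lattice) : z ∈ ((L.lattice : Set ℂ) \ {0})ᶜ :=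
  fun h => hz h.1

theorem ne_zero_of_notMem {z : ℂ} (hz : z ∉ L.lattice) : z ≠ 0 := by
  rintro rfl
  exact hz (zero_mem _)

theorem differentiableAt_zetaRest {z : ℂ} (hz : z ∈ ((L.lattice : Set ℂ) \ {0})ᶜ) :
    DifferentiableAt ℂ (zetaRest L) z :=
  (differentiableOn_zetaRest L).differentiableAt (L.isOpen_compl_lattice_sdiff.mem_nhds hz)

theorem analyticAt_zetaRest_zero : AnalyticAt ℂ (zetaRest L) 0 :=
  (differentiableOn_zetaRest L).analyticAt (L.isOpen_compl_lattice_sdiff.mem_nhds (by simp))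

theorem differentiableAt_weierstrassZeta {z : ℂ} (hz : z ∉ L.lattice) :
    DifferentiableAt ℂ (weierstrassZeta L) z := by
  have h0 := ne_zero_of_notMem L hz
  have h1 : DifferentiableAt ℂ (fun z : ℂ => 1 / z) z := by fun_prop (disch := assumption)
  rw [funext (weierstrassZeta_eq L)]
  exact h1.add (differentiableAt_zetaRest L (mem_compl_of_notMem L hz))

theorem deriv_weierstrassZeta {z : ℂ} (hz : z ∉ L.lattice) :
    deriv (weierstrassZeta L) z = -L.weierstrassP z := by
  have h0 := ne_zero_of_notMem L hz
  have h1 : HasDerivAt (fun z : ℂ => 1 / z) (-(z ^ 2)⁻¹) z := by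
    simpa using hasDerivAt_inv h0
  have hm := mem_compl_of_notMem L hz
  have h2 := h1.add (differentiableAt_zetaRest L hm).hasDerivAt
  rw [funext (weierstrassZeta_eq L)]
  refine h2.deriv.trans ?_
  have h3 := L.weierstrassPExcept_add 0 z
  rw [deriv_zetaRest L hm, ← h3]
  simp

theorem isOpen_compl_lattice : IsOpen ((L.lattice : Set ℂ)ᶜ) := L.isClosed_lattice.isOpen_compl

theorem iteratedDeriv_weierstrassP_eq (j : ℕ) {z : ℂ} (hz : z ∉ L.lattice) :
    iteratedDeriv j L.weierstrassP z = -iteratedDeriv (j + 1) (weierstrassZeta L) z := by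
  rw [iteratedDeriv_succ', ← iteratedDeriv_fun_neg]
  refine Filter.EventuallyEq.iteratedDeriv_eq j ?_
  filter_upwards [(isOpen_compl_lattice L).mem_nhds hz] with x hx
  rw [deriv_weierstrassZeta L hx, neg_neg]

theorem countable_coe_lattice : (L.lattice : Set ℂ).Countable := by
  have : (L.lattice : Set ℂ) ⊆ Set.range fun x : ℤ × ℤ => (x.1 : ℂ) * L.ω₁ + x.2 * L.ω₂ := by
    intro x hx
    obtain ⟨a, b, h⟩ := PeriodPair.mem_lattice.1 hx
    exact ⟨(a, b), h⟩
  exact (Set.countable_range _).mono this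

/-- Quasi-periodicity of the zeta function. -/
theorem exists_weierstrassZeta_add {l : ℂ} (hl : l ∈ L.lattice) :
    ∃ η : ℂ, ∀ z ∉ L.lattice, weierstrassZeta L (z + l) = weierstrassZeta L z + η := by
  -- The plane without a countable set is connected, so a function on it with vanishing derivative
  -- is constant.
  have hc : IsPreconnected ((L.lattice : Set ℂ)ᶜ) :=
    ((countable_coe_lattice L).isPathConnected_compl_of_one_lt_rank
      (by rw [Complex.rank_real_complex]; norm_num)).isConnected.isPreconnected
  have hmem : ∀ z ∉ L.lattice, z + l ∉ L.lattice := fun z hz h => hz (by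
    simpa using sub_mem h hl)
  have hd : ∀ z ∉ L.lattice, HasDerivAt (fun z => weierstrassZeta L (z + l) - weierstrassZeta L z)
      (-L.weierstrassP (z + l) - -L.weierstrassP z) z := by
    intro z hz
    have h1 := (differentiableAt_weierstrassZeta L (hmem z hz)).hasDerivAt
    rw [deriv_weierstrassZeta L (hmem z hz)] at h1
    have h2 := (differentiableAt_weierstrassZeta L hz).hasDerivAt
    rw [deriv_weierstrassZeta L hz] at h2
    exact (h1.comp_add_const z l).sub h2
  obtain ⟨η, hη⟩ := (isOpen_compl_lattice L).exists_is_const_of_deriv_eq_zero hc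
    (fun z hz => (hd z hz).differentiableAt.differentiableWithinAt) (fun z hz => by
      rw [(hd z hz).deriv, L.weierstrassP_add_coe z ⟨l, hl⟩]
      simp)
  exact ⟨η, fun z hz => by rw [← hη z hz]; ring⟩

/-! ### Homogeneity -/

variable {L} {L' : PeriodPair} {c : ℂ}

/-- Scaling as a bijection of lattices. -/
def scaleEquiv (hc : c ≠ 0) (h : ∀ x, x ∈ L.lattice ↔ c * x ∈ L'.lattice) :
    L.lattice ≃ L'.lattice :=
  (Equiv.mulLeft₀ c hc).subtypeEquiv h

theorem weierstrassZeta_scale (hc : c ≠ 0) (h : ∀ x, x ∈ L.lattice ↔ c * x ∈ L'.lattice) (z : ℂ) :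
    weierstrassZeta L' (c * z) = c⁻¹ * weierstrassZeta L z := by
  rw [weierstrassZeta, weierstrassZeta, ← (scaleEquiv hc h).tsum_eq, ← tsum_mul_left]
  refine tsum_congr fun l => ?_
  have e : ((scaleEquiv hc h l : L'.lattice) : ℂ) = c * l := rfl
  rw [e, ← mul_sub]
  field_simp

theorem weierstrassP_scale (hc : c ≠ 0) (h : ∀ x, x ∈ L.lattice ↔ c * x ∈ L'.lattice) (z : ℂ) :
    L'.weierstrassP (c * z) = c⁻¹ ^ 2 * L.weierstrassP z := by
  rw [PeriodPair.weierstrassP, PeriodPair.weierstrassP, ← (scaleEquiv hc h).tsum_eq,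
    ← tsum_mul_left]
  refine tsum_congr fun l => ?_
  have e : ((scaleEquiv hc h l : L'.lattice) : ℂ) = c * l := rfl
  rw [e, ← mul_sub]
  field_simp

theorem iteratedDeriv_weierstrassP_scale (hc : c ≠ 0)
    (h : ∀ x, x ∈ L.lattice ↔ c * x ∈ L'.lattice) (j : ℕ) (z : ℂ) :
    iteratedDeriv j L'.weierstrassP (c * z) = c⁻¹ ^ (j + 2) * iteratedDeriv j L.weierstrassP z := by
  induction j generalizing z with
  | zero => simpa using weierstrassP_scale hc h z
  | succ j ih =>
    have h1 := deriv_comp_mul_left c (iteratedDeriv j L'.weierstrassP) z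
    rw [funext ih, deriv_const_mul_field, smul_eq_mul] at h1
    rw [iteratedDeriv_succ, iteratedDeriv_succ]
    have h2 : deriv (iteratedDeriv j L'.weierstrassP) (c * z) =
        c⁻¹ * (c * deriv (iteratedDeriv j L'.weierstrassP) (c * z)) := by
      field_simp
    rw [h2, ← h1]
    ring

theorem basisFun_scale (hc : c ≠ 0) (h : ∀ x, x ∈ L.lattice ↔ c * x ∈ L'.lattice) (w z : ℂ)
    (j : ℕ) : basisFun L' (c * w) (c * z) j = c⁻¹ ^ j * basisFun L w z j := by
  match j with
  | 0 => simp [basisFun]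
  | 1 =>
    simp only [basisFun, ← mul_add, weierstrassZeta_scale hc h]
    ring
  | j + 2 => simp only [basisFun, iteratedDeriv_weierstrassP_scale hc h]

/-! ### The zeta function as a function of `(z, τ)` -/

/-- The zeta function of `ℤ + τ ℤ`. -/
def zetaPair (q : ℂ × ℂ) : ℂ := ∑' x : Fin 2 → ℤ, zetaTerm q.1 (x 0 * q.2 + x 1)

/-- The pairs `(z, τ)` with `z` not in the lattice. -/
def offLattice : Set (ℂ × ℂ) := {q | 0 < q.2.im ∧ theta q.2 q.1 ≠ 0}

theorem mem_offLattice {z τ : ℂ} (hτ : 0 < τ.im) :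
    (z, τ) ∈ offLattice ↔ z ∉ (periods τ hτ).lattice := by
  simp [offLattice, hτ, theta_eq_zero_iff hτ]

theorem isOpen_offLattice : IsOpen offLattice := by
  rw [isOpen_iff_mem_nhds]
  intro q hq
  have h1 : ∀ᶠ p : ℂ × ℂ in 𝓝 q, 0 < p.2.im :=
    (Complex.continuous_im.comp continuous_snd).continuousAt.eventually (lt_mem_nhds hq.1)
  filter_upwards [h1, (differentiableAt_theta₂ hq.1).continuousAt.eventually_ne hq.2] with p h h'
  exact ⟨h, h'⟩

/-- Pairs of integers as elements of the lattice. -/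
def pairEquiv (τ : ℂ) (hτ : 0 < τ.im) : (Fin 2 → ℤ) ≃ (periods τ hτ).lattice :=
  (finTwoArrowEquiv ℤ).trans ((Equiv.prodComm ℤ ℤ).trans
    (periods τ hτ).latticeEquivProd.symm.toEquiv)

theorem coe_pairEquiv (τ : ℂ) (hτ : 0 < τ.im) (x : Fin 2 → ℤ) :
    (pairEquiv τ hτ x : ℂ) = x 0 * τ + x 1 := by
  have := (periods τ hτ).latticeEquiv_symm_apply (x 1, x 0)
  refine this.trans ?_
  simp [periods]
  ring

theorem zetaPair_eq {τ : ℂ} (hτ : 0 < τ.im) (z : ℂ) :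
    zetaPair (z, τ) = weierstrassZeta (periods τ hτ) z := by
  rw [weierstrassZeta, ← (pairEquiv τ hτ).tsum_eq, zetaPair]
  refine tsum_congr fun x => ?_
  rw [coe_pairEquiv, zetaTerm]

/-- The constant is uniform for `τ` in a vertical half strip; this is the estimate behind the
convergence of Eisenstein series. -/
theorem exists_mul_norm_le (A : ℝ) {B : ℝ} (hB : 0 < B) : ∃ c : ℝ, 0 < c ∧ ∀ τ : ℂ,
    |τ.re| ≤ A → B ≤ τ.im → ∀ x : Fin 2 → ℤ, c * ‖x‖ ≤ ‖(x 0 : ℂ) * τ + x 1‖ := by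
  refine ⟨EisensteinSeries.r ⟨⟨A, B⟩, hB⟩, EisensteinSeries.r_pos _, fun τ h1 h2 x => ?_⟩
  by_cases hx : x = 0
  · simp [hx]
  · have h3 := EisensteinSeries.r_mul_max_le ⟨τ, hB.trans_le h2⟩ hx
    refine le_trans ?_ h3
    gcongr
    exact EisensteinSeries.r_lower_bound_on_verticalStrip ⟨τ, hB.trans_le h2⟩ hB ⟨h1, h2⟩

theorem rpow_neg_three_le {c a b : ℝ} (hc : 0 < c) (ha : 0 < a) (h : c * a ≤ b) :
    b ^ (-3 : ℝ) ≤ c ^ (-3 : ℝ) * a ^ (-3 : ℝ) := by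
  rw [← Real.mul_rpow hc.le ha.le]
  exact Real.rpow_le_rpow_of_nonpos (by positivity) h (by norm_num)

/-- Summation over pairs of integers instead of lattice points keeps the index set fixed while `τ`
varies. Near a given point all but finitely many terms are bounded by a multiple of `‖x‖⁻³`. -/
theorem differentiableOn_zetaPair : DifferentiableOn ℂ zetaPair offLattice := by
  intro q hq
  obtain ⟨r₀, hr₀, hball⟩ := Metric.isOpen_iff.1 isOpen_offLattice q hq
  have hq1 : 0 < q.2.im := hq.1
  set ρ := min r₀ (q.2.im / 2) with hρ
  have hρ0 : 0 < ρ := lt_min hr₀ (by positivity)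
  set r := ‖q.1‖ + ρ with hr
  have hr0 : 0 < r := by positivity
  obtain ⟨c, hc, hcx⟩ := exists_mul_norm_le (|q.2.re| + ρ) (B := q.2.im / 2) (by positivity)
  have hsum : Summable fun x : Fin 2 → ℤ => 4 * r ^ 2 * (c ^ (-3 : ℝ) * ‖x‖ ^ (-3 : ℝ)) :=
    ((EisensteinSeries.summable_one_div_norm_rpow (by norm_num)).mul_left _).mul_left _
  have hmem : ∀ p ∈ Metric.ball q ρ, p ∈ offLattice ∧ ‖p.1‖ ≤ r ∧ |p.2.re| ≤ |q.2.re| + ρ ∧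
      q.2.im / 2 ≤ p.2.im := by
    intro p hp
    have h1 := hball (Metric.ball_subset_ball (min_le_left _ _) hp)
    rw [Metric.mem_ball, dist_eq_norm] at hp
    have h2 : ‖p.1 - q.1‖ ≤ ρ := (norm_fst_le (p - q)).trans hp.le
    have h3 : ‖p.2 - q.2‖ ≤ ρ := (norm_snd_le (p - q)).trans hp.le
    have h4 := (Complex.abs_re_le_norm (p.2 - q.2)).trans h3
    have h5 := (Complex.abs_im_le_norm (p.2 - q.2)).trans h3
    have h6 : ρ ≤ q.2.im / 2 := min_le_right _ _
    rw [Complex.sub_re] at h4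
    rw [Complex.sub_im] at h5
    refine ⟨h1, ?_, ?_, ?_⟩
    · have := norm_sub_norm_le p.1 q.1
      linarith
    · have := abs_sub_abs_le_abs_sub p.2.re q.2.re
      linarith
    · have := (abs_le.1 h5).1
      linarith
  have hfin : ∀ᶠ x : Fin 2 → ℤ in Filter.cofinite, 2 * r / c ≤ ‖x‖ := by
    rw [← Filter.cocompact_eq_cofinite]
    exact tendsto_norm_cocompact_atTop.eventually_ge_atTop _
  have hd := differentiableAt_tsum_of_norm_le_cofinite
    (f := fun (x : Fin 2 → ℤ) (p : ℂ × ℂ) => zetaTerm p.1 (x 0 * p.2 + x 1)) (x := q) hρ0 hsum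
    (fun x p hp => ?_) ?_
  · exact hd.differentiableWithinAt
  · have hp1 := (hmem p hp).1
    have hne : p.1 - (x 0 * p.2 + x 1) ≠ 0 := by
      intro h
      refine (mem_offLattice hp1.1).1 hp1 (mem_periods.2 ⟨x 1, x 0, ?_⟩)
      linear_combination h
    refine DifferentiableAt.differentiableWithinAt ?_
    unfold zetaTerm
    by_cases hx : x = 0
    · subst hx
      simp only [Pi.zero_apply, Int.cast_zero, zero_mul, add_zero, sub_zero] at hne ⊢
      fun_prop (disch := simpa using hne)
    · have h0 : (x 0 : ℂ) * p.2 + x 1 ≠ 0 := by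
        refine norm_pos_iff.1 (lt_of_lt_of_le ?_ (hcx p.2 (hmem p hp).2.2.1 (hmem p hp).2.2.2 x))
        have := norm_pos_iff.2 hx
        positivity
      have h1 : ((x 0 : ℂ) * p.2 + x 1) ^ 2 ≠ 0 := pow_ne_zero 2 h0
      fun_prop (disch := assumption)
  · filter_upwards [hfin] with x hx p hp
    obtain ⟨-, h1, h2, h3⟩ := hmem p hp
    have h4 := hcx p.2 h2 h3 x
    have hx0 : 0 < ‖x‖ := lt_of_lt_of_le (by positivity) hx
    refine (norm_zetaTerm_le_of_two_mul_le hr0 h1 ?_).trans ?_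
    · rw [div_le_iff₀ hc] at hx
      linarith
    · gcongr
      exact rpow_neg_three_le hc hx0 h4

theorem iteratedDeriv_weierstrassP_eq_zetaPair {τ : ℂ} (hτ : 0 < τ.im) (j : ℕ) {z : ℂ}
    (hz : z ∉ (periods τ hτ).lattice) : iteratedDeriv j (periods τ hτ).weierstrassP z =
      -iteratedDeriv (j + 1) (fun z => zetaPair (z, τ)) z := by
  rw [iteratedDeriv_weierstrassP_eq _ j hz, funext fun z => zetaPair_eq hτ z]

/-! ### Boundedness as `Im τ → ∞` -/

theorem mem_periods_add_int {τ : ℂ} (hτ : 0 < τ.im) (k : ℤ) (hτ' : 0 < (τ + k).im) (x : ℂ) :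
    x ∈ (periods (τ + k) hτ').lattice ↔ x ∈ (periods τ hτ).lattice := by
  rw [mem_periods, mem_periods]
  constructor
  · rintro ⟨a, b, rfl⟩
    exact ⟨a + b * k, b, by push_cast; ring⟩
  · rintro ⟨a, b, rfl⟩
    exact ⟨a - b * k, b, by push_cast; ring⟩

theorem zetaPair_add_int {τ : ℂ} (hτ : 0 < τ.im) (k : ℤ) (z : ℂ) :
    zetaPair (z, τ + k) = zetaPair (z, τ) := by
  have hτ' : 0 < (τ + k).im := by simpa using hτ
  rw [zetaPair_eq hτ, zetaPair_eq hτ']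
  have := weierstrassZeta_scale (L := periods τ hτ) (L' := periods (τ + k) hτ') one_ne_zero
    (fun x => by rw [one_mul, mem_periods_add_int hτ]) z
  simpa using this

/-- Points of bounded size and at a distance from the integers. -/
def awayFromInt (r δ : ℝ) : Set ℂ := {z | ‖z‖ ≤ r ∧ ∀ k : ℤ, δ ≤ ‖z - k‖}

/-- Lattice points that are not integers have an imaginary part of size at least `Im τ`, out of
reach for bounded `z`. -/
theorem le_norm_sub_of_mem_awayFromInt {r δ : ℝ} {z τ : ℂ} (hz : z ∈ awayFromInt r δ)
    (hτ : r + δ ≤ τ.im) (hτ0 : 0 ≤ τ.im) (a b : ℤ) : δ ≤ ‖z - (a * τ + b)‖ := by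
  by_cases ha : a = 0
  · subst ha
    simpa using hz.2 b
  · have h1 := Complex.abs_im_le_norm (z - (a * τ + b))
    have h2 : (z - (a * τ + b)).im = z.im - a * τ.im := by simp
    have h3 : (1 : ℝ) ≤ |(a : ℝ)| := by
      have := Int.one_le_abs ha
      exact_mod_cast this
    have h4 := abs_sub_abs_le_abs_sub ((a : ℝ) * τ.im) z.im
    rw [abs_mul, abs_of_nonneg hτ0, abs_sub_comm] at h4
    have h5 := (Complex.abs_im_le_norm z).trans hz.1
    rw [h2] at h1
    nlinarith

theorem notMem_of_mem_awayFromInt {r δ : ℝ} (hδ : 0 < δ) {z τ : ℂ} (hz : z ∈ awayFromInt r δ)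
    (hτ : r + δ ≤ τ.im) (hτ0 : 0 < τ.im) : z ∉ (periods τ hτ0).lattice := by
  intro h
  obtain ⟨a, b, rfl⟩ := mem_periods.1 h
  have := le_norm_sub_of_mem_awayFromInt hz hτ hτ0.le b a
  rw [add_comm, sub_self, norm_zero] at this
  linarith

/-- The period `1` in `τ` allows `|Re τ| ≤ 1`; there the lattice sum has a majorant independent of
`z` and `τ`. -/
theorem exists_norm_zetaPair_le {r δ : ℝ} (hr : 0 ≤ r) (hδ : 0 < δ) : ∃ C : ℝ, ∀ z ∈ awayFromInt r δ,
    ∀ τ : ℂ, r + δ ≤ τ.im → ‖zetaPair (z, τ)‖ ≤ C := by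
  obtain ⟨c, hc, hcx⟩ := exists_mul_norm_le 1 (B := r + δ) (by positivity)
  set K := r ^ 2 * (2 + 2 * r / δ) with hK
  have hK0 : 0 ≤ K := by positivity
  have hsum : Summable fun x : Fin 2 → ℤ =>
      K * (c ^ (-3 : ℝ) * ‖x‖ ^ (-3 : ℝ)) + if x = 0 then 1 / δ else 0 :=
    (((EisensteinSeries.summable_one_div_norm_rpow (by norm_num)).mul_left _).mul_left _).add
      (hasSum_ite_eq 0 _).summable
  have key : ∀ z ∈ awayFromInt r δ, ∀ τ : ℂ, |τ.re| ≤ 1 → r + δ ≤ τ.im →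
      ‖zetaPair (z, τ)‖ ≤ ∑' x : Fin 2 → ℤ,
        (K * (c ^ (-3 : ℝ) * ‖x‖ ^ (-3 : ℝ)) + if x = 0 then 1 / δ else 0) := by
    intro z hz τ h1 h2
    refine tsum_of_norm_bounded hsum.hasSum fun x => ?_
    have h3 := le_norm_sub_of_mem_awayFromInt hz h2 (by linarith) (x 0) (x 1)
    by_cases hx : x = 0
    · subst hx
      simp only [Pi.zero_apply, Int.cast_zero, zero_mul, add_zero, sub_zero] at h3 ⊢
      rw [zetaTerm_zero, if_true, norm_div, norm_one]
      have : 1 / ‖z‖ ≤ 1 / δ := one_div_le_one_div_of_le hδ h3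
      have h4 : 0 ≤ K * (c ^ (-3 : ℝ) * ‖(0 : Fin 2 → ℤ)‖ ^ (-3 : ℝ)) := by positivity
      linarith
    · have hx0 := norm_pos_iff.2 hx
      have h4 := hcx τ h1 h2 x
      have h0 : (x 0 : ℂ) * τ + x 1 ≠ 0 := norm_pos_iff.1 (lt_of_lt_of_le (by positivity) h4)
      rw [if_neg hx, add_zero]
      refine (norm_zetaTerm_le hz.1 h0 hδ h3).trans ?_
      gcongr
      exact rpow_neg_three_le hc hx0 h4
  refine ⟨∑' x : Fin 2 → ℤ, (K * (c ^ (-3 : ℝ) * ‖x‖ ^ (-3 : ℝ)) + if x = 0 then 1 / δ else 0),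
    fun z hz τ h => ?_⟩
  have hτ : 0 < τ.im := by linarith
  rw [← zetaPair_add_int hτ (-⌊τ.re⌋) z]
  refine key z hz _ ?_ (by simpa using h)
  have h1 := Int.floor_le τ.re
  have h2 := (Int.lt_floor_add_one τ.re).le
  simp only [Complex.add_re, Int.cast_neg, Complex.neg_re, Complex.intCast_re]
  rw [abs_le]
  constructor <;> linarith

theorem mem_awayFromInt_of_dist {r δ : ℝ} {z z' : ℂ} (hz : z ∈ awayFromInt r δ)
    (h : ‖z' - z‖ ≤ δ / 2) : z' ∈ awayFromInt (r + δ / 2) (δ / 2) := by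
  refine ⟨?_, fun k => ?_⟩
  · have := norm_sub_norm_le z' z
    have := hz.1
    linarith
  · have h1 := norm_sub_norm_le (z - k) (z' - k)
    rw [sub_sub_sub_cancel_right, norm_sub_rev z z'] at h1
    have := hz.2 k
    linarith

/-- Cauchy's estimate on circles of radius `δ / 2`. The enlarged region has parameters `r + δ / 2`
and `δ / 2`, whose sum is again `r + δ`. -/
theorem exists_norm_iteratedDeriv_zetaPair_le {r δ : ℝ} (hr : 0 ≤ r) (hδ : 0 < δ) (j : ℕ) :
    ∃ C : ℝ, ∀ z ∈ awayFromInt r δ, ∀ τ : ℂ, r + δ ≤ τ.im →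
      ‖iteratedDeriv j (fun z => zetaPair (z, τ)) z‖ ≤ C := by
  obtain ⟨C, hC⟩ := exists_norm_zetaPair_le (r := r + δ / 2) (δ := δ / 2) (by positivity)
    (by positivity)
  refine ⟨j.factorial * C / (δ / 2) ^ j, fun z hz τ hτ => ?_⟩
  have hτ0 : 0 < τ.im := by linarith
  refine Complex.norm_iteratedDeriv_le_of_forall_mem_sphere_norm_le j (by positivity) ?_
    fun z' hz' => ?_
  · refine DifferentiableOn.diffContOnCl ?_
    rw [closure_ball z (by positivity)]
    intro z' hz'
    rw [Metric.mem_closedBall, dist_eq_norm] at hz'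
    have h1 := notMem_of_mem_awayFromInt (by positivity) (mem_awayFromInt_of_dist hz hz')
      (by linarith) hτ0
    rw [funext fun z => zetaPair_eq hτ0 z]
    exact (differentiableAt_weierstrassZeta _ h1).differentiableWithinAt
  · rw [Metric.mem_sphere, dist_eq_norm] at hz'
    exact hC z' (mem_awayFromInt_of_dist hz hz'.le) τ (by linarith)

theorem exists_norm_basisFun_le {r δ : ℝ} (hr : 0 ≤ r) (hδ : 0 < δ) (j : ℕ) :
    ∃ C : ℝ, ∀ w ∈ awayFromInt r δ, ∀ z ∈ awayFromInt r δ, z + w ∈ awayFromInt r δ →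
      ∀ (τ : ℂ) (hτ : 0 < τ.im), r + δ ≤ τ.im → ‖basisFun (periods τ hτ) w z j‖ ≤ C := by
  match j with
  | 0 => exact ⟨1, fun w _ z _ _ τ hτ _ => by simp [basisFun]⟩
  | 1 =>
    obtain ⟨C, hC⟩ := exists_norm_zetaPair_le hr hδ
    refine ⟨C + C + C, fun w hw z hz hzw τ hτ h => ?_⟩
    simp only [basisFun, ← zetaPair_eq hτ]
    refine (norm_add_le _ _).trans (add_le_add ((norm_sub_le _ _).trans (add_le_add ?_ ?_)) ?_)
    · exact hC z hz τ h
    · exact hC _ hzw τ h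
    · exact hC w hw τ h
  | j + 2 =>
    obtain ⟨C, hC⟩ := exists_norm_iteratedDeriv_zetaPair_le hr hδ (j + 1)
    refine ⟨C, fun w hw z hz hzw τ hτ h => ?_⟩
    simp only [basisFun]
    rw [iteratedDeriv_weierstrassP_eq_zetaPair hτ j (notMem_of_mem_awayFromInt hδ hz h hτ), norm_neg]
    exact hC z hz τ h

/-- `basisFun` as a function of `(w, z, τ)`. -/
def basisPair (j : ℕ) (q : ℂ × ℂ × ℂ) : ℂ :=
  match j with
  | 0 => 1
  | 1 => zetaPair (q.2.1, q.2.2) - zetaPair (q.2.1 + q.1, q.2.2) + zetaPair (q.1, q.2.2)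
  | j + 2 => -iteratedDeriv (j + 1) (fun z => zetaPair (z, q.2.2)) q.2.1

theorem basisPair_eq {τ : ℂ} (hτ : 0 < τ.im) {w z : ℂ} (hz : z ∉ (periods τ hτ).lattice) (j : ℕ) :
    basisPair j (w, z, τ) = basisFun (periods τ hτ) w z j := by
  match j with
  | 0 => rfl
  | 1 => simp only [basisPair, basisFun, zetaPair_eq hτ]
  | j + 2 =>
    simp only [basisPair, basisFun]
    rw [iteratedDeriv_weierstrassP_eq_zetaPair hτ j hz]

theorem differentiableAt_basisPair (j : ℕ) {q : ℂ × ℂ × ℂ} (h1 : (q.1, q.2.2) ∈ offLattice)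
    (h2 : (q.2.1, q.2.2) ∈ offLattice) (h3 : (q.2.1 + q.1, q.2.2) ∈ offLattice) :
    DifferentiableAt ℂ (basisPair j) q := by
  have hd : ∀ p ∈ offLattice, DifferentiableAt ℂ zetaPair p := fun p hp =>
    differentiableOn_zetaPair.differentiableAt (isOpen_offLattice.mem_nhds hp)
  match j with
  | 0 => exact differentiableAt_const _
  | 1 =>
    have e1 := DifferentiableAt.comp (g := zetaPair) (f := fun q : ℂ × ℂ × ℂ => (q.2.1, q.2.2)) q
      (hd _ h2) (by fun_prop)
    have e2 := DifferentiableAt.comp (g := zetaPair)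
      (f := fun q : ℂ × ℂ × ℂ => (q.2.1 + q.1, q.2.2)) q (hd _ h3) (by fun_prop)
    have e3 := DifferentiableAt.comp (g := zetaPair) (f := fun q : ℂ × ℂ × ℂ => (q.1, q.2.2)) q
      (hd _ h1) (by fun_prop)
    exact (e1.sub e2).add e3
  | j + 2 =>
    have h := (differentiableOn_iteratedDeriv_fst isOpen_offLattice differentiableOn_zetaPair
      (j + 1)).differentiableAt (isOpen_offLattice.mem_nhds h2)
    exact (DifferentiableAt.comp
      (g := fun q : ℂ × ℂ => iteratedDeriv (j + 1) (fun z => zetaPair (z, q.2)) q.1)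
      (f := fun q : ℂ × ℂ × ℂ => (q.2.1, q.2.2)) q h (by fun_prop)).neg

/-! ### Transformation rules of the theta function -/

theorem theta1_eq (z τ : ℂ) :
    theta1 z τ = -cexp (Real.pi * I * τ / 4 + Real.pi * I * (z + 1 / 2)) * theta τ z := rfl

theorem theta1_eq_zero_iff {τ : ℂ} (hτ : 0 < τ.im) {z : ℂ} :
    theta1 z τ = 0 ↔ z ∈ (periods τ hτ).lattice := by
  rw [theta1_eq, mul_eq_zero, neg_eq_zero, or_iff_right (Complex.exp_ne_zero _),
    theta_eq_zero_iff hτ]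

theorem differentiable_theta1 {τ : ℂ} (hτ : 0 < τ.im) : Differentiable ℂ fun z => theta1 z τ := by
  have := differentiable_theta hτ
  simp only [theta1_eq]
  fun_prop

theorem deriv_theta1_ne_zero {τ : ℂ} (hτ : 0 < τ.im) {z : ℂ} (hz : theta1 z τ = 0) :
    deriv (fun z => theta1 z τ) z ≠ 0 := by
  have hz' : theta τ z = 0 := (theta_eq_zero_iff hτ).2 ((theta1_eq_zero_iff hτ).1 hz)
  have h1 : DifferentiableAt ℂ
      (fun z => -cexp (Real.pi * I * τ / 4 + Real.pi * I * (z + 1 / 2))) z := by fun_prop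
  have h2 := h1.hasDerivAt.mul (differentiable_theta hτ z).hasDerivAt
  have h3 : deriv (fun z => theta1 z τ) z =
      -cexp (Real.pi * I * τ / 4 + Real.pi * I * (z + 1 / 2)) * deriv (theta τ) z := by
    refine Eq.trans h2.deriv ?_
    rw [hz', mul_zero, zero_add]
  rw [h3]
  exact mul_ne_zero (neg_ne_zero.2 (Complex.exp_ne_zero _))
    (deriv_theta_ne_zero hτ ((theta1_eq_zero_iff hτ).1 hz))

theorem theta1_add_one (z τ : ℂ) : theta1 (z + 1) τ = -theta1 z τ := by
  rw [theta1_eq, theta1_eq, theta_add_one, show Real.pi * I * τ / 4 + Real.pi * I * (z + 1 + 1 / 2) =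
    Real.pi * I * τ / 4 + Real.pi * I * (z + 1 / 2) + Real.pi * I by ring, Complex.exp_add,
    Complex.exp_pi_mul_I]
  ring

theorem theta1_add_tau (z τ : ℂ) :
    theta1 (z + τ) τ = -cexp (-(Real.pi * I * (τ + 2 * z))) * theta1 z τ := by
  rw [theta1_eq, theta1_eq, theta_add_tau, show Real.pi * I * τ / 4 + Real.pi * I * (z + τ + 1 / 2) =
    (Real.pi * I * τ / 4 + Real.pi * I * (z + 1 / 2)) + Real.pi * I * τ by ring,
    Complex.exp_add _ (Real.pi * I * τ),
    show -2 * Real.pi * I * (z + τ) = -(Real.pi * I * (τ + 2 * z)) + -(Real.pi * I * τ) by ring,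
    Complex.exp_add (-(Real.pi * I * (τ + 2 * z))), Complex.exp_neg (Real.pi * I * τ)]
  have := Complex.exp_ne_zero (Real.pi * I * τ)
  field_simp

theorem theta1_add_int (z τ : ℂ) (b : ℤ) :
    theta1 (z + b) τ = cexp (Real.pi * I * b) * theta1 z τ := by
  induction b using Int.induction_on with
  | zero => simp
  | succ k ih =>
    push_cast at ih ⊢
    rw [← add_assoc, theta1_add_one, ih, mul_add, Complex.exp_add, mul_one, Complex.exp_pi_mul_I]
    ring
  | pred k ih =>
    have h := theta1_add_one (z + ((-(k : ℤ) - 1 : ℤ) : ℂ)) τ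
    push_cast at ih h ⊢
    rw [show z + (-(k : ℂ) - 1) + 1 = z + -k by ring, ih] at h
    rw [← neg_eq_iff_eq_neg] at h
    rw [← h, mul_sub, Complex.exp_sub, mul_one, Complex.exp_pi_mul_I]
    ring

theorem theta1_add_mul_tau (z τ : ℂ) (a : ℤ) :
    theta1 (z + a * τ) τ =
      cexp (Real.pi * I * a) * cexp (-(Real.pi * I * (a ^ 2 * τ + 2 * a * z))) * theta1 z τ := by
  induction a using Int.induction_on with
  | zero => simp
  | succ k ih =>
    push_cast at ih ⊢
    rw [show z + ((k : ℂ) + 1) * τ = z + k * τ + τ by ring, theta1_add_tau, ih,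
      mul_add (Real.pi * I : ℂ) (k : ℂ) 1, Complex.exp_add, mul_one, Complex.exp_pi_mul_I,
      show -(Real.pi * I * (((k : ℂ) + 1) ^ 2 * τ + 2 * (k + 1) * z)) =
        -(Real.pi * I * (τ + 2 * (z + k * τ))) + -(Real.pi * I * ((k : ℂ) ^ 2 * τ + 2 * k * z)) by ring,
      Complex.exp_add]
    ring
  | pred k ih =>
    have h := theta1_add_tau (z + ((-(k : ℤ) - 1 : ℤ) : ℂ) * τ) τ
    push_cast at ih h ⊢
    rw [show z + (-(k : ℂ) - 1) * τ + τ = z + -k * τ by ring, ih] at h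
    rw [mul_sub, Complex.exp_sub, mul_one, Complex.exp_pi_mul_I,
      show -(Real.pi * I * ((-(k : ℂ) - 1) ^ 2 * τ + 2 * (-k - 1) * z)) =
        Real.pi * I * (τ + 2 * (z + (-k - 1) * τ)) +
          -(Real.pi * I * ((-(k : ℂ)) ^ 2 * τ + 2 * (-k) * z)) by ring,
      Complex.exp_add]
    have h2 : theta1 (z + (-(k : ℂ) - 1) * τ) τ =
        -cexp (Real.pi * I * (τ + 2 * (z + (-k - 1) * τ))) *
          (-cexp (-(Real.pi * I * (τ + 2 * (z + (-k - 1) * τ)))) *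
            theta1 (z + (-(k : ℂ) - 1) * τ) τ) := by
      rw [Complex.exp_neg]
      have := Complex.exp_ne_zero (Real.pi * I * (τ + 2 * (z + (-k - 1) * τ)))
      field_simp
    rw [h2, ← h]
    ring

theorem theta1_add_lattice (z τ : ℂ) (a b : ℤ) :
    theta1 (z + a * τ + b) τ =
      cexp (Real.pi * I * (a + b)) * cexp (-(Real.pi * I * (a ^ 2 * τ + 2 * a * z))) *
        theta1 z τ := by
  rw [theta1_add_int, theta1_add_mul_tau, mul_add (Real.pi * I : ℂ) (a : ℂ) b, Complex.exp_add]
  ring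

theorem exp_pi_int_odd {k : ℤ} (h : Odd k) : cexp (Real.pi * I * k) = -1 := by
  obtain ⟨m, rfl⟩ := h
  push_cast
  rw [mul_add, Complex.exp_add, mul_one, Complex.exp_pi_mul_I,
    show Real.pi * I * (2 * m : ℂ) = 2 * Real.pi * I * m by ring, exp_two_pi_int, one_mul]

theorem det_eq (γ : Matrix.SpecialLinearGroup (Fin 2) ℤ) :
    γ.1 0 0 * γ.1 1 1 - γ.1 0 1 * γ.1 1 0 = 1 := by
  rw [← Matrix.det_fin_two]
  exact γ.2

theorem det_eq_complex (γ : Matrix.SpecialLinearGroup (Fin 2) ℤ) :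
    (γ.1 0 0 : ℂ) * γ.1 1 1 - γ.1 0 1 * γ.1 1 0 = 1 := by
  exact_mod_cast det_eq γ

theorem one_div_autFactor (γ : Matrix.SpecialLinearGroup (Fin 2) ℤ) {τ : ℂ} (hτ : 0 < τ.im) :
    1 / autFactor γ τ = γ.1 0 0 - γ.1 1 0 * moebius γ τ := by
  have h := autFactor_ne_zero γ hτ
  have hd := det_eq_complex γ
  rw [moebius]
  field_simp
  rw [autFactor]
  linear_combination -hd

theorem tau_div_autFactor (γ : Matrix.SpecialLinearGroup (Fin 2) ℤ) {τ : ℂ} (hτ : 0 < τ.im) :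
    τ / autFactor γ τ = γ.1 1 1 * moebius γ τ - γ.1 0 1 := by
  have h := autFactor_ne_zero γ hτ
  have hd := det_eq_complex γ
  rw [moebius]
  field_simp
  rw [autFactor]
  linear_combination (-τ) * hd

theorem mem_periods_moebius (γ : Matrix.SpecialLinearGroup (Fin 2) ℤ) {τ : ℂ} (hτ : 0 < τ.im)
    (x : ℂ) : x ∈ (periods τ hτ).lattice ↔
      (autFactor γ τ)⁻¹ * x ∈ (periods (moebius γ τ) (moebius_im_pos γ hτ)).lattice := by
  have hj := autFactor_ne_zero γ hτ
  have h1 := one_div_autFactor γ hτ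
  have h2 := tau_div_autFactor γ hτ
  rw [mem_periods, mem_periods]
  constructor
  · rintro ⟨a, b, rfl⟩
    refine ⟨a * γ.1 0 0 - b * γ.1 0 1, b * γ.1 1 1 - a * γ.1 1 0, ?_⟩
    push_cast
    rw [mul_add, show (autFactor γ τ)⁻¹ * a + (autFactor γ τ)⁻¹ * (b * τ) =
      a * (1 / autFactor γ τ) + b * (τ / autFactor γ τ) by ring, h1, h2]
    ring
  · rintro ⟨a, b, h⟩
    refine ⟨a * γ.1 1 1 + b * γ.1 0 1, a * γ.1 1 0 + b * γ.1 0 0, ?_⟩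
    rw [inv_mul_eq_iff_eq_mul₀ hj] at h
    rw [h, moebius]
    field_simp
    rw [autFactor]
    push_cast
    ring

/-- The modular transformation of `θ₁`. -/
theorem exists_theta1_modular (γ : Matrix.SpecialLinearGroup (Fin 2) ℤ) {τ : ℂ} (hτ : 0 < τ.im) :
    ∃ C : ℂ, C ≠ 0 ∧ ∀ z, theta1 (z / autFactor γ τ) (moebius γ τ) =
      C * cexp (Real.pi * I * (γ.1 1 0 * z ^ 2 / autFactor γ τ)) * theta1 z τ := by
  have hj := autFactor_ne_zero γ hτ
  have hτ' := moebius_im_pos γ hτ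
  have h1 := one_div_autFactor γ hτ
  have h2 := tau_div_autFactor γ hτ
  have hd := det_eq_complex γ
  have hdet := det_eq γ
  set j := autFactor γ τ with hjdef
  set τ' := moebius γ τ with hτ'def
  have hj' : (γ.1 1 0 : ℂ) * τ + γ.1 1 1 = j := rfl
  set a := γ.1 0 0
  set b := γ.1 0 1
  set c := γ.1 1 0
  set d := γ.1 1 1
  -- Without the Gaussian factor, the transformed theta function has the same multipliers under `z +
  -- 1` and `z + τ` as `θ₁(z, τ)` and vanishes on the same lattice. The quotient is entire and
  -- doubly periodic, hence constant.
  set f : ℂ → ℂ := fun z => cexp (-(Real.pi * I * (c * z ^ 2 / j))) * theta1 (z / j) τ' with hf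
  have hfd : Differentiable ℂ f := by
    have := differentiable_theta1 hτ'
    have h3 : Differentiable ℂ fun z => theta1 (z / j) τ' := this.comp (by fun_prop)
    fun_prop
  have hf1 : ∀ z, f (z + 1) = -f z := by
    intro z
    have e : (z + 1) / j = z / j + ((-c : ℤ) : ℂ) * τ' + (a : ℤ) := by
      push_cast
      rw [add_div, h1]
      ring
    -- The exponent is even only if `a` and `c` both are, which the determinant excludes.
    have hodd : cexp (Real.pi * I * ((-c * a - c + a : ℤ) : ℂ)) = -1 := by
      refine exp_pi_int_odd ?_
      by_contra hc
      rw [Int.not_odd_iff_even] at hc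
      have hac : Even a ∧ Even c := by
        rw [Int.even_add, Int.even_sub, Int.even_mul, even_neg] at hc
        tauto
      have : Even (1 : ℤ) := by
        rw [← hdet]
        exact (hac.1.mul_right d).sub (hac.2.mul_left b)
      exact absurd this (by decide)
    simp only [hf]
    have hn : ∀ x y : ℂ, -(cexp x * y) =
        cexp (Real.pi * I * ((-c * a - c + a : ℤ) : ℂ) + x) * y := by
      intro x y
      rw [Complex.exp_add, hodd]
      ring
    rw [e, theta1_add_lattice, hn, ← mul_assoc, ← mul_assoc, ← Complex.exp_add, ← Complex.exp_add]
    congr 2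
    push_cast
    have h3 : c * τ' = a - 1 / j := by rw [h1]; ring
    linear_combination (-(Real.pi * I * c)) * h3 + 0 * hd
  have hf2 : ∀ z, f (z + τ) = -cexp (-(Real.pi * I * (τ + 2 * z))) * f z := by
    intro z
    have e : (z + τ) / j = z / j + (d : ℤ) * τ' + ((-b : ℤ) : ℂ) := by
      push_cast
      rw [add_div, h2]
      ring
    have hodd : cexp (Real.pi * I * ((-b * d - b + d : ℤ) : ℂ)) = -1 := by
      refine exp_pi_int_odd ?_
      by_contra hc
      rw [Int.not_odd_iff_even] at hc
      have hac : Even d ∧ Even b := by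
        rw [Int.even_add, Int.even_sub, Int.even_mul, even_neg] at hc
        tauto
      have : Even (1 : ℤ) := by
        rw [← hdet]
        exact (hac.1.mul_left a).sub (hac.2.mul_right c)
      exact absurd this (by decide)
    simp only [hf]
    have hn : ∀ x x' y : ℂ, -cexp x * (cexp x' * y) =
        cexp (Real.pi * I * ((-b * d - b + d : ℤ) : ℂ) + x + x') * y := by
      intro x x' y
      rw [Complex.exp_add, Complex.exp_add, hodd]
      ring
    rw [e, theta1_add_lattice, hn, ← mul_assoc, ← mul_assoc, ← Complex.exp_add, ← Complex.exp_add]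
    congr 2
    push_cast
    have h3 : d * τ' = b + τ / j := by rw [h2]; ring
    have h4 : d ^ 2 * τ' = d * b + d * τ / j := by linear_combination d * h3
    rw [h4, ← hj']
    rw [← hj'] at hj
    field_simp
    ring
  obtain ⟨q, hq, hfq⟩ := exists_eq_mul_of_simple_zeros hfd (differentiable_theta1 hτ)
    (fun z hz => deriv_theta1_ne_zero hτ hz) (fun z hz => by
      have h3 := (mem_periods_moebius γ hτ z).1 ((theta1_eq_zero_iff hτ).1 hz)
      simp only [hf]
      rw [(theta1_eq_zero_iff hτ').2 (by rwa [div_eq_inv_mul]), mul_zero])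
  have hzero : ∀ z ∉ ((periods τ hτ).lattice : Set ℂ), theta1 z τ ≠ 0 := fun z hz h =>
    hz ((theta1_eq_zero_iff hτ).1 h)
  have hq1 := eq_of_eq_off_countable (f := fun z => q (z + 1)) (hq.continuous.comp (by fun_prop)) hq.continuous
    (countable_lattice hτ) (fun z hz => by
      have h3 := hf1 z
      rw [hfq, hfq, theta1_add_one, neg_mul] at h3
      exact mul_left_cancel₀ (hzero z hz) (neg_injective h3))
  have hq2 := eq_of_eq_off_countable (f := fun z => q (z + τ)) (hq.continuous.comp (by fun_prop)) hq.continuous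
    (countable_lattice hτ) (fun z hz => by
      have h3 := hf2 z
      rw [hfq, hfq, theta1_add_tau, mul_assoc] at h3
      exact mul_left_cancel₀ (hzero z hz)
        (mul_left_cancel₀ (neg_ne_zero.2 (Complex.exp_ne_zero _)) h3))
  have hconst := apply_eq_apply_of_periodic hτ hq (congrFun hq1) (congrFun hq2)
  have key : ∀ z, theta1 (z / j) τ' = q 0 * cexp (Real.pi * I * (c * z ^ 2 / j)) * theta1 z τ := by
    intro z
    have h3 := hfq z
    simp only [hf] at h3
    rw [hconst z 0, Complex.exp_neg, inv_mul_eq_iff_eq_mul₀ (Complex.exp_ne_zero _)] at h3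
    rw [h3]
    ring
  refine ⟨q 0, fun h0 => ?_, key⟩
  -- The constant cannot be zero: the left side at `z = j / 2` is `θ₁(1/2, τ')`, and `1/2` is not a
  -- lattice point.
  have h3 := key (j * (1 / 2))
  rw [h0, zero_mul, zero_mul, mul_div_cancel_left₀ _ hj, theta1_eq_zero_iff hτ'] at h3
  refine notMem_lattice_of_real hτ' (x := 1 / 2) (by norm_num) (by norm_num) ?_
  push_cast
  exact h3

/-! ### Invariance of the superpotential -/

variable {n : ℕ}

/-- The exponential factors of `θ₁` cancel: numerator and denominator consist of `n + 1` theta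
factors each, and their arguments have the same sum as `∑ v_i = 0`. -/
theorem superpotential_eq (p : Space n) (z : ℂ) :
    superpotential p z = cexp (-2 * Real.pi * I * p.1) *
      (∏ i, theta p.2.2 (z - p.2.1.1.1 i + p.2.1.2)) /
        (theta p.2.2 z ^ n * theta p.2.2 (z + ((n : ℂ) + 1) * p.2.1.2)) := by
  set τ := p.2.2
  set v := p.2.1.1
  set s := p.2.1.2
  have hsum : ∑ i, (Real.pi * I * τ / 4 + Real.pi * I * (z - v.1 i + s + 1 / 2)) =
      n * (Real.pi * I * τ / 4 + Real.pi * I * (z + 1 / 2)) +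
        (Real.pi * I * τ / 4 + Real.pi * I * (z + ((n : ℂ) + 1) * s + 1 / 2)) := by
    simp only [Finset.sum_add_distrib, ← Finset.mul_sum, Finset.sum_sub_distrib,
      Hyperplane.sum_eq_zero, Finset.sum_const, Finset.card_univ, Fintype.card_fin, nsmul_eq_mul]
    push_cast
    ring
  have hprod : ∏ i, theta1 (z - v.1 i + s) τ =
      -(-cexp (Real.pi * I * τ / 4 + Real.pi * I * (z + 1 / 2))) ^ n *
        cexp (Real.pi * I * τ / 4 + Real.pi * I * (z + ((n : ℂ) + 1) * s + 1 / 2)) *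
          ∏ i, theta τ (z - v.1 i + s) := by
    simp only [theta1_eq, Finset.prod_mul_distrib, Finset.prod_neg, ← Complex.exp_sum, hsum]
    rw [Complex.exp_add, Complex.exp_nat_mul]
    simp only [Finset.card_univ, Fintype.card_fin]
    rw [neg_pow (cexp _), pow_succ]
    ring
  have h1 := Complex.exp_ne_zero (Real.pi * I * τ / 4 + Real.pi * I * (z + 1 / 2))
  have h2 := Complex.exp_ne_zero
    (Real.pi * I * τ / 4 + Real.pi * I * (z + ((n : ℂ) + 1) * s + 1 / 2))
  rw [superpotential]
  change cexp (-2 * Real.pi * I * p.1) * (∏ i, theta1 (z - v.1 i + s) τ) /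
    (theta1 z τ ^ n * theta1 (z + ((n : ℂ) + 1) * s) τ) = _
  rw [hprod, theta1_eq z, theta1_eq (z + _), mul_pow]
  set A := -cexp (Real.pi * I * τ / 4 + Real.pi * I * (z + 1 / 2)) with hA
  set B := cexp (Real.pi * I * τ / 4 + Real.pi * I * (z + ((n : ℂ) + 1) * s + 1 / 2)) with hB
  have hA0 : -A ^ n * B ≠ 0 := mul_ne_zero (neg_ne_zero.2 (pow_ne_zero _ (neg_ne_zero.2 h1))) h2
  rw [show A ^ n * theta τ z ^ n * (-B * theta τ (z + ((n : ℂ) + 1) * s)) =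
    (-A ^ n * B) * (theta τ z ^ n * theta τ (z + ((n : ℂ) + 1) * s)) by ring,
    show cexp (-2 * Real.pi * I * p.1) * (-A ^ n * B * ∏ i, theta τ (z - v.1 i + s)) =
      (-A ^ n * B) * (cexp (-2 * Real.pi * I * p.1) * ∏ i, theta τ (z - v.1 i + s)) by ring,
    mul_div_mul_left _ _ hA0]

theorem superpotential_weylAct (σ : Equiv.Perm (Fin (n + 1))) (p : Space n) (z : ℂ) :
    superpotential (weylAct σ p) z = superpotential p z := by
  simp only [superpotential, weylAct]
  rw [Equiv.prod_comp σ fun i => theta1 (z - p.2.1.1.1 i + p.2.1.2) p.2.2]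

theorem superpotential_add_u (u u' : ℂ) (x : Cartan n × ℂ) (z : ℂ) :
    superpotential (u + u', x) z = cexp (-2 * Real.pi * I * u') * superpotential (u, x) z := by
  simp only [superpotential, mul_add, Complex.exp_add]
  ring

/-- The Gaussian factors contribute `∑ (z - v_i + s)² - n z² - (z + (n+1)s)² = ∑ v_i² - n(n+1)s²`.
This is `⟨v, v⟩`, independent of `z`, and the shift of `u` compensates it; here lies the origin of
the coefficient `-n(n+1)`. -/
theorem superpotential_modAct (γ : Matrix.SpecialLinearGroup (Fin 2) ℤ) (p : Space n)
    (hτ : 0 < p.2.2.im) (z : ℂ) :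
    superpotential (modAct γ p) ((autFactor γ p.2.2)⁻¹ * z) = superpotential p z := by
  obtain ⟨u, ⟨v, s⟩, τ⟩ := p
  obtain ⟨C, hC, h⟩ := exists_theta1_modular γ hτ
  have hj := autFactor_ne_zero γ hτ
  simp only at hτ h hj ⊢
  simp only [modAct]
  rw [superpotential_add_u]
  simp only [superpotential]
  set j := autFactor γ τ with hjd
  set c : ℂ := ((γ.1 1 0 : ℤ) : ℂ)
  have e : ∀ x : ℂ, theta1 (j⁻¹ * x) (moebius γ τ) =
      C * cexp (Real.pi * I * (c * x ^ 2 / j)) * theta1 x τ := fun x => by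
    rw [← h x, div_eq_inv_mul]
  have e1 : ∏ i, theta1 (j⁻¹ * z - ((j⁻¹ • (v, s) : Cartan n).1.1 i) + (j⁻¹ • (v, s) : Cartan n).2)
      (moebius γ τ) = C ^ (n + 1) *
        cexp (∑ i, Real.pi * I * (c * (z - v.1 i + s) ^ 2 / j)) * ∏ i, theta1 (z - v.1 i + s) τ := by
    have : ∀ i, theta1 (j⁻¹ * z - ((j⁻¹ • (v, s) : Cartan n).1.1 i) + (j⁻¹ • (v, s) : Cartan n).2)
      (moebius γ τ) = C * cexp (Real.pi * I * (c * (z - v.1 i + s) ^ 2 / j)) *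
        theta1 (z - v.1 i + s) τ := by
      intro i
      rw [← e]
      congr 1
      simp
      ring
    simp only [this, Finset.prod_mul_distrib, Complex.exp_sum, Finset.prod_const, Finset.card_univ,
      Fintype.card_fin]
  have e2 : theta1 (j⁻¹ * z + ((n : ℂ) + 1) * (j⁻¹ • (v, s) : Cartan n).2) (moebius γ τ) =
      C * cexp (Real.pi * I * (c * (z + ((n : ℂ) + 1) * s) ^ 2 / j)) *
        theta1 (z + ((n : ℂ) + 1) * s) τ := by
    rw [← e]
    congr 1
    simp
    ring
  rw [e1, e2, e z, mul_pow, mul_pow, ← Complex.exp_nat_mul]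
  have e3 : ∑ i, Real.pi * I * (c * (z - v.1 i + s) ^ 2 / j) =
      n * (Real.pi * I * (c * z ^ 2 / j)) + Real.pi * I * (c * (z + ((n : ℂ) + 1) * s) ^ 2 / j) +
        2 * Real.pi * I * (c * form (v, s) (v, s) / (2 * j)) := by
    have e4 : ∑ i, (z - v.1 i + s) ^ 2 = ((n : ℂ) + 1) * (z + s) ^ 2 + ∑ i, v.1 i * v.1 i := by
      have e5 : ∀ i, (z - v.1 i + s) ^ 2 = (z + s) ^ 2 - 2 * (z + s) * v.1 i + v.1 i * v.1 i :=
        fun i => by ring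
      simp only [e5, Finset.sum_add_distrib, Finset.sum_sub_distrib, ← Finset.mul_sum,
        Hyperplane.sum_eq_zero, Finset.sum_const, Finset.card_univ, Fintype.card_fin, nsmul_eq_mul]
      push_cast
      ring
    rw [← Finset.mul_sum, ← Finset.sum_div, ← Finset.mul_sum, e4, form]
    simp only
    field_simp
    ring
  rw [e3, Complex.exp_add, Complex.exp_add,
    show -2 * Real.pi * I * (c * form (v, s) (v, s) / (2 * j)) =
      -(2 * Real.pi * I * (c * form (v, s) (v, s) / (2 * j))) by ring, Complex.exp_neg]
  have h1 := Complex.exp_ne_zero (2 * Real.pi * I * (c * form (v, s) (v, s) / (2 * j)))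
  set E1 := cexp (2 * Real.pi * I * (c * form (v, s) (v, s) / (2 * j)))
  have h2 := Complex.exp_ne_zero (n * (Real.pi * I * (c * z ^ 2 / j)))
  set E2 := cexp (n * (Real.pi * I * (c * z ^ 2 / j)))
  have h3 := Complex.exp_ne_zero (Real.pi * I * (c * (z + ((n : ℂ) + 1) * s) ^ 2 / j))
  set E3 := cexp (Real.pi * I * (c * (z + ((n : ℂ) + 1) * s) ^ 2 / j))
  set Q := ∏ i, theta1 (z - v.1 i + s) τ
  have hk : C ^ (n + 1) * E2 * E3 ≠ 0 := mul_ne_zero (mul_ne_zero (pow_ne_zero _ hC) h2) h3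
  rw [show C ^ n * E2 * theta1 z τ ^ n * (C * E3 * theta1 (z + ((n : ℂ) + 1) * s) τ) =
    (C ^ (n + 1) * E2 * E3) * (theta1 z τ ^ n * theta1 (z + ((n : ℂ) + 1) * s) τ) by ring,
    show cexp (-2 * Real.pi * I * u) * (C ^ (n + 1) * (E2 * E3 * E1) * Q) =
      (C ^ (n + 1) * E2 * E3) * (E1 * (cexp (-2 * Real.pi * I * u) * Q)) by ring,
    mul_div_mul_left _ _ hk, mul_div_assoc, inv_mul_cancel_left₀ h1]

/-- The signs agree in numerator and denominator since the integers `λ_i` and `μ_i` with `i ≤ n` sum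
to zero. Of the exponents there remains `⟨λ, v⟩ + ½⟨λ, λ⟩τ`, which the shift of `u` compensates. -/
theorem superpotential_transAct {x y : Cartan n} (hx : x ∈ intLattice n) (hy : y ∈ intLattice n)
    (k : ℤ) (p : Space n) (z : ℂ) : superpotential (transAct x y k p) z = superpotential p z := by
  obtain ⟨u, ⟨v, s⟩, τ⟩ := p
  obtain ⟨⟨lv, hlv⟩, ls⟩ := x
  obtain ⟨⟨mv, hmv⟩, ms⟩ := y
  obtain ⟨h1, ls', h2⟩ := hx
  obtain ⟨h3, ms', h4⟩ := hy
  choose l h1 using h1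
  choose m h3 using h3
  simp only at h1 h2 h3 h4
  subst h2 h4
  have hl0 : ∑ i, (l i : ℂ) = 0 := by
    have : ∑ i, lv i = 0 := hlv
    simpa only [h1] using this
  have hm0 : ∑ i, (m i : ℂ) = 0 := by
    have : ∑ i, mv i = 0 := hmv
    simpa only [h3] using this
  have e : ∀ i, theta1 (z - (v.1 i + τ * l i + m i) + (s + τ * ls' + ms')) τ =
      cexp (Real.pi * I * (-l i + ls' + (-m i + ms'))) *
        cexp (-(Real.pi * I * ((-l i + ls') ^ 2 * τ + 2 * (-l i + ls') * (z - v.1 i + s)))) *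
        theta1 (z - v.1 i + s) τ := by
    intro i
    have := theta1_add_lattice (z - v.1 i + s) τ (-l i + ls') (-m i + ms')
    push_cast at this
    rw [← this]
    congr 1
    ring
  have e' : theta1 (z + ((n : ℂ) + 1) * (s + τ * ls' + ms')) τ =
      cexp (Real.pi * I * (((n : ℂ) + 1) * ls' + ((n : ℂ) + 1) * ms')) *
        cexp (-(Real.pi * I * ((((n : ℂ) + 1) * ls') ^ 2 * τ +
          2 * (((n : ℂ) + 1) * ls') * (z + ((n : ℂ) + 1) * s)))) *
        theta1 (z + ((n : ℂ) + 1) * s) τ := by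
    have := theta1_add_lattice (z + ((n : ℂ) + 1) * s) τ (((n : ℤ) + 1) * ls') (((n : ℤ) + 1) * ms')
    push_cast at this
    rw [← this]
    congr 1
    ring
  simp only [superpotential, transAct, Prod.fst_add, Prod.snd_add, Prod.smul_fst, Prod.smul_snd,
    smul_eq_mul, Submodule.coe_add, Submodule.coe_smul, Pi.add_apply, Pi.smul_apply, h1, h3]
  rw [Finset.prod_congr rfl fun i _ => e i, e', Finset.prod_mul_distrib, Finset.prod_mul_distrib,
    ← Complex.exp_sum, ← Complex.exp_sum]
  have s1 : ∑ i, Real.pi * I * (-(l i : ℂ) + ls' + (-m i + ms')) =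
      Real.pi * I * (((n : ℂ) + 1) * ls' + ((n : ℂ) + 1) * ms') := by
    simp only [← Finset.mul_sum, Finset.sum_add_distrib, Finset.sum_neg_distrib, hl0, hm0,
      Finset.sum_const, Finset.card_univ, Fintype.card_fin, nsmul_eq_mul]
    push_cast
    ring
  have s2 : ∑ i, -(Real.pi * I * ((-(l i : ℂ) + ls') ^ 2 * τ +
      2 * (-l i + ls') * (z - v.1 i + s))) =
      -(Real.pi * I * ((((n : ℂ) + 1) * ls') ^ 2 * τ +
          2 * (((n : ℂ) + 1) * ls') * (z + ((n : ℂ) + 1) * s))) -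
        2 * Real.pi * I * (∑ i, (l i : ℂ) * v.1 i - n * (n + 1) * ls' * s +
          1 / 2 * (∑ i, (l i : ℂ) * l i - n * (n + 1) * ls' * ls') * τ) := by
    have e5 : ∀ i, -(Real.pi * I * ((-(l i : ℂ) + ls') ^ 2 * τ +
        2 * (-l i + ls') * (z - v.1 i + s))) = -(Real.pi * I * τ) * (l i * l i) -
          2 * Real.pi * I * (l i * v.1 i) + (2 * Real.pi * I * (ls' * τ + z + s)) * l i +
          2 * Real.pi * I * ls' * v.1 i - Real.pi * I * (ls' ^ 2 * τ + 2 * ls' * (z + s)) := by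
      intro i; ring
    simp only [e5, Finset.sum_add_distrib, Finset.sum_sub_distrib, ← Finset.mul_sum,
        Hyperplane.sum_eq_zero, hl0, Finset.sum_const, Finset.card_univ, Fintype.card_fin,
        nsmul_eq_mul]
    push_cast
    ring
  rw [s1, s2]
  set A := cexp (Real.pi * I * (((n : ℂ) + 1) * ls' + ((n : ℂ) + 1) * ms')) with hA
  have hA0 : A ≠ 0 := Complex.exp_ne_zero _
  rw [Complex.exp_sub]
  set B := cexp (-(Real.pi * I * ((((n : ℂ) + 1) * ls') ^ 2 * τ +
          2 * (((n : ℂ) + 1) * ls') * (z + ((n : ℂ) + 1) * s)))) with hB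
  have hB0 : B ≠ 0 := Complex.exp_ne_zero _
  have hu : cexp (-2 * Real.pi * I * (u - form (⟨lv, hlv⟩, (ls' : ℂ)) (v, s) -
      1 / 2 * form (⟨lv, hlv⟩, (ls' : ℂ)) (⟨lv, hlv⟩, (ls' : ℂ)) * τ + k)) =
      cexp (-2 * Real.pi * I * u) * cexp (2 * Real.pi * I * (∑ i, (l i : ℂ) * v.1 i -
        n * (n + 1) * ls' * s + 1 / 2 * (∑ i, (l i : ℂ) * l i - n * (n + 1) * ls' * ls') * τ)) := by
    rw [← Complex.exp_add, form, form]
    simp only [h1]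
    have h5 := exp_two_pi_int (-k)
    rw [← mul_one (cexp (-2 * Real.pi * I * u + _)), ← h5, ← Complex.exp_add]
    congr 1
    push_cast
    ring
  rw [hu]
  set D := cexp (2 * Real.pi * I * (∑ i, (l i : ℂ) * v.1 i -
        n * (n + 1) * ls' * s + 1 / 2 * (∑ i, (l i : ℂ) * l i - n * (n + 1) * ls' * ls') * τ))
  have hD0 : D ≠ 0 := Complex.exp_ne_zero _
  set Q := ∏ i, theta1 (z - v.1 i + s) τ
  have hAB : A * B ≠ 0 := mul_ne_zero hA0 hB0
  rw [show theta1 z τ ^ n * (A * B * theta1 (z + ((n : ℂ) + 1) * s) τ) =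
    (A * B) * (theta1 z τ ^ n * theta1 (z + ((n : ℂ) + 1) * s) τ) by ring,
    show cexp (-2 * Real.pi * I * u) * D * (A * (B / D) * Q) =
      (A * B) * (cexp (-2 * Real.pi * I * u) * Q) by field_simp,
    mul_div_mul_left _ _ hAB]

/-! ### The theta function as `Im τ → ∞` -/

/-- The decay in `Im τ` is governed by `k² + k`, which is at least `2` except for `k = 0` and `k =
-1`. Splitting `Im τ = (Im τ - 1) + 1` leaves a majorant that is summable over `k`. -/
theorem norm_theta_term_le {S : ℝ} {z τ : ℂ} (hz : |z.im| ≤ S) (hτ : 1 ≤ τ.im) {k : ℤ}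
    (h0 : k ≠ 0) (h1 : k ≠ -1) : ‖jacobiTheta₂_term k (z + 1 / 2 + τ / 2) τ‖ ≤
      Real.exp (-2 * Real.pi * (τ.im - 1)) *
        Real.exp (-Real.pi * (1 * (k : ℝ) ^ 2 - 2 * (S + 1 / 2) * |(k : ℝ)|)) := by
  rw [norm_jacobiTheta₂_term, ← Real.exp_add, Real.exp_le_exp]
  have him : (z + 1 / 2 + τ / 2).im = z.im + τ.im / 2 := by
    simp [Complex.add_im]
  rw [him]
  have hk : (2 : ℝ) ≤ (k : ℝ) ^ 2 + k := by
    have : 2 ≤ k ^ 2 + k := by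
      rcases lt_or_gt_of_ne h0 with h | h
      · nlinarith [show k ≤ -2 by omega]
      · nlinarith
    exact_mod_cast this
  have h2 : -(k : ℝ) * z.im ≤ |(k : ℝ)| * S := by
    calc -(k : ℝ) * z.im ≤ |-(k : ℝ) * z.im| := le_abs_self _
      _ = |(k : ℝ)| * |z.im| := by rw [abs_mul, abs_neg]
      _ ≤ _ := by gcongr
  have h3 : -(k : ℝ) ≤ |(k : ℝ)| := neg_le_abs _
  have key : -(k : ℝ) ^ 2 * τ.im - 2 * k * (z.im + τ.im / 2) ≤
      -2 * (τ.im - 1) - (1 * (k : ℝ) ^ 2 - 2 * (S + 1 / 2) * |(k : ℝ)|) := by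
    nlinarith [mul_le_mul_of_nonneg_right hk (sub_nonneg.2 hτ)]
  calc -Real.pi * (k : ℝ) ^ 2 * τ.im - 2 * Real.pi * k * (z.im + τ.im / 2)
      = Real.pi * (-(k : ℝ) ^ 2 * τ.im - 2 * k * (z.im + τ.im / 2)) := by ring
    _ ≤ Real.pi * (-2 * (τ.im - 1) - (1 * (k : ℝ) ^ 2 - 2 * (S + 1 / 2) * |(k : ℝ)|)) := by gcongr
    _ = _ := by ring

/-- The theta function converges to `1 - e^{-2πiz}`. -/
theorem exists_norm_theta_sub_le (S : ℝ) : ∃ K : ℝ, 0 ≤ K ∧ ∀ z τ : ℂ, |z.im| ≤ S → 1 ≤ τ.im →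
    ‖theta τ z - (1 - cexp (-2 * Real.pi * I * z))‖ ≤ K * Real.exp (-2 * Real.pi * (τ.im - 1)) := by
  have hs := summable_pow_mul_jacobiTheta₂_term_bound (S + 1 / 2) one_pos 0
  simp only [pow_zero, one_mul] at hs
  refine ⟨∑' k : ℤ, Real.exp (-Real.pi * ((k : ℝ) ^ 2 - 2 * (S + 1 / 2) * (|k| : ℤ))),
    tsum_nonneg fun k => Real.exp_nonneg _, fun z τ hz hτ => ?_⟩
  have h1 := hasSum_jacobiTheta₂_term (z + 1 / 2 + τ / 2) (one_pos.trans_le hτ)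
  have h2 : HasSum (fun k : ℤ => if k = 0 then (1 : ℂ) else 0) 1 := hasSum_ite_eq 0 _
  have h3 : HasSum (fun k : ℤ => if k = -1 then -cexp (-2 * Real.pi * I * z) else 0)
    (-cexp (-2 * Real.pi * I * z)) := hasSum_ite_eq (-1) _
  have h4 := h1.sub (h2.add h3)
  rw [← sub_eq_add_neg] at h4
  rw [theta, ← h4.tsum_eq]
  refine tsum_of_norm_bounded (hs.hasSum.mul_right _) fun k => ?_
  by_cases hk0 : k = 0
  · subst hk0
    simp [jacobiTheta₂_term]
    positivity
  · by_cases hk1 : k = -1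
    · subst hk1
      have : jacobiTheta₂_term (-1) (z + 1 / 2 + τ / 2) τ = -cexp (-2 * Real.pi * I * z) := by
        rw [jacobiTheta₂_term]
        push_cast
        rw [show 2 * Real.pi * I * (-1) * (z + 1 / 2 + τ / 2) + Real.pi * I * (-1) ^ 2 * τ =
          -2 * Real.pi * I * z - Real.pi * I by ring, Complex.exp_sub, Complex.exp_pi_mul_I]
        ring
      rw [this]
      simp
      positivity
    · rw [if_neg hk0, if_neg hk1, add_zero, sub_zero, mul_comm]
      simpa using norm_theta_term_le hz hτ hk0 hk1

theorem exists_norm_theta_le (r : ℝ) : ∃ C : ℝ, 0 ≤ C ∧ ∀ z τ : ℂ, ‖z‖ ≤ r → 1 ≤ τ.im →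
    ‖theta τ z‖ ≤ C := by
  obtain ⟨K, hK, h⟩ := exists_norm_theta_sub_le r
  refine ⟨K + (1 + Real.exp (2 * Real.pi * r)), by positivity, fun z τ hz hτ => ?_⟩
  have him := (Complex.abs_im_le_norm z).trans hz
  have h1 := h z τ him hτ
  have h2 : K * Real.exp (-2 * Real.pi * (τ.im - 1)) ≤ K := by
    refine mul_le_of_le_one_right hK (Real.exp_le_one_iff.2 ?_)
    have := Real.pi_pos
    nlinarith
  have h3 : ‖1 - cexp (-2 * Real.pi * I * z)‖ ≤ 1 + Real.exp (2 * Real.pi * r) := by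
    refine (norm_sub_le _ _).trans ?_
    rw [norm_one, Complex.norm_exp]
    gcongr
    simp
    have := Real.pi_pos
    gcongr
    exact (le_abs_self _).trans him
  calc ‖theta τ z‖ = ‖(theta τ z - (1 - cexp (-2 * Real.pi * I * z))) +
        (1 - cexp (-2 * Real.pi * I * z))‖ := by rw [sub_add_cancel]
    _ ≤ _ := (norm_add_le _ _).trans (add_le_add (h1.trans h2) h3)

theorem isCompact_awayFromInt (r δ : ℝ) : IsCompact (awayFromInt r δ) := by
  have : awayFromInt r δ = Metric.closedBall 0 r ∩ ⋂ k : ℤ, {z : ℂ | δ ≤ ‖z - k‖} := by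
    ext z
    simp [awayFromInt]
  rw [this]
  refine (isCompact_closedBall 0 r).inter_right (isClosed_iInter fun k => ?_)
  exact isClosed_le continuous_const (by fun_prop)

/-- The limit `1 - exp(-2πiz)` vanishes at integers only, so it is bounded below on the compact set
`awayFromInt r δ`; the error tends to zero with `Im τ → ∞`. -/
theorem exists_le_norm_theta (r : ℝ) {δ : ℝ} (hδ : 0 < δ) : ∃ c T : ℝ, 0 < c ∧ 1 ≤ T ∧
    ∀ z ∈ awayFromInt r δ, ∀ τ : ℂ, T ≤ τ.im → c ≤ ‖theta τ z‖ := by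
  obtain ⟨c, hc, hcz⟩ : ∃ c : ℝ, 0 < c ∧
      ∀ z ∈ awayFromInt r δ, c ≤ ‖1 - cexp (-2 * Real.pi * I * z)‖ := by
    rcases (awayFromInt r δ).eq_empty_or_nonempty with h | h
    · exact ⟨1, one_pos, by simp [h]⟩
    · obtain ⟨z₀, hz₀, hmin⟩ := (isCompact_awayFromInt r δ).exists_isMinOn h
        (f := fun z => ‖1 - cexp (-2 * Real.pi * I * z)‖) (by fun_prop)
      refine ⟨_, norm_pos_iff.2 fun h0 => ?_, fun z hz => hmin hz⟩
      rw [sub_eq_zero, eq_comm, Complex.exp_eq_one_iff] at h0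
      obtain ⟨k, hk⟩ := h0
      have hpi : (2 * Real.pi * I : ℂ) ≠ 0 := Complex.two_pi_I_ne_zero
      have h1 : z₀ = ((-k : ℤ) : ℂ) := by
        push_cast
        refine mul_left_cancel₀ hpi ?_
        linear_combination -hk
      have := hz₀.2 (-k)
      rw [← h1, sub_self, norm_zero] at this
      linarith
  obtain ⟨K, hK, h⟩ := exists_norm_theta_sub_le r
  have hlim : Filter.Tendsto (fun t : ℝ => K * Real.exp (-2 * Real.pi * (t - 1))) Filter.atTop
      (𝓝 0) := by
    rw [← mul_zero K]
    refine Filter.Tendsto.const_mul K (Real.tendsto_exp_atBot.comp ?_)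
    refine Filter.Tendsto.const_mul_atTop_of_neg ?_
      (Filter.tendsto_atTop_add_const_right _ (-1) Filter.tendsto_id)
    have := Real.pi_pos
    linarith
  obtain ⟨T, hT⟩ := Filter.eventually_atTop.1 (hlim.eventually (ge_mem_nhds (half_pos hc)))
  refine ⟨c / 2, max T 1, half_pos hc, le_max_right _ _, fun z hz τ hτ => ?_⟩
  have h1 := h z τ ((Complex.abs_im_le_norm z).trans hz.1) ((le_max_right _ _).trans hτ)
  have h2 := hT τ.im ((le_max_left _ _).trans hτ)
  have h3 := hcz z hz
  have h4 := norm_sub_norm_le (1 - cexp (-2 * Real.pi * I * z)) (theta τ z)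
  rw [norm_sub_rev _ (theta τ z)] at h4
  linarith

variable {n : ℕ}

/-- The superpotential is bounded as `Im τ → ∞`. -/
theorem exists_norm_superpotential_le (n : ℕ) (r : ℝ) {δ : ℝ} (hδ : 0 < δ) :
    ∃ C T : ℝ, ∀ (u : ℂ) (v : Hyperplane n) (s z τ : ℂ), ‖u‖ ≤ r → (∀ i, ‖v.1 i‖ ≤ r) → ‖s‖ ≤ r →
      z ∈ awayFromInt r δ → z + ((n : ℂ) + 1) * s ∈ awayFromInt r δ → T ≤ τ.im →
      ‖superpotential (u, (v, s), τ) z‖ ≤ C := by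
  obtain ⟨C, hC, h1⟩ := exists_norm_theta_le (r + r + r)
  obtain ⟨c, T, hc, hT, h2⟩ := exists_le_norm_theta r hδ
  refine ⟨Real.exp (2 * Real.pi * r) * C ^ (n + 1) / (c ^ n * c), T,
    fun u v s z τ hu hv hs hz hzw hτ => ?_⟩
  rw [superpotential_eq, norm_div, norm_mul, norm_mul, norm_pow, norm_prod, Complex.norm_exp]
  have hpi := Real.pi_pos
  have e1 : (-2 * Real.pi * I * u).re ≤ 2 * Real.pi * r := by
    have : (-2 * Real.pi * I * u).re = 2 * Real.pi * u.im := by simp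
    rw [this]
    gcongr
    exact (le_abs_self _).trans ((Complex.abs_im_le_norm u).trans hu)
  have e2 : ∏ i, ‖theta τ (z - v.1 i + s)‖ ≤ C ^ (n + 1) := by
    calc ∏ i, ‖theta τ (z - v.1 i + s)‖ ≤ ∏ _i : Fin (n + 1), C := by
          refine Finset.prod_le_prod (fun i _ => norm_nonneg _) fun i _ => h1 _ _ ?_ (hT.trans hτ)
          exact (norm_add_le _ _).trans (add_le_add ((norm_sub_le _ _).trans
            (add_le_add hz.1 (hv i))) hs)
      _ = _ := by simp
  have e3 := h2 z hz τ hτ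
  have e4 := h2 _ hzw τ hτ
  refine div_le_div₀ (by positivity) (mul_le_mul (Real.exp_le_exp.2 e1) e2
    (Finset.prod_nonneg fun i _ => norm_nonneg _) (Real.exp_nonneg _)) (by positivity) ?_
  exact mul_le_mul (pow_le_pow_left₀ hc.le e3 n) e4 hc.le (by positivity)

theorem differentiableAt_superpotential {q : Space n × ℂ} (hτ : 0 < q.1.2.2.im)
    (h1 : (q.2, q.1.2.2) ∈ offLattice)
    (h2 : (q.2 + ((n : ℂ) + 1) * q.1.2.1.2, q.1.2.2) ∈ offLattice) :
    DifferentiableAt ℂ (fun q : Space n × ℂ => superpotential q.1 q.2) q := by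
  simp only [superpotential_eq]
  have hθ : ∀ g : Space n × ℂ → ℂ, DifferentiableAt ℂ g q →
      DifferentiableAt ℂ (fun q : Space n × ℂ => theta q.1.2.2 (g q)) q := fun g hg =>
    DifferentiableAt.comp (g := fun q : ℂ × ℂ => theta q.2 q.1)
      (f := fun q : Space n × ℂ => (g q, q.1.2.2)) q (differentiableAt_theta₂ hτ) (by fun_prop)
  have hc : ∀ i, DifferentiableAt ℂ (fun q : Space n × ℂ => q.1.2.1.1.1 i) q := fun i =>
    (differentiable_coord i _).comp q (f := fun q : Space n × ℂ => q.1.2.1.1) (by fun_prop)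
  have d1 := hθ (fun q => q.2) (by fun_prop)
  have d2 := hθ (fun q => q.2 + ((n : ℂ) + 1) * q.1.2.1.2) (by fun_prop)
  have d3 : ∀ i, DifferentiableAt ℂ
      (fun q : Space n × ℂ => theta q.1.2.2 (q.2 - q.1.2.1.1.1 i + q.1.2.1.2)) q := fun i =>
    hθ (fun q => q.2 - q.1.2.1.1.1 i + q.1.2.1.2) (by have := hc i; fun_prop)
  have d4 : DifferentiableAt ℂ
      (fun q : Space n × ℂ => ∏ i, theta q.1.2.2 (q.2 - q.1.2.1.1.1 i + q.1.2.1.2)) q := by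
    fun_prop
  have hne : theta q.1.2.2 q.2 ^ n * theta q.1.2.2 (q.2 + ((n : ℂ) + 1) * q.1.2.1.2) ≠ 0 :=
    mul_ne_zero (pow_ne_zero _ h1.2) h2.2
  have d5 : DifferentiableAt ℂ (fun q : Space n × ℂ => cexp (-2 * Real.pi * I * q.1.1)) q := by
    fun_prop
  have d6 := d5.fun_mul d4
  have d7 := (d1.fun_pow n).fun_mul d2
  simp only [div_eq_mul_inv]
  exact d6.fun_mul (d7.fun_inv hne)

/-! ### Elliptic functions -/

section Elliptic

open Filter

theorem exists_differentiable_extension {f : ℂ → ℂ} {S : Set ℂ}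
    (hd : ∀ z ∉ S, DifferentiableAt ℂ f z) (hS : ∀ a, ∀ᶠ z in 𝓝[≠] a, z ∉ S)
    (hb : ∀ a ∈ S, ∃ C : ℝ, ∀ᶠ z in 𝓝[≠] a, ‖f z‖ ≤ C) :
    ∃ F : ℂ → ℂ, Differentiable ℂ F ∧ ∀ z ∉ S, F z = f z := by
  have hval : ∀ z ∉ S, limUnder (𝓝[≠] z) f = f z := fun z hz =>
    ((hd z hz).continuousAt.tendsto.mono_left nhdsWithin_le_nhds).limUnder_eq
  refine ⟨fun z => limUnder (𝓝[≠] z) f, fun a => ?_, hval⟩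
  have hb' : ∃ C : ℝ, ∀ᶠ z in 𝓝[≠] a, ‖f z‖ ≤ C := by
    by_cases ha : a ∈ S
    · exact hb a ha
    · refine ⟨‖f a‖ + 1, nhdsWithin_le_nhds ?_⟩
      exact (hd a ha).continuousAt.norm.eventually (ge_mem_nhds (lt_add_one _))
  obtain ⟨C, hC⟩ := hb'
  obtain ⟨g, hg, hfg⟩ := exists_analyticAt_of_bounded ((hS a).mono fun z hz => hd z hz) hC
  have hga : limUnder (𝓝[≠] a) f = g a :=
    (hg.continuousAt.tendsto.mono_left nhdsWithin_le_nhds |>.congr'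
      (hfg.mono fun z hz => hz.symm)).limUnder_eq
  refine hg.differentiableAt.congr_of_eventuallyEq ?_
  have h1 : ∀ᶠ z in 𝓝[≠] a, limUnder (𝓝[≠] z) f = g z := by
    filter_upwards [hfg, hS a] with z hz hzS
    rw [hval z hzS, hz]
  rw [eventually_nhdsWithin_iff] at h1
  filter_upwards [h1] with z hz
  by_cases hza : z = a
  · rw [hza, hga]
  · exact hz hza

theorem tendsto_sub_punctured (a l : ℂ) : Tendsto (fun z => z - l) (𝓝[≠] a) (𝓝[≠] (a - l)) := by
  refine tendsto_nhdsWithin_of_tendsto_nhds_of_eventually_within _ ?_ ?_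
  · exact (continuous_sub_right l).continuousAt.tendsto.mono_left nhdsWithin_le_nhds
  · filter_upwards [self_mem_nhdsWithin] with z hz h
    exact hz (sub_left_injective h)

theorem exists_norm_le_of_tendsto {f : ℂ → ℂ} {l : Filter ℂ} {b : ℂ} (h : Tendsto f l (𝓝 b)) :
    ∃ C : ℝ, ∀ᶠ z in l, ‖f z‖ ≤ C :=
  ⟨‖b‖ + 1, h.norm.eventually (ge_mem_nhds (lt_add_one _))⟩

theorem tendsto_div_sub {f : ℂ → ℂ} {a : ℂ} (hf : DifferentiableAt ℂ f a) :
    Tendsto (fun z => (f z - f a) / (z - a)) (𝓝[≠] a) (𝓝 (deriv f a)) := by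
  have h := hasDerivAt_iff_tendsto_slope.1 hf.hasDerivAt
  refine h.congr fun z => ?_
  rw [slope_def_field]

variable {τ : ℂ}

theorem half_notMem (hτ : 0 < τ.im) : (1 / 2 : ℂ) ∉ (periods τ hτ).lattice := by
  have := notMem_lattice_of_real hτ (x := 1 / 2) (by norm_num) (by norm_num)
  push_cast at this
  exact this

theorem half_sub_half_tau_notMem (hτ : 0 < τ.im) : 1 / 2 - τ / 2 ∉ (periods τ hτ).lattice := by
  intro h
  obtain ⟨a, b, hab⟩ := mem_periods.1 h
  have him := congrArg Complex.im hab
  simp at him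
  have h2 : (-1 / 2 : ℝ) = b := mul_right_cancel₀ hτ.ne' (by linarith)
  have h3 : (-1 : ℝ) = 2 * b := by linarith
  have h4 : (-1 : ℤ) = 2 * b := by exact_mod_cast h3
  omega

/-- The symmetrised function `H(z) + exp(-2πiz) H(-z)` has the same multipliers, hence degree one,
but vanishes at the two half periods `1/2` and `τ/2`. So it is zero, and its value at `0` is `2
H(0)`. -/
theorem apply_zero_of_isQuasiperiodic (hτ : 0 < τ.im) {H : ℂ → ℂ} (hd : Differentiable ℂ H)
    (hH : IsQuasiperiodic τ (-cexp (-2 * Real.pi * I * τ)) 1 H) : H 0 = 0 := by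
  set K : ℂ → ℂ := fun z => H z + cexp (-(2 * Real.pi * I * z)) * H (-z) with hK
  have hKd : Differentiable ℂ K := by
    have : Differentiable ℂ fun z => H (-z) := hd.comp (by fun_prop)
    fun_prop
  have hadd : ∀ z, H (z + τ) = -cexp (-(2 * Real.pi * I * (z + τ))) * H z := by
    intro z
    have e : cexp (-(2 * Real.pi * I * (z + τ))) =
        cexp (-2 * Real.pi * I * τ) * cexp (-2 * Real.pi * I * ((1 : ℤ) : ℂ) * z) := by
      rw [← Complex.exp_add]
      congr 1
      push_cast
      ring
    rw [hH.add_tau, e]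
    ring
  have hKq : IsQuasiperiodic τ (-cexp (-2 * Real.pi * I * τ)) 1 K := by
    constructor
    · intro z
      have h1 := hH.add_one (-(z + 1))
      rw [show -(z + 1) + 1 = -z by ring] at h1
      simp only [hK]
      rw [hH.add_one, ← h1, show -(2 * Real.pi * I * (z + 1)) =
        -(2 * Real.pi * I * z) + 2 * Real.pi * I * ((-1 : ℤ) : ℂ) by push_cast; ring,
        Complex.exp_add, exp_two_pi_int, mul_one]
    · intro z
      have h1 := hadd (-(z + τ))
      rw [show -(z + τ) + τ = -z by ring, show -(2 * Real.pi * I * -z) = 2 * Real.pi * I * z by ring]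
        at h1
      simp only [hK]
      rw [h1, hadd, show (-2 * Real.pi * I * ((1 : ℤ) : ℂ) * z : ℂ) = -(2 * Real.pi * I * z) by
        push_cast; ring, show (-2 * Real.pi * I * τ : ℂ) = -(2 * Real.pi * I * τ) by ring,
        mul_add, neg_add, Complex.exp_add, Complex.exp_neg (2 * Real.pi * I * z)]
      have := Complex.exp_ne_zero (2 * Real.pi * I * z)
      field_simp
      ring
  have h0 := hKq.eq_zero hτ {1 / 2, τ / 2} (by
    intro a ha b hb hab
    simp only [Finset.mem_insert, Finset.mem_singleton] at ha hb
    rcases ha with rfl | rfl <;> rcases hb with rfl | rfl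
    · exact absurd rfl hab
    · exact half_sub_half_tau_notMem hτ
    · rw [← neg_mem_iff, neg_sub]
      exact half_sub_half_tau_notMem hτ
    · exact absurd rfl hab) (by simp) (by
    rw [Finset.card_pair]
    · norm_num
    · intro h
      exact half_sub_half_tau_notMem hτ (by rw [h, sub_self]; exact zero_mem _)) hKd (by
    intro a ha
    simp only [Finset.mem_insert, Finset.mem_singleton] at ha
    rcases ha with rfl | rfl
    · have h1 := hH.add_one (-(1 / 2))
      rw [show (-(1 / 2) + 1 : ℂ) = 1 / 2 by norm_num] at h1
      simp only [hK]
      rw [h1, show -(2 * Real.pi * I * (1 / 2 : ℂ)) = -(Real.pi * I) by ring, Complex.exp_neg,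
        Complex.exp_pi_mul_I]
      norm_num
    · have h1 := hadd (-(τ / 2))
      rw [show (-(τ / 2) + τ : ℂ) = τ / 2 by ring] at h1
      simp only [hK]
      rw [h1]
      ring)
  have h1 := congrFun h0 0
  simp only [hK] at h1
  simpa using h1

/-- With `c` fitted at `1/2`, the difference `H - c θ` has degree one and two incongruent zeros, `0`
and `1/2`. -/
theorem eq_const_mul_theta (hτ : 0 < τ.im) {H : ℂ → ℂ} (hd : Differentiable ℂ H)
    (hH : IsQuasiperiodic τ (-cexp (-2 * Real.pi * I * τ)) 1 H) :
    ∃ c : ℂ, ∀ z, H z = c * theta τ z := by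
  have hθ : theta τ (1 / 2) ≠ 0 := fun h => half_notMem hτ ((theta_eq_zero_iff hτ).1 h)
  set c := H (1 / 2) / theta τ (1 / 2) with hc
  have hq := theta_isQuasiperiodic τ
  have h0 := IsQuasiperiodic.eq_zero (g := fun z => H z - c * theta τ z) hτ {0, 1 / 2} (by
    intro a ha b hb hab
    simp only [Finset.mem_insert, Finset.mem_singleton] at ha hb
    rcases ha with rfl | rfl <;> rcases hb with rfl | rfl
    · exact absurd rfl hab
    · rw [zero_sub, neg_mem_iff]
      exact half_notMem hτ
    · rw [sub_zero]
      exact half_notMem hτ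
    · exact absurd rfl hab) (C := -cexp (-2 * Real.pi * I * τ)) (by simp) (d := 1) (by
    rw [Finset.card_pair (by norm_num)]
    norm_num) (hd.sub ((differentiable_theta hτ).const_mul c))
    ⟨fun z => by rw [hH.add_one, hq.add_one], fun z => by rw [hH.add_tau, hq.add_tau]; ring⟩ (by
    intro a ha
    simp only [Finset.mem_insert, Finset.mem_singleton] at ha
    rcases ha with rfl | rfl
    · rw [apply_zero_of_isQuasiperiodic hτ hd hH, theta_zero]
      ring
    · rw [hc, div_mul_cancel₀ _ hθ, sub_self])
  exact ⟨c, fun z => sub_eq_zero.1 (congrFun h0 z)⟩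

/-- The points `z` with `z` or `z + w` in the lattice. -/
def poleSet (L : PeriodPair) (w : ℂ) : Set ℂ := {z | z ∈ L.lattice ∨ z + w ∈ L.lattice}

theorem eventually_notMem_lattice (L : PeriodPair) (a : ℂ) : ∀ᶠ z in 𝓝[≠] a, z ∉ L.lattice := by
  filter_upwards [nhdsWithin_le_nhds (L.compl_lattice_sdiff_singleton_mem_nhds a),
    self_mem_nhdsWithin] with z h1 h2 h3
  exact h1 ⟨h3, h2⟩

theorem eventually_notMem_poleSet (L : PeriodPair) (w a : ℂ) :
    ∀ᶠ z in 𝓝[≠] a, z ∉ poleSet L w := by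
  have h1 := (tendsto_sub_punctured a (-w)).eventually (eventually_notMem_lattice L (a - -w))
  filter_upwards [eventually_notMem_lattice L a, h1] with z h2 h3
  rw [sub_neg_eq_add] at h3
  exact fun h => h.elim h2 h3

theorem countable_poleSet (L : PeriodPair) (w : ℂ) : (poleSet L w).Countable := by
  have : poleSet L w = (L.lattice : Set ℂ) ∪ (fun z => z + w) ⁻¹' (L.lattice : Set ℂ) := rfl
  rw [this]
  exact (countable_coe_lattice L).union ((countable_coe_lattice L).preimage (add_left_injective w))

theorem add_notMem_poleSet {L : PeriodPair} {w z l : ℂ} (hz : z ∉ poleSet L w) (hl : l ∈ L.lattice) :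
    z + l ∉ poleSet L w := by
  rintro (h | h)
  · exact hz (Or.inl (by simpa using sub_mem h hl))
  · refine hz (Or.inr ?_)
    have := sub_mem h hl
    rwa [show z + l + w - l = z + w by ring] at this

/-- Holomorphic and periodic functions off the pole set. -/
structure IsEllipticFun (L : PeriodPair) (w : ℂ) (f : ℂ → ℂ) : Prop where
  diff : ∀ z ∉ poleSet L w, DifferentiableAt ℂ f z
  per : ∀ z ∉ poleSet L w, ∀ l ∈ L.lattice, f (z + l) = f z

theorem IsEllipticFun.add_const_mul {L : PeriodPair} {w : ℂ} {f g : ℂ → ℂ}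
    (hf : IsEllipticFun L w f) (hg : IsEllipticFun L w g) (c : ℂ) :
    IsEllipticFun L w fun z => f z + c * g z where
  diff z hz := (hf.diff z hz).add ((hg.diff z hz).const_mul c)
  per z hz l hl := by rw [hf.per z hz l hl, hg.per z hz l hl]

theorem exists_norm_theta_le_mul (hτ : 0 < τ.im) {l : ℂ} (hl : l ∈ (periods τ hτ).lattice) :
    ∃ C : ℝ, ∀ᶠ z in 𝓝[≠] l, ‖theta τ z / (z - l)‖ ≤ C := by
  have h := tendsto_div_sub (differentiable_theta hτ l)
  rw [theta_eq_zero_of_mem hτ hl] at h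
  simp only [sub_zero] at h
  exact exists_norm_le_of_tendsto h

/-- An elliptic function cannot have a single simple pole: the product with `θ` is entire with the
multipliers of `θ`, hence a multiple of `θ`. -/
theorem IsEllipticFun.eq_const (hτ : 0 < τ.im) {w : ℂ} {f : ℂ → ℂ}
    (hf : IsEllipticFun (periods τ hτ) w f) {C₀ C₁ : ℝ} (h0 : ∀ᶠ z in 𝓝[≠] 0, ‖z * f z‖ ≤ C₀)
    (h1 : ∀ᶠ z in 𝓝[≠] (-w), ‖f z‖ ≤ C₁) :
    ∃ c : ℂ, ∀ z ∉ poleSet (periods τ hτ) w, f z = c := by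
  have hθ := differentiable_theta hτ
  obtain ⟨F, hF, hFf⟩ := exists_differentiable_extension (f := fun z => theta τ z * f z)
    (S := poleSet (periods τ hτ) w) (fun z hz => (hθ z).mul (hf.diff z hz))
    (eventually_notMem_poleSet _ w) (by
      intro a ha
      by_cases ha' : a ∈ (periods τ hτ).lattice
      · obtain ⟨C, hC⟩ := exists_norm_theta_le_mul hτ ha'
        have h2 : Tendsto (fun z => z - a) (𝓝[≠] a) (𝓝[≠] 0) := by
          simpa using tendsto_sub_punctured a a
        refine ⟨C * C₀, ?_⟩
        filter_upwards [hC, h2.eventually h0, eventually_notMem_poleSet _ w a,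
          self_mem_nhdsWithin] with z h3 h4 h5 h6
        have h7 : z - a ≠ 0 := sub_ne_zero.2 h6
        have h8 := hf.per z h5 (-a) (neg_mem ha')
        rw [← sub_eq_add_neg] at h8
        rw [h8] at h4
        calc ‖theta τ z * f z‖ = ‖theta τ z / (z - a)‖ * ‖(z - a) * f z‖ := by
              rw [← norm_mul]; congr 1; field_simp
          _ ≤ C * C₀ := mul_le_mul h3 h4 (norm_nonneg _) ((norm_nonneg _).trans h3)
      · have ha2 : a + w ∈ (periods τ hτ).lattice := ha.resolve_left ha'
        have h2 := tendsto_sub_punctured a (a + w)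
        rw [sub_add_cancel_left] at h2
        obtain ⟨C, hC⟩ := exists_norm_le_of_tendsto
          ((hθ a).continuousAt.tendsto.mono_left (nhdsWithin_le_nhds (s := {a}ᶜ)))
        refine ⟨C * C₁, ?_⟩
        filter_upwards [hC, h2.eventually h1, eventually_notMem_poleSet _ w a] with z h3 h4 h5
        have h8 := hf.per z h5 (-(a + w)) (neg_mem ha2)
        rw [← sub_eq_add_neg] at h8
        rw [h8] at h4
        rw [norm_mul]
        exact mul_le_mul h3 h4 (norm_nonneg _) ((norm_nonneg _).trans h3))
  have hone : (1 : ℂ) ∈ (periods τ hτ).lattice := mem_periods.2 ⟨1, 0, by simp⟩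
  have htau : τ ∈ (periods τ hτ).lattice := mem_periods.2 ⟨0, 1, by simp⟩
  have hq := theta_isQuasiperiodic τ
  have hcont : ∀ x : ℂ, Continuous fun z => F (z + x) := fun x => hF.continuous.comp (by fun_prop)
  have hFq : IsQuasiperiodic τ (-cexp (-2 * Real.pi * I * τ)) 1 F := by
    refine ⟨congrFun (eq_of_eq_off_countable (hcont 1) hF.continuous
      (countable_poleSet (periods τ hτ) w)
      fun z hz => ?_), congrFun (eq_of_eq_off_countable (hcont τ) ?_
      (countable_poleSet (periods τ hτ) w)
      fun z hz => ?_)⟩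
    · rw [hFf _ (add_notMem_poleSet hz hone), hFf z hz, hq.add_one, hf.per z hz 1 hone]
    · have := hF.continuous
      fun_prop
    · rw [hFf _ (add_notMem_poleSet hz htau), hFf z hz, hq.add_tau, hf.per z hz τ htau, mul_assoc]
  obtain ⟨c, hc⟩ := eq_const_mul_theta hτ hF hFq
  refine ⟨c, fun z hz => ?_⟩
  have h2 := hFf z hz
  rw [hc, mul_comm] at h2
  refine (mul_left_cancel₀ ?_ h2).symm
  exact fun h => hz (Or.inl ((theta_eq_zero_iff hτ).1 h))

/-! ### Principal parts of the basis functions -/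

/-- Leading coefficients at `0`. -/
def basisCoeff : ℕ → ℂ
  | 0 => 0
  | 1 => 1
  | j + 2 => (-1) ^ j * (j + 1).factorial

/-- The basis functions without their poles at `0`. -/
def basisRest (L : PeriodPair) (w z : ℂ) : ℕ → ℂ
  | 0 => 1
  | 1 => zetaRest L z - weierstrassZeta L (z + w) + weierstrassZeta L w
  | j + 2 => -iteratedDeriv (j + 1) (zetaRest L) z

theorem basisCoeff_ne_zero {j : ℕ} (hj : j ≠ 0) : basisCoeff j ≠ 0 := by
  match j with
  | 1 => exact one_ne_zero
  | j + 2 =>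
    exact mul_ne_zero (pow_ne_zero _ (by norm_num)) (Nat.cast_ne_zero.2 (Nat.factorial_ne_zero _))

variable {L : PeriodPair}

theorem analyticAt_zetaRest {z : ℂ} (hz : z ∈ ((L.lattice : Set ℂ) \ {0})ᶜ) :
    AnalyticAt ℂ (zetaRest L) z :=
  (differentiableOn_zetaRest L).analyticAt (L.isOpen_compl_lattice_sdiff.mem_nhds hz)

theorem basisFun_eq {w z : ℂ} (hz : z ∉ L.lattice) (j : ℕ) :
    basisFun L w z j = basisCoeff j / z ^ j + basisRest L w z j := by
  match j with
  | 0 => simp [basisFun, basisCoeff, basisRest]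
  | 1 =>
    simp only [basisFun, basisCoeff, basisRest, weierstrassZeta_eq L z, pow_one]
    ring
  | j + 2 =>
    have h0 := ne_zero_of_notMem L hz
    simp only [basisFun, basisCoeff, basisRest]
    rw [iteratedDeriv_weierstrassP_eq L j hz, funext (weierstrassZeta_eq L), iteratedDeriv_fun_add]
    · have h1 : iteratedDeriv (j + 1) (fun z : ℂ => 1 / z) z =
          (-1) ^ (j + 1) * (j + 1).factorial / z ^ (j + 2) := by
        simp only [one_div]
        rw [iteratedDeriv_eq_iterate]
        refine (iter_deriv_inv (j + 1) z).trans ?_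
        rw [div_eq_mul_inv, ← zpow_natCast z (j + 2), ← zpow_neg]
        congr 2
        push_cast
        ring
      rw [h1, pow_succ]
      ring
    · have h1 : AnalyticAt ℂ (fun z : ℂ => 1 / z) z := analyticAt_const.div analyticAt_id h0
      exact h1.contDiffAt
    · exact (analyticAt_zetaRest (mem_compl_of_notMem L hz)).contDiffAt

theorem differentiableAt_basisRest {w z : ℂ} (hz : z ∈ ((L.lattice : Set ℂ) \ {0})ᶜ)
    (hzw : z + w ∉ L.lattice) (j : ℕ) : DifferentiableAt ℂ (fun z => basisRest L w z j) z := by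
  match j with
  | 0 => exact differentiableAt_const _
  | 1 =>
    have h1 := differentiableAt_zetaRest L hz
    have h2 : DifferentiableAt ℂ (fun z => weierstrassZeta L (z + w)) z :=
      DifferentiableAt.comp (g := weierstrassZeta L) (f := fun z => z + w) z
        (differentiableAt_weierstrassZeta L hzw) (by fun_prop)
    exact (h1.sub h2).add_const _
  | j + 2 =>
    have h1 := (analyticAt_zetaRest hz).iterated_deriv (j + 1)
    simp only [basisRest, iteratedDeriv_eq_iterate]
    exact h1.differentiableAt.neg

/-- For `j = 1` the quasi-periods of `ζ(z)` and `ζ(z + w)` cancel. -/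
theorem isEllipticFun_basisFun (w : ℂ) (j : ℕ) :
    IsEllipticFun L w fun z => basisFun L w z j where
  diff z hz := by
    have h1 : z ∉ L.lattice := fun h => hz (Or.inl h)
    have h2 := differentiableAt_basisRest (mem_compl_of_notMem L h1) (fun h => hz (Or.inr h)) j
    have h3 : z ^ j ≠ 0 := pow_ne_zero _ (ne_zero_of_notMem L h1)
    have h4 : DifferentiableAt ℂ (fun z => basisCoeff j / z ^ j + basisRest L w z j) z := by
      have h5 : DifferentiableAt ℂ (fun z : ℂ => basisCoeff j / z ^ j) z := by
        fun_prop (disch := assumption)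
      exact h5.add h2
    refine h4.congr_of_eventuallyEq ?_
    filter_upwards [(isOpen_compl_lattice L).mem_nhds h1] with x hx
    exact basisFun_eq hx j
  per z hz l hl := by
    match j with
    | 0 => rfl
    | 1 =>
      obtain ⟨η, hη⟩ := exists_weierstrassZeta_add L hl
      simp only [basisFun]
      rw [show z + l + w = z + w + l by ring, hη z fun h => hz (Or.inl h),
        hη (z + w) fun h => hz (Or.inr h)]
      ring
    | j + 2 =>
      simp only [basisFun]
      have h1 : (fun z => L.weierstrassP (z + l)) = L.weierstrassP :=
        funext fun z => L.weierstrassP_add_coe z ⟨l, hl⟩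
      have h2 := congrFun (iteratedDeriv_comp_add_const j L.weierstrassP l) z
      rw [h1] at h2
      exact h2.symm

/-- `basisFun` only depends on `w` modulo the lattice. -/
theorem basisFun_add_lattice {w l : ℂ} (hw : w ∉ L.lattice) (hl : l ∈ L.lattice) {z : ℂ}
    (hz : z + w ∉ L.lattice) (j : ℕ) : basisFun L (w + l) z j = basisFun L w z j := by
  match j with
  | 0 => rfl
  | 1 =>
    obtain ⟨η, hη⟩ := exists_weierstrassZeta_add L hl
    simp only [basisFun]
    rw [← add_assoc, hη _ hz, hη _ hw]
    ring
  | j + 2 => rfl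

/-! ### The expansion -/

/-- The coefficient `c` cancels the leading term of the pole of `f` against `κ / z^(N+1)`, which
lowers the order of the pole by one. -/
theorem exists_bound_sub_pole {f r : ℂ → ℂ} {κ : ℂ} (hκ : κ ≠ 0) {N : ℕ} {C : ℝ}
    (hd : ∀ᶠ z in 𝓝[≠] 0, DifferentiableAt ℂ f z)
    (hf : ∀ᶠ z in 𝓝[≠] 0, ‖z ^ (N + 1) * f z‖ ≤ C) (hr : ContinuousAt r 0) :
    ∃ (c : ℂ) (C' : ℝ), ∀ᶠ z in 𝓝[≠] 0, ‖z ^ N * (f z + c * (κ / z ^ (N + 1) + r z))‖ ≤ C' := by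
  obtain ⟨g, hg, hfg⟩ := exists_analyticAt_of_bounded (f := fun z => z ^ (N + 1) * f z)
    (hd.mono fun z hz => by fun_prop) hf
  refine ⟨-(g 0 / κ), ?_⟩
  have h1 := tendsto_div_sub hg.differentiableAt
  have h2 : ContinuousAt (fun z => z ^ N * (-(g 0 / κ) * r z)) 0 := by fun_prop
  have h3 := h1.add (h2.tendsto.mono_left (nhdsWithin_le_nhds (s := {0}ᶜ)))
  obtain ⟨C', hC'⟩ := exists_norm_le_of_tendsto h3
  refine ⟨C', ?_⟩
  filter_upwards [hC', hfg, self_mem_nhdsWithin] with z h4 h5 h6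
  have hz : z ≠ 0 := h6
  refine le_of_eq_of_le ?_ h4
  congr 1
  rw [← h5, sub_zero]
  field_simp
  ring

theorem continuousAt_basisRest {w : ℂ} (hw : w ∉ L.lattice) (j : ℕ) :
    ContinuousAt (fun z => basisRest L w z j) 0 :=
  (differentiableAt_basisRest (by simp) (by simpa using hw) j).continuousAt

/-- Induction on the order of the pole at `0`: a multiple of `℘^(N)` removes a pole of order `N +
2`. What is left at the end has at most a simple pole and is constant. -/
theorem exists_expansion_of_bounded (hτ : 0 < τ.im) {w : ℂ} (hw : w ∉ (periods τ hτ).lattice)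
    (N : ℕ) {f : ℂ → ℂ} (hf : IsEllipticFun (periods τ hτ) w f) {C₀ C₁ : ℝ}
    (h0 : ∀ᶠ z in 𝓝[≠] 0, ‖z ^ (N + 1) * f z‖ ≤ C₀) (h1 : ∀ᶠ z in 𝓝[≠] (-w), ‖f z‖ ≤ C₁) :
    ∃ (c : ℂ) (a : ℕ → ℂ), ∀ z ∉ poleSet (periods τ hτ) w, f z = c +
      ∑ j ∈ Finset.range N, a j * basisFun (periods τ hτ) w z (j + 2) := by
  induction N generalizing f C₀ C₁ with
  | zero =>
    obtain ⟨c, hc⟩ := hf.eq_const hτ (by simpa using h0) h1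
    exact ⟨c, 0, fun z hz => by simpa using hc z hz⟩
  | succ N ih =>
    set L := periods τ hτ
    have hb := isEllipticFun_basisFun (L := L) w (N + 2)
    have hbeq : ∀ᶠ z in 𝓝[≠] (0 : ℂ), basisFun L w z (N + 2) =
        basisCoeff (N + 2) / z ^ (N + 1 + 1) + basisRest L w z (N + 2) := by
      filter_upwards [eventually_notMem_lattice L 0] with z hz
      exact basisFun_eq hz (N + 2)
    obtain ⟨c, C', h2⟩ := exists_bound_sub_pole (basisCoeff_ne_zero (j := N + 2) (by omega))
      ((eventually_notMem_poleSet L w 0).mono fun z hz => hf.diff z hz) h0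
      (continuousAt_basisRest hw (N + 2))
    have hbw : ContinuousAt (fun z => basisFun L w z (N + 2)) (-w) := by
      have h3 : -w ∉ L.lattice := fun h => hw (neg_mem_iff.1 h)
      have h4 : ContinuousAt (fun z => -iteratedDeriv (N + 1) (weierstrassZeta L) z) (-w) := by
        have h5 : AnalyticAt ℂ (weierstrassZeta L) (-w) := by
          refine DifferentiableOn.analyticAt (s := (L.lattice : Set ℂ)ᶜ) (fun z hz => ?_)
            ((isOpen_compl_lattice L).mem_nhds h3)
          exact (differentiableAt_weierstrassZeta L hz).differentiableWithinAt
        rw [iteratedDeriv_eq_iterate]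
        exact (h5.iterated_deriv (N + 1)).continuousAt.neg
      refine h4.congr ?_
      filter_upwards [(isOpen_compl_lattice L).mem_nhds h3] with z hz
      exact (iteratedDeriv_weierstrassP_eq L N hz).symm
    obtain ⟨C₂, hC₂⟩ := exists_norm_le_of_tendsto
      (hbw.tendsto.mono_left (nhdsWithin_le_nhds (s := {-w}ᶜ)))
    obtain ⟨c', a, ha⟩ := ih (hf.add_const_mul hb c) (C₀ := C') (C₁ := C₁ + ‖c‖ * C₂) (by
      filter_upwards [h2, hbeq] with z h3 h4
      rwa [h4]) (by
      filter_upwards [h1, hC₂] with z h3 h4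
      refine (norm_add_le _ _).trans (add_le_add h3 ?_)
      rw [norm_mul]
      gcongr)
    refine ⟨c', Function.update a N (-c), fun z hz => ?_⟩
    rw [Finset.sum_range_succ, Function.update_self]
    have h3 : ∑ j ∈ Finset.range N, Function.update a N (-c) j * basisFun L w z (j + 2) =
        ∑ j ∈ Finset.range N, a j * basisFun L w z (j + 2) :=
      Finset.sum_congr rfl fun j hj => by
        rw [Function.update_of_ne (Finset.mem_range.1 hj).ne]
    rw [h3]
    linear_combination ha z hz

/-- Among the basis functions only the one with `j = 1` has a pole at `-w`, so it is used first to
remove the pole there. The simple pole at `0` that this brings in does no harm because `n ≥ 1`. -/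
theorem exists_expansion (hτ : 0 < τ.im) {w : ℂ} (hw : w ∉ (periods τ hτ).lattice)
    {n : ℕ} (hn : 1 ≤ n) {f : ℂ → ℂ} (hf : IsEllipticFun (periods τ hτ) w f) {C₀ C₁ : ℝ}
    (h0 : ∀ᶠ z in 𝓝[≠] 0, ‖z ^ n * f z‖ ≤ C₀)
    (h1 : ∀ᶠ z in 𝓝[≠] (-w), ‖(z + w) * f z‖ ≤ C₁) :
    ∃ φ : Fin (n + 1) → ℂ, ∀ z ∉ poleSet (periods τ hτ) w,
      f z = ∑ j : Fin (n + 1), φ j * basisFun (periods τ hτ) w z j := by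
  obtain ⟨N, rfl⟩ : ∃ N, n = N + 1 := ⟨n - 1, by omega⟩
  set L := periods τ hτ
  have hb := isEllipticFun_basisFun (L := L) w 1
  obtain ⟨g, hg, hfg⟩ := exists_analyticAt_of_bounded (f := fun z => (z + w) * f z)
    ((eventually_notMem_poleSet L w (-w)).mono fun z hz => by
      have := hf.diff z hz
      fun_prop) h1
  set c := g (-w) with hc
  have hrw : ContinuousAt (fun z => weierstrassZeta L z - zetaRest L (z + w) + weierstrassZeta L w)
      (-w) := by
    have h3 := (differentiableAt_weierstrassZeta L
      (fun h => hw (neg_mem_iff.1 h) : -w ∉ L.lattice)).continuousAt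
    have h4 : ContinuousAt (fun z => zetaRest L (z + w)) (-w) :=
      ContinuousAt.comp (g := zetaRest L) (f := fun z => z + w)
        (by rw [neg_add_cancel]; exact (analyticAt_zetaRest_zero L).continuousAt) (by fun_prop)
    exact (h3.sub h4).add continuousAt_const
  have h2 := tendsto_div_sub hg.differentiableAt
  obtain ⟨C₂, hC₂⟩ := exists_norm_le_of_tendsto
    (h2.add ((hrw.const_smul c).tendsto.mono_left (nhdsWithin_le_nhds (s := {-w}ᶜ))))
  obtain ⟨C₃, hC₃⟩ := exists_norm_le_of_tendsto
    ((continuousAt_basisRest hw 1).tendsto.mono_left (nhdsWithin_le_nhds (s := {0}ᶜ)))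
  have hball : ∀ᶠ z in 𝓝[≠] (0 : ℂ), ‖z‖ ≤ 1 :=
    nhdsWithin_le_nhds (continuous_norm.continuousAt.eventually (ge_mem_nhds (by simp)))
  obtain ⟨c', a, ha⟩ := exists_expansion_of_bounded hτ hw N (hf.add_const_mul hb c)
    (C₀ := C₀ + ‖c‖ * (1 + C₃)) (C₁ := C₂) (by
      filter_upwards [h0, hC₃, hball, eventually_notMem_lattice L 0] with z h3 h4 h5 h6
      have h7 := ne_zero_of_notMem L h6
      rw [mul_add]
      refine (norm_add_le _ _).trans (add_le_add h3 ?_)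
      rw [basisFun_eq h6 1, mul_left_comm, norm_mul]
      gcongr
      rw [mul_add]
      refine (norm_add_le _ _).trans (add_le_add ?_ ?_)
      · rw [pow_one, pow_succ, basisCoeff, mul_assoc, mul_one_div_cancel h7, mul_one, norm_pow]
        exact pow_le_one₀ (norm_nonneg _) h5
      · rw [norm_mul, norm_pow]
        exact (mul_le_of_le_one_left (norm_nonneg _) (pow_le_one₀ (norm_nonneg _) h5)).trans h4)
    (by
      filter_upwards [hC₂, hfg, self_mem_nhdsWithin] with z h3 h4 h5
      have h6 : z + w ≠ 0 := fun h => h5 (eq_neg_of_add_eq_zero_left h)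
      refine le_of_eq_of_le ?_ h3
      congr 1
      simp only [basisFun, weierstrassZeta_eq L (z + w), Pi.smul_apply, smul_eq_mul]
      rw [← h4, sub_neg_eq_add]
      field_simp
      rw [hc]
      ring)
  refine ⟨Fin.cons c' (Fin.cons (-c) fun j => a j), fun z hz => ?_⟩
  rw [Fin.sum_univ_succ, Fin.sum_univ_succ]
  simp only [Fin.cons_zero, Fin.cons_succ, Fin.val_zero, Fin.val_succ]
  have h3 := ha z hz
  rw [Finset.sum_range] at h3
  have h4 : basisFun L w z 0 = 1 := rfl
  rw [h4]
  linear_combination h3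

end Elliptic

/-! ### The coefficients of an expansion -/

section Coefficients

open Filter Metric

variable {L : PeriodPair} {w : ℂ} {ρ : ℝ}

/-- The closed disc of radius `ρ` meets the poles of the basis functions in `0` only. -/
def IsPoleFreeDisc (L : PeriodPair) (w : ℂ) (ρ : ℝ) : Prop :=
  0 < ρ ∧ ∀ z : ℂ, ‖z‖ ≤ ρ → z ∈ ((L.lattice : Set ℂ) \ {0})ᶜ ∧ z + w ∉ L.lattice

theorem IsPoleFreeDisc.notMem_poleSet (h : IsPoleFreeDisc L w ρ) {z : ℂ} (hz : ‖z‖ ≤ ρ)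
    (h0 : z ≠ 0) : z ∉ poleSet L w := by
  rintro (h1 | h1)
  · exact (h.2 z hz).1 ⟨h1, h0⟩
  · exact (h.2 z hz).2 h1

theorem exists_isPoleFreeDisc (hw : w ∉ L.lattice) : ∃ ρ, IsPoleFreeDisc L w ρ := by
  have h1 := eventually_notMem_poleSet L w 0
  rw [eventually_nhdsWithin_iff, Metric.eventually_nhds_iff] at h1
  obtain ⟨ε, hε, h2⟩ := h1
  refine ⟨ε / 2, half_pos hε, fun z hz => ?_⟩
  by_cases h0 : z = 0
  · subst h0
    exact ⟨by simp, by simpa using hw⟩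
  · have h3 := h2 (y := z) (by rw [dist_zero_right]; linarith) h0
    exact ⟨fun h => h3 (Or.inl h.1), fun h => h3 (Or.inr h)⟩

/-- For `j ≥ 1` the principal part at `0` is a single term `z^(-j)`, so integration against powers
of `z` picks out one basis function at a time. -/
theorem circleIntegral_basisFun (h : IsPoleFreeDisc L w ρ) (j k : ℕ) :
    (∮ z in C(0, ρ), z ^ k * basisFun L w z j) =
      if k + 1 = j then 2 * Real.pi * I * basisCoeff j else 0 := by
  have hne : ∀ z ∈ sphere (0 : ℂ) ρ, z ≠ 0 := fun z hz =>
    ne_zero_of_mem_sphere h.1.ne' ⟨z, hz⟩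
  have e1 : (∮ z in C(0, ρ), z ^ k * basisFun L w z j) =
      ∮ z in C(0, ρ), (basisCoeff j * (z - 0) ^ ((k : ℤ) - j) + z ^ k * basisRest L w z j) := by
    refine circleIntegral.integral_congr h.1.le fun z hz => ?_
    have h0 := hne z hz
    have h1 : z ∉ L.lattice := fun h2 =>
      h.notMem_poleSet (mem_sphere_zero_iff_norm.1 hz).le h0 (Or.inl h2)
    simp only [basisFun_eq h1, sub_zero, zpow_sub₀ h0, zpow_natCast]
    ring
  have hrest : ∀ z ∈ closedBall (0 : ℂ) ρ,
      DifferentiableAt ℂ (fun z => z ^ k * basisRest L w z j) z := fun z hz => by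
    have h1 := h.2 z (mem_closedBall_zero_iff.1 hz)
    have h2 := differentiableAt_basisRest h1.1 h1.2 j
    fun_prop
  have e2 : (∮ z in C(0, ρ), z ^ k * basisRest L w z j) = 0 :=
    circleIntegral_eq_zero_of_differentiable_on_off_countable h.1.le Set.countable_empty
      (fun z hz => (hrest z hz).continuousAt.continuousWithinAt)
      fun z hz => hrest z (ball_subset_closedBall hz.1)
  have c1 : CircleIntegrable (fun z : ℂ => basisCoeff j * (z - 0) ^ ((k : ℤ) - j)) 0 ρ := by
    refine ContinuousOn.circleIntegrable h.1.le fun z hz => ?_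
    have := hne z hz
    refine ContinuousAt.continuousWithinAt ?_
    refine continuousAt_const.mul (ContinuousAt.zpow₀ (by fun_prop) _ (Or.inl ?_))
    simpa using this
  have c2 : CircleIntegrable (fun z => z ^ k * basisRest L w z j) 0 ρ :=
    ContinuousOn.circleIntegrable h.1.le fun z hz =>
      (hrest z (sphere_subset_closedBall hz)).continuousAt.continuousWithinAt
  rw [e1, circleIntegral.integral_add c1 c2, e2, add_zero, circleIntegral.integral_const_mul]
  split_ifs with hkj
  · have e3 : (k : ℤ) - j = -1 := by omega
    simp only [e3, zpow_neg_one]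
    rw [circleIntegral.integral_sub_center_inv _ h.1.ne']
    ring
  · rw [circleIntegral.integral_sub_zpow_of_ne (by omega), mul_zero]

theorem circleIntegrable_mul_basisFun (h : IsPoleFreeDisc L w ρ) (j k : ℕ) :
    CircleIntegrable (fun z => z ^ k * basisFun L w z j) 0 ρ := by
  refine ContinuousOn.circleIntegrable h.1.le fun z hz => ?_
  have h0 : z ≠ 0 := ne_zero_of_mem_sphere h.1.ne' ⟨z, hz⟩
  have h1 := (isEllipticFun_basisFun (L := L) w j).diff z
    (h.notMem_poleSet (mem_sphere_zero_iff_norm.1 hz).le h0)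
  exact (continuousWithinAt_id.pow k).mul h1.continuousAt.continuousWithinAt

variable {n : ℕ} {f : ℂ → ℂ} {φ : Fin (n + 1) → ℂ}

theorem circleIntegral_expansion (h : IsPoleFreeDisc L w ρ)
    (hf : ∀ z ∉ poleSet L w, f z = ∑ j, φ j * basisFun L w z j) (k : Fin n) :
    (∮ z in C(0, ρ), z ^ (k : ℕ) * f z) =
      2 * Real.pi * I * basisCoeff (k + 1) * φ k.succ := by
  have e1 : (∮ z in C(0, ρ), z ^ (k : ℕ) * f z) =
      ∮ z in C(0, ρ), ∑ j, φ j * (z ^ (k : ℕ) * basisFun L w z j) := by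
    refine circleIntegral.integral_congr h.1.le fun z hz => ?_
    have h0 : z ≠ 0 := ne_zero_of_mem_sphere h.1.ne' ⟨z, hz⟩
    rw [hf z (h.notMem_poleSet (mem_sphere_zero_iff_norm.1 hz).le h0), Finset.mul_sum]
    exact Finset.sum_congr rfl fun j _ => by ring
  have hi : ∀ j ∈ Finset.univ,
      CircleIntegrable (fun z => φ j * (z ^ (k : ℕ) * basisFun L w z j)) 0 ρ := fun j _ =>
    (circleIntegrable_mul_basisFun h j k).const_smul (a := φ j)
  rw [e1, circleIntegral.integral_fun_sum hi]
  rw [Finset.sum_eq_single k.succ]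
  · rw [circleIntegral.integral_const_mul, circleIntegral_basisFun h, if_pos (by simp)]
    simp only [Fin.val_succ]
    ring
  · intro j _ hj
    rw [circleIntegral.integral_const_mul, circleIntegral_basisFun h, if_neg, mul_zero]
    exact fun e => hj (Fin.ext (by simp [← e]))
  · simp

/-- The contour formula yields the uniqueness, the holomorphy and all bounds of the coefficients
with positive index. -/
theorem expansion_succ_eq (h : IsPoleFreeDisc L w ρ)
    (hf : ∀ z ∉ poleSet L w, f z = ∑ j, φ j * basisFun L w z j) (k : Fin n) :
    φ k.succ = (2 * Real.pi * I * basisCoeff (k + 1))⁻¹ *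
      ∮ z in C(0, ρ), z ^ (k : ℕ) * f z := by
  rw [circleIntegral_expansion h hf k, inv_mul_cancel_left₀]
  exact mul_ne_zero two_pi_I_ne_zero (basisCoeff_ne_zero k.1.succ_ne_zero)

theorem expansion_zero_eq (hf : ∀ z ∉ poleSet L w, f z = ∑ j, φ j * basisFun L w z j)
    {z : ℂ} (hz : z ∉ poleSet L w) :
    φ 0 = f z - ∑ k : Fin n, φ k.succ * basisFun L w z (k + 1) := by
  rw [hf z hz, Fin.sum_univ_succ]
  simp [basisFun]

theorem expansion_unique (hw : w ∉ L.lattice) {ψ : Fin (n + 1) → ℂ}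
    (hf : ∀ z ∉ poleSet L w, f z = ∑ j, φ j * basisFun L w z j)
    (hg : ∀ z ∉ poleSet L w, f z = ∑ j, ψ j * basisFun L w z j) : φ = ψ := by
  obtain ⟨ρ, hρ⟩ := exists_isPoleFreeDisc hw
  have h1 : ∀ k : Fin n, φ k.succ = ψ k.succ := fun k => by
    rw [expansion_succ_eq hρ hf, expansion_succ_eq hρ hg]
  obtain ⟨z, hz⟩ := (eventually_notMem_poleSet L w 0).exists
  funext j
  refine Fin.cases ?_ h1 j
  rw [expansion_zero_eq hf hz, expansion_zero_eq hg hz]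
  simp only [h1]

end Coefficients

/-! ### The expansion of the superpotential -/

section Superpotential

open Filter

variable {n : ℕ}

/-- The multiple `w = (n + 1) v_{n+1}`. -/
def spread (p : Space n) : ℂ := ((n : ℂ) + 1) * p.2.1.2

theorem spread_notMem (p : regular n) : spread p.1 ∉ (periods p.1.2.2 p.2.1).lattice := by
  intro h
  obtain ⟨a, b, h1⟩ := mem_periods.1 h
  exact p.2.2 a b h1

theorem superpotential_add_one (p : Space n) (z : ℂ) :
    superpotential p (z + 1) = superpotential p z := by
  rw [superpotential_eq, superpotential_eq]
  have e : ∀ x : ℂ, theta p.2.2 (z + 1 + x) = theta p.2.2 (z + x) := fun x => by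
    rw [add_right_comm, theta_add_one]
  have e' : ∀ i, theta p.2.2 (z + 1 - p.2.1.1.1 i + p.2.1.2) =
      theta p.2.2 (z - p.2.1.1.1 i + p.2.1.2) := fun i => by
    rw [sub_add, sub_add, sub_eq_add_neg, e, ← sub_eq_add_neg]
  simp only [e, e', theta_add_one]

/-- The multipliers of numerator and denominator agree: both are `(-exp(-2πi(z + τ)))^(n+1)
exp(-2πi(n+1)s)`, again as `∑ v_i = 0`. -/
theorem superpotential_add_tau (p : Space n) (z : ℂ) :
    superpotential p (z + p.2.2) = superpotential p z := by
  rw [superpotential_eq, superpotential_eq]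
  set τ := p.2.2
  set a := cexp (-2 * Real.pi * I * (z + τ)) with ha
  set b := cexp (-2 * Real.pi * I * p.2.1.2) with hb
  have e1 : ∀ i, theta τ (z + τ - p.2.1.1.1 i + p.2.1.2) =
      -(a * b) * cexp (2 * Real.pi * I * p.2.1.1.1 i) *
        theta τ (z - p.2.1.1.1 i + p.2.1.2) := fun i => by
    rw [show z + τ - p.2.1.1.1 i + p.2.1.2 = z - p.2.1.1.1 i + p.2.1.2 + τ by ring,
      theta_add_tau, ha, hb, ← Complex.exp_add, neg_mul (cexp _) (cexp _), ← Complex.exp_add]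
    congr 3
    ring
  have e2 : ∏ i, cexp (2 * Real.pi * I * p.2.1.1.1 i) = 1 := by
    rw [← Complex.exp_sum, ← Finset.mul_sum, Hyperplane.sum_eq_zero, mul_zero, Complex.exp_zero]
  have e3 : theta τ (z + τ + ((n : ℂ) + 1) * p.2.1.2) =
      -(a * b ^ (n + 1)) * theta τ (z + ((n : ℂ) + 1) * p.2.1.2) := by
    rw [add_right_comm, theta_add_tau, ha, hb, ← Complex.exp_nat_mul, ← Complex.exp_add]
    congr 3
    push_cast
    ring
  have ha0 : a ≠ 0 := Complex.exp_ne_zero _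
  have hb0 : b ≠ 0 := Complex.exp_ne_zero _
  have e4 : (-(a * b)) ^ (n + 1) = (-a) ^ n * (-(a * b ^ (n + 1))) := by
    rw [← neg_mul, mul_pow, pow_succ (-a)]
    ring
  simp only [e1, e3, Finset.prod_mul_distrib, e2, Finset.prod_const, Finset.card_univ,
    Fintype.card_fin, mul_one, theta_add_tau]
  rw [e4, ← ha, mul_pow]
  have h1 : (-a) ^ n * (-(a * b ^ (n + 1))) ≠ 0 :=
    mul_ne_zero (pow_ne_zero _ (neg_ne_zero.2 ha0))
      (neg_ne_zero.2 (mul_ne_zero ha0 (pow_ne_zero _ hb0)))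
  rw [show (-a) ^ n * theta τ z ^ n * (-(a * b ^ (n + 1)) * theta τ (z + ((n : ℂ) + 1) * p.2.1.2)) =
    ((-a) ^ n * (-(a * b ^ (n + 1)))) *
      (theta τ z ^ n * theta τ (z + ((n : ℂ) + 1) * p.2.1.2)) by ring,
    mul_left_comm, mul_div_mul_left _ _ h1]

theorem superpotential_add_lattice (p : Space n) (hτ : 0 < p.2.2.im) {l : ℂ}
    (hl : l ∈ (periods p.2.2 hτ).lattice) (z : ℂ) :
    superpotential p (z + l) = superpotential p z := by
  let G : AddSubgroup ℂ :=
    { carrier := {l | ∀ z, superpotential p (z + l) = superpotential p z}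
      add_mem' := fun {x y} hx hy z => by rw [← add_assoc, hy, hx]
      zero_mem' := fun z => by rw [add_zero]
      neg_mem' := fun {x} hx z => by rw [← hx (z + -x), neg_add_cancel_right] }
  exact lattice_le_of_mem hτ (G := G) (superpotential_add_one p) (superpotential_add_tau p) hl z

theorem isEllipticFun_superpotential (p : regular n) :
    IsEllipticFun (periods p.1.2.2 p.2.1) (spread p.1) (superpotential p.1) where
  diff z hz := by
    refine DifferentiableAt.comp (g := fun q : Space n × ℂ => superpotential q.1 q.2)
      (f := fun z => (p.1, z)) z (differentiableAt_superpotential p.2.1 ?_ ?_) (by fun_prop)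
    · exact (mem_offLattice p.2.1).2 fun h => hz (Or.inl h)
    · exact (mem_offLattice p.2.1).2 fun h => hz (Or.inr h)
  per z _ l hl := superpotential_add_lattice p.1 p.2.1 hl z

theorem tendsto_div_theta {τ : ℂ} (hτ : 0 < τ.im) (w : ℂ) :
    Tendsto (fun z => (z + w) / theta τ (z + w)) (𝓝[≠] (-w)) (𝓝 (deriv (theta τ) 0)⁻¹) := by
  have hd := differentiable_theta hτ
  have h1 := tendsto_div_sub (f := fun z => theta τ (z + w)) (a := -w)
    (hd.comp (differentiable_id.add_const w) (-w))
  rw [deriv_comp_add_const, neg_add_cancel, theta_zero] at h1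
  refine (h1.inv₀ (deriv_theta_ne_zero hτ (Submodule.zero_mem _))).congr fun z => ?_
  rw [inv_div, sub_zero, sub_neg_eq_add]

theorem exists_norm_superpotential_zero_le (p : regular n) :
    ∃ C : ℝ, ∀ᶠ z in 𝓝[≠] 0, ‖z ^ n * superpotential p.1 z‖ ≤ C := by
  have hd := differentiable_theta p.2.1
  have h1 := (tendsto_div_theta p.2.1 0).pow n
  have hw : theta p.1.2.2 (0 + spread p.1) ≠ 0 := by
    rw [zero_add, Ne, theta_eq_zero_iff p.2.1]
    exact spread_notMem p
  have h2 : ContinuousAt (fun z => cexp (-2 * Real.pi * I * p.1.1) *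
      (∏ i, theta p.1.2.2 (z - p.1.2.1.1.1 i + p.1.2.1.2)) / theta p.1.2.2 (z + spread p.1)) 0 := by
    have hc := hd.continuous
    refine ContinuousAt.div ?_ ?_ hw
    · fun_prop
    · fun_prop
  rw [neg_zero] at h1
  obtain ⟨C, hC⟩ := exists_norm_le_of_tendsto
    (h1.mul (h2.tendsto.mono_left (nhdsWithin_le_nhds (s := {0}ᶜ))))
  refine ⟨C, hC.mono fun z hz => le_of_eq_of_le ?_ hz⟩
  rw [superpotential_eq, add_zero, div_pow, spread, div_mul_div_comm, ← mul_div_assoc]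

theorem exists_norm_superpotential_spread_le (p : regular n) :
    ∃ C : ℝ, ∀ᶠ z in 𝓝[≠] (-spread p.1), ‖(z + spread p.1) * superpotential p.1 z‖ ≤ C := by
  have hd := differentiable_theta p.2.1
  have h1 := tendsto_div_theta p.2.1 (spread p.1)
  have hw : theta p.1.2.2 (-spread p.1) ≠ 0 := by
    rw [Ne, theta_eq_zero_iff p.2.1]
    exact fun h => spread_notMem p (neg_mem_iff.1 h)
  have h2 : ContinuousAt (fun z => cexp (-2 * Real.pi * I * p.1.1) *
      (∏ i, theta p.1.2.2 (z - p.1.2.1.1.1 i + p.1.2.1.2)) / theta p.1.2.2 z ^ n)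
      (-spread p.1) := by
    have hc := hd.continuous
    refine ContinuousAt.div ?_ ?_ (pow_ne_zero _ hw)
    · fun_prop
    · fun_prop
  obtain ⟨C, hC⟩ := exists_norm_le_of_tendsto
    (h1.mul (h2.tendsto.mono_left (nhdsWithin_le_nhds (s := {-spread p.1}ᶜ))))
  refine ⟨C, hC.mono fun z hz => le_of_eq_of_le ?_ hz⟩
  rw [superpotential_eq, spread, div_mul_div_comm, mul_comm (theta _ _) (_ ^ n), ← mul_div_assoc]

theorem exists_isExpansion (hn : 1 ≤ n) : ∃ φ : Fin (n + 1) → Fun n, IsExpansion φ := by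
  have h1 : ∀ p : regular n, ∃ φ : Fin (n + 1) → ℂ,
      ∀ z ∉ poleSet (periods p.1.2.2 p.2.1) (spread p.1), superpotential p.1 z =
        ∑ j : Fin (n + 1), φ j * basisFun (periods p.1.2.2 p.2.1) (spread p.1) z j := fun p => by
    obtain ⟨C₀, h0⟩ := exists_norm_superpotential_zero_le p
    obtain ⟨C₁, h1⟩ := exists_norm_superpotential_spread_le p
    exact exists_expansion p.2.1 (spread_notMem p) hn (isEllipticFun_superpotential p) h0 h1
  choose φ hφ using h1
  exact ⟨fun j p => φ p j, fun p z hz hzw => hφ p z fun h => h.elim hz hzw⟩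

theorem IsExpansion.eq_sum {φ : Fin (n + 1) → Fun n} (hφ : IsExpansion φ) (p : regular n) :
    ∀ z ∉ poleSet (periods p.1.2.2 p.2.1) (spread p.1), superpotential p.1 z =
      ∑ j : Fin (n + 1), φ j p * basisFun (periods p.1.2.2 p.2.1) (spread p.1) z j :=
  fun z hz => hφ p z (fun h => hz (Or.inl h)) fun h => hz (Or.inr h)

theorem IsExpansion.unique {φ ψ : Fin (n + 1) → Fun n} (hφ : IsExpansion φ)
    (hψ : IsExpansion ψ) : φ = ψ := by
  funext j p
  exact congrFun (expansion_unique (spread_notMem p) (hφ.eq_sum p) (hψ.eq_sum p)) j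

end Superpotential

/-! ### The coefficients are Jacobi forms -/

section BasicForms

open Filter Metric

variable {n : ℕ} {φ : Fin (n + 1) → Fun n}

/-- If `λ` is unchanged while `z` and the lattice are scaled by `c`, the homogeneity of degree `-j`
of the `j`-th basis function and the uniqueness of the expansion force the factor `c^j`. The three
transformation rules are special cases, with `c = 1` or `c = (cτ + d)⁻¹`. -/
theorem IsExpansion.apply_eq (hφ : IsExpansion φ) (p q : regular n) {c : ℂ} (hc : c ≠ 0)
    (hL : ∀ x, x ∈ (periods p.1.2.2 p.2.1).lattice ↔ c * x ∈ (periods q.1.2.2 q.2.1).lattice)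
    {l : ℂ} (hl : l ∈ (periods q.1.2.2 q.2.1).lattice) (hs : spread q.1 = c * spread p.1 + l)
    (hf : ∀ z, superpotential q.1 (c * z) = superpotential p.1 z) (j : Fin (n + 1)) :
    φ j q = c ^ (j : ℕ) * φ j p := by
  have hcw : c * spread p.1 ∉ (periods q.1.2.2 q.2.1).lattice := fun h =>
    spread_notMem p ((hL _).2 h)
  have h1 : ∀ z ∉ poleSet (periods p.1.2.2 p.2.1) (spread p.1), superpotential p.1 z =
      ∑ j : Fin (n + 1), (c⁻¹ ^ (j : ℕ) * φ j q) *
        basisFun (periods p.1.2.2 p.2.1) (spread p.1) z j := fun z hz => by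
    have h2 : c * z + c * spread p.1 ∉ (periods q.1.2.2 q.2.1).lattice := fun h =>
      hz (Or.inr ((hL _).2 (by rwa [mul_add])))
    have h3 : c * z ∉ poleSet (periods q.1.2.2 q.2.1) (spread q.1) := by
      rintro (h | h)
      · exact hz (Or.inl ((hL _).2 h))
      · refine h2 ?_
        have h4 : c * z + spread q.1 ∈ (periods q.1.2.2 q.2.1).lattice := h
        have h5 := sub_mem h4 hl
        rwa [hs, ← add_assoc, add_sub_cancel_right] at h5
    rw [← hf, hφ.eq_sum q _ h3]
    refine Finset.sum_congr rfl fun j _ => ?_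
    rw [hs, basisFun_add_lattice hcw hl h2, basisFun_scale hc hL]
    ring
  have h2 := congrFun (expansion_unique (spread_notMem p) (hφ.eq_sum p) h1) j
  rw [h2, inv_pow, mul_inv_cancel_left₀ (pow_ne_zero _ hc)]

theorem IsExpansion.weyl (hφ : IsExpansion φ) (j : Fin (n + 1))
    (σ : Equiv.Perm (Fin (n + 1))) (p : regular n) :
    φ j ⟨weylAct σ p.1, weylAct_mem σ p.2⟩ = φ j p := by
  have := hφ.apply_eq p ⟨weylAct σ p.1, weylAct_mem σ p.2⟩ one_ne_zero (l := 0)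
    (fun x => by rw [one_mul]; rfl) (Submodule.zero_mem _) (by rw [one_mul, add_zero]; rfl)
    (fun z => by rw [one_mul]; exact superpotential_weylAct σ p.1 z) j
  rwa [one_pow, one_mul] at this

theorem IsExpansion.trans (hφ : IsExpansion φ) (j : Fin (n + 1)) {x y : Cartan n}
    (hx : x ∈ intLattice n) (hy : y ∈ intLattice n) (k : ℤ) (p : regular n) :
    φ j ⟨transAct x y k p.1, transAct_mem hx hy k p.2⟩ = φ j p := by
  obtain ⟨a, ha⟩ := hx.2
  obtain ⟨b, hb⟩ := hy.2
  have hl : ((n + 1) * b : ℤ) + ((n + 1) * a : ℤ) * p.1.2.2 ∈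
      (periods p.1.2.2 p.2.1).lattice := mem_periods.2 ⟨_, _, rfl⟩
  have := hφ.apply_eq p ⟨transAct x y k p.1, transAct_mem hx hy k p.2⟩ one_ne_zero
    (fun x => by rw [one_mul]; rfl) hl (by
      simp only [spread, transAct, Prod.snd_add, Prod.smul_snd, smul_eq_mul, ha, hb]
      push_cast
      ring)
    (fun z => by rw [one_mul]; exact superpotential_transAct hx hy k p.1 z) j
  rwa [one_pow, one_mul] at this

theorem IsExpansion.modular (hφ : IsExpansion φ) (j : Fin (n + 1))
    (γ : Matrix.SpecialLinearGroup (Fin 2) ℤ) (p : regular n) :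
    φ j ⟨modAct γ p.1, modAct_mem γ p.2⟩ = autFactor γ p.1.2.2 ^ (-(j : ℤ)) * φ j p := by
  rw [zpow_neg, zpow_natCast, ← inv_pow]
  refine hφ.apply_eq p ⟨modAct γ p.1, modAct_mem γ p.2⟩
    (inv_ne_zero (autFactor_ne_zero γ p.2.1)) (l := 0)
    (fun x => mem_periods_moebius γ p.2.1 x) (Submodule.zero_mem _) ?_
    (fun z => superpotential_modAct γ p.1 p.2.1 z) j
  simp only [spread, modAct, Prod.smul_snd, smul_eq_mul]
  ring

theorem IsExpansion.add_u (hφ : IsExpansion φ) (j : Fin (n + 1)) (u u' : ℂ)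
    (x : Cartan n × ℂ) (h : (u, x) ∈ regular n) (h' : (u + u', x) ∈ regular n) :
    φ j ⟨(u + u', x), h'⟩ = cexp (-2 * Real.pi * I * u') * φ j ⟨(u, x), h⟩ := by
  have h1 := hφ.eq_sum ⟨(u, x), h⟩
  have h2 := hφ.eq_sum ⟨(u + u', x), h'⟩
  refine congrFun (expansion_unique (ψ := fun j => cexp (-2 * Real.pi * I * u') *
    φ j ⟨(u, x), h⟩) (spread_notMem ⟨(u + u', x), h'⟩) h2 fun z hz => ?_) j
  change superpotential (u + u', x) z = _
  rw [superpotential_add_u, h1 z hz, Finset.mul_sum]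
  exact Finset.sum_congr rfl fun j _ => by ring_nf; rfl

theorem IsExpansion.index (hφ : IsExpansion φ) (j : Fin (n + 1)) (p : regular n) :
    -(1 / (2 * Real.pi * I)) * deriv (fun u => ext (φ j) (u, p.1.2)) p.1.1 = (1 : ℤ) * φ j p := by
  have e : (fun u => ext (φ j) (u, p.1.2)) =
      fun u => cexp (-2 * Real.pi * I * (u - p.1.1)) * φ j p := funext fun u => by
    have h : (p.1.1 + (u - p.1.1), p.1.2) ∈ regular n := p.2
    rw [← hφ.add_u j p.1.1 (u - p.1.1) p.1.2 p.2 h, ← ext_apply (φ j) ⟨_, h⟩, add_sub_cancel]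
  have hd : HasDerivAt (fun u => cexp (-2 * Real.pi * I * (u - p.1.1)) * φ j p)
      (cexp (-2 * Real.pi * I * (p.1.1 - p.1.1)) * (-2 * Real.pi * I * 1) * φ j p) p.1.1 :=
    ((((hasDerivAt_id _).sub_const _).const_mul _).cexp).mul_const _
  rw [e, hd.deriv, sub_self, mul_zero, Complex.exp_zero]
  have := two_pi_I_ne_zero
  have h2 : (Real.pi : ℂ) ≠ 0 := by exact_mod_cast Real.pi_ne_zero
  push_cast
  field_simp

theorem exists_le_norm_lattice {τ₀ : ℂ} (hτ₀ : 0 < τ₀.im) : ∃ c : ℝ, 0 < c ∧ ∀ᶠ τ in 𝓝 τ₀,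
    ∀ (hτ : 0 < τ.im), ∀ l ∈ (periods τ hτ).lattice, l ≠ 0 → c ≤ ‖l‖ := by
  obtain ⟨c, hc, h⟩ := exists_mul_norm_le (|τ₀.re| + 1) (half_pos hτ₀)
  refine ⟨c, hc, ?_⟩
  filter_upwards [Complex.continuous_im.continuousAt.eventually (lt_mem_nhds (half_lt_self hτ₀)),
    (continuous_abs.comp Complex.continuous_re).continuousAt.eventually
      (gt_mem_nhds (lt_add_one |τ₀.re|))] with τ h1 h2 hτ l hl h0
  obtain ⟨a, b, rfl⟩ := mem_periods.1 hl
  have h3 := h τ h2.le h1.le ![b, a]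
  simp only [Matrix.cons_val_zero, Matrix.cons_val_one] at h3
  rw [add_comm] at h3
  refine le_trans ?_ h3
  have h4 : (![b, a] : Fin 2 → ℤ) ≠ 0 := fun h => h0 (by
    have ha : a = 0 := congrFun h 1
    have hb : b = 0 := congrFun h 0
    simp [ha, hb])
  obtain ⟨i, hi⟩ := Function.ne_iff.1 h4
  have h5 : (1 : ℝ) ≤ ‖(![b, a] : Fin 2 → ℤ) i‖ := by
    rw [Int.norm_eq_abs]
    exact_mod_cast Int.one_le_abs hi
  exact le_mul_of_one_le_right hc.le (h5.trans (norm_le_pi_norm _ i))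

theorem isPoleFreeDisc_of_lt {L : PeriodPair} {w : ℂ} {ρ c : ℝ} (hρ : 0 < ρ) (hc : ρ < c)
    (h : ∀ l ∈ L.lattice, l ≠ 0 → c ≤ ‖l‖) (hw : ∀ z : ℂ, ‖z‖ ≤ ρ → z + w ∉ L.lattice) :
    IsPoleFreeDisc L w ρ :=
  ⟨hρ, fun z hz => ⟨fun h1 => absurd (h z h1.1 h1.2) (by linarith), hw z hz⟩⟩

theorem isOpen_regular : IsOpen (regular n) := by
  have e : regular n = (fun p : Space n => (spread p, p.2.2)) ⁻¹' offLattice := by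
    ext p
    by_cases h : 0 < p.2.2.im
    · rw [Set.mem_preimage, mem_offLattice h, mem_periods]
      simp only [regular, Set.mem_ofPred_eq, h, true_and, spread, not_exists]
    · exact ⟨fun h' => absurd h'.1 h, fun h' => absurd h'.1 h⟩
  rw [e]
  refine isOpen_offLattice.preimage ?_
  unfold spread
  fun_prop

/-- A radius that serves all points near a given one. -/
theorem exists_isPoleFreeDisc_nhds (p₀ : regular n) : ∃ ρ : ℝ, 0 < ρ ∧ ∀ᶠ p in 𝓝 p₀.1,
    ∃ h : p ∈ regular n, IsPoleFreeDisc (periods p.2.2 h.1) (spread p) ρ := by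
  obtain ⟨c, hc, h1⟩ := exists_le_norm_lattice p₀.2.1
  obtain ⟨ρ₁, hρ₁⟩ := exists_isPoleFreeDisc (spread_notMem p₀)
  refine ⟨min ρ₁ (c / 2), lt_min hρ₁.1 (half_pos hc), ?_⟩
  have hcont : Continuous fun q : Space n × ℂ => (q.2 + spread q.1, q.1.2.2) := by
    unfold spread
    fun_prop
  have h2 : ∀ᶠ p in 𝓝 p₀.1, ∀ z ∈ closedBall (0 : ℂ) (min ρ₁ (c / 2)),
      (z + spread p, p.2.2) ∈ offLattice := by
    refine (isCompact_closedBall _ _).eventually_forall_of_forall_eventually fun z hz => ?_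
    refine hcont.continuousAt.eventually (isOpen_offLattice.mem_nhds ?_)
    exact (mem_offLattice p₀.2.1).2
      (hρ₁.2 z ((mem_closedBall_zero_iff.1 hz).trans (min_le_left _ _))).2
  have h3 : ∀ᶠ p : Space n in 𝓝 p₀.1, ∀ (hτ : 0 < p.2.2.im),
      ∀ l ∈ (periods p.2.2 hτ).lattice, l ≠ 0 → c ≤ ‖l‖ :=
    (continuous_snd.comp continuous_snd).continuousAt.eventually h1
  filter_upwards [h2, h3, isOpen_regular.mem_nhds p₀.2] with p h4 h5 h6
  refine ⟨h6, isPoleFreeDisc_of_lt (lt_min hρ₁.1 (half_pos hc))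
    ((min_le_right _ _).trans_lt (half_lt_self hc)) (h5 h6.1) fun z hz => ?_⟩
  exact (mem_offLattice h6.1).1 (h4 z (mem_closedBall_zero_iff.2 hz))

theorem IsPoleFreeDisc.mem_offLattice {p : Space n} {hτ : 0 < p.2.2.im} {ρ : ℝ}
    (h : IsPoleFreeDisc (periods p.2.2 hτ) (spread p) ρ) {z : ℂ} (hz : ‖z‖ = ρ) :
    (z, p.2.2) ∈ offLattice ∧ (z + spread p, p.2.2) ∈ offLattice := by
  have h1 := h.notMem_poleSet hz.le (norm_pos_iff.1 (hz ▸ h.1))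
  exact ⟨(AffineJacobi.mem_offLattice hτ).2 fun h2 => h1 (Or.inl h2),
    (AffineJacobi.mem_offLattice hτ).2 fun h2 => h1 (Or.inr h2)⟩

/-- Near a given point one radius serves for all contours, so the contour formula is an integral
over a fixed circle of a function holomorphic in the parameters. -/
theorem IsExpansion.differentiableAt_succ (hφ : IsExpansion φ) (k : Fin n) (p₀ : regular n) :
    DifferentiableAt ℂ (ext (φ k.succ)) p₀.1 := by
  obtain ⟨ρ, hρ, h1⟩ := exists_isPoleFreeDisc_nhds p₀
  have h2 : DifferentiableAt ℂ (fun p : Space n => (2 * Real.pi * I * basisCoeff (k + 1))⁻¹ *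
      ∮ z in C(0, ρ), z ^ (k : ℕ) * superpotential p z) p₀.1 := by
    refine DifferentiableAt.const_mul (differentiableAt_circleIntegral hρ.le fun z hz => ?_) _
    have hz' := mem_sphere_zero_iff_norm.1 hz
    obtain ⟨h3, h4⟩ := h1.self_of_nhds
    obtain ⟨h5, h6⟩ := h4.mem_offLattice hz'
    have hc1 : Continuous fun q : Space n × ℂ => (q.2, q.1.2.2) := by fun_prop
    have hc2 : Continuous fun q : Space n × ℂ => (q.2 + spread q.1, q.1.2.2) := by
      unfold spread
      fun_prop
    filter_upwards [hc1.continuousAt.eventually (isOpen_offLattice.mem_nhds h5),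
      hc2.continuousAt.eventually (isOpen_offLattice.mem_nhds h6)] with q h7 h8
    have h9 := differentiableAt_superpotential (q := q) h7.1 h7 h8
    refine ⟨(continuousAt_snd.pow k).mul h9.continuousAt, DifferentiableAt.const_mul ?_ _⟩
    exact DifferentiableAt.comp (g := fun q : Space n × ℂ => superpotential q.1 q.2)
      (f := fun p => (p, q.2)) q.1 h9 (by fun_prop)
  refine h2.congr_of_eventuallyEq (h1.mono fun p hp => ?_)
  obtain ⟨h3, h4⟩ := hp
  rw [ext_apply (φ k.succ) ⟨p, h3⟩]
  exact expansion_succ_eq h4 (hφ.eq_sum ⟨p, h3⟩) k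

/-- The coefficient with index zero is recovered from the value of `λ` at the single point `z = ρ`
and the other coefficients. -/
theorem IsExpansion.differentiableAt_zero (hφ : IsExpansion φ) (p₀ : regular n) :
    DifferentiableAt ℂ (ext (φ 0)) p₀.1 := by
  obtain ⟨ρ, hρ, h1⟩ := exists_isPoleFreeDisc_nhds p₀
  obtain ⟨h3, h4⟩ := h1.self_of_nhds
  have hn : ‖(ρ : ℂ)‖ = ρ := by rw [Complex.norm_real, Real.norm_of_nonneg hρ.le]
  obtain ⟨h5, h6⟩ := h4.mem_offLattice hn
  have d1 : DifferentiableAt ℂ (fun p : Space n => superpotential p ρ) p₀.1 :=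
    DifferentiableAt.comp (g := fun q : Space n × ℂ => superpotential q.1 q.2)
      (f := fun p => (p, (ρ : ℂ))) p₀.1 (differentiableAt_superpotential (q := (p₀.1, (ρ : ℂ)))
        h3.1 h5 h6) (by fun_prop)
  have h7 : (spread p₀.1, p₀.1.2.2) ∈ offLattice :=
    (AffineJacobi.mem_offLattice p₀.2.1).2 (spread_notMem p₀)
  have d2 : ∀ k : Fin n, DifferentiableAt ℂ
      (fun p : Space n => basisPair (k + 1) (spread p, (ρ : ℂ), p.2.2)) p₀.1 := fun k =>
    DifferentiableAt.comp (g := basisPair (k + 1))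
      (f := fun p : Space n => (spread p, (ρ : ℂ), p.2.2)) p₀.1
      (differentiableAt_basisPair _ h7 h5 h6) (by unfold spread; fun_prop)
  have d3 : DifferentiableAt ℂ (fun p : Space n => superpotential p ρ -
      ∑ k : Fin n, ext (φ k.succ) p * basisPair (k + 1) (spread p, (ρ : ℂ), p.2.2)) p₀.1 :=
    d1.sub (DifferentiableAt.fun_sum fun k _ => (hφ.differentiableAt_succ k p₀).mul (d2 k))
  refine d3.congr_of_eventuallyEq (h1.mono fun p hp => ?_)
  obtain ⟨h3, h4⟩ := hp
  have hz := h4.notMem_poleSet hn.le (by exact_mod_cast hρ.ne')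
  rw [ext_apply (φ 0) ⟨p, h3⟩, expansion_zero_eq (hφ.eq_sum ⟨p, h3⟩) hz]
  congr 1
  refine Finset.sum_congr rfl fun k _ => ?_
  rw [ext_apply (φ k.succ) ⟨p, h3⟩, basisPair_eq h3.1 fun h => hz (Or.inl h)]

theorem IsExpansion.holo (hφ : IsExpansion φ) (j : Fin (n + 1)) :
    DifferentiableOn ℂ (ext (φ j)) (regular n) := fun p hp =>
  DifferentiableAt.differentiableWithinAt <|
    Fin.cases (motive := fun j => DifferentiableAt ℂ (ext (φ j)) p)
      (hφ.differentiableAt_zero ⟨p, hp⟩) (fun k => hφ.differentiableAt_succ k ⟨p, hp⟩) j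

theorem one_le_norm_basisCoeff {j : ℕ} (hj : j ≠ 0) : 1 ≤ ‖basisCoeff j‖ := by
  match j with
  | 0 => exact absurd rfl hj
  | 1 => simp [basisCoeff]
  | j + 2 =>
    simp only [basisCoeff, norm_mul, norm_pow, norm_neg, norm_one, one_pow, one_mul,
      Complex.norm_natCast]
    exact_mod_cast Nat.one_le_iff_ne_zero.2 (Nat.factorial_ne_zero _)

/-- A bound that serves both limits, `Im τ → ∞` and `v_{n+1}` tending to a torsion point: the
contour formula controls `φ_1, …, φ_n`, and the expansion at `z = ρ` controls `φ_0`. -/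
theorem IsExpansion.norm_le (hφ : IsExpansion φ) (p : regular n) {ρ M B : ℝ}
    (hρ : IsPoleFreeDisc (periods p.1.2.2 p.2.1) (spread p.1) ρ) (h1 : ρ ≤ 1)
    (hM : ∀ z : ℂ, ‖z‖ = ρ → ‖superpotential p.1 z‖ ≤ M) (hB0 : 0 ≤ B)
    (hB : ∀ k : Fin n, ‖basisFun (periods p.1.2.2 p.2.1) (spread p.1) ρ (k + 1)‖ ≤ B)
    (j : Fin (n + 1)) : ‖φ j p‖ ≤ M * (1 + n * B) := by
  have hn : ‖(ρ : ℂ)‖ = ρ := by rw [Complex.norm_real, Real.norm_of_nonneg hρ.1.le]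
  have hM0 : 0 ≤ M := (norm_nonneg _).trans (hM ρ hn)
  have hs : ∀ k : Fin n, ‖φ k.succ p‖ ≤ M := fun k => by
    rw [expansion_succ_eq hρ (hφ.eq_sum p) k]
    have h2 : ‖∮ z in C(0, ρ), z ^ (k : ℕ) * superpotential p.1 z‖ ≤ 2 * Real.pi * ρ * M := by
      refine circleIntegral.norm_integral_le_of_norm_le_const hρ.1.le fun z hz => ?_
      rw [mem_sphere_zero_iff_norm] at hz
      rw [norm_mul, norm_pow, hz]
      exact (mul_le_of_le_one_left (norm_nonneg _) (pow_le_one₀ hρ.1.le h1)).trans (hM z hz)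
    rw [norm_mul, norm_inv, norm_mul, norm_mul, norm_mul, Complex.norm_I, Complex.norm_real,
      Real.norm_of_nonneg Real.pi_pos.le, Complex.norm_two, mul_one]
    have h3 := one_le_norm_basisCoeff (j := k + 1) k.1.succ_ne_zero
    have h4 : (0 : ℝ) < 2 * Real.pi := by positivity
    rw [inv_mul_le_iff₀ (by positivity)]
    calc _ ≤ 2 * Real.pi * ρ * M := h2
      _ ≤ 2 * Real.pi * 1 * M := by gcongr
      _ ≤ 2 * Real.pi * ‖basisCoeff (k + 1)‖ * M := by gcongr
  refine Fin.cases ?_ (fun k => ?_) j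
  · rw [expansion_zero_eq (hφ.eq_sum p) (hρ.notMem_poleSet hn.le (by exact_mod_cast hρ.1.ne'))]
    refine (norm_sub_le _ _).trans ?_
    rw [mul_add, mul_one]
    refine add_le_add (hM _ hn) ((norm_sum_le _ _).trans ?_)
    calc _ ≤ ∑ _k : Fin n, M * B := Finset.sum_le_sum fun k _ => by
          rw [norm_mul]
          exact mul_le_mul (hs k) (hB k) (norm_nonneg _) hM0
      _ = _ := by simp; ring
  · exact (hs k).trans (le_mul_of_one_le_right hM0 (by
      have : (0 : ℝ) ≤ n * B := by positivity
      linarith))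

theorem one_le_norm_of_mem_lattice {τ : ℂ} (hτ : 1 ≤ τ.im) {l : ℂ}
    (hl : l ∈ (periods τ (one_pos.trans_le hτ)).lattice) (h0 : l ≠ 0) : 1 ≤ ‖l‖ := by
  obtain ⟨a, b, rfl⟩ := mem_periods.1 hl
  by_cases hb : b = 0
  · have ha : a ≠ 0 := fun h => h0 (by simp [h, hb])
    simp only [hb, Int.cast_zero, zero_mul, add_zero, Complex.norm_intCast]
    exact_mod_cast Int.one_le_abs ha
  · have h1 : |(b : ℝ)| * τ.im ≤ ‖(a + b * τ : ℂ)‖ := by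
      have := Complex.abs_im_le_norm (a + b * τ : ℂ)
      simpa [abs_mul, abs_of_pos (one_pos.trans_le hτ)] using this
    have h2 : (1 : ℝ) ≤ |(b : ℝ)| := by exact_mod_cast Int.one_le_abs hb
    nlinarith

theorem exists_mem_awayFromInt {w : ℂ} (hw : ∀ k : ℤ, w ≠ k) : ∃ δ : ℝ, 0 < δ ∧ δ ≤ 1 / 2 ∧
    ∀ k : ℤ, 2 * δ ≤ ‖w - k‖ := by
  have hc : IsClosed (Set.range ((↑) : ℤ → ℂ)) := Complex.isClosed_range_intCast
  have h1 : w ∈ (Set.range ((↑) : ℤ → ℂ))ᶜ := fun ⟨k, hk⟩ => hw k hk.symm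
  obtain ⟨ε, hε, h2⟩ := Metric.isOpen_iff.1 hc.isOpen_compl w h1
  refine ⟨min (ε / 2) (1 / 2), lt_min (half_pos hε) (by norm_num), min_le_right _ _, fun k => ?_⟩
  by_contra! h3
  have h4 : (k : ℂ) ∈ ball w ε := by
    rw [mem_ball, dist_comm, dist_eq_norm]
    have := min_le_left (ε / 2) (1 / 2)
    linarith
  exact h2 h4 ⟨k, rfl⟩

theorem IsExpansion.weak (hφ : IsExpansion φ) (j : Fin (n + 1)) (u : ℂ) (v : Hyperplane n)
    (s : ℂ) : ∃ U ∈ 𝓝 v, ∃ C T : ℝ, ∀ v' ∈ U, ∀ τ : ℂ,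
      T ≤ τ.im → ‖ext (φ j) (u, (v', s), τ)‖ ≤ C := by
  set w := ((n : ℂ) + 1) * s with hw
  -- If `w` is an integer, no `τ` gives a regular point, and `ext` takes its default value `0`.
  by_cases hk : ∃ k : ℤ, w = k
  · obtain ⟨k, hk⟩ := hk
    refine ⟨Set.univ, univ_mem, 0, 0, fun v' _ τ _ => ?_⟩
    rw [ext, dif_neg, norm_zero]
    exact fun h => h.2 k 0 (by simpa using hk)
  push Not at hk
  -- As `2δ` is at most the distance from `w` to the integers and `δ ≤ 1/2`, the circle `|z| = δ`
  -- and its translate by `w` both stay at distance `δ` from the integers.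
  obtain ⟨δ, hδ, hδ2, hδw⟩ := exists_mem_awayFromInt hk
  set r := 1 + ‖u‖ + (‖v‖ + 1) + ‖s‖ + ‖w‖ with hr
  have r0 : 0 ≤ r := by positivity
  obtain ⟨C, T, hC⟩ := exists_norm_superpotential_le n r hδ
  choose B hB using fun j => exists_norm_basisFun_le r0 hδ j
  have nu := norm_nonneg u
  have nv := norm_nonneg v
  have ns := norm_nonneg s
  have nw := norm_nonneg w
  refine ⟨closedBall v 1, closedBall_mem_nhds v one_pos,
    C * (1 + n * ∑ k : Fin n, |B (k + 1)|), max (max T 1) (r + δ), fun v' hv' τ hτ => ?_⟩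
  have h1 : 1 ≤ τ.im := (le_max_right T 1).trans ((le_max_left _ _).trans hτ)
  have h2 : T ≤ τ.im := (le_max_left T 1).trans ((le_max_left _ _).trans hτ)
  have h3 : r + δ ≤ τ.im := (le_max_right _ _).trans hτ
  have h0 : 0 < τ.im := one_pos.trans_le h1
  have away : ∀ z : ℂ, ‖z‖ ≤ δ → z + w ∈ awayFromInt r δ := fun z hz => by
    refine ⟨(norm_add_le _ _).trans (by linarith), fun k => ?_⟩
    have h4 := hδw k
    have h5 : ‖w - k‖ ≤ ‖z + w - k‖ + ‖z‖ := by
      have := norm_sub_le (z + w - k) z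
      rwa [show z + w - k - z = w - k by ring] at this
    linarith
  have away' : ∀ z : ℂ, ‖z‖ = δ → z ∈ awayFromInt r δ := fun z hz => by
    refine ⟨by linarith, fun k => ?_⟩
    by_cases hk0 : k = 0
    · rw [hk0, Int.cast_zero, sub_zero, hz]
    · have h4 : (1 : ℝ) ≤ ‖(k : ℂ)‖ := by
        rw [Complex.norm_intCast]
        exact_mod_cast Int.one_le_abs hk0
      have h5 := norm_sub_norm_le (k : ℂ) z
      rw [norm_sub_rev] at h5
      linarith
  have hww : w ∈ awayFromInt r δ := by simpa using away 0 (by simpa using hδ.le)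
  have hp : (u, (v', s), τ) ∈ regular n := by
    refine ⟨h0, fun a b hab => ?_⟩
    exact notMem_of_mem_awayFromInt hδ hww h3 h0 (mem_periods.2 ⟨a, b, hab⟩)
  have hdisc : IsPoleFreeDisc (periods τ h0) w δ :=
    isPoleFreeDisc_of_lt hδ (by linarith : δ < 1)
      (fun l hl => one_le_norm_of_mem_lattice h1 hl)
      fun z hz => notMem_of_mem_awayFromInt hδ (away z hz) h3 h0
  have hn : ‖(δ : ℂ)‖ = δ := by rw [Complex.norm_real, Real.norm_of_nonneg hδ.le]
  have hvi : ∀ i, ‖v'.1 i‖ ≤ r := fun i => by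
    have h4 : ‖v'.1 i‖ ≤ ‖v'‖ := norm_le_pi_norm v'.1 i
    have h5 : ‖v'‖ ≤ ‖v‖ + 1 := by
      have := norm_le_norm_add_norm_sub' v' v
      rw [mem_closedBall, dist_eq_norm] at hv'
      linarith
    linarith
  rw [ext_apply (φ j) ⟨_, hp⟩]
  refine hφ.norm_le ⟨_, hp⟩ hdisc (by linarith) (fun z hz => ?_)
    (Finset.sum_nonneg fun _ _ => abs_nonneg _) (fun k => ?_) j
  · exact hC u v' s z τ (by linarith) hvi (by linarith) (away' z hz) (away z hz.le) h2
  · refine (hB (k + 1) w hww δ (away' δ hn) (away δ hn.le) τ h0 h3).trans ((le_abs_self _).trans ?_)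
    exact Finset.single_le_sum (f := fun k : Fin n => |B (k + 1)|)
      (fun _ _ => abs_nonneg _) (Finset.mem_univ k)

end BasicForms

/-! ### The poles of the coefficients at the torsion points. -/

section Polar

open Filter Metric

variable {n : ℕ} {φ : Fin (n + 1) → Fun n}

theorem exists_norm_weierstrassZeta_le {L : PeriodPair} {l : ℂ} (hl : l ∈ L.lattice) :
    ∃ C : ℝ, 0 ≤ C ∧ ∀ᶠ y in 𝓝[≠] (0 : ℂ), ‖weierstrassZeta L (l + y)‖ ≤ C / ‖y‖ := by
  obtain ⟨η, hη⟩ := exists_weierstrassZeta_add L hl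
  obtain ⟨C, hC⟩ := exists_norm_le_of_tendsto
    ((analyticAt_zetaRest_zero L).continuousAt.tendsto.mono_left
      (nhdsWithin_le_nhds (s := {0}ᶜ)))
  refine ⟨1 + |C| + ‖η‖, by positivity, ?_⟩
  filter_upwards [hC, eventually_notMem_lattice L 0, nhdsWithin_le_nhds (ball_mem_nhds 0 one_pos)]
    with y h1 h2 h3
  have h0 := norm_pos_iff.2 (ne_zero_of_notMem L h2)
  have h4 : ‖y‖ ≤ 1 := (mem_ball_zero_iff.1 h3).le
  rw [add_comm l, hη y h2, weierstrassZeta_eq, le_div_iff₀ h0]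
  have h5 : ‖1 / y + zetaRest L y + η‖ ≤ 1 / ‖y‖ + |C| + ‖η‖ := by
    refine (norm_add₃_le ..).trans ?_
    rw [norm_div, norm_one]
    gcongr
    exact h1.trans (le_abs_self _)
  calc _ ≤ (1 / ‖y‖ + |C| + ‖η‖) * ‖y‖ := by gcongr
    _ = 1 + |C| * ‖y‖ + ‖η‖ * ‖y‖ := by field_simp
    _ ≤ _ := by
      gcongr
      · exact mul_le_of_le_one_right (abs_nonneg _) h4
      · exact mul_le_of_le_one_right (norm_nonneg _) h4

theorem exists_mul_norm_le_theta {τ : ℂ} (hτ : 0 < τ.im) {l : ℂ}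
    (hl : l ∈ (periods τ hτ).lattice) :
    ∃ c : ℝ, 0 < c ∧ ∀ᶠ y in 𝓝[≠] (0 : ℂ), c * ‖y‖ ≤ ‖theta τ (l + y)‖ := by
  have hd : DifferentiableAt ℂ (fun y => theta τ (l + y)) 0 :=
    ((differentiable_theta hτ).comp (differentiable_id.const_add l)) 0
  have h1 := tendsto_div_sub hd
  have h2 : deriv (fun y => theta τ (l + y)) 0 ≠ 0 := by
    rw [deriv_comp_const_add, add_zero]
    exact deriv_theta_ne_zero hτ hl
  rw [add_zero, theta_eq_zero_of_mem hτ hl] at h1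
  refine ⟨‖deriv (fun y => theta τ (l + y)) 0‖ / 2, half_pos (norm_pos_iff.2 h2), ?_⟩
  filter_upwards [h1.norm.eventually (lt_mem_nhds (half_lt_self (norm_pos_iff.2 h2))),
    self_mem_nhdsWithin] with y h3 h4
  have h5 : 0 < ‖y‖ := norm_pos_iff.2 h4
  rw [sub_zero, sub_zero, norm_div, lt_div_iff₀ h5] at h3
  exact h3.le

theorem exists_ball_of_punctured {P : ℂ → Prop} (h : ∀ᶠ y in 𝓝[≠] (0 : ℂ), P y) :
    ∃ ε : ℝ, 0 < ε ∧ ∀ y : ℂ, 0 < ‖y‖ → ‖y‖ < ε → P y := by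
  rw [eventually_nhdsWithin_iff, Metric.eventually_nhds_iff] at h
  obtain ⟨ε, hε, h⟩ := h
  exact ⟨ε, hε, fun y h1 h2 => h (by rwa [dist_zero_right]) (norm_pos_iff.1 h1)⟩

/-- With `w = l + x`, `|x| = 2ρ` and `z = ρ`, the number `|x + ρ|` lies between `ρ` and `3ρ`. So all
arguments of `ζ` and `℘` have a distance of order `ρ` from a lattice point. -/
theorem exists_norm_basisFun_half_le {L : PeriodPair} {l : ℂ} (hl : l ∈ L.lattice) (j : ℕ) :
    ∃ C ε : ℝ, 0 ≤ C ∧ 0 < ε ∧ ∀ (x : ℂ) (ρ : ℝ), 0 < ρ → ρ < ε → ‖x‖ = 2 * ρ →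
      ‖basisFun L (l + x) ρ j‖ ≤ C / ρ ^ j := by
  match j with
  | 0 => exact ⟨1, 1, zero_le_one, one_pos, fun x ρ _ _ _ => by simp [basisFun]⟩
  | 1 =>
    obtain ⟨C, hC, h⟩ := exists_norm_weierstrassZeta_le hl
    obtain ⟨C', hC', h'⟩ := exists_norm_weierstrassZeta_le (L := L) (Submodule.zero_mem _)
    obtain ⟨ε, hε, h⟩ := exists_ball_of_punctured h
    obtain ⟨ε', hε', h'⟩ := exists_ball_of_punctured h'
    refine ⟨C' + C + C, min (ε / 3) ε', by positivity, lt_min (by positivity) hε',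
      fun x ρ h0 h1 hx => ?_⟩
    have h2 := h1.trans_le (min_le_left _ _)
    have h3 := h1.trans_le (min_le_right _ _)
    have hn : ‖(ρ : ℂ)‖ = ρ := by rw [Complex.norm_real, Real.norm_of_nonneg h0.le]
    have n1 : ρ ≤ ‖x + ρ‖ := by
      have := norm_sub_le (x + ρ) (ρ : ℂ)
      rw [add_sub_cancel_right] at this
      linarith
    have n2 : ‖x + ρ‖ ≤ 3 * ρ := (norm_add_le _ _).trans (by linarith)
    have a1 := h' ρ (by linarith) (by linarith)
    have a2 := h (x + ρ) (by linarith) (by linarith)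
    have a3 := h x (by linarith) (by linarith)
    rw [zero_add, hn] at a1
    simp only [basisFun]
    rw [pow_one, show (ρ : ℂ) + (l + x) = l + (x + ρ) by ring, add_div, add_div]
    refine (norm_add_le _ _).trans (add_le_add ((norm_sub_le _ _).trans (add_le_add a1 ?_)) ?_)
    · exact a2.trans (by gcongr)
    · exact a3.trans (by gcongr; linarith)
  | j + 2 =>
    have hd : ContinuousAt (fun z => -iteratedDeriv (j + 1) (zetaRest L) z) 0 := by
      have h1 := (analyticAt_zetaRest_zero L).iterated_deriv (j + 1)
      rw [iteratedDeriv_eq_iterate]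
      exact h1.continuousAt.neg
    obtain ⟨C, hC⟩ := exists_norm_le_of_tendsto
      (hd.tendsto.mono_left (nhdsWithin_le_nhds (s := {0}ᶜ)))
    obtain ⟨ε, hε, h⟩ := exists_ball_of_punctured (hC.and (eventually_notMem_lattice L 0))
    refine ⟨‖basisCoeff (j + 2)‖ + |C|, min ε 1, by positivity, lt_min hε one_pos,
      fun x ρ h0 h1 hx => ?_⟩
    have hn : ‖(ρ : ℂ)‖ = ρ := by rw [Complex.norm_real, Real.norm_of_nonneg h0.le]
    obtain ⟨h2, h3⟩ := h ρ (by rw [hn]; exact h0) (by rw [hn]; exact h1.trans_le (min_le_left _ _))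
    rw [basisFun_eq h3, add_div]
    refine (norm_add_le _ _).trans (add_le_add ?_ ?_)
    · rw [norm_div, norm_pow, hn]
    · rw [le_div_iff₀ (by positivity)]
      have h4 : ρ ^ (j + 2) ≤ 1 := pow_le_one₀ h0.le (h1.trans_le (min_le_right _ _)).le
      calc _ ≤ |C| * ρ ^ (j + 2) := by
            gcongr
            exact h2.trans (le_abs_self _)
        _ ≤ _ := mul_le_of_le_one_right (abs_nonneg _) h4

/-- Each of the `n + 1` theta factors in the denominator is at least a constant times `ρ` on the
circle `|z| = ρ`, since `z + w` also has distance at least `ρ` from its lattice point; the numerator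
stays bounded. -/
theorem exists_norm_superpotential_half_le (u : ℂ) (v : Hyperplane n) {s τ : ℂ} (hτ : 0 < τ.im)
    (hs : ((n : ℂ) + 1) * s ∈ (periods τ hτ).lattice) :
    ∃ C ε : ℝ, 0 ≤ C ∧ 0 < ε ∧ ∀ (s' z : ℂ) (ρ : ℝ), 0 < ρ → ρ < ε →
      ((n : ℝ) + 1) * ‖s' - s‖ = 2 * ρ → ‖z‖ = ρ →
      ‖superpotential (u, (v, s'), τ) z‖ ≤ C / ρ ^ (n + 1) := by
  obtain ⟨c, hc, h⟩ := exists_mul_norm_le_theta hτ hs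
  obtain ⟨c', hc', h'⟩ := exists_mul_norm_le_theta hτ (Submodule.zero_mem _)
  obtain ⟨ε, hε, h⟩ := exists_ball_of_punctured h
  obtain ⟨ε', hε', h'⟩ := exists_ball_of_punctured h'
  have hd := (differentiable_theta hτ).continuous
  have hcont : Continuous fun q : ℂ × ℂ => cexp (-2 * Real.pi * I * u) *
      ∏ i, theta τ (q.1 - v.1 i + q.2) := by fun_prop
  obtain ⟨ε₂, hε₂, hb⟩ := Metric.eventually_nhds_iff.1
    (hcont.continuousAt.norm.eventually (ge_mem_nhds (lt_add_one _)) :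
      ∀ᶠ q in 𝓝 ((0 : ℂ), s), _)
  set M := ‖cexp (-2 * Real.pi * I * u) * ∏ i, theta τ (0 - v.1 i + s)‖ + 1
  refine ⟨M / (c' ^ n * c), min (min (ε / 3) ε') (ε₂ / 2), by positivity,
    lt_min (lt_min (by positivity) hε') (by positivity), fun s' z ρ h0 h1 hx hz => ?_⟩
  have h2 := h1.trans_le ((min_le_left _ _).trans (min_le_left _ _))
  have h3 := h1.trans_le ((min_le_left _ _).trans (min_le_right _ _))
  have h4 := h1.trans_le (min_le_right _ _)
  have hs1 : ‖s' - s‖ ≤ 2 * ρ := by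
    rw [← hx]
    exact le_mul_of_one_le_left (norm_nonneg _) (by linarith [n.cast_nonneg (α := ℝ)])
  set x := ((n : ℂ) + 1) * (s' - s) with hxdef
  have hxn : ‖x‖ = 2 * ρ := by
    rw [← hx, hxdef, norm_mul]
    congr 1
    exact_mod_cast Complex.norm_natCast (n + 1)
  have n1 : ρ ≤ ‖x + z‖ := by
    have := norm_sub_le (x + z) z
    rw [add_sub_cancel_right] at this
    linarith
  have n2 : ‖x + z‖ ≤ 3 * ρ := (norm_add_le _ _).trans (by linarith)
  have a1 := h' z (by linarith) (by linarith)
  have a2 := h (x + z) (by linarith) (by linarith)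
  have a3 := hb (y := (z, s')) (by
    rw [Prod.dist_eq, dist_zero_right, dist_eq_norm]
    exact max_lt (by linarith) (by linarith))
  rw [zero_add, hz] at a1
  rw [superpotential_eq]
  dsimp only
  rw [show z + ((n : ℂ) + 1) * s' = ((n : ℂ) + 1) * s + (x + z) by rw [hxdef]; ring,
    norm_div, norm_mul (theta τ z ^ n), norm_pow, div_div]
  have h5 : c' ^ n * c * ρ ^ (n + 1) ≤
      ‖theta τ z‖ ^ n * ‖theta τ (((n : ℂ) + 1) * s + (x + z))‖ := by
    calc c' ^ n * c * ρ ^ (n + 1) = (c' * ρ) ^ n * (c * ρ) := by ring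
      _ ≤ (c' * ρ) ^ n * (c * ‖x + z‖) := by gcongr
      _ ≤ _ := by gcongr
  exact div_le_div₀ (by positivity) a3 (by positivity) h5

theorem IsExpansion.polar (hφ : IsExpansion φ) (j : Fin (n + 1)) (u : ℂ) (v : Hyperplane n)
    (s τ : ℂ) (hτ : 0 < τ.im) (hs : ∃ a b : ℤ, ((n : ℂ) + 1) * s = a + b * τ) :
    MeromorphicAt (fun s' => ext (φ j) (u, (v, s'), τ)) s ∧
      ((-(2 * n - 1 + 2 * 1) : ℤ) : WithTop ℤ) ≤
        meromorphicOrderAt (fun s' => ext (φ j) (u, (v, s'), τ)) s := by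
  have hs' : ((n : ℂ) + 1) * s ∈ (periods τ hτ).lattice := mem_periods.2 hs
  obtain ⟨C, ε, hC, hε, h⟩ := exists_norm_superpotential_half_le u v hτ hs'
  choose B η hB hη hB' using fun j => exists_norm_basisFun_half_le hs' j
  obtain ⟨c, hc, h1⟩ := exists_le_norm_lattice hτ
  have hsm : ∀ᶠ s' in 𝓝[≠] s, ∀ e ∈ insert ε (insert (c / 3) (insert 1
      (Finset.univ.image fun k : Fin n => η (k + 1)))), ((n : ℝ) + 1) / 2 * ‖s' - s‖ < e := by
    refine nhdsWithin_le_nhds ((Finset.eventually_all _).2 fun e he => ?_)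
    have he0 : 0 < e := by
      simp only [Finset.mem_insert, Finset.mem_image, Finset.mem_univ, true_and] at he
      rcases he with rfl | rfl | rfl | ⟨k, rfl⟩
      exacts [hε, by positivity, one_pos, hη _]
    have hcont : Continuous fun s' : ℂ => ((n : ℝ) + 1) / 2 * ‖s' - s‖ := by fun_prop
    exact hcont.continuousAt.eventually (gt_mem_nhds (by simpa using he0))
  set K := ∑ k : Fin n, B (k + 1) with hK
  have hK0 : 0 ≤ K := Finset.sum_nonneg fun k _ => hB _
  -- The exponent is `2n + 1`: `n + 1` from the superpotential on the circle and at most `n` from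
  -- the basis functions at `z = ρ`.
  refine meromorphicAt_of_bounded (2 * n - 1 + 2 * 1)
    ((regular_punctured u v s τ hτ).mono fun s' hs' => ?_)
    (C := 2 ^ (2 * n + 1) * (C * (1 + n * K))) ?_
  · exact DifferentiableAt.comp (g := ext (φ j)) (f := fun s' => (u, (v, s'), τ)) s'
      ((hφ.holo j _ hs').differentiableAt (isOpen_regular.mem_nhds hs')) (by fun_prop)
  filter_upwards [hsm, regular_punctured u v s τ hτ, self_mem_nhdsWithin] with s' h2 h3 h4
  have hne : 0 < ‖s' - s‖ := norm_pos_iff.2 (sub_ne_zero.2 h4)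
  -- The radius is half the distance of `w` from the lattice point it approaches, so the disc
  -- contains no pole of the basis functions other than `0`.
  set ρ := ((n : ℝ) + 1) / 2 * ‖s' - s‖ with hρ
  have h0 : 0 < ρ := by positivity
  have e1 := h2 ε (by simp)
  have e2 := h2 (c / 3) (by simp)
  have e3 := h2 1 (by simp)
  have e4 : ∀ k : Fin n, ρ < η (k + 1) := fun k => h2 _ (by simp)
  set x := ((n : ℂ) + 1) * (s' - s) with hxdef
  have hxn : ‖x‖ = 2 * ρ := by
    rw [hρ, hxdef, norm_mul, show (n : ℂ) + 1 = ((n + 1 : ℕ) : ℂ) by push_cast; rfl,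
      Complex.norm_natCast]
    push_cast
    ring
  have hw : ((n : ℂ) + 1) * s' = ((n : ℂ) + 1) * s + x := by rw [hxdef]; ring
  have hdisc : IsPoleFreeDisc (periods τ hτ) (((n : ℂ) + 1) * s') ρ := by
    refine isPoleFreeDisc_of_lt h0 (by linarith) (h1.self_of_nhds hτ) fun z hz hmem => ?_
    have h5 : z + x ∈ (periods τ hτ).lattice := by
      have := sub_mem hmem hs'
      rwa [show z + ((n : ℂ) + 1) * s' - ((n : ℂ) + 1) * s = z + x by rw [hw]; ring] at this
    have h6 : z + x = 0 := by
      by_contra h7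
      have h8 := h1.self_of_nhds hτ _ h5 h7
      have := norm_add_le z x
      linarith
    have h7 : ‖z‖ = ‖x‖ := by rw [eq_neg_of_add_eq_zero_left h6, norm_neg]
    linarith
  have hmain := hφ.norm_le ⟨_, h3⟩ hdisc e3.le (M := C / ρ ^ (n + 1)) (B := K / ρ ^ n)
    (fun z hz => h s' z ρ h0 e1 (by rw [hρ]; ring) hz) (by positivity) (fun k => by
      change ‖basisFun (periods τ hτ) (((n : ℂ) + 1) * s') ρ (k + 1)‖ ≤ _
      rw [hw]
      refine (hB' (k + 1) x ρ h0 (e4 k) hxn).trans ?_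
      refine div_le_div₀ hK0 ?_ (by positivity) ?_
      · exact Finset.single_le_sum (f := fun k : Fin n => B (k + 1)) (fun _ _ => hB _)
          (Finset.mem_univ k)
      · exact pow_le_pow_of_le_one h0.le e3.le k.2) j
  rw [ext_apply (φ j) ⟨_, h3⟩, show (2 * n - 1 + 2 * 1 : ℤ) = ((2 * n + 1 : ℕ) : ℤ) by
    push_cast; ring, zpow_natCast, norm_mul, norm_pow]
  have h5 : ‖s' - s‖ ≤ 2 * ρ := by
    rw [hρ]
    have : (0 : ℝ) ≤ n * ‖s' - s‖ := by positivity
    linarith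
  calc ‖s' - s‖ ^ (2 * n + 1) * ‖φ j ⟨_, h3⟩‖
      ≤ (2 * ρ) ^ (2 * n + 1) * (C / ρ ^ (n + 1) * (1 + n * (K / ρ ^ n))) := by gcongr
    _ ≤ (2 * ρ) ^ (2 * n + 1) * (C / ρ ^ (n + 1) * (1 / ρ ^ n + n * (K / ρ ^ n))) := by
        gcongr
        rw [le_div_iff₀ (by positivity), one_mul]
        exact pow_le_one₀ h0.le e3.le
    _ = _ := by
        field_simp
        ring_nf

/-- The coefficients of the superpotential are Jacobi forms. -/
theorem IsExpansion.isJacobiForm (hφ : IsExpansion φ) (j : Fin (n + 1)) :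
    IsJacobiForm n (-(j : ℤ)) (2 * n - 1) 1 (φ j) where
  weyl := hφ.weyl j
  trans _ _ hx hy k p := hφ.trans j hx hy k p
  modular := hφ.modular j
  index := hφ.index j
  weak := hφ.weak j
  polar u v s τ hτ hs := hφ.polar j u v s τ hτ hs
  holo := hφ.holo j

end Polar

/-! ### Jacobi forms as theta functions -/

section ThetaFunctions

open Filter

variable {n : ℕ} {k l m : ℤ} {F : Fun n}

theorem IsJacobiForm.differentiableAt (hF : IsJacobiForm n k l m F) {p : Space n}
    (hp : p ∈ regular n) : DifferentiableAt ℂ (ext F) p :=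
  (hF.holo p hp).differentiableAt (isOpen_regular.mem_nhds hp)

/-- The index condition is a linear differential equation in `u`, solved by an exponential; outside
the regular points both sides are `0`. -/
theorem IsJacobiForm.ext_eq_exp_mul (hF : IsJacobiForm n k l m F) (u : ℂ) (x : Cartan n × ℂ) :
    ext F (u, x) = cexp (-2 * Real.pi * I * m * u) * ext F (0, x) := by
  by_cases hx : ((0 : ℂ), x) ∈ regular n
  · have hx' : ∀ u : ℂ, (u, x) ∈ regular n := fun _ => hx
    have hd : ∀ u : ℂ, DifferentiableAt ℂ (fun u => ext F (u, x)) u := fun u =>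
      hF.diff ⟨(u, x), hx' u⟩
    have h1 : ∀ u : ℂ, HasDerivAt
        (fun u => cexp (2 * Real.pi * I * m * u) * ext F (u, x)) 0 u := fun u => by
      have h2 := hF.index ⟨(u, x), hx' u⟩
      rw [← ext_apply F] at h2
      have h3 : HasDerivAt (fun u => cexp (2 * Real.pi * I * m * u))
          (cexp (2 * Real.pi * I * m * u) * (2 * Real.pi * I * m * 1)) u :=
        ((hasDerivAt_id u).const_mul _).cexp
      refine (h3.mul (hd u).hasDerivAt).congr_deriv ?_
      have h5 : (Real.pi : ℂ) ≠ 0 := by exact_mod_cast Real.pi_ne_zero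
      dsimp only at h2
      have h6 : deriv (fun u => ext F (u, x)) u = -(2 * Real.pi * I) * (m * ext F (u, x)) := by
        rw [← h2]
        field_simp
      rw [h6]
      ring
    have h2 := is_const_of_deriv_eq_zero (fun u => (h1 u).differentiableAt)
      (fun u => (h1 u).deriv) u 0
    simp only [mul_zero, Complex.exp_zero, one_mul] at h2
    rw [← h2, ← mul_assoc, ← Complex.exp_add,
      show -2 * Real.pi * I * m * u + 2 * Real.pi * I * m * u = 0 by ring, Complex.exp_zero,
      one_mul]
  · have hx' : (u, x) ∉ regular n := hx
    rw [ext, ext, dif_neg hx, dif_neg hx', mul_zero]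

theorem rootVec_mem_intLattice (i j : Fin (n + 1)) :
    ((rootVec i j, 0) : Cartan n) ∈ intLattice n := by
  refine ⟨fun t => ?_, 0, by simp⟩
  rw [rootVec_apply]
  exact ⟨(Pi.single i 1 : Fin (n + 1) → ℤ) t - (Pi.single j 1 : Fin (n + 1) → ℤ) t, by
    simp [Pi.single_apply]⟩

theorem zero_mem_intLattice : (0 : Cartan n) ∈ intLattice n :=
  ⟨fun _ => ⟨0, by simp⟩, 0, by simp⟩

theorem form_rootVec {i j : Fin (n + 1)} (v : Cartan n) :
    form (rootVec i j, 0) v = v.1.1 i - v.1.1 j := by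
  simp [form, rootVec_apply, sub_mul, Finset.sum_sub_distrib, Pi.single_apply]

/-- A Jacobi form of index `m` is, in `v_0, …, v_n`, a theta function of level `m`. -/
theorem IsJacobiForm.isThetaFun (hF : IsJacobiForm n k l m F) {q : ℂ × ℂ}
    (hq : q ∈ ellRegular n) : IsThetaFun q.2 m fun v => ext F (0, (v, q.1), q.2) where
  diff v := DifferentiableAt.comp (g := ext F) (f := fun v => (0, (v, q.1), q.2)) v
    (hF.differentiableAt hq) (by fun_prop)
  symm σ v := by
    have h1 := hF.weyl σ ⟨(0, (v, q.1), q.2), hq⟩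
    rw [← ext_apply F, ← ext_apply F] at h1
    exact h1
  add_root i j _ v := by
    have h1 := hF.trans 0 (rootVec i j, 0) zero_mem_intLattice (rootVec_mem_intLattice i j) 0
      ⟨(0, (v, q.1), q.2), hq⟩
    rw [← ext_apply F, ← ext_apply F] at h1
    simpa [transAct, form] using h1
  add_tau i j h v := by
    have h1 := hF.trans (rootVec i j, 0) 0 (rootVec_mem_intLattice i j) zero_mem_intLattice 0
      ⟨(0, (v, q.1), q.2), hq⟩
    rw [← ext_apply F, ← ext_apply F] at h1
    -- A root has square `2`, so `u` is lowered by `v_i - v_j + τ`; the index turns this shift into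
    -- the multiplier of a theta function.
    have h2 : transAct (rootVec i j, 0) 0 0 ((0 : ℂ), (v, q.1), q.2) =
        (-(v.1 i - v.1 j + q.2), (v + q.2 • rootVec i j, q.1), q.2) := by
      simp only [transAct, form_rootVec, rootVec_left h, rootVec_right h]
      refine Prod.ext ?_ (Prod.ext (Prod.ext ?_ ?_) rfl)
      · push_cast
        ring
      · simp
      · simp
    dsimp only at h1
    rw [h2, hF.ext_eq_exp_mul] at h1
    rw [← h1, ← mul_assoc, ← Complex.exp_add]
    rw [show -2 * Real.pi * I * m * (v.1 i - v.1 j + q.2) +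
      -2 * Real.pi * I * m * -(v.1 i - v.1 j + q.2) = 0 by ring, Complex.exp_zero, one_mul]

theorem IsJacobiForm.eq_zero_of_neg (hn : 1 ≤ n) (hF : IsJacobiForm n k l m F) (hm : m < 0) :
    F = 0 := by
  obtain ⟨y, hy, -⟩ := exists_nodes ∅ Set.countable_empty
  funext p
  have h1 := (hF.isThetaFun (q := (p.1.2.1.2, p.1.2.2)) p.2).eq_zero_of_neg hn p.2.1 hm hy
    p.1.2.1.1
  rw [← ext_apply F]
  have h2 := hF.ext_eq_exp_mul p.1.1 p.1.2
  rw [h1, mul_zero] at h2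
  exact h2

/-- For level zero there are `n` nodes in all. The only set of `n` nodes has empty complement, and
the Lagrange basis is the constant `1`. -/
theorem IsThetaFun.eq_of_level_zero {τ : ℂ} (hτ : 0 < τ.im) {f : Hyperplane n → ℂ}
    (hf : IsThetaFun τ 0 f) (v v' : Hyperplane n) : f v = f v' := by
  obtain ⟨y, hy, -⟩ := exists_nodes ∅ Set.countable_empty
  have hf' : IsThetaFun τ (0 : ℕ) f := hf
  have h1 : ∀ (S : NodeSet n (0 + n)) (v : Hyperplane n), nodeBasis τ y S v = 1 := fun S v => by
    have h2 : Finset.range (0 + n) \ S.1 = ∅ := by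
      rw [← Finset.card_eq_zero, Finset.card_sdiff_of_subset S.subset, S.card, Finset.card_range]
      omega
    rw [nodeBasis, h2, Finset.prod_empty]
  rw [hf'.eq_sum_nodeBasis hτ hy v, hf'.eq_sum_nodeBasis hτ hy v']
  simp only [h1]

/-- A Jacobi form of index `0` only depends on `v_{n+1}` and `τ`. -/
theorem IsJacobiForm.ext_eq_of_index_zero (hF : IsJacobiForm n k l 0 F) {q : ℂ × ℂ}
    (hq : q ∈ ellRegular n) (u u' : ℂ) (v v' : Hyperplane n) :
    ext F (u, (v, q.1), q.2) = ext F (u', (v', q.1), q.2) := by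
  rw [hF.ext_eq_exp_mul u, hF.ext_eq_exp_mul u',
    (hF.isThetaFun hq).eq_of_level_zero hq.1 v v']
  simp

end ThetaFunctions

/-! ### Forms of index zero -/

section IndexZero

open Filter

variable {n : ℕ} {k l : ℤ} {F : Fun n}

/-- Translation by the vector `e_{n+1}` and the modular group move `u` as well, but a form of index
zero does not depend on `u` and `v'`, so the rules descend to the slice `u = 0`, `v' = 0`. -/
theorem IsJacobiForm.isEllipticModular (hF : IsJacobiForm n k l 0 F) :
    IsEllipticModular n k l fun q => ext F (0, (0, q.1), q.2) where
  elliptic a b q hq := by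
    have h1 := hF.trans (0, (a : ℂ)) (0, (b : ℂ)) ⟨fun _ => ⟨0, by simp⟩, a, rfl⟩
      ⟨fun _ => ⟨0, by simp⟩, b, rfl⟩ 0 ⟨(0, (0, q.1), q.2), hq⟩
    rw [← ext_apply F, ← ext_apply F] at h1
    rw [← h1]
    have h2 := transAct_mem (l := ((0 : Hyperplane n), (a : ℂ)))
      (μ := ((0 : Hyperplane n), (b : ℂ))) ⟨fun _ => ⟨0, by simp⟩, a, rfl⟩
      ⟨fun _ => ⟨0, by simp⟩, b, rfl⟩ 0 (p := (0, (0, q.1), q.2)) hq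
    have h3 := hF.ext_eq_of_index_zero (q := (q.1 + q.2 * a + b, q.2)) h2 0
      (transAct (0, (a : ℂ)) (0, (b : ℂ)) 0 ((0 : ℂ), ((0 : Hyperplane n), q.1), q.2)).1 0
      (0 + q.2 • 0 + 0)
    dsimp only at h3 ⊢
    rw [mul_comm (a : ℂ), h3]
    rfl
  modular γ q hq := by
    have h1 := hF.modular γ ⟨(0, (0, q.1), q.2), hq⟩
    rw [← ext_apply F, ← ext_apply F] at h1
    dsimp only at h1 ⊢
    rw [← h1]
    have h2 := modAct_mem γ (p := (0, ((0 : Hyperplane n), q.1), q.2)) hq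
    have h3 := hF.ext_eq_of_index_zero (q := ((autFactor γ q.2)⁻¹ * q.1, moebius γ q.2)) h2 0
      (modAct γ ((0 : ℂ), ((0 : Hyperplane n), q.1), q.2)).1 0 ((autFactor γ q.2)⁻¹ • 0)
    rw [div_eq_inv_mul]
    exact h3
  weak s := by
    obtain ⟨U, hU, C, T, h⟩ := hF.weak 0 0 s
    exact ⟨C, T, fun τ hτ _ => h 0 (mem_of_mem_nhds hU) τ hτ⟩
  polar s τ hτ hs := by
    have h1 := hF.polar 0 0 s τ hτ hs
    rwa [mul_zero, add_zero] at h1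
  holo q hq := DifferentiableAt.differentiableWithinAt <|
    DifferentiableAt.comp (g := ext F) (f := fun q : ℂ × ℂ => (0, (0, q.1), q.2)) q
      (hF.differentiableAt hq) (by fun_prop)

theorem IsEllipticModular.isJacobiForm {g : ℂ × ℂ → ℂ} (hg : IsEllipticModular n k l g)
    (hF : ∀ p : regular n, F p = g (p.1.2.1.2, p.1.2.2)) : IsJacobiForm n k l 0 F := by
  have hext : ∀ p ∈ regular n, ext F p = g (p.2.1.2, p.2.2) := fun p hp => by
    rw [ext_apply F ⟨p, hp⟩, hF]
  exact
  { weyl := fun σ p => by rw [hF, hF]; rfl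
    trans := fun x y hx hy j p => by
      rw [hF, hF]
      obtain ⟨a, ha⟩ := hx.2
      obtain ⟨b, hb⟩ := hy.2
      rw [← hg.elliptic a b (p.1.2.1.2, p.1.2.2) p.2]
      simp only [transAct, Prod.snd_add, Prod.smul_snd, smul_eq_mul, ha, hb]
      rw [mul_comm]
    modular := fun γ p => by
      rw [hF, hF, ← hg.modular γ (p.1.2.1.2, p.1.2.2) p.2]
      simp only [modAct, Prod.smul_snd, smul_eq_mul]
      rw [div_eq_inv_mul]
    index := fun p => by
      have e : (fun u : ℂ => ext F (u, p.1.2)) = fun _ => g (p.1.2.1.2, p.1.2.2) :=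
        funext fun u => hext (u, p.1.2) p.2
      rw [e]
      simp
    weak := fun u v s => by
      obtain ⟨C, T, h⟩ := hg.weak s
      refine ⟨Set.univ, univ_mem, |C|, T, fun v' _ τ hτ => ?_⟩
      by_cases hp : (u, (v', s), τ) ∈ regular n
      · rw [hext _ hp]
        exact (h τ hτ hp).trans (le_abs_self C)
      · rw [ext, dif_neg hp, norm_zero]
        exact abs_nonneg C
    polar := fun u v s τ hτ hs => by
      have e : (fun s' => g (s', τ)) =ᶠ[𝓝[≠] s] fun s' => ext F (u, (v, s'), τ) :=
        (regular_punctured u v s τ hτ).mono fun s' hs' => (hext _ hs').symm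
      obtain ⟨h1, h2⟩ := hg.polar s τ hτ hs
      rw [← meromorphicOrderAt_congr e, mul_zero, add_zero]
      exact ⟨h1.congr e, h2⟩
    holo := by
      have h1 : DifferentiableOn ℂ (fun p : Space n => g (p.2.1.2, p.2.2)) (regular n) :=
        hg.holo.comp (t := ellRegular n) (f := fun p : Space n => (p.2.1.2, p.2.2))
          (by fun_prop) fun p hp => hp
      exact h1.congr hext }

theorem mem_J_zero_iff : F ∈ J n k l 0 ↔ ∃ g : ℂ × ℂ → ℂ, IsEllipticModular n k l g ∧
    ∀ p : regular n, F p = g (p.1.2.1.2, p.1.2.2) := by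
  refine ⟨fun hF => ⟨_, IsJacobiForm.isEllipticModular hF, fun p => ?_⟩,
    fun ⟨g, hg, h⟩ => hg.isJacobiForm h⟩
  rw [← ext_apply F]
  exact IsJacobiForm.ext_eq_of_index_zero hF (q := (p.1.2.1.2, p.1.2.2)) p.2 _ _ _ _

/-- The coefficients only depend on `v_{n+1}` and `τ`. -/
theorem eq_of_mem_coeffRing {G : Fun n} (hG : G ∈ coeffRing n) {p p' : regular n}
    (h1 : p.1.2.1.2 = p'.1.2.1.2) (h2 : p.1.2.2 = p'.1.2.2) : G p = G p' := by
  let W : Submodule ℂ (Fun n) :=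
    { carrier := {G | G p = G p'}
      add_mem' := fun {a b} ha hb => by
        change a p + b p = a p' + b p'
        rw [show a p = a p' from ha, show b p = b p' from hb]
      zero_mem' := rfl
      smul_mem' := fun c a ha => by
        change c * a p = c * a p'
        rw [show a p = a p' from ha] }
  have h3 : (⨆ (k : ℤ) (l : ℤ), J n k l 0) ≤ W := by
    refine iSup₂_le fun k l G hG => ?_
    obtain ⟨g, -, hg⟩ := mem_J_zero_iff.1 hG
    change G p = G p'
    rw [hg, hg, h1, h2]
  exact h3 hG

end IndexZero

/-! ### Homogeneous forms in `n + 1` variables -/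

section Forms

variable {n m : ℕ}

/-- The monomial that belongs to a multiset of variables. -/
def symMonomial (x : Fin (n + 1) → ℂ) (s : Sym (Fin (n + 1)) m) : ℂ := (s.1.map x).prod

/-- The homogeneous form with given coefficients. -/
def symForm (c : Sym (Fin (n + 1)) m → ℂ) (x : Fin (n + 1) → ℂ) : ℂ := ∑ s, c s * symMonomial x s

/-- The multiset of values of a function. -/
def symOf (e : Fin m → Fin (n + 1)) : Sym (Fin (n + 1)) m :=
  ⟨Finset.univ.val.map e, by simp⟩

theorem symMonomial_symOf (x : Fin (n + 1) → ℂ) (e : Fin m → Fin (n + 1)) :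
    symMonomial x (symOf e) = ∏ i, x (e i) := by
  simp only [symMonomial, symOf, Multiset.map_map]
  rfl

/-- The coefficients of a product of linear forms. -/
def prodCoeff (b : Fin m → Fin (n + 1) → ℂ) (s : Sym (Fin (n + 1)) m) : ℂ :=
  ∑ e : Fin m → Fin (n + 1) with symOf e = s, ∏ i, b i (e i)

/-- The product is expanded over all choices of one variable per factor, and the choices are
collected by their multiset of values. -/
theorem symForm_prodCoeff (b : Fin m → Fin (n + 1) → ℂ) (x : Fin (n + 1) → ℂ) :
    symForm (prodCoeff b) x = ∏ i, ∑ j, b i j * x j := by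
  rw [Finset.prod_univ_sum, Fintype.piFinset_univ, symForm,
    ← Finset.sum_fiberwise (g := symOf (n := n) (m := m))]
  refine Finset.sum_congr rfl fun s _ => ?_
  rw [prodCoeff, Finset.sum_mul]
  refine Finset.sum_congr rfl fun e he => ?_
  rw [← (Finset.mem_filter.1 he).2, symMonomial_symOf, Finset.prod_mul_distrib]

theorem symForm_sum_smul {ι : Type*} [Fintype ι] (a : ι → ℂ) (c : ι → Sym (Fin (n + 1)) m → ℂ)
    (x : Fin (n + 1) → ℂ) :
    symForm (fun s => ∑ i, a i * c i s) x = ∑ i, a i * symForm (c i) x := by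
  simp only [symForm, Finset.sum_mul, Finset.mul_sum]
  rw [Finset.sum_comm]
  exact Finset.sum_congr rfl fun i _ => Finset.sum_congr rfl fun s _ => by ring

theorem symMonomial_mul (x y : Fin (n + 1) → ℂ) (s : Sym (Fin (n + 1)) m) :
    symMonomial (fun j => x j * y j) s = symMonomial x s * symMonomial y s :=
  Multiset.prod_map_mul

/-- The weight of a monomial whose `j`-th variable has weight `j`. -/
def symWeight (s : Sym (Fin (n + 1)) m) : ℕ := (s.1.map fun j => (j : ℕ)).sum

theorem symMonomial_pow (t : ℂ) (s : Sym (Fin (n + 1)) m) :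
    symMonomial (fun j => t ^ (j : ℕ)) s = t ^ symWeight s := by
  rw [symWeight, Multiset.sum, symMonomial, Multiset.prod]
  induction s.1 using Multiset.induction_on with
  | empty => simp
  | cons a s ih => simp [ih, pow_add]

theorem isBigO_prodCoeff {X : Type*} {l : Filter X} {g : X → ℂ}
    {b : X → Fin m → Fin (n + 1) → ℂ} (hb : ∀ i j, (fun x => b x i j) =O[l] g)
    (s : Sym (Fin (n + 1)) m) : (fun x => prodCoeff (b x) s) =O[l] fun x => g x ^ m := by
  refine Asymptotics.IsBigO.fun_sum fun e _ => ?_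
  have := Asymptotics.IsBigO.finsetProd (s := (Finset.univ : Finset (Fin m)))
    (f := fun i x => b x i (e i)) (g := fun _ => g) (l := l) fun i _ => hb i (e i)
  simpa using this

theorem symForm_sub (c c' : Sym (Fin (n + 1)) m → ℂ) (x : Fin (n + 1) → ℂ) :
    symForm (fun s => c s - c' s) x = symForm c x - symForm c' x := by
  simp only [symForm, sub_mul, Finset.sum_sub_distrib]

end Forms

/-! ### Interpolation of Jacobi forms -/

section Interpolation

open Filter

variable {n : ℕ} {φ : Fin (n + 1) → Fun n}

/-- The coefficient of `φ_j` in the expansion of `∏ θ(y - v_i)`; here `q = (v_{n+1}, τ)`. -/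
def nodeCoeff (n : ℕ) (j : ℕ) (y : ℂ) (q : ℂ × ℂ) : ℂ :=
  theta q.2 (y - q.1) ^ n * theta q.2 (y - q.1 + ((n : ℂ) + 1) * q.1) *
    basisPair j (((n : ℂ) + 1) * q.1, y - q.1, q.2)

/-- The point `y` avoids the poles. -/
def IsAdapted (n : ℕ) (y : ℂ) (q : ℂ × ℂ) : Prop :=
  (y - q.1, q.2) ∈ offLattice ∧ (y - q.1 + ((n : ℂ) + 1) * q.1, q.2) ∈ offLattice

/-- At `z = y - v_{n+1}` the numerator of `λ` becomes `∏ θ(y - v_i)`, and the denominator depends on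
`(v_{n+1}, τ)` only. -/
theorem IsExpansion.exp_mul_thetaAt (hφ : IsExpansion φ) (p : regular n) {y : ℂ}
    (hy : IsAdapted n y (p.1.2.1.2, p.1.2.2)) :
    cexp (-2 * Real.pi * I * p.1.1) * thetaAt p.1.2.2 y p.1.2.1.1 =
      ∑ j : Fin (n + 1), nodeCoeff n j y (p.1.2.1.2, p.1.2.2) * φ j p := by
  have h1 := (mem_offLattice p.2.1).1 hy.1
  have h2 := (mem_offLattice p.2.1).1 hy.2
  have h3 := hφ p (y - p.1.2.1.2) h1 h2
  have h4 : ∑ j : Fin (n + 1), nodeCoeff n j y (p.1.2.1.2, p.1.2.2) * φ j p =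
      theta p.1.2.2 (y - p.1.2.1.2) ^ n *
        theta p.1.2.2 (y - p.1.2.1.2 + ((n : ℂ) + 1) * p.1.2.1.2) *
        superpotential p.1 (y - p.1.2.1.2) := by
    rw [h3, Finset.mul_sum]
    refine Finset.sum_congr rfl fun j _ => ?_
    rw [nodeCoeff, basisPair_eq p.2.1 h1]
    ring
  rw [h4, superpotential_eq, thetaAt, mul_div_cancel₀]
  · congr 1
    exact Finset.prod_congr rfl fun i _ => by congr 1; ring
  · exact mul_ne_zero (pow_ne_zero _ hy.1.2) hy.2.2

variable {m : ℕ}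

/-- The enumeration of the complement of a set of nodes. -/
def coNode (S : NodeSet n (m + n)) : Fin m ↪o ℕ :=
  (Finset.range (m + n) \ S.1).orderEmbOfFin (by
    rw [Finset.card_sdiff_of_subset S.subset, S.card, Finset.card_range, Nat.add_sub_cancel])

theorem coNode_lt (S : NodeSet n (m + n)) (i : Fin m) : coNode S i < m + n := by
  have := Finset.orderEmbOfFin_mem (Finset.range (m + n) \ S.1) (by
    rw [Finset.card_sdiff_of_subset S.subset, S.card, Finset.card_range, Nat.add_sub_cancel]) i
  exact Finset.mem_range.1 (Finset.mem_sdiff.1 this).1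

theorem nodeBasis_eq (τ : ℂ) (y : ℕ → ℝ) (S : NodeSet n (m + n)) (v : Hyperplane n) :
    nodeBasis τ y S v = ∏ i, thetaAt τ (y (coNode S i)) v := by
  refine Eq.symm ((Finset.prod_map Finset.univ (coNode S).toEmbedding
    fun k => thetaAt τ (y k : ℂ) v).symm.trans ?_)
  rw [nodeBasis]
  congr 1
  ext k
  simp [coNode]

/-- The coefficients of the Lagrange basis as forms in the basic Jacobi forms. -/
def basisNodeCoeff (y : ℕ → ℝ) (S : NodeSet n (m + n)) (s : Sym (Fin (n + 1)) m)
    (q : ℂ × ℂ) : ℂ :=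
  prodCoeff (fun i j => nodeCoeff n j (y (coNode S i)) q) s

theorem IsExpansion.symForm_basisNodeCoeff (hφ : IsExpansion φ) {y : ℕ → ℝ} (p : regular n)
    (hy : ∀ k < m + n, IsAdapted n (y k) (p.1.2.1.2, p.1.2.2)) (S : NodeSet n (m + n)) :
    symForm (fun s => basisNodeCoeff y S s (p.1.2.1.2, p.1.2.2)) (fun j => φ j p) =
      cexp (-2 * Real.pi * I * p.1.1) ^ m * nodeBasis p.1.2.2 y S p.1.2.1.1 := by
  rw [nodeBasis_eq]
  refine (symForm_prodCoeff _ _).trans ?_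
  have h1 : cexp (-2 * Real.pi * I * p.1.1) ^ m =
      ∏ _i : Fin m, cexp (-2 * Real.pi * I * p.1.1) := by simp
  rw [h1, ← Finset.prod_mul_distrib]
  exact Finset.prod_congr rfl fun i _ =>
    (hφ.exp_mul_thetaAt p (hy _ (coNode_lt S i))).symm

theorem exists_adapted (q : ℂ × ℂ) (hq : 0 < q.2.im) :
    ∃ y : ℕ → ℝ, IsNodes y ∧ ∀ k, IsAdapted n (y k) q := by
  obtain ⟨y, hy, h⟩ := exists_nodes
    ((fun x => x - q.1) ⁻¹' poleSet (periods q.2 hq) (((n : ℂ) + 1) * q.1))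
    ((countable_poleSet _ _).preimage sub_left_injective)
  exact ⟨y, hy, fun k => ⟨(mem_offLattice hq).2 fun h1 => h k (Or.inl h1),
    (mem_offLattice hq).2 fun h1 => h k (Or.inr h1)⟩⟩

/-- A form that vanishes on the basic Jacobi forms over a point is zero. -/
theorem IsExpansion.eq_zero_of_symForm (hφ : IsExpansion φ) {q : ℂ × ℂ} (hq : q ∈ ellRegular n)
    {c : Sym (Fin (n + 1)) m → ℂ}
    (hc : ∀ v : Hyperplane n, symForm c (fun j => φ j ⟨(0, (v, q.1), q.2), hq⟩) = 0) : c = 0 := by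
  obtain ⟨y, hy, hyq⟩ := exists_adapted q hq.1
  -- Evaluation of forms in the `φ_j` at the interpolation points. It is onto because the Lagrange
  -- basis consists of such forms, and it is injective because source and target both have dimension
  -- `binom(m + n, n)`.
  let T : (Sym (Fin (n + 1)) m → ℂ) →ₗ[ℂ] (NodeSet n (m + n) → ℂ) :=
    { toFun := fun c S => symForm c (fun j => φ j ⟨(0, (nodePoint y S, q.1), q.2), hq⟩)
      map_add' := fun a b => by
        funext S
        simp only [symForm, Pi.add_apply, add_mul, Finset.sum_add_distrib]
      map_smul' := fun r a => by
        funext S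
        simp only [symForm, Pi.smul_apply, smul_eq_mul, RingHom.id_apply, Finset.mul_sum, mul_assoc] }
  have hsurj : Function.Surjective T := fun a => by
    refine ⟨fun s => ∑ S, a S / nodeBasis q.2 y S (nodePoint y S) * basisNodeCoeff y S s q, ?_⟩
    funext R
    refine (symForm_sum_smul _ _ _).trans ?_
    have h1 : ∀ S : NodeSet n (m + n), symForm (fun s => basisNodeCoeff y S s q)
        (fun j => φ j ⟨(0, (nodePoint y R, q.1), q.2), hq⟩) =
          nodeBasis q.2 y S (nodePoint y R) := fun S => by
      have := hφ.symForm_basisNodeCoeff ⟨(0, (nodePoint y R, q.1), q.2), hq⟩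
        (fun k _ => hyq k) S
      simpa using this
    simp only [h1]
    rw [Finset.sum_eq_single R, div_mul_cancel₀ _ (nodeBasis_nodePoint_self hq.1 hy R)]
    · intro S _ hS
      rw [nodeBasis_nodePoint_of_ne q.2 y hS.symm, mul_zero]
    · simp
  have hcard : Module.finrank ℂ (Sym (Fin (n + 1)) m → ℂ) =
      Module.finrank ℂ (NodeSet n (m + n) → ℂ) := by
    rw [Module.finrank_fintype_fun_eq_card, Module.finrank_fintype_fun_eq_card,
      Sym.card_sym_eq_choose, Fintype.card_coe, Finset.card_powersetCard, Finset.card_range,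
      Fintype.card_fin, show n + 1 + m - 1 = m + n by omega, Nat.choose_symm_add]
  have hinj := (LinearMap.injective_iff_surjective_of_finrank_eq_finrank hcard).2 hsurj
  refine hinj ?_
  rw [map_zero]
  exact funext fun S => hc _

theorem IsExpansion.symForm_unique (hφ : IsExpansion φ) {q : ℂ × ℂ} (hq : q ∈ ellRegular n)
    {c c' : Sym (Fin (n + 1)) m → ℂ}
    (h : ∀ v : Hyperplane n, symForm c (fun j => φ j ⟨(0, (v, q.1), q.2), hq⟩) =
      symForm c' (fun j => φ j ⟨(0, (v, q.1), q.2), hq⟩)) : c = c' := by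
  have h1 := hφ.eq_zero_of_symForm hq (c := fun s => c s - c' s) fun v => by
    rw [symForm_sub, h, sub_self]
  exact funext fun s => sub_eq_zero.1 (congrFun h1 s)

/-- The coefficients of a Jacobi form of index `m` as a form in the basic Jacobi forms. -/
def jacobiCoeff (F : Fun n) (y : ℕ → ℝ) (s : Sym (Fin (n + 1)) m) (q : ℂ × ℂ) : ℂ :=
  ∑ S : NodeSet n (m + n), ext F (0, (nodePoint y S, q.1), q.2) /
    nodeBasis q.2 y S (nodePoint y S) * basisNodeCoeff y S s q

variable {k l : ℤ} {F : Fun n}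

theorem IsExpansion.eq_symForm_jacobiCoeff (hφ : IsExpansion φ) (hF : IsJacobiForm n k l m F)
    {y : ℕ → ℝ} (hy : IsNodes y) (p : regular n)
    (hyp : ∀ k < m + n, IsAdapted n (y k) (p.1.2.1.2, p.1.2.2)) :
    F p = symForm (fun s : Sym (Fin (n + 1)) m => jacobiCoeff F y s (p.1.2.1.2, p.1.2.2))
      (fun j => φ j p) := by
  refine Eq.trans ?_ (symForm_sum_smul _ _ _).symm
  have h1 := hF.ext_eq_exp_mul p.1.1 p.1.2
  have h2 := (hF.isThetaFun (q := (p.1.2.1.2, p.1.2.2)) p.2).eq_sum_nodeBasis p.2.1 hy p.1.2.1.1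
  have h3 : F p = cexp (-2 * Real.pi * I * p.1.1) ^ m * ext F (0, p.1.2) := by
    rw [← ext_apply F, ← Complex.exp_nat_mul]
    refine h1.trans ?_
    congr 2
    push_cast
    ring
  have h4 : ext F (0, p.1.2) = _ := h2
  rw [h3, h4, Finset.mul_sum]
  refine Finset.sum_congr rfl fun S _ => ?_
  rw [hφ.symForm_basisNodeCoeff p hyp S]
  ring

/-- A family of coefficients that expresses `F` through the basic Jacobi forms. -/
def IsCoeff (φ : Fin (n + 1) → Fun n) (F : Fun n) (c : ℂ × ℂ → Sym (Fin (n + 1)) m → ℂ) : Prop :=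
  ∀ p : regular n, F p = symForm (c (p.1.2.1.2, p.1.2.2)) fun j => φ j p

/-- The nodes are chosen for each `q` separately, without any coherence; uniqueness makes the
coefficients independent of the choice. -/
theorem IsExpansion.exists_isCoeff (hφ : IsExpansion φ) (hF : IsJacobiForm n k l m F) :
    ∃ c : ℂ × ℂ → Sym (Fin (n + 1)) m → ℂ, IsCoeff φ F c := by
  have h1 : ∀ q : ℂ × ℂ, ∃ c : Sym (Fin (n + 1)) m → ℂ, ∀ p : regular n,
      q = (p.1.2.1.2, p.1.2.2) → F p = symForm c fun j => φ j p := fun q => by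
    by_cases hq : 0 < q.2.im
    · obtain ⟨y, hy, hyq⟩ := exists_adapted (n := n) q hq
      refine ⟨fun s => jacobiCoeff F y s q, ?_⟩
      rintro p rfl
      exact hφ.eq_symForm_jacobiCoeff hF hy p fun k _ => hyq k
    · exact ⟨0, fun p hp => absurd (by rw [hp]; exact p.2.1) hq⟩
  choose c hc using h1
  exact ⟨c, fun p => hc _ p rfl⟩

/-- Uniqueness permits any adapted nodes in the Lagrange formula, in particular nodes that stay
fixed while `q` varies. -/
theorem IsCoeff.eq_jacobiCoeff {c : ℂ × ℂ → Sym (Fin (n + 1)) m → ℂ} (hc : IsCoeff φ F c)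
    (hφ : IsExpansion φ) (hF : IsJacobiForm n k l m F) {q : ℂ × ℂ} (hq : q ∈ ellRegular n)
    {y : ℕ → ℝ} (hy : IsNodes y) (hyq : ∀ k < m + n, IsAdapted n (y k) q) :
    c q = fun s => jacobiCoeff F y s q :=
  hφ.symForm_unique hq fun v => by
    rw [← hφ.eq_symForm_jacobiCoeff hF hy ⟨(0, (v, q.1), q.2), hq⟩ hyq]
    exact (hc ⟨(0, (v, q.1), q.2), hq⟩).symm

end Interpolation

/-! ### The coefficients are forms of index zero -/

section CoefficientForms

open Filter Asymptotics

variable {n m : ℕ} {φ : Fin (n + 1) → Fun n} {k l : ℤ} {F : Fun n}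
  {c : ℂ × ℂ → Sym (Fin (n + 1)) m → ℂ}

/-- Neither `F` nor the `φ_j` change under translations, so the coefficients at the translated point
also represent `F` at the original one. -/
theorem IsCoeff.elliptic (hc : IsCoeff φ F c) (hφ : IsExpansion φ)
    (hF : IsJacobiForm n k l m F) (a b : ℤ) {q : ℂ × ℂ} (hq : q ∈ ellRegular n) :
    c (q.1 + a * q.2 + b, q.2) = c q :=
  hφ.symForm_unique hq fun v => by
    have hx : ((0 : Hyperplane n), (a : ℂ)) ∈ intLattice n := ⟨fun _ => ⟨0, by simp⟩, a, rfl⟩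
    have hy : ((0 : Hyperplane n), (b : ℂ)) ∈ intLattice n := ⟨fun _ => ⟨0, by simp⟩, b, rfl⟩
    set p : regular n := ⟨(0, (v, q.1), q.2), hq⟩ with hp
    have h1 := hc ⟨transAct _ _ 0 p.1, transAct_mem hx hy 0 p.2⟩
    rw [hF.trans _ _ hx hy, funext fun j => hφ.trans j hx hy 0 p] at h1
    have h2 := hc p
    rw [h1] at h2
    rw [mul_comm (a : ℂ)]
    exact h2

/-- Since `φ_j` has weight `-j`, the monomial of `s` has weight `-symWeight s`, and its coefficient
must make up for it. -/
theorem IsCoeff.modular (hc : IsCoeff φ F c) (hφ : IsExpansion φ) (hF : IsJacobiForm n k l m F)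
    (γ : Matrix.SpecialLinearGroup (Fin 2) ℤ) {q : ℂ × ℂ} (hq : q ∈ ellRegular n)
    (s : Sym (Fin (n + 1)) m) : c (q.1 / autFactor γ q.2, moebius γ q.2) s =
      autFactor γ q.2 ^ (k + symWeight s) * c q s := by
  have ha := autFactor_ne_zero γ hq.1
  have h1 : c q = fun s => autFactor γ q.2 ^ (-k) * (autFactor γ q.2)⁻¹ ^ symWeight s *
      c (q.1 / autFactor γ q.2, moebius γ q.2) s := hφ.symForm_unique hq fun v => by
    set p : regular n := ⟨(0, (v, q.1), q.2), hq⟩ with hp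
    have h2 := hc p
    have h3 := hc ⟨modAct γ p.1, modAct_mem γ p.2⟩
    have h4 : ∀ j : Fin (n + 1), φ j ⟨modAct γ p.1, modAct_mem γ p.2⟩ =
        (autFactor γ q.2)⁻¹ ^ (j : ℕ) * φ j p := fun j => by
      rw [hφ.modular, zpow_neg, zpow_natCast, inv_pow]
    rw [hF.modular, funext h4] at h3
    have h5 : F p = autFactor γ q.2 ^ (-k) * (autFactor γ p.1.2.2 ^ k * F p) := by
      rw [← mul_assoc, ← zpow_add₀ ha, neg_add_cancel, zpow_zero, one_mul]
    rw [h3, h2] at h5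
    refine h5.trans ?_
    simp only [symForm, symMonomial_mul, symMonomial_pow, Finset.mul_sum]
    refine Finset.sum_congr rfl fun s _ => ?_
    have h6 : ((modAct γ p.1).2.1.2, (modAct γ p.1).2.2) =
        (q.1 / autFactor γ q.2, moebius γ q.2) := by
      rw [div_eq_inv_mul]
      rfl
    rw [h6]
    ring
  rw [h1]
  dsimp only
  rw [zpow_add₀ ha, zpow_natCast, zpow_neg, inv_pow]
  field_simp

/-! ### Holomorphy of the coefficients -/

theorem differentiableAt_nodeCoeff (j : ℕ) {y : ℂ} {q : ℂ × ℂ} (hq : q ∈ ellRegular n)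
    (hy : IsAdapted n y q) : DifferentiableAt ℂ (nodeCoeff n j y) q := by
  have hw : (((n : ℂ) + 1) * q.1, q.2) ∈ offLattice :=
    (mem_offLattice hq.1).2 fun h => by
      obtain ⟨a, b, h1⟩ := mem_periods.1 h
      exact hq.2 a b h1
  have d1 : DifferentiableAt ℂ (fun q : ℂ × ℂ => theta q.2 (y - q.1)) q :=
    DifferentiableAt.comp (g := fun q : ℂ × ℂ => theta q.2 q.1)
      (f := fun q : ℂ × ℂ => (y - q.1, q.2)) q (differentiableAt_theta₂ hq.1) (by fun_prop)
  have d2 : DifferentiableAt ℂ (fun q : ℂ × ℂ => theta q.2 (y - q.1 + ((n : ℂ) + 1) * q.1)) q :=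
    DifferentiableAt.comp (g := fun q : ℂ × ℂ => theta q.2 q.1)
      (f := fun q : ℂ × ℂ => (y - q.1 + ((n : ℂ) + 1) * q.1, q.2)) q
      (differentiableAt_theta₂ hq.1) (by fun_prop)
  have d3 : DifferentiableAt ℂ
      (fun q : ℂ × ℂ => basisPair j (((n : ℂ) + 1) * q.1, y - q.1, q.2)) q :=
    DifferentiableAt.comp (g := basisPair j)
      (f := fun q : ℂ × ℂ => (((n : ℂ) + 1) * q.1, y - q.1, q.2)) q
      (differentiableAt_basisPair j hw hy.1 hy.2) (by fun_prop)
  exact ((d1.fun_pow n).fun_mul d2).fun_mul d3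

theorem isOpen_isAdapted (y : ℂ) : IsOpen {q | IsAdapted n y q} := by
  refine IsOpen.inter (isOpen_offLattice.preimage ?_) (isOpen_offLattice.preimage ?_)
  · fun_prop
  · fun_prop

theorem isOpen_ellRegular : IsOpen (ellRegular n) :=
  (isOpen_regular (n := n)).preimage (f := fun q : ℂ × ℂ => ((0 : ℂ), ((0 : Hyperplane n), q.1), q.2))
    (by fun_prop)

theorem differentiableAt_jacobiCoeff (hF : IsJacobiForm n k l m F) {y : ℕ → ℝ} (hy : IsNodes y)
    {q : ℂ × ℂ} (hq : q ∈ ellRegular n) (hyq : ∀ k < m + n, IsAdapted n (y k) q)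
    (s : Sym (Fin (n + 1)) m) : DifferentiableAt ℂ (jacobiCoeff F y s) q := by
  refine DifferentiableAt.fun_sum fun S _ => ?_
  have d1 : DifferentiableAt ℂ (fun q : ℂ × ℂ => ext F (0, (nodePoint y S, q.1), q.2)) q :=
    DifferentiableAt.comp (g := ext F) (f := fun q : ℂ × ℂ => (0, (nodePoint y S, q.1), q.2)) q
      (hF.differentiableAt hq) (by fun_prop)
  have d2 : DifferentiableAt ℂ (fun q : ℂ × ℂ => nodeBasis q.2 y S (nodePoint y S)) q := by
    have h1 : ∀ x : ℂ, DifferentiableAt ℂ (fun q : ℂ × ℂ => theta q.2 x) q := fun x =>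
      DifferentiableAt.comp (g := fun q : ℂ × ℂ => theta q.2 q.1)
        (f := fun q : ℂ × ℂ => (x, q.2)) q (differentiableAt_theta₂ hq.1) (by fun_prop)
    have h2 : ∀ (k : ℕ) (i : Fin (n + 1)), DifferentiableAt ℂ
        (fun q : ℂ × ℂ => theta q.2 ((y k : ℂ) - (nodePoint y S).1 i)) q := fun k i => h1 _
    have h3 : ∀ k : ℕ, DifferentiableAt ℂ
        (fun q : ℂ × ℂ => thetaAt q.2 (y k) (nodePoint y S)) q := fun k => by
      have h4 := h2 k
      unfold thetaAt
      fun_prop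
    exact (HasFDerivAt.finsetProd fun k _ => (h3 k).hasFDerivAt).differentiableAt
  have d3 : DifferentiableAt ℂ (basisNodeCoeff y S s) q := by
    have h1 : ∀ (i : Fin m) (j : Fin (n + 1)),
        DifferentiableAt ℂ (nodeCoeff n j (y (coNode S i))) q := fun i j =>
      differentiableAt_nodeCoeff _ hq (hyq _ (coNode_lt S i))
    unfold basisNodeCoeff prodCoeff
    fun_prop
  exact (d1.fun_mul (d2.fun_inv (nodeBasis_nodePoint_self hq.1 hy S))).fun_mul d3

/-- To be adapted is an open condition, so near `q` the coefficients are given by the Lagrange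
formula with fixed nodes. -/
theorem IsCoeff.differentiableAt (hc : IsCoeff φ F c) (hφ : IsExpansion φ)
    (hF : IsJacobiForm n k l m F) {q : ℂ × ℂ} (hq : q ∈ ellRegular n)
    (s : Sym (Fin (n + 1)) m) : DifferentiableAt ℂ (fun q => c q s) q := by
  obtain ⟨y, hy, hyq⟩ := exists_adapted (n := n) q hq.1
  refine (differentiableAt_jacobiCoeff hF hy hq (fun k _ => hyq k) s).congr_of_eventuallyEq ?_
  have h1 : ∀ᶠ q in 𝓝 q, ∀ k ∈ Finset.range (m + n), IsAdapted n (y k) q :=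
    (Finset.eventually_all _).2 fun k _ => (isOpen_isAdapted _).mem_nhds (hyq k)
  filter_upwards [h1, isOpen_ellRegular.mem_nhds hq] with q' h2 h3
  rw [hc.eq_jacobiCoeff hφ hF h3 hy fun k hk => h2 k (Finset.mem_range.2 hk)]

/-! ### Growth of the coefficients -/

theorem isBigO_jacobiCoeff {X : Type*} {L : Filter X} {f : X → ℂ × ℂ} {g h : X → ℂ} {y : ℕ → ℝ}
    (h1 : ∀ S : NodeSet n (m + n), (fun x => ext F (0, (nodePoint y S, (f x).1), (f x).2)) =O[L] g)
    (h2 : ∀ S : NodeSet n (m + n),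
      (fun x => (nodeBasis (f x).2 y S (nodePoint y S))⁻¹) =O[L] fun _ => (1 : ℂ))
    (h3 : ∀ (j : ℕ), ∀ k < m + n, (fun x => nodeCoeff n j (y k) (f x)) =O[L] h)
    (s : Sym (Fin (n + 1)) m) :
    (fun x => jacobiCoeff F y s (f x)) =O[L] fun x => g x * h x ^ m := by
  refine IsBigO.fun_sum fun S _ => ?_
  have h4 : (fun x => basisNodeCoeff y S s (f x)) =O[L] fun x => h x ^ m :=
    isBigO_prodCoeff (fun i j => h3 j _ (coNode_lt S i)) s
  simpa [div_eq_mul_inv] using ((h1 S).mul (h2 S)).mul h4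

theorem isBigO_one_iff_im {f : ℂ → ℂ} : f =O[comap Complex.im atTop] (fun _ => (1 : ℂ)) ↔
    ∃ C T : ℝ, ∀ τ : ℂ, T ≤ τ.im → ‖f τ‖ ≤ C := by
  rw [isBigO_iff]
  refine exists_congr fun C => ?_
  rw [eventually_comap, eventually_atTop]
  simp only [norm_one, mul_one]
  exact exists_congr fun T => ⟨fun h τ hτ => h _ hτ τ rfl, fun h b hb τ hτ => h τ (hτ ▸ hb)⟩

theorem exists_mem_awayFromInt_of_finset (s : Finset ℂ) (hs : ∀ w ∈ s, ∀ k : ℤ, w ≠ k) :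
    ∃ r δ : ℝ, 0 ≤ r ∧ 0 < δ ∧ ∀ w ∈ s, w ∈ awayFromInt r δ := by
  classical
  induction s using Finset.induction_on with
  | empty => exact ⟨0, 1, le_rfl, one_pos, by simp⟩
  | insert a s ha ih =>
    obtain ⟨r, δ, hr, hδ, h⟩ := ih fun w hw => hs w (Finset.mem_insert_of_mem hw)
    obtain ⟨δ', hδ', -, h'⟩ := exists_mem_awayFromInt (hs a (Finset.mem_insert_self a s))
    refine ⟨max r ‖a‖, min δ δ', hr.trans (le_max_left _ _), lt_min hδ hδ', fun w hw => ?_⟩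
    rcases Finset.mem_insert.1 hw with rfl | hw
    · refine ⟨le_max_right _ _, fun k => (min_le_right _ _).trans ?_⟩
      linarith [h' k]
    · exact ⟨(h w hw).1.trans (le_max_left _ _), fun k => (min_le_left _ _).trans ((h w hw).2 k)⟩

theorem isBigO_theta_inv {x : ℂ} (hx : ∀ k : ℤ, x ≠ k) :
    (fun τ => (theta τ x)⁻¹) =O[comap Complex.im atTop] fun _ => (1 : ℂ) := by
  obtain ⟨r, δ, -, hδ, h⟩ := exists_mem_awayFromInt_of_finset {x} (by simpa using hx)
  obtain ⟨a, T, ha, -, hT⟩ := exists_le_norm_theta r hδ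
  refine isBigO_one_iff_im.2 ⟨a⁻¹, T, fun τ hτ => ?_⟩
  rw [norm_inv]
  exact inv_anti₀ ha (hT x (h x (by simp)) τ hτ)

/-- The arguments of the theta factors do not depend on `τ`. Since integers are lattice points for
every `τ`, non-vanishing at `τ = i` shows that none of the arguments is an integer, and then each
factor is bounded below as `Im τ → ∞`. -/
theorem isBigO_nodeBasis_inv {y : ℕ → ℝ} (hy : IsNodes y) (S : NodeSet n (m + n)) :
    (fun τ => (nodeBasis τ y S (nodePoint y S))⁻¹) =O[comap Complex.im atTop]
      fun _ => (1 : ℂ) := by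
  have hI : 0 < Complex.I.im := by simp
  have h1 : ∀ k ∈ Finset.range (m + n) \ S.1, ∀ i, ∀ t : ℤ,
      (y k : ℂ) - (nodePoint y S).1 i ≠ t := fun k hk i t h => by
    have h2 := nodeBasis_nodePoint_self hI hy S
    rw [nodeBasis, Finset.prod_ne_zero_iff] at h2
    have h3 := h2 k hk
    rw [thetaAt, Finset.prod_ne_zero_iff] at h3
    refine h3 i (Finset.mem_univ i) ((theta_eq_zero_iff hI).2 (mem_periods.2 ⟨t, 0, ?_⟩))
    rw [h]
    simp
  simp only [nodeBasis, thetaAt, ← Finset.prod_inv_distrib]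
  have h2 := IsBigO.finsetProd (s := Finset.range (m + n) \ S.1)
    (f := fun k τ => ∏ i, (theta τ (y k - (nodePoint y S).1 i))⁻¹) (g := fun _ _ => (1 : ℂ))
    (l := comap Complex.im atTop) fun k hk => by
      have := IsBigO.finsetProd (s := Finset.univ)
        (f := fun i τ => (theta τ (y k - (nodePoint y S).1 i))⁻¹) (g := fun _ _ => (1 : ℂ))
        (l := comap Complex.im atTop) fun i _ => isBigO_theta_inv (h1 k hk i)
      simpa using this
  simpa using h2

theorem isBigO_theta (x : ℂ) :
    (fun τ => theta τ x) =O[comap Complex.im atTop] fun _ => (1 : ℂ) := by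
  obtain ⟨C, -, hC⟩ := exists_norm_theta_le ‖x‖
  exact isBigO_one_iff_im.2 ⟨C, 1, fun τ hτ => hC x τ le_rfl hτ⟩

theorem isBigO_nodeCoeff_im (j : ℕ) {y s : ℂ} {r δ : ℝ} (hr : 0 ≤ r) (hδ : 0 < δ)
    (hw : ((n : ℂ) + 1) * s ∈ awayFromInt r δ) (hy : y - s ∈ awayFromInt r δ)
    (hyw : y - s + ((n : ℂ) + 1) * s ∈ awayFromInt r δ) :
    (fun τ => nodeCoeff n j y (s, τ)) =O[comap Complex.im atTop] fun _ => (1 : ℂ) := by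
  obtain ⟨C, hC⟩ := exists_norm_basisFun_le hr hδ j
  have h1 : (fun τ => basisPair j (((n : ℂ) + 1) * s, y - s, τ)) =O[comap Complex.im atTop]
      fun _ => (1 : ℂ) := by
    refine isBigO_one_iff_im.2 ⟨C, max 1 (r + δ), fun τ hτ => ?_⟩
    have h2 : 0 < τ.im := one_pos.trans_le ((le_max_left _ _).trans hτ)
    have h3 := (le_max_right _ _).trans hτ
    rw [basisPair_eq h2 (notMem_of_mem_awayFromInt hδ hy h3 h2)]
    exact hC _ hw _ hy hyw τ h2 h3
  have h2 := (((isBigO_theta (y - s)).pow n).mul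
    (isBigO_theta (y - s + ((n : ℂ) + 1) * s))).mul h1
  simp only [one_pow, mul_one] at h2
  exact h2

theorem IsCoeff.weak (hc : IsCoeff φ F c) (hφ : IsExpansion φ) (hF : IsJacobiForm n k l m F)
    (s : Sym (Fin (n + 1)) m) (x : ℂ) : ∃ C T : ℝ, ∀ τ : ℂ, T ≤ τ.im →
      (x, τ) ∈ ellRegular n → ‖c (x, τ) s‖ ≤ C := by
  by_cases hx : ∃ t : ℤ, ((n : ℂ) + 1) * x = t
  · obtain ⟨t, ht⟩ := hx
    exact ⟨0, 0, fun τ _ h => absurd (show ((n : ℂ) + 1) * x = t + (0 : ℤ) * τ by simpa using ht)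
      (h.2 t 0)⟩
  push Not at hx
  -- The nodes avoid `x + ℤ` and `x - w + ℤ` with `w = (n + 1) x`, so they are adapted to `(x, τ)`
  -- as soon as `Im τ` is large, with uniform bounds.
  obtain ⟨y, hy, hyx⟩ := exists_nodes (Set.range (fun t : ℤ => t + x) ∪
    Set.range fun t : ℤ => t + x - ((n : ℂ) + 1) * x)
    ((Set.countable_range _).union (Set.countable_range _))
  obtain ⟨r, δ, hr, hδ, h⟩ := exists_mem_awayFromInt_of_finset
    (insert (((n : ℂ) + 1) * x) ((Finset.range (m + n)).image (fun k => (y k : ℂ) - x) ∪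
      (Finset.range (m + n)).image fun k => (y k : ℂ) - x + ((n : ℂ) + 1) * x)) (fun w hw t ht => by
    simp only [Finset.mem_insert, Finset.mem_union, Finset.mem_image] at hw
    rcases hw with rfl | ⟨k, -, rfl⟩ | ⟨k, -, rfl⟩
    · exact hx t ht
    · exact hyx k (Or.inl ⟨t, by dsimp only; rw [← ht]; ring⟩)
    · exact hyx k (Or.inr ⟨t, by dsimp only; rw [← ht]; ring⟩))
  have hw := h _ (Finset.mem_insert_self _ _)
  have h1 : ∀ k < m + n, (y k : ℂ) - x ∈ awayFromInt r δ := fun k hk => h _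
    (Finset.mem_insert_of_mem (Finset.mem_union_left _
      (Finset.mem_image_of_mem _ (Finset.mem_range.2 hk))))
  have h2 : ∀ k < m + n, (y k : ℂ) - x + ((n : ℂ) + 1) * x ∈ awayFromInt r δ := fun k hk => h _
    (Finset.mem_insert_of_mem (Finset.mem_union_right _
      (Finset.mem_image_of_mem (fun k => (y k : ℂ) - x + ((n : ℂ) + 1) * x)
        (Finset.mem_range.2 hk))))
  have h3 := isBigO_jacobiCoeff (F := F) (f := fun τ => (x, τ)) (L := comap Complex.im atTop)
    (g := fun _ => 1) (h := fun _ => 1) (y := y) (m := m) (fun S => by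
      obtain ⟨U, hU, C, T, hT⟩ := hF.weak 0 (nodePoint y S) x
      exact isBigO_one_iff_im.2 ⟨C, T, fun τ hτ => hT _ (mem_of_mem_nhds hU) τ hτ⟩)
    (fun S => isBigO_nodeBasis_inv hy S)
    (fun j k hk => isBigO_nodeCoeff_im j hr hδ hw (h1 k hk) (h2 k hk)) s
  simp only [one_pow, mul_one] at h3
  obtain ⟨C, T, hT⟩ := isBigO_one_iff_im.1 h3
  refine ⟨C, max T (r + δ), fun τ hτ hq => ?_⟩
  have h4 := (le_max_right _ _).trans hτ
  rw [hc.eq_jacobiCoeff hφ hF hq hy fun k hk =>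
    ⟨(mem_offLattice hq.1).2 (notMem_of_mem_awayFromInt hδ (h1 k hk) h4 hq.1),
      (mem_offLattice hq.1).2 (notMem_of_mem_awayFromInt hδ (h2 k hk) h4 hq.1)⟩]
  exact hT τ ((le_max_left _ _).trans hτ)

theorem isBigO_inv_of_continuousAt {f : ℂ → ℂ} {x : ℂ} (hf : ContinuousAt f x) :
    f =O[𝓝[≠] x] fun x' => (x' - x)⁻¹ := by
  obtain ⟨C, hC⟩ := exists_norm_le_of_tendsto (hf.tendsto.mono_left (nhdsWithin_le_nhds (s := {x}ᶜ)))
  refine IsBigO.of_bound |C| ?_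
  filter_upwards [hC, nhdsWithin_le_nhds (Metric.ball_mem_nhds x one_pos), self_mem_nhdsWithin]
    with x' h1 h2 h3
  rw [mem_ball_iff_norm] at h2
  have h4 : 0 < ‖x' - x‖ := norm_pos_iff.2 (sub_ne_zero.2 h3)
  rw [norm_inv]
  calc ‖f x'‖ ≤ |C| * 1 := by rw [mul_one]; exact h1.trans (le_abs_self C)
    _ ≤ _ := by gcongr; exact (one_le_inv₀ h4).2 h2.le

/-- As `w` tends to a lattice point with `y` adapted, the only term that becomes singular is `ζ(w)`
in the function with `j = 1`, and its pole is simple. -/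
theorem isBigO_basisPair_spread (j : ℕ) {x y τ : ℂ} (hτ : 0 < τ.im)
    (hx : ((n : ℂ) + 1) * x ∈ (periods τ hτ).lattice) (hy : IsAdapted n y (x, τ)) :
    (fun x' => basisPair j (((n : ℂ) + 1) * x', y - x', τ)) =O[𝓝[≠] x]
      fun x' => (x' - x)⁻¹ := by
  have h1 : y - x ∉ (periods τ hτ).lattice := (mem_offLattice hτ).1 hy.1
  have h2 : y - x + ((n : ℂ) + 1) * x ∉ (periods τ hτ).lattice := (mem_offLattice hτ).1 hy.2
  have hev : ∀ᶠ x' in 𝓝 x, y - x' ∉ (periods τ hτ).lattice := by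
    have hcont : Continuous fun x' : ℂ => y - x' := by fun_prop
    exact hcont.continuousAt.eventually ((isOpen_compl_lattice _).mem_nhds h1)
  have hcongr : (fun x' => basisPair j (((n : ℂ) + 1) * x', y - x', τ)) =ᶠ[𝓝[≠] x]
      fun x' => basisFun (periods τ hτ) (((n : ℂ) + 1) * x') (y - x') j :=
    nhdsWithin_le_nhds (hev.mono fun x' h => basisPair_eq hτ h j)
  refine hcongr.trans_isBigO ?_
  match j with
  | 0 => exact isBigO_inv_of_continuousAt continuousAt_const
  | 1 =>
    have c1 : ContinuousAt (fun x' => weierstrassZeta (periods τ hτ) (y - x')) x :=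
      ContinuousAt.comp (g := weierstrassZeta (periods τ hτ)) (f := fun x' => y - x')
        (differentiableAt_weierstrassZeta _ h1).continuousAt (by fun_prop)
    have c2 : ContinuousAt
        (fun x' => weierstrassZeta (periods τ hτ) (y - x' + ((n : ℂ) + 1) * x')) x :=
      ContinuousAt.comp (g := weierstrassZeta (periods τ hτ))
        (f := fun x' => y - x' + ((n : ℂ) + 1) * x')
        (differentiableAt_weierstrassZeta _ h2).continuousAt (by fun_prop)
    refine (isBigO_inv_of_continuousAt (c1.sub c2)).add ?_
    obtain ⟨C, hC, hb⟩ := exists_norm_weierstrassZeta_le hx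
    obtain ⟨ε, hε, hb⟩ := exists_ball_of_punctured hb
    refine IsBigO.of_bound C ?_
    have hn : ‖(n : ℂ) + 1‖ = n + 1 := by exact_mod_cast Complex.norm_natCast (n + 1)
    have hsm : ∀ᶠ x' in 𝓝 x, ‖((n : ℂ) + 1) * (x' - x)‖ < ε := by
      have hcont : Continuous fun x' : ℂ => ‖((n : ℂ) + 1) * (x' - x)‖ := by fun_prop
      exact hcont.continuousAt.eventually (gt_mem_nhds (by simpa using hε))
    filter_upwards [nhdsWithin_le_nhds hsm, self_mem_nhdsWithin] with x' h3 h4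
    have h5 : 0 < ‖x' - x‖ := norm_pos_iff.2 (sub_ne_zero.2 h4)
    have h6 : ‖x' - x‖ ≤ ‖((n : ℂ) + 1) * (x' - x)‖ := by
      rw [norm_mul, hn]
      exact le_mul_of_one_le_left h5.le (by linarith [n.cast_nonneg (α := ℝ)])
    have h7 := hb _ (h5.trans_le h6) h3
    rw [show ((n : ℂ) + 1) * x + ((n : ℂ) + 1) * (x' - x) = ((n : ℂ) + 1) * x' by ring] at h7
    refine h7.trans ?_
    rw [norm_inv, ← div_eq_mul_inv]
    gcongr
  | j + 2 =>
    have h3 := ((isEllipticFun_basisFun (L := periods τ hτ) 0 (j + 2)).diff (y - x)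
      (fun h => h.elim h1 fun h => h1 (by rwa [add_zero] at h))).continuousAt
    exact isBigO_inv_of_continuousAt (ContinuousAt.comp
      (g := fun z => basisFun (periods τ hτ) 0 z (j + 2)) (f := fun x' => y - x') h3 (by fun_prop))

theorem isBigO_nodeCoeff_spread (j : ℕ) {x y τ : ℂ} (hτ : 0 < τ.im)
    (hx : ((n : ℂ) + 1) * x ∈ (periods τ hτ).lattice) (hy : IsAdapted n y (x, τ)) :
    (fun x' => nodeCoeff n j y (x', τ)) =O[𝓝[≠] x] fun x' => (x' - x)⁻¹ := by
  have hd := (differentiable_theta hτ).continuous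
  have hc : Continuous fun x' => theta τ (y - x') ^ n * theta τ (y - x' + ((n : ℂ) + 1) * x') := by
    fun_prop
  obtain ⟨C, hC⟩ := exists_norm_le_of_tendsto
    (hc.continuousAt.tendsto.mono_left (nhdsWithin_le_nhds (a := x) (s := {x}ᶜ)))
  have h1 : (fun x' => theta τ (y - x') ^ n * theta τ (y - x' + ((n : ℂ) + 1) * x')) =O[𝓝[≠] x]
      fun _ => (1 : ℂ) := IsBigO.of_bound C (by simpa using hC)
  have h2 := h1.mul (isBigO_basisPair_spread j hτ hx hy)
  simp only [one_mul] at h2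
  exact h2

/-- In the Lagrange formula the values of `F` have poles of order at most `l + 2m`, and each of the
`m` linear factors contributes at most one more. -/
theorem IsCoeff.polar (hc : IsCoeff φ F c) (hφ : IsExpansion φ) (hF : IsJacobiForm n k l m F)
    (s : Sym (Fin (n + 1)) m) {x τ : ℂ} (hτ : 0 < τ.im)
    (hx : ∃ a b : ℤ, ((n : ℂ) + 1) * x = a + b * τ) :
    MeromorphicAt (fun x' => c (x', τ) s) x ∧
      ((-(l + 3 * m) : ℤ) : WithTop ℤ) ≤ meromorphicOrderAt (fun x' => c (x', τ) s) x := by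
  obtain ⟨y, hy, hyx⟩ := exists_adapted (n := n) (x, τ) hτ
  have hreg : ∀ᶠ x' in 𝓝[≠] x, (x', τ) ∈ ellRegular n := regular_punctured 0 0 x τ hτ
  have h1 : ∀ S : NodeSet n (m + n), (fun x' => ext F (0, (nodePoint y S, x'), τ)) =O[𝓝[≠] x]
      fun x' => (x' - x) ^ (-(l + 2 * m)) := fun S => by
    obtain ⟨hm, ho⟩ := hF.polar 0 (nodePoint y S) x τ hτ hx
    obtain ⟨C, hC⟩ := bounded_of_order_le hm ho
    refine IsBigO.of_bound C ?_
    filter_upwards [hC, self_mem_nhdsWithin] with x' h2 h3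
    have h4 : 0 < ‖x' - x‖ := norm_pos_iff.2 (sub_ne_zero.2 h3)
    rw [norm_mul, norm_zpow] at h2
    rw [norm_zpow, zpow_neg, ← div_eq_mul_inv, le_div_iff₀ (zpow_pos h4 _), mul_comm]
    exact h2
  have h2 := isBigO_jacobiCoeff (m := m) (f := fun x' => (x', τ)) h1
    (fun S => isBigO_const_const (nodeBasis τ y S (nodePoint y S))⁻¹ one_ne_zero (𝓝[≠] x))
    (fun j k _ => isBigO_nodeCoeff_spread j hτ (mem_periods.2 hx) (hyx k)) s
  obtain ⟨C, hC⟩ := h2.bound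
  have hev : ∀ᶠ x' in 𝓝 x, ∀ k ∈ Finset.range (m + n), IsAdapted n (y k) (x', τ) :=
    (Finset.eventually_all _).2 fun k _ => by
      have hcont : Continuous fun x' : ℂ => (x', τ) := by fun_prop
      exact hcont.continuousAt.eventually ((isOpen_isAdapted _).mem_nhds (hyx k))
  refine meromorphicAt_of_bounded (l + 3 * m) (hreg.mono fun x' hx' => ?_) (C := C) ?_
  · exact DifferentiableAt.comp (g := fun q => c q s) (f := fun x' => (x', τ)) x'
      (hc.differentiableAt hφ hF hx' s) (by fun_prop)
  filter_upwards [hC, hreg, nhdsWithin_le_nhds hev, self_mem_nhdsWithin] with x' h3 h4 h5 h6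
  have h7 : x' - x ≠ 0 := sub_ne_zero.2 h6
  rw [hc.eq_jacobiCoeff hφ hF h4 hy fun k hk => h5 k (Finset.mem_range.2 hk), norm_mul]
  refine (mul_le_mul_of_nonneg_left h3 (norm_nonneg _)).trans_eq ?_
  have h8 : (x' - x) ^ (l + 3 * m) * ((x' - x) ^ (-(l + 2 * m)) * (x' - x)⁻¹ ^ m) = 1 := by
    rw [← zpow_natCast, ← zpow_neg_one, ← zpow_mul, ← zpow_add₀ h7, ← zpow_add₀ h7,
      show l + 3 * (m : ℤ) + (-(l + 2 * m) + -1 * m) = 0 by ring, zpow_zero]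
  rw [mul_left_comm, ← norm_mul, h8, norm_one, mul_one]

/-- This identifies the coefficients as forms of index zero, so that they belong to `coeffRing n`.
-/
theorem IsCoeff.isEllipticModular (hc : IsCoeff φ F c) (hφ : IsExpansion φ)
    (hF : IsJacobiForm n k l m F) (s : Sym (Fin (n + 1)) m) :
    IsEllipticModular n (k + symWeight s) (l + 3 * m) fun q => c q s where
  elliptic a b q hq := by rw [hc.elliptic hφ hF a b hq]
  modular γ q hq := hc.modular hφ hF γ hq s
  weak x := hc.weak hφ hF s x
  polar x τ hτ hx := hc.polar hφ hF s hτ hx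
  holo _ hq := (hc.differentiableAt hφ hF hq s).differentiableWithinAt

theorem mem_coeffRing_of_mem_J {G : Fun n} (hG : G ∈ J n k l 0) : G ∈ coeffRing n :=
  Submodule.mem_iSup_of_mem k (Submodule.mem_iSup_of_mem l hG)

/-- Every Jacobi form is a polynomial in the basic ones, with coefficients of index zero. -/
theorem IsExpansion.mem_adjoin (hn : 1 ≤ n) (hφ : IsExpansion φ) {m : ℤ}
    (hF : IsJacobiForm n k l m F) : F ∈ Algebra.adjoin (coeffRing n) (Set.range φ) := by
  rcases lt_or_ge m 0 with hm | hm
  · rw [hF.eq_zero_of_neg hn hm]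
    exact Subalgebra.zero_mem _
  obtain ⟨m, rfl⟩ := Int.eq_ofNat_of_zero_le hm
  obtain ⟨c, hc⟩ := hφ.exists_isCoeff hF
  have h1 : F = ∑ s : Sym (Fin (n + 1)) m,
      (fun p : regular n => c (p.1.2.1.2, p.1.2.2) s) * (s.1.map φ).prod := by
    funext p
    rw [hc p, symForm, Finset.sum_apply]
    refine Finset.sum_congr rfl fun s _ => ?_
    rw [Pi.mul_apply, symMonomial]
    congr 1
    have h2 := map_multiset_prod (Pi.evalMonoidHom (fun _ : regular n => ℂ) p) (s.1.map φ)
    rw [Multiset.map_map] at h2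
    exact h2.symm
  rw [h1]
  refine Subalgebra.sum_mem _ fun s _ => Subalgebra.mul_mem _ ?_ ?_
  · have h2 : (fun p : regular n => c (p.1.2.1.2, p.1.2.2) s) ∈ coeffRing n :=
      mem_coeffRing_of_mem_J (mem_J_zero_iff.2 ⟨_, hc.isEllipticModular hφ hF s, fun _ => rfl⟩)
    exact Subalgebra.algebraMap_mem _ (⟨_, h2⟩ : coeffRing n)
  · refine Subalgebra.multiset_prod_mem _ fun G hG => ?_
    obtain ⟨j, -, rfl⟩ := Multiset.mem_map.1 hG
    exact Algebra.subset_adjoin ⟨j, rfl⟩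

end CoefficientForms

/-! ### Independence -/

section Independence

/-- After multiplication by a power of `t`, a Laurent polynomial with infinitely many zeros becomes
a polynomial with infinitely many roots. -/
theorem eq_zero_of_sum_zpow (s : Finset ℤ) (a : ℤ → ℂ) {T : Set ℂ} (hT : T.Infinite)
    (h0 : ∀ t ∈ T, t ≠ 0) (h : ∀ t ∈ T, ∑ k ∈ s, a k * t ^ k = 0) : ∀ k ∈ s, a k = 0 := by
  -- Large enough to make every exponent `k + N` nonnegative.
  set N : ℕ := ∑ k ∈ s, k.natAbs with hN
  have hk : ∀ k ∈ s, 0 ≤ k + N := fun k hk => by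
    have := Finset.single_le_sum (f := fun k : ℤ => k.natAbs) (fun _ _ => Nat.zero_le _) hk
    omega
  set P : Polynomial ℂ := ∑ k ∈ s, Polynomial.monomial (k + N).toNat (a k) with hP
  have h1 : P = 0 := by
    refine Polynomial.eq_zero_of_infinite_isRoot P (hT.mono fun t ht => ?_)
    change P.eval t = 0
    rw [hP, Polynomial.eval_finsetSum]
    have h2 : ∀ k ∈ s, (Polynomial.monomial (k + N).toNat (a k)).eval t =
        t ^ N * (a k * t ^ k) := fun k hks => by
      rw [Polynomial.eval_monomial, ← zpow_natCast, Int.toNat_of_nonneg (hk k hks),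
        zpow_add₀ (h0 t ht), zpow_natCast]
      ring
    rw [Finset.sum_congr rfl h2, ← Finset.mul_sum, h t ht, mul_zero]
  intro k hks
  have h2 := congrArg (fun Q : Polynomial ℂ => Q.coeff (k + N).toNat) h1
  simp only [hP, Polynomial.finsetSum_coeff, Polynomial.coeff_monomial, Polynomial.coeff_zero] at h2
  rw [Finset.sum_eq_single k (fun k' hk' hne => if_neg fun h => hne ?_)
    (fun h => absurd hks h), if_pos rfl] at h2
  · exact h2
  · have := hk k hks
    have := hk k' hk'
    omega

variable {n : ℕ} {φ : Fin (n + 1) → Fun n}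

theorem symMonomial_eq_prod {m : ℕ} (x : Fin (n + 1) → ℂ) (s : Sym (Fin (n + 1)) m) :
    symMonomial x s = ∏ j, x j ^ Multiset.toFinsupp s.1 j := by
  rw [symMonomial, Finset.prod_multiset_map_count]
  simp only [Multiset.toFinsupp_apply]
  refine Finset.prod_subset (Finset.subset_univ _) fun j _ hj => ?_
  rw [Multiset.mem_toFinset] at hj
  rw [Multiset.count_eq_zero_of_notMem hj, pow_zero]

theorem symForm_eq_sum (s : Finset (Fin (n + 1) →₀ ℕ)) (a : (Fin (n + 1) →₀ ℕ) → ℂ)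
    (ha : ∀ α ∉ s, a α = 0) (d : ℕ) (x : Fin (n + 1) → ℂ) :
    symForm (m := d) (fun t => a (Multiset.toFinsupp t.1)) x =
      ∑ α ∈ s with α.degree = d, a α * ∏ j, x j ^ α j := by
  classical
  have hinj : Function.Injective fun t : Sym (Fin (n + 1)) d => Multiset.toFinsupp t.1 :=
    fun t t' h => Subtype.ext (Multiset.toFinsupp.injective h)
  have h1 : symForm (m := d) (fun t => a (Multiset.toFinsupp t.1)) x =
      ∑ α ∈ Finset.univ.image fun t : Sym (Fin (n + 1)) d => Multiset.toFinsupp t.1,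
        a α * ∏ j, x j ^ α j := by
    rw [Finset.sum_image fun _ _ _ _ h => hinj h, symForm]
    simp only [symMonomial_eq_prod]
  rw [h1]
  refine (Finset.sum_subset (fun α hα => ?_) fun α hα hα' => ?_).symm
  · have hd := (Finset.mem_filter.1 hα).2
    refine Finset.mem_image.2 ⟨⟨Finsupp.toMultiset α, ?_⟩, Finset.mem_univ _, ?_⟩
    · rw [Finsupp.card_toMultiset, ← hd]
      rfl
    · simp
  · have hd : α.degree = d := by
      obtain ⟨t, -, rfl⟩ := Finset.mem_image.1 hα
      have h2 : (Finsupp.toMultiset (Multiset.toFinsupp t.1)).card = d := by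
        rw [Multiset.toFinsupp_toMultiset]
        exact t.2
      rw [Finsupp.card_toMultiset] at h2
      exact h2
    rw [ha α fun h => hα' (Finset.mem_filter.2 ⟨h, hd⟩), zero_mul]

/-- The basic Jacobi forms are algebraically independent over the forms of index zero. -/
theorem IsExpansion.algebraicIndependent (hφ : IsExpansion φ) :
    AlgebraicIndependent (coeffRing n) φ := by
  rw [algebraicIndependent_iff]
  intro P hP
  have hval : ∀ p : regular n, ∑ α ∈ P.support, (P.coeff α).1 p * ∏ j, φ j p ^ α j = 0 :=
    fun p => by
      have h1 := congrFun hP p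
      rw [MvPolynomial.aeval_def, MvPolynomial.eval₂_eq', Finset.sum_apply] at h1
      refine Eq.trans (Finset.sum_congr rfl fun α _ => ?_) h1
      rw [Pi.mul_apply, Finset.prod_apply]
      rfl
  have key : ∀ {q : ℂ × ℂ} (hq : q ∈ ellRegular n) (α : Fin (n + 1) →₀ ℕ),
      (P.coeff α).1 ⟨(0, (0, q.1), q.2), hq⟩ = 0 := fun {q} hq α => by
    set a : (Fin (n + 1) →₀ ℕ) → ℂ := fun α => (P.coeff α).1 ⟨(0, (0, q.1), q.2), hq⟩ with ha
    have ha0 : ∀ α ∉ P.support, a α = 0 := fun α hα => by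
      rw [ha, MvPolynomial.notMem_support_iff] at *
      simp only [hα]
      rfl
    have h2 : (fun t : Sym (Fin (n + 1)) α.degree => a (Multiset.toFinsupp t.1)) = 0 := by
      refine hφ.eq_zero_of_symForm hq fun v => ?_
      set x : Fin (n + 1) → ℂ := fun j => φ j ⟨(0, (v, q.1), q.2), hq⟩ with hx
      rw [symForm_eq_sum P.support a ha0]
      -- A shift of `u` multiplies all `φ_j` by an arbitrary nonzero `t` and leaves the coefficients
      -- unchanged. The relation becomes a polynomial in `t`, so its homogeneous parts vanish one by
      -- one. A degree that does not occur has an empty part.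
      by_cases hd : (α.degree : ℤ) ∈ P.support.image fun α => (α.degree : ℤ)
      · have h3 := eq_zero_of_sum_zpow (P.support.image fun α => (α.degree : ℤ))
          (fun k => ∑ α ∈ P.support with (α.degree : ℤ) = k, a α * ∏ j, x j ^ α j)
          (T := {0}ᶜ) (Set.finite_singleton (0 : ℂ)).infinite_compl (fun t ht => ht)
          (fun t ht => ?_) _ hd
        · simpa using h3
        · obtain ⟨w, rfl⟩ : ∃ w, cexp w = t := ⟨_, Complex.exp_log ht⟩
          set u : ℂ := w / (-2 * Real.pi * I) with hu
          have h4 : -2 * Real.pi * I * u = w := by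
            rw [hu, mul_div_cancel₀]
            simp
          have h5 := hval ⟨(0 + u, (v, q.1), q.2), hq⟩
          have h6 : ∀ α, (P.coeff α).1 ⟨(0 + u, (v, q.1), q.2), hq⟩ = a α := fun α =>
            eq_of_mem_coeffRing (P.coeff α).2 rfl rfl
          have h7 : ∀ j, φ j ⟨(0 + u, (v, q.1), q.2), hq⟩ = cexp w * x j := fun j => by
            rw [hφ.add_u j 0 u ((v, q.1), q.2) hq hq, h4]
          simp only [h6, h7, mul_pow, Finset.prod_mul_distrib] at h5
          rw [← h5, ← Finset.sum_fiberwise_of_maps_to (s := P.support)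
            (t := P.support.image fun α => (α.degree : ℤ)) (g := fun α => (α.degree : ℤ))
            fun α hα => Finset.mem_image_of_mem _ hα]
          refine Finset.sum_congr rfl fun k _ => ?_
          rw [Finset.sum_mul]
          refine Finset.sum_congr rfl fun α hα => ?_
          rw [← (Finset.mem_filter.1 hα).2, zpow_natCast, Finset.prod_pow_eq_pow_sum,
            Finsupp.degree_eq_sum]
          ring
      · rw [Finset.sum_eq_zero]
        intro β hβ
        obtain ⟨h3, h4⟩ := Finset.mem_filter.1 hβ
        exact absurd (Finset.mem_image.2 ⟨β, h3, by rw [h4]⟩) hd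
    have h3 := congrFun h2 ⟨Finsupp.toMultiset α, by rw [Finsupp.card_toMultiset]; rfl⟩
    have h4 : a (Multiset.toFinsupp (Finsupp.toMultiset α)) = 0 := h3
    rwa [Finsupp.toMultiset_toFinsupp] at h4
  ext α p
  have h1 := key (q := (p.1.2.1.2, p.1.2.2)) p.2 α
  rw [MvPolynomial.coeff_zero]
  refine Eq.trans ?_ h1
  exact eq_of_mem_coeffRing (P.coeff α).2 rfl rfl

/-- The functions that transform like a form of weight `k` and index `m`. -/
def weightIndexSpace (n : ℕ) (k m : ℤ) : Submodule ℂ (Fun n) where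
  carrier := {F | (∀ (u : ℂ) (p p' : regular n), p'.1 = (p.1.1 + u, p.1.2) →
      F p' = cexp (-2 * Real.pi * I * m * u) * F p) ∧
    ∀ (γ : Matrix.SpecialLinearGroup (Fin 2) ℤ) (p : regular n),
      F ⟨modAct γ p.1, modAct_mem γ p.2⟩ = autFactor γ p.1.2.2 ^ k * F p}
  add_mem' := fun {F G} hF hG => ⟨fun u p p' h => by
      rw [Pi.add_apply, Pi.add_apply, hF.1 u p p' h, hG.1 u p p' h, mul_add],
    fun γ p => by rw [Pi.add_apply, Pi.add_apply, hF.2, hG.2, mul_add]⟩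
  zero_mem' := ⟨fun _ _ _ _ => by simp, fun _ _ => by simp⟩
  smul_mem' := fun c F hF => ⟨fun u p p' h => by
      rw [Pi.smul_apply, Pi.smul_apply, hF.1 u p p' h, smul_eq_mul, smul_eq_mul]; ring,
    fun γ p => by rw [Pi.smul_apply, Pi.smul_apply, hF.2, smul_eq_mul, smul_eq_mul]; ring⟩

theorem J_le_weightIndexSpace (n : ℕ) (k l m : ℤ) : J n k l m ≤ weightIndexSpace n k m := by
  intro F hF
  have hF' : IsJacobiForm n k l m F := hF
  refine ⟨fun u p p' h => ?_, hF'.modular⟩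
  rw [← ext_apply F, ← ext_apply F, h, hF'.ext_eq_exp_mul, hF'.ext_eq_exp_mul p.1.1, ← mul_assoc,
    ← Complex.exp_add]
  congr 2
  ring

/-- The matrix with lower left entry `c`. -/
def lowerUnipotent (c : ℤ) : Matrix.SpecialLinearGroup (Fin 2) ℤ :=
  ⟨!![1, 0; c, 1], by simp⟩

theorem autFactor_lowerUnipotent (c : ℤ) (τ : ℂ) : autFactor (lowerUnipotent c) τ = c * τ + 1 := by
  simp [autFactor, lowerUnipotent]

/-- For a fixed matrix, a shift of `u` turns the relation into a Laurent polynomial in an arbitrary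
nonzero `t` and separates the indices. For each index the lower unipotent matrices then give a
Laurent polynomial in `c τ + 1`, which takes infinitely many values, and this separates the weights.
-/
theorem iSupIndep_weightIndexSpace (n : ℕ) :
    iSupIndep fun km : ℤ × ℤ => weightIndexSpace n km.1 km.2 := by
  classical
  rw [iSupIndep_iff_finsetSum_eq_zero_imp_eq_zero]
  intro s F hF hsum i hi
  funext p
  set a : ℤ × ℤ → ℂ := fun i => if i ∈ s then F i p else 0 with ha
  have h1 : ∀ (c : ℤ) (t : ℂ), t ≠ 0 →
      ∑ i ∈ s, F i p * (autFactor (lowerUnipotent c) p.1.2.2 ^ i.1 * t ^ i.2) = 0 := by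
    intro c t ht
    obtain ⟨w, rfl⟩ : ∃ w, cexp w = t := ⟨_, Complex.exp_log ht⟩
    set u : ℂ := w / (-2 * Real.pi * I) with hu
    have h4 : -2 * Real.pi * I * u = w := by
      rw [hu, mul_div_cancel₀]
      simp
    set p₁ : regular n := ⟨modAct (lowerUnipotent c) p.1, modAct_mem _ p.2⟩ with hp₁
    have h5 := congrFun hsum ⟨(p₁.1.1 + u, p₁.1.2), p₁.2⟩
    rw [Finset.sum_apply] at h5
    refine Eq.trans (Finset.sum_congr rfl fun i hi => ?_) h5
    rw [(hF i hi).1 u p₁ ⟨(p₁.1.1 + u, p₁.1.2), p₁.2⟩ rfl, (hF i hi).2, ← Complex.exp_int_mul, ← h4]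
    ring_nf
  have h2 : ∀ (c : ℤ), ∀ m ∈ s.image Prod.snd, ∑ k ∈ s.image Prod.fst,
      a (k, m) * autFactor (lowerUnipotent c) p.1.2.2 ^ k = 0 := by
    intro c
    refine eq_zero_of_sum_zpow _ (fun m => ∑ k ∈ s.image Prod.fst,
      a (k, m) * autFactor (lowerUnipotent c) p.1.2.2 ^ k) (T := {0}ᶜ)
      (Set.finite_singleton (0 : ℂ)).infinite_compl (fun t ht => ht) fun t ht => ?_
    rw [← h1 c t ht]
    simp only [Finset.sum_mul]
    rw [Finset.sum_comm, ← Finset.sum_product']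
    refine (Finset.sum_subset (s₁ := s) (fun i hi => Finset.mem_product.2
      ⟨Finset.mem_image_of_mem _ hi, Finset.mem_image_of_mem _ hi⟩) fun i _ hi => ?_).symm.trans
      (Finset.sum_congr rfl fun i hi => ?_)
    · simp [ha, hi]
    · simp [ha, hi, mul_assoc]
  have h3 := eq_zero_of_sum_zpow (s.image Prod.fst) (fun k => a (k, i.2))
    (T := Set.range fun c : ℤ => autFactor (lowerUnipotent c) p.1.2.2)
    (Set.infinite_range_of_injective fun c c' h => by
      have hτ : p.1.2.2 ≠ 0 := fun h => by
        have := p.2.1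
        rw [h] at this
        simp at this
      simp only [autFactor_lowerUnipotent, add_left_inj] at h
      exact_mod_cast mul_right_cancel₀ hτ h)
    (by
      rintro _ ⟨c, rfl⟩
      exact autFactor_ne_zero _ p.2.1)
    (by
      rintro _ ⟨c, rfl⟩
      exact h2 c i.2 (Finset.mem_image_of_mem _ hi)) i.1 (Finset.mem_image_of_mem _ hi)
  simpa [ha, hi] using h3

end Independence

/-! ### The algebra of Jacobi forms -/

section Algebra

variable {n : ℕ} {φ : Fin (n + 1) → Fun n}

theorem mem_jacobiAlgebra_of_mem_J {k l m : ℤ} {F : Fun n} (hF : F ∈ J n k l m) :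
    F ∈ jacobiAlgebra n :=
  Submodule.mem_iSup_of_mem k (Submodule.mem_iSup_of_mem l (Submodule.mem_iSup_of_mem m hF))

theorem coeffRing_le_jacobiAlgebra (n : ℕ) : coeffRing n ≤ jacobiAlgebra n := by
  intro F hF
  have h1 : (⨆ (k : ℤ) (l : ℤ), J n k l 0) ≤ ⨆ (k : ℤ) (l : ℤ) (m : ℤ), J n k l m :=
    iSup₂_mono fun k l => le_iSup (fun m => J n k l m) 0
  exact h1 hF

theorem IsExpansion.adjoin_eq (hn : 1 ≤ n) (hφ : IsExpansion φ) :
    (Algebra.adjoin (coeffRing n) (Set.range φ)).restrictScalars ℂ = jacobiAlgebra n := by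
  refine le_antisymm (fun F hF => ?_) fun F hF => ?_
  · have hF' : F ∈ Algebra.adjoin (coeffRing n) (Set.range φ) := hF
    induction hF' using Algebra.adjoin_induction with
    | mem x hx =>
      obtain ⟨j, rfl⟩ := hx
      exact mem_jacobiAlgebra_of_mem_J (hφ.isJacobiForm j)
    | algebraMap r => exact coeffRing_le_jacobiAlgebra n r.2
    | add x y hx hy h1 h2 => exact add_mem (h1 hx) (h2 hy)
    | mul x y hx hy h1 h2 => exact mul_mem (h1 hx) (h2 hy)
  · have h1 : (⨆ (k : ℤ) (l : ℤ) (m : ℤ), J n k l m) ≤ Subalgebra.toSubmodule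
        ((Algebra.adjoin (coeffRing n) (Set.range φ)).restrictScalars ℂ) :=
      iSup_le fun k => iSup_le fun l => iSup_le fun m G hG => hφ.mem_adjoin hn hG
    exact h1 hF

end Algebra

end AffineJacobi

end

theorem mainTheorem2 (n : ℕ) (hn : 1 ≤ n) :
    (∃! φ : Fin (n + 1) → AffineJacobi.Fun n, AffineJacobi.IsExpansion φ) ∧
    (∀ φ : Fin (n + 1) → AffineJacobi.Fun n, AffineJacobi.IsExpansion φ →
      (∀ j : Fin (n + 1), ∃ l : ℤ, φ j ∈ AffineJacobi.J n (-(j : ℤ)) l 1) ∧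
      AlgebraicIndependent (AffineJacobi.coeffRing n) φ ∧
      (Algebra.adjoin (AffineJacobi.coeffRing n) (Set.range φ)).restrictScalars ℂ =
        AffineJacobi.jacobiAlgebra n) ∧
    (iSupIndep fun km : ℤ × ℤ => ⨆ l : ℤ, AffineJacobi.J n km.1 l km.2) ∧
    (∀ (k l : ℤ) (F : AffineJacobi.Fun n), F ∈ AffineJacobi.J n k l 0 ↔
      ∃ g : ℂ × ℂ → ℂ, AffineJacobi.IsEllipticModular n k l g ∧
        ∀ p : AffineJacobi.regular n, F p = g (p.1.2.1.2, p.1.2.2)) := by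
  obtain ⟨φ, hφ⟩ := AffineJacobi.exists_isExpansion hn
  refine ⟨⟨φ, hφ, fun ψ hψ => hψ.unique hφ⟩, fun ψ hψ => ⟨fun j => ⟨_, hψ.isJacobiForm j⟩,
    hψ.algebraicIndependent, hψ.adjoin_eq hn⟩, ?_, fun k l F => AffineJacobi.mem_J_zero_iff⟩
  -- The order plays no part in the transformation rules, so the sum over all `l` lies in one space
  -- for each weight and index.
  exact (AffineJacobi.iSupIndep_weightIndexSpace n).mono fun km =>
    iSup_le fun l => AffineJacobi.J_le_weightIndexSpace n km.1 l km.2
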